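/- Let $\mathbb{F}$ be a finite field of characteristic $p$, let $F$ be the function field of a smooth projective geometrically irreducible curve over $\mathbb{F}$, let $F^{\mathrm{sep}}$ be a separable closure of $F$ and $G_F=\mathrm{Gal}(F^{\mathrm{sep}}/F)$. Let $E$ be an elliptic curve over $F$ and let $l\neq p$ be a prime number. Write $E[l]$ for the $l$-torsion subgroup of $E(F^{\mathrm{sep}})$ and $E[l]_{G_F}=E[l]/I(E[l])$ for its maximal $G_F$-coinvariant quotient, where $I(E[l])$ is the subgroup generated by all $\sigma P-P$ with $\sigma\in G_F$, $P\in E[l]$. Consider the conditions - $(\mathrm{SC}_l)$: $\dim_{\mathbb{F}_l}E(F)[l]=1$, and $E$ has more than one $F$-isogeny of degree $l$; - $(\mathrm{B}'_l)$: $\dim_{\mathbb{F}_l}E(F)[l]=1$, and $E$ has exactly one $F$-isogeny of degree $l$; - $(\mathrm{B}_l)$: $E(F)[l]=0$, and there is an $F$-isogeny $\phi\colon E'\to E$ of degree $l$ from an elliptic curve $E'$ over $F$ with $E'(F)[l]\neq 0$. Here $F$-isogenies of degree $l$ from $E$ to elliptic curves over $F$ are counted up to isomorphism of the target, that is, two of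 them are identified when they have the same kernel. 1. Assume $l\nmid \#\mathbb{F}-1$. Then $$\dim_{\mathbb{F}_l}(E[l]_{G_F})=\begin{cases}0,&\text{if }(\mathrm{B}'_l)\text{ holds},\\ 1,&\text{if }(\mathrm{SC}_l)\text{ or }(\mathrm{B}_l)\text{ holds},\\ 2,&\text{if }E[l]\subset E(F).\end{cases}$$ 2. Assume $l\mid \#\mathbb{F}-1$. Then $$\dim_{\mathbb{F}_l}(E[l]_{G_F})=\begin{cases}1,&\text{if }(\mathrm{B}'_l),\ (\mathrm{SC}_l)\text{ or }(\mathrm{B}_l)\text{ holds},\\ 2,&\text{if }E[l]\subset E(F).\end{cases}$$ -/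

import Mathlib

open scoped Polynomial.Bivariate RatFunc

namespace WeierstrassCurve

noncomputable section

/-- The set `E(L)` of `L`-points, for a field extension `L` of the field `F` of definition. -/
abbrev PointsOver {F : Type*} [Field F] (E : WeierstrassCurve F) (L : Type*) [Field L]
    [Algebra F L] : Type _ :=
  (E.toAffine.baseChange L).Point

open scoped Classical in
/-- Mathlib's group law on `E(L)`, with classical decidability of equality in `L`. -/
instance instAddCommGroupPointsOver {F : Type*} [Field F] (E : WeierstrassCurve F) (L : Type*)
    [Field L] [Algebra F L] : AddCommGroup (E.PointsOver L) :=
  inferInstanceAs (AddCommGroup (E.toAffine.baseChange L).Point)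

open scoped Classical in
/-- The homomorphism `E(L) → E(M)` induced by an `F`-algebra homomorphism `L → M`. -/
def pointsMap {F : Type*} [Field F] (E : WeierstrassCurve F) {L M : Type*} [Field L] [Algebra F L]
    [Field M] [Algebra F M] (f : L →ₐ[F] M) : E.PointsOver L →+ E.PointsOver M :=
  Affine.Point.map f

/-- The `l`-torsion subgroup `E(L)[l]`. -/
abbrev torsionOver {F : Type*} [Field F] (E : WeierstrassCurve F) (L : Type*) [Field L]
    [Algebra F L] (l : ℕ) : AddSubgroup (E.PointsOver L) :=
  AddSubgroup.torsionBy (E.PointsOver L) (l : ℤ)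

/-- `E(L)[l]` as a module over `ℤ/l`. -/
instance instModuleTorsionOver {F : Type*} [Field F] (E : WeierstrassCurve F) (L : Type*) [Field L]
    [Algebra F L] (l : ℕ) : Module (ZMod l) (E.torsionOver L l) :=
  AddSubgroup.torsionBy.zmodModule

/-- The group `E(Fˢᵉᵖ)` of points over the separable closure. -/
abbrev SepPoints {F : Type*} [Field F] (E : WeierstrassCurve F) : Type _ :=
  E.PointsOver (SeparableClosure F)

/-- The `l`-torsion subgroup `E[l]` of `E(Fˢᵉᵖ)`. -/
abbrev geomTorsion {F : Type*} [Field F] (E : WeierstrassCurve F) (l : ℕ) :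
    AddSubgroup E.SepPoints :=
  E.torsionOver (SeparableClosure F) l

/-- The mod `l` Galois representation: the natural action of `Gal(Fˢᵉᵖ/F)` on `E[l]`. -/
def modGaloisRep {F : Type*} [Field F] (E : WeierstrassCurve F) (l : ℕ) :
    Representation (ZMod l) Gal(SeparableClosure F/F) (E.geomTorsion l) where
  toFun σ := AddMonoidHom.toZModLinearMap l
    (((E.pointsMap (σ : SeparableClosure F →ₐ[F] SeparableClosure F)).comp
      (E.geomTorsion l).subtype).codRestrict (E.geomTorsion l) fun P => by
        have hP : l • (P : E.SepPoints) = 0 := AddSubgroup.torsionBy.nsmul_iff.mp P.2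
        refine AddSubgroup.torsionBy.nsmul_iff.mpr ?_
        change l • E.pointsMap _ (P : E.SepPoints) = 0
        rw [← map_nsmul, hP, map_zero])
  map_one' := by
    ext P
    obtain ⟨P, hP⟩ := P
    cases P <;> rfl
  map_mul' σ τ := by
    ext P
    obtain ⟨P, hP⟩ := P
    cases P <;> rfl

/-- The maximal `G_F`-coinvariant quotient `E[l]_{G_F}`, the quotient of `E[l]` by the subgroup
generated by all `σ P - P`. -/
abbrev torsionCoinvariants {F : Type*} [Field F] (E : WeierstrassCurve F) (l : ℕ) : Type _ :=
  (E.modGaloisRep l).Coinvariants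

/-- The condition `E[l] ⊂ E(F)`: all `l`-torsion points over `Fˢᵉᵖ` are defined over `F`. -/
def HasRationalTorsion {F : Type*} [Field F] (E : WeierstrassCurve F) (l : ℕ) : Prop :=
  E.geomTorsion l ≤ (E.pointsMap (Algebra.ofId F (SeparableClosure F))).range

/-- An isogeny `E₁ → E₂` defined over `F`: a homomorphism on `Fˢᵉᵖ`-points which is given at the
generic point by the rational functions `numX / den`, `numY / den` in the function field `F(E₁)`,
where `numX`, `numY`, `den` are polynomials over `F`: an affine point `(x, y)` of `E₁` with
`den(x, y) ≠ 0` is sent to the affine point `(numX(x, y) / den(x, y), numY(x, y) / den(x, y))`.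
In particular the zero homomorphism is not an isogeny. -/
structure Isogeny {F : Type*} [Field F] (E₁ E₂ : WeierstrassCurve F) where
  /-- The homomorphism on points over the separable closure. -/
  toHom : E₁.SepPoints →+ E₂.SepPoints
  /-- The numerator of the pullback of the coordinate function `x` of `E₂`. -/
  numX : F[X][Y]
  /-- The numerator of the pullback of the coordinate function `y` of `E₂`. -/
  numY : F[X][Y]
  /-- The common denominator of the two pullbacks. -/
  den : F[X][Y]
  den_ne_zero : Affine.CoordinateRing.mk E₁.toAffine den ≠ 0
  toHom_some : ∀ (x y : SeparableClosure F)
    (h : (E₁.toAffine.baseChange (SeparableClosure F)).Nonsingular x y),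
    Polynomial.aevalAeval x y den ≠ 0 →
    ∃ h' : (E₂.toAffine.baseChange (SeparableClosure F)).Nonsingular
        (Polynomial.aevalAeval x y numX / Polynomial.aevalAeval x y den)
        (Polynomial.aevalAeval x y numY / Polynomial.aevalAeval x y den),
      toHom (Affine.Point.some x y h) = Affine.Point.some _ _ h'

/-- The rational function on `E` that a polynomial in the coordinates defines. -/
def polynomialFunction {F : Type*} [Field F] (E : WeierstrassCurve F) (f : F[X][Y]) :
    E.toAffine.FunctionField :=
  algebraMap E.toAffine.CoordinateRing E.toAffine.FunctionField (Affine.CoordinateRing.mk E.toAffine f)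

/-- The subfield `φ^* F(E₂)` of `F(E₁)` for an isogeny `φ : E₁ → E₂`: it is generated over `F` by
the pullbacks of the two coordinate functions of `E₂`. -/
def Isogeny.pullbackField {F : Type*} [Field F] {E₁ E₂ : WeierstrassCurve F} (φ : Isogeny E₁ E₂) :
    IntermediateField F E₁.toAffine.FunctionField :=
  IntermediateField.adjoin F
    {E₁.polynomialFunction φ.numX / E₁.polynomialFunction φ.den,
      E₁.polynomialFunction φ.numY / E₁.polynomialFunction φ.den}

/-- The degree `[F(E₁) : φ^* F(E₂)]` of an isogeny `φ : E₁ → E₂`. -/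
def Isogeny.degree {F : Type*} [Field F] {E₁ E₂ : WeierstrassCurve F} (φ : Isogeny E₁ E₂) : ℕ :=
  Module.finrank φ.pullbackField E₁.toAffine.FunctionField

/-- The kernels of the `F`-isogenies of degree `l` from `E` to elliptic curves over `F`. Isogenies
out of `E` of the same degree `l`, prime to the characteristic, are identified (up to an
`F`-isomorphism of their targets) when they have the same kernel. -/
def isogenyKernels {F : Type*} [Field F] (E : WeierstrassCurve F) (l : ℕ) :
    Set (AddSubgroup E.SepPoints) :=
  {C | ∃ (E' : WeierstrassCurve F) (_ : E'.IsElliptic) (φ : Isogeny E E'),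
    φ.degree = l ∧ φ.toHom.ker = C}

/-- Condition `(SC_l)`: `dim E(F)[l] = 1`, and `E` has more than one `F`-isogeny of degree `l`. -/
def CondSC {F : Type*} [Field F] (E : WeierstrassCurve F) (l : ℕ) : Prop :=
  Module.rank (ZMod l) (E.torsionOver F l) = 1 ∧ (E.isogenyKernels l).Nontrivial

/-- Condition `(B'_l)`: `dim E(F)[l] = 1`, and `E` has only one `F`-isogeny of degree `l`. -/
def CondB' {F : Type*} [Field F] (E : WeierstrassCurve F) (l : ℕ) : Prop :=
  Module.rank (ZMod l) (E.torsionOver F l) = 1 ∧ ∃! C, C ∈ E.isogenyKernels l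

/-- Condition `(B_l)`: `E(F)[l] = 0`, and there is an `F`-isogeny `φ : E' → E` of degree `l` with
`E'(F)[l] ≠ 0`. -/
def CondB {F : Type*} [Field F] (E : WeierstrassCurve F) (l : ℕ) : Prop :=
  E.torsionOver F l = ⊥ ∧
    ∃ (E' : WeierstrassCurve F) (_ : E'.IsElliptic) (φ : Isogeny E' E),
      φ.degree = l ∧ E'.torsionOver F l ≠ ⊥

end

end WeierstrassCurve

/-! Write V = E[l], and let I be the subgroup generated by all σQ − Q. Since V has order l²
(`card_geomTorsion`), the coinvariants have dimension 2 − dim I. Here I = 0 exactly when all of V is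
rational, and I ≠ V as soon as all σQ − Q lie in a subgroup that does not contain V.

Under (SC), let P span the rational line. Some stable line C misses P, so V = ⟨P⟩ ⊕ C with P fixed
and C stable, and I ⊂ C. Under (B), a rational point P of order l on E' must lie in ker φ, so ker φ
= ⟨P⟩. If Q = φ(Q') is l-torsion, then lQ' is a multiple of P, hence fixed; so σQ' − Q' ∈ E'[l] and
I ⊂ φ(E'[l]), which is smaller than V because P is killed. In both cases V is not rational, so I is
a line, whatever the roots of unity (`rank_of_condSC`, `rank_of_condB`).

Under (B'), with P rational, the action on V/⟨P⟩ is governed by the l-th roots of unity. If they lie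
in F, the action on V/⟨P⟩ is trivial and I = ⟨P⟩ (`ker_ne_top_of_rootOfUnity`). Conversely, if I ≠ V
then I is a stable line, hence the kernel of an isogeny; uniqueness gives I = ⟨P⟩, so the action on
V/⟨P⟩ is trivial and the roots of unity lie in F (`exists_rootOfUnity_of_ker_ne_top`). As k is
algebraically closed in F, F contains them if and only if l divides #k − 1.

Lagrange resolvents replace the Weil pairing. For odd l let s be the slope function with simple
poles at 0 and P. For an l-th root of unity ξ ≠ 1 the function g_ξ = ∑ ξ^i s(· + iP) is an
eigenfunction of translation by P with eigenvalue ξ⁻¹, with simple poles exactly along ⟨P⟩. Its l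
zeros form one coset Q + ⟨P⟩, and lQ = 0 because the points of a principal divisor sum to zero.
Different ξ give different cosets, and an automorphism σ fixing P carries the zeros of g_ξ to those
of g_{σξ}.

Two facts on isogenies are needed. First, an isogeny of degree l ≠ p is surjective with kernel of
order l: its x-coordinate is a rational function u/w of x of degree l, and a general fibre is
counted by the roots of u − a w (`card_ker_and_surjective_of_xCoord`). The same count for
multiplication by n, of x-degree n², gives the order of E[n]. Second, a stable subgroup S of odd
order prime to p is a kernel (`mem_isogenyKernels`): the sums of x and y over S-translates satisfy a
nonsingular Weierstrass equation, because an S-invariant function with at most simple poles along S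
is constant (`IsInvariantRegular.exists_eq_const`). The function theory is done over an
algebraically closed field of constants and then descended to the separable closure and to F. -/

lemma IsSepClosed.infinite (K : Type*) [Field K] [IsSepClosed K] : Infinite K := by
  by_contra h
  rw [not_infinite_iff_finite] at h
  -- A finite field is perfect, so separably closed implies algebraically closed.
  have : IsAlgClosed K := inferInstance
  exact not_finite K

/-! ### Points over separably closed fields; homomorphisms given by a rational function of x -/

namespace WeierstrassCurve.Affine

open Polynomial

variable {K : Type*} [Field K] {W W' : Affine K}

/-- If it vanished, then 4 = b₂ = b₆ = 0, and Δ would reduce to −8b₄³ = 0. This works in every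
characteristic. -/
lemma Ψ₂Sq_ne_zero_of_isElliptic (W : Affine K) [W.IsElliptic] : W.Ψ₂Sq ≠ 0 := by
  intro h
  have h4 : (4 : K) = 0 := by simpa [Ψ₂Sq] using congrArg (coeff · 3) h
  have h2 : W.b₂ = 0 := by simpa [Ψ₂Sq] using congrArg (coeff · 2) h
  have h6 : W.b₆ = 0 := by simpa [Ψ₂Sq] using congrArg (coeff · 0) h
  refine W.isUnit_Δ.ne_zero ?_
  rw [Δ, h2, h6]
  linear_combination (-2 * W.b₄ ^ 3) * h4

lemma Equation.sub_negY_sq {x y : K} (h : W.Equation x y) :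
    (y - W.negY x y) ^ 2 = W.Ψ₂Sq.eval x := by
  rw [equation_iff] at h
  simp only [negY, Ψ₂Sq, b₂, b₄, b₆, eval_add, eval_mul, eval_C, eval_pow, eval_X]
  linear_combination 4 * h

lemma Equation.ne_negY {x y : K} (h : W.Equation x y) (hx : W.Ψ₂Sq.eval x ≠ 0) :
    y ≠ W.negY x y := by
  intro hy
  rw [← h.sub_negY_sq, sub_eq_zero.mpr hy] at hx
  simp at hx

/-- The curve equation is a quadratic in y of discriminant Ψ₂Sq(x). Nonvanishing makes it separable,
in characteristic 2 as well, so a separably closed field contains a root. -/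
lemma exists_equation_of_eval_Ψ₂Sq_ne_zero [IsSepClosed K] {x : K} (hx : W.Ψ₂Sq.eval x ≠ 0) :
    ∃ y, W.Equation x y := by
  set b := W.a₁ * x + W.a₃
  set c := x ^ 3 + W.a₂ * x ^ 2 + W.a₄ * x + W.a₆
  set f : K[X] := X ^ 2 + (C b * X - C c)
  have hdeg : (C b * X - C c).degree < ((2 : ℕ) : WithBot ℕ) := by
    refine lt_of_le_of_lt (b := ((1 : ℕ) : WithBot ℕ)) ?_ (by norm_num)
    refine (degree_sub_le _ _).trans (max_le ?_ (degree_C_le.trans (by norm_num)))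
    exact (degree_C_mul_X_le b)
  have hf : f.degree = 2 := by
    rw [show f = X ^ 2 + (C b * X - C c) from rfl, degree_add_eq_left_of_degree_lt]
    · simp
    · simpa using hdeg
  have hsep : f.Separable := by
    have hd : derivative f = C 2 * X + C b := by simp [f, one_add_one_eq_two]
    have hD : b ^ 2 + 4 * c ≠ 0 := by
      convert hx using 1
      simp only [Ψ₂Sq, b₂, b₄, b₆, eval_add, eval_mul, eval_C, eval_pow, eval_X, b, c]
      ring
    rw [Separable, hd]
    -- From f'² − 4f = b² + 4c for f = y² + by − c.
    refine ⟨C (-4 * (b ^ 2 + 4 * c)⁻¹), C (b ^ 2 + 4 * c)⁻¹ * (C 2 * X + C b), ?_⟩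
    have h1 : C (b ^ 2 + 4 * c)⁻¹ * (C b ^ 2 + 4 * C c) = 1 := by
      rw [← C_pow, ← map_ofNat C 4, ← C_mul, ← C_add, ← C_mul, inv_mul_cancel₀ hD, C_1]
    simp only [f, C_mul, C_neg, map_ofNat]
    linear_combination h1
  obtain ⟨y, hy⟩ := IsSepClosed.exists_root f (by simp [hf]) hsep
  refine ⟨y, (W.equation_iff x y).mpr ?_⟩
  simp only [f, b, c, IsRoot.def, eval_add, eval_sub, eval_mul, eval_C, eval_pow, eval_X] at hy
  linear_combination hy

namespace Point

/-- The `x`-coordinate of a point, with value `0` at the point at infinity. -/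
def xCoord : W.Point → K
  | 0 => 0
  | some x _ _ => x

@[simp] lemma xCoord_some {x y : K} (h : W.Nonsingular x y) : (some x y h).xCoord = x := rfl

lemma finite_setOf_xCoord_eq (a : K) : {P : W.Point | P ≠ 0 ∧ P.xCoord = a}.Finite := by
  by_cases hP : ∃ P : W.Point, P ≠ 0 ∧ P.xCoord = a
  · obtain ⟨P, hP0, hPa⟩ := hP
    refine (Set.toFinite {P, -P}).subset ?_
    rintro Q ⟨hQ0, hQa⟩
    rcases P with _ | ⟨x, y, h⟩
    · exact absurd rfl hP0
    rcases Q with _ | ⟨x', y', h'⟩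
    · exact absurd rfl hQ0
    exact X_eq_iff.mp (hQa.trans hPa.symm)
  · convert Set.finite_empty
    ext P
    simpa using fun h h' ↦ hP ⟨P, h, h'⟩

lemma finite_setOf_xCoord_mem {s : Set K} (hs : s.Finite) :
    {P : W.Point | P ≠ 0 ∧ P.xCoord ∈ s}.Finite := by
  refine (hs.biUnion fun a _ ↦ finite_setOf_xCoord_eq a).subset ?_
  rintro P ⟨h, h'⟩
  exact Set.mem_biUnion h' ⟨h, rfl⟩

lemma exists_xCoord_eq [W.IsElliptic] [IsSepClosed K] {x : K} (hx : W.Ψ₂Sq.eval x ≠ 0) :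
    ∃ P : W.Point, P ≠ 0 ∧ P ≠ -P ∧ P.xCoord = x := by
  obtain ⟨y, hy⟩ := exists_equation_of_eval_Ψ₂Sq_ne_zero hx
  refine ⟨some x y (equation_iff_nonsingular.mp hy), some_ne_zero _, ?_, rfl⟩
  rw [neg_some]
  intro h
  exact hy.ne_negY hx (by simpa using h)

lemma ne_neg_of_eval_Ψ₂Sq_ne_zero {P : W.Point} (h0 : P ≠ 0) (h : W.Ψ₂Sq.eval P.xCoord ≠ 0) :
    P ≠ -P := by
  rcases P with _ | ⟨x, y, hP⟩
  · exact absurd rfl h0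
  · rw [neg_some]
    intro h'
    exact hP.1.ne_negY h (by simpa using h')

lemma eq_or_eq_neg_of_xCoord_eq {P Q : W.Point} (hP : P ≠ 0) (hQ : Q ≠ 0)
    (h : P.xCoord = Q.xCoord) : P = Q ∨ P = -Q := by
  rcases P with _ | ⟨x, y, h1⟩
  · exact absurd rfl hP
  rcases Q with _ | ⟨x', y', h'⟩
  · exact absurd rfl hQ
  exact X_eq_iff.mp h

@[simp] lemma xCoord_neg (P : W.Point) : (-P).xCoord = P.xCoord := by
  rcases P with _ | ⟨x, y, h⟩ <;> rfl

lemma finite_setOf_eval_eq_zero {f : K[X]} (hf : f ≠ 0) :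
    {P : W.Point | P ≠ 0 ∧ f.eval P.xCoord = 0}.Finite := by
  refine (finite_setOf_xCoord_mem (f.rootSet_finite K)).subset ?_
  rintro P ⟨h, h'⟩
  exact ⟨h, by simpa [mem_rootSet, hf] using h'⟩

instance [W.IsElliptic] [IsSepClosed K] : Infinite W.Point := by
  refine Set.infinite_univ_iff.mp fun hfin ↦ ?_
  have : (Set.univ : Set K) ⊆ W.Ψ₂Sq.rootSet K ∪ xCoord '' (Set.univ : Set W.Point) := by
    intro x _
    by_cases hx : W.Ψ₂Sq.eval x = 0
    · left
      simpa [mem_rootSet, Ψ₂Sq_ne_zero_of_isElliptic W] using hx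
    · obtain ⟨P, -, -, hP⟩ := exists_xCoord_eq hx
      exact Or.inr ⟨P, trivial, hP⟩
  have hK := IsSepClosed.infinite K
  exact Set.infinite_univ ((((W.Ψ₂Sq).rootSet_finite K).union (hfin.image _)).subset this)

/-- A repeated root β of u − a v is a root of the Wronskian w = u'v − uv', and then a = u(β)/v(β);
so only finitely many a are bad once w ≠ 0. If w = 0, coprimality forces u' = v' = 0, and as n is
invertible in K both coefficients of degree n vanish, against the definition of n. A drop of the
degree excludes at most one further value of a. -/
lemma finite_setOf_not_separable [Infinite K] {u v : K[X]} (huv : IsCoprime u v) {n : ℕ}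
    (hn : max u.natDegree v.natDegree = n) (hn0 : (n : K) ≠ 0) :
    {a : K | ¬ ((u - C a * v).Separable ∧ (u - C a * v).natDegree = n)}.Finite := by
  have hdeg (a : K) : (u - C a * v).natDegree ≤ n := by
    rw [← hn]
    refine (natDegree_sub_le _ _).trans (max_le_max le_rfl (natDegree_C_mul_le a v))
  have hcoef (a : K) (ha : u.coeff n - a * v.coeff n ≠ 0) : (u - C a * v).natDegree = n :=
    le_antisymm (hdeg a) (le_natDegree_of_ne_zero (by simpa using ha))
  have hlead : u.coeff n ≠ 0 ∨ v.coeff n ≠ 0 := by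
    have hn' : n ≠ 0 := by rintro rfl; simp at hn0
    rcases le_total u.natDegree v.natDegree with h | h
    · right
      rw [max_eq_right h] at hn
      rw [← hn]
      have : v ≠ 0 := by rintro rfl; simp at hn; exact hn' hn.symm
      simpa using this
    · left
      rw [max_eq_left h] at hn
      rw [← hn]
      have : u ≠ 0 := by rintro rfl; simp at hn; exact hn' hn.symm
      simpa using this
  have hfin1 : {a : K | (u - C a * v).natDegree ≠ n}.Finite := by
    refine (Set.toFinite {u.coeff n / v.coeff n}).subset fun a ha ↦ ?_
    have h0 : u.coeff n - a * v.coeff n = 0 := by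
      by_contra h
      exact ha (hcoef a h)
    have hv : v.coeff n ≠ 0 := by
      intro hv
      rw [hv, mul_zero, sub_zero] at h0
      simp_all
    rw [Set.mem_singleton_iff, eq_div_iff hv]
    linear_combination -h0
  set w := derivative u * v - u * derivative v with hw
  have hw0 : w ≠ 0 := by
    intro hw0
    have h1 : derivative u * v = u * derivative v := by rw [← sub_eq_zero, ← hw, hw0]
    have hu' : derivative u = 0 := by
      by_contra hne
      have : u ∣ derivative u := huv.dvd_of_dvd_mul_right ⟨_, h1⟩
      exact absurd (degree_le_of_dvd this hne) (not_le.mpr (degree_derivative_lt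
        (by rintro rfl; simp at hne)))
    have hv' : derivative v = 0 := by
      by_contra hne
      have : v ∣ derivative v := huv.symm.dvd_of_dvd_mul_left ⟨derivative u, by
        rw [← h1, mul_comm]⟩
      exact absurd (degree_le_of_dvd this hne) (not_le.mpr (degree_derivative_lt
        (by rintro rfl; simp at hne)))
    have key (f : K[X]) (hf : derivative f = 0) : f.coeff n = 0 := by
      have hn' : n ≠ 0 := by rintro rfl; simp at hn0
      obtain ⟨m, rfl⟩ := Nat.exists_eq_succ_of_ne_zero hn'
      have := congrArg (coeff · m) hf
      simp only [coeff_derivative, coeff_zero] at this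
      have h2 : ((m : K) + 1) ≠ 0 := by simpa using hn0
      simpa [h2] using this
    rcases hlead with h | h
    · exact h (key u hu')
    · exact h (key v hv')
  have hfin2 : {a : K | ¬ IsCoprime (u - C a * v) w}.Finite := by
    -- A common factor of u − a v and w yields a common root only after enlarging K.
    let A := AlgebraicClosure K
    have hfinA : ((fun β : A ↦ aeval β u / aeval β v) '' (w.rootSet A)).Finite :=
      (w.rootSet_finite A).image _
    refine (hfinA.preimage (f := algebraMap K A) (algebraMap K A).injective.injOn).subset ?_
    intro a ha
    rw [Set.mem_ofPred_eq, ← isCoprime_map (algebraMap K A)] at ha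
    have : ∃ β : A, aeval β (u - C a * v) = 0 ∧ aeval β w = 0 := by
      by_contra! hcon
      refine ha ((isCoprime_of_irreducible_dvd ?_ ?_))
      · rintro ⟨-, h⟩
        exact hw0 ((Polynomial.map_eq_zero _).mp h)
      · intro z hz hz1 hz2
        obtain ⟨β, hβ⟩ := IsAlgClosed.exists_root z
          (by rw [IsAlgClosed.degree_eq_one_of_irreducible A hz]; simp)
        refine hcon β ?_ ?_
        · rw [aeval_def, ← eval_map]
          exact eval_eq_zero_of_dvd_of_eval_eq_zero hz1 hβ
        · rw [aeval_def, ← eval_map]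
          exact eval_eq_zero_of_dvd_of_eval_eq_zero hz2 hβ
    obtain ⟨β, h1, h2⟩ := this
    refine ⟨β, ?_, ?_⟩
    · rw [mem_rootSet]
      exact ⟨hw0, h2⟩
    · have hv : aeval β v ≠ 0 := by
        intro hv
        have hu : aeval β u = 0 := by simpa [hv] using h1
        obtain ⟨c, d, hcd⟩ := huv
        have := congrArg (aeval β) hcd
        simp [hu, hv] at this
      change aeval β u / aeval β v = algebraMap K A a
      rw [div_eq_iff hv]
      simp only [map_sub, map_mul, aeval_C] at h1
      linear_combination h1
  refine (hfin1.union hfin2).subset fun a ha ↦ ?_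
  by_contra hcon
  simp only [Set.mem_union, Set.mem_ofPred_eq, not_or, not_not] at hcon
  refine ha ⟨?_, hcon.1⟩
  obtain ⟨c, d, hcd⟩ := hcon.2
  refine ⟨c - d * derivative v, d * v, ?_⟩
  simp only [derivative_sub, derivative_mul, derivative_C, zero_mul, zero_add]
  rw [← hcd, hw]
  ring

/-- A homomorphism which is given on `x`-coordinates by a rational function of degree `n` prime to
the characteristic is surjective, with a kernel of order `n`. -/
theorem card_ker_and_surjective_of_xCoord [W.IsElliptic] [W'.IsElliptic] [IsSepClosed K]
    [DecidableEq K] (φ : W.Point →+ W'.Point) {u v : K[X]} (huv : IsCoprime u v) {n : ℕ}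
    (hn : max u.natDegree v.natDegree = n) (hn0 : (n : K) ≠ 0)
    (hfin : {P : W.Point | ¬ (v.eval P.xCoord ≠ 0 ∧ φ P ≠ 0 ∧
      (φ P).xCoord = u.eval P.xCoord / v.eval P.xCoord)}.Finite) :
    Nat.card φ.ker = n ∧ Function.Surjective φ := by
  have := IsSepClosed.infinite K
  set B := {P : W.Point | ¬ (v.eval P.xCoord ≠ 0 ∧ φ P ≠ 0 ∧
      (φ P).xCoord = u.eval P.xCoord / v.eval P.xCoord)} with hB
  have hn' : n ≠ 0 := by rintro rfl; simp at hn0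
  set B' : Set W.Point := B ∪ {P | P ≠ 0 ∧ W.Ψ₂Sq.eval P.xCoord = 0} with hB'
  have hB'fin : B'.Finite :=
    hfin.union (finite_setOf_eval_eq_zero (Ψ₂Sq_ne_zero_of_isElliptic W))
  set xB : Set K := (xCoord '' B) ∪ W.Ψ₂Sq.rootSet K with hxB
  have hxBfin : xB.Finite := (hfin.image _).union (rootSet_finite _ _)
  set bad : Set K := {a : K | ¬ ((u - C a * v).Separable ∧ (u - C a * v).natDegree = n)} ∪
    ((fun P ↦ (φ P).xCoord) '' B') ∪ ((fun β ↦ u.eval β / v.eval β) '' xB) ∪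
    W'.Ψ₂Sq.rootSet K with hbad
  have hbadfin : bad.Finite := (((finite_setOf_not_separable huv hn hn0).union
    (hB'fin.image _)).union (hxBfin.image _)).union (rootSet_finite _ _)
  -- For x(R) = a outside `bad`, x maps the fibre bijectively to the n roots of u − a v. A point
  -- above a root is sent to R or −R, so it or its negative lies in the fibre; two points of the
  -- fibre with equal x are equal or opposite, and the latter would give R = −R.
  have key (R : W'.Point) (hR : R ≠ 0) (ha : R.xCoord ∉ bad) : Nat.card (φ ⁻¹' {R}) = n := by
    set a := R.xCoord
    simp only [hbad, Set.mem_union, not_or, Set.mem_ofPred_eq, not_not] at ha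
    obtain ⟨⟨⟨⟨hsep, hdeg⟩, ha1⟩, ha2⟩, ha3⟩ := ha
    have ha3 : W'.Ψ₂Sq.eval a ≠ 0 := by
      intro h
      exact ha3 (by simpa [mem_rootSet, Ψ₂Sq_ne_zero_of_isElliptic W'] using h)
    have hRneg : R ≠ -R := ne_neg_of_eval_Ψ₂Sq_ne_zero hR ha3
    have hmem (P : W.Point) (hP : φ P = R) : P ∉ B' := fun h ↦ ha1 ⟨P, h, by simp [hP, a]⟩
    have h0 (P : W.Point) (hP : φ P = R) : P ≠ 0 := by
      rintro rfl
      exact hR (by simpa using hP.symm)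
    have hf0 : u - C a * v ≠ 0 := hsep.ne_zero
    have himg : xCoord '' (φ ⁻¹' {R}) = (u - C a * v).rootSet K := by
      ext x
      constructor
      · rintro ⟨P, hP, rfl⟩
        have h1 := hmem P hP
        simp only [hB', hB, Set.mem_union, Set.mem_ofPred_eq, not_or, not_not] at h1
        have h2 := h1.1.2.2
        rw [show φ P = R from hP, eq_div_iff h1.1.1] at h2
        rw [mem_rootSet]
        refine ⟨hf0, ?_⟩
        simp only [coe_aeval_eq_eval, eval_sub, eval_mul, eval_C]
        rw [h2, sub_self]
      · intro hx
        have hroot : (u - C a * v).eval x = 0 := by simpa [mem_rootSet, hf0] using hx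
        have hv : v.eval x ≠ 0 := by
          intro hv
          have hu : u.eval x = 0 := by simpa [hv] using hroot
          obtain ⟨c, d, hcd⟩ := huv
          have := congrArg (eval x) hcd
          simp [hu, hv] at this
        have hau : u.eval x / v.eval x = a := by
          rw [div_eq_iff hv]
          simp only [eval_sub, eval_mul, eval_C] at hroot
          linear_combination hroot
        have hxB' : x ∉ xB := fun h ↦ ha2 ⟨x, h, hau⟩
        have hΨ : W.Ψ₂Sq.eval x ≠ 0 := by
          intro h
          exact hxB' (Or.inr (by simpa [mem_rootSet, Ψ₂Sq_ne_zero_of_isElliptic W] using h))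
        obtain ⟨P, hP0, -, rfl⟩ := exists_xCoord_eq hΨ
        have hPB : P ∉ B := fun h ↦ hxB' (Or.inl ⟨P, h, rfl⟩)
        simp only [hB, Set.mem_ofPred_eq, not_not] at hPB
        rcases eq_or_eq_neg_of_xCoord_eq hPB.2.1 hR (hPB.2.2.trans hau) with h | h
        · exact ⟨P, h, rfl⟩
        · exact ⟨-P, by simp [h], by simp⟩
    have hinj : Set.InjOn xCoord (φ ⁻¹' {R}) := by
      intro P hP Q hQ hPQ
      rcases eq_or_eq_neg_of_xCoord_eq (h0 P hP) (h0 Q hQ) hPQ with h | h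
      · exact h
      · have h1 : φ P = R := hP
        have h2 : φ Q = R := hQ
        rw [h, map_neg, h2] at h1
        exact absurd h1.symm hRneg
    rw [← Nat.card_image_of_injOn hinj, himg, Nat.card_eq_fintype_card,
      card_rootSet_eq_natDegree hsep, hdeg]
    simpa using IsSepClosed.splits_of_separable _ hsep
  have hgood : {R : W'.Point | ¬ (R ≠ 0 ∧ R.xCoord ∉ bad)}.Finite := by
    refine ((Set.finite_singleton 0).union (finite_setOf_xCoord_mem hbadfin)).subset fun R hR ↦ ?_
    by_cases h : R = 0
    · exact Or.inl h
    · right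
      refine ⟨h, ?_⟩
      by_contra h'
      exact hR ⟨h, h'⟩
  have hmemrange (R : W'.Point) (hR : R ≠ 0 ∧ R.xCoord ∉ bad) : ∃ P, φ P = R := by
    have : Nat.card (φ ⁻¹' {R}) ≠ 0 := by rw [key R hR.1 hR.2]; exact hn'
    obtain ⟨⟨P, hP⟩⟩ := (Nat.card_ne_zero.mp this).1
    exact ⟨P, hP⟩
  constructor
  -- A nonempty fibre is a coset of the kernel, so one good fibre counts the kernel.
  · obtain ⟨R, hR⟩ := hgood.exists_notMem
    simp only [Set.mem_ofPred_eq, not_not] at hR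
    obtain ⟨P, rfl⟩ := hmemrange R hR
    rw [← key _ hR.1 hR.2]
    refine Nat.card_congr ⟨fun Q ↦ ⟨Q + P, ?_⟩, fun Q ↦ ⟨Q - P, ?_⟩, fun Q ↦ ?_, fun Q ↦ ?_⟩
    · simp [AddMonoidHom.mem_ker.mp Q.2]
    · have := Q.2
      simp only [Set.mem_preimage, Set.mem_singleton_iff] at this
      simp [AddMonoidHom.mem_ker, this]
    · simp
    · simp
  -- All but finitely many points lie in the image, so T is a sum R + (T − R) of two points of the
  -- image.
  · intro T
    have h2 : {R : W'.Point | ¬ (T - R ≠ 0 ∧ (T - R).xCoord ∉ bad)}.Finite :=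
      hgood.preimage (f := fun R ↦ T - R) (sub_right_injective.injOn)
    obtain ⟨R, hR⟩ := (hgood.union h2).exists_notMem
    simp only [Set.mem_union, not_or, Set.mem_ofPred_eq, not_not] at hR
    obtain ⟨P, hP⟩ := hmemrange R hR.1
    obtain ⟨Q, hQ⟩ := hmemrange _ hR.2
    exact ⟨Q + P, by simp [hP, hQ]⟩

end Point

end WeierstrassCurve.Affine

/-! ### The x-coordinates of P + Q and P − Q -/

namespace WeierstrassCurve.Affine

open Polynomial

section AddSub

variable {R : Type*} [CommRing R] (W : WeierstrassCurve R)

lemma eval_addSubMap_zero (s : Fin 3 → R) : (W.addSubMap 0).eval s =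
    s 0 ^ 2 - W.b₄ * s 0 * s 2 - W.b₆ * s 1 * s 2 - W.b₈ * s 2 ^ 2 := by
  simp [addSubMap]

lemma eval_addSubMap_one (s : Fin 3 → R) : (W.addSubMap 1).eval s =
    2 * s 1 * s 0 + W.b₂ * s 0 * s 2 + W.b₄ * s 1 * s 2 + W.b₆ * s 2 ^ 2 := by
  simp [addSubMap]

lemma eval_addSubMap_two (s : Fin 3 → R) : (W.addSubMap 2).eval s =
    s 1 ^ 2 - 4 * s 0 * s 2 := by
  simp [addSubMap]

end AddSub

variable {K : Type*} [Field K] {W : Affine K}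

namespace Point

/-- The duplication formula, i.e. the case Q = P. If 2P = 0, components 1 and 2 of `addSubMap`
vanish, and component 0 does not because the components have no common zero; otherwise the factor is
the inverse square of y − (−y − a₁x − a₃). -/
lemma sym2x_add_self_zero [W.IsElliptic] [DecidableEq K] {x y : K} (h : W.Nonsingular x y) :
    ∃ c : K, ∀ i, (some x y h + some x y h).sym2x 0 i =
      c * (W.addSubMap i).eval ![x ^ 2, 2 * x, 1] := by
  have hsq := h.1.sub_negY_sq
  have heq := (W.equation_iff x y).mp h.1
  by_cases hy : y = W.negY x y
  · rw [add_self_of_Y_eq hy]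
    have h1 : (W.addSubMap 1).eval ![x ^ 2, 2 * x, 1] = 0 := by
      rw [← hy, sub_self] at hsq
      rw [eval_addSubMap_one]
      simp only [Ψ₂Sq, eval_add, eval_mul, eval_C, eval_pow, eval_X] at hsq
      simp
      linear_combination -hsq
    have h2 : (W.addSubMap 2).eval ![x ^ 2, 2 * x, 1] = 0 := by
      rw [eval_addSubMap_two]
      simp
      ring
    have h0 : (W.addSubMap 0).eval ![x ^ 2, 2 * x, 1] ≠ 0 := by
      intro h0
      have hne : ![x ^ 2, 2 * x, 1] ≠ 0 := fun h ↦ one_ne_zero (congrFun h 2)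
      refine addSubMap_ne_zero W hne (funext fun i ↦ ?_)
      fin_cases i
      exacts [h0, h1, h2]
    refine ⟨((W.addSubMap 0).eval ![x ^ 2, 2 * x, 1])⁻¹, fun i ↦ ?_⟩
    rw [sym2x_zero_zero]
    fin_cases i
    · simp [h0]
    · simp [h1]
    · simp [h2]
  · rw [add_self_of_Y_ne hy, sym2x_some_zero]
    have hne : y - W.negY x y ≠ 0 := sub_ne_zero.mpr hy
    refine ⟨((y - W.negY x y) ^ 2)⁻¹, fun i ↦ ?_⟩
    fin_cases i
    · simp only [Fin.zero_eta, eval_addSubMap_zero, Matrix.cons_val_zero, Matrix.cons_val_one,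
        Matrix.cons_val]
      rw [eq_inv_mul_iff_mul_eq₀ (pow_ne_zero 2 hne), addX, slope_of_Y_ne rfl hy]
      field_simp
      simp only [negY, b₄, b₆, b₈]
      linear_combination (-8 * x - 4 * W.a₂ - W.a₁ ^ 2) * heq
    · simp only [Fin.mk_one, eval_addSubMap_one, Matrix.cons_val_zero, Matrix.cons_val_one,
        Matrix.cons_val]
      rw [eq_inv_mul_iff_mul_eq₀ (pow_ne_zero 2 hne), hsq]
      simp only [Ψ₂Sq, eval_add, eval_mul, eval_C, eval_pow, eval_X]
      ring
    · simp only [Fin.reduceFinMk, eval_addSubMap_two, Matrix.cons_val_zero, Matrix.cons_val_one,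
        Matrix.cons_val]
      ring

lemma sym2x_self {x y : K} (h : W.Nonsingular x y) :
    (some x y h).sym2x (some x y h) = ![x ^ 2, 2 * x, 1] := by
  rw [sym2x_some_some]
  ext i
  fin_cases i
  · exact (sq x).symm
  · exact (two_mul x).symm
  · rfl

/-- `addSubMap` describes the map `(P, Q) ↦ (P + Q, P - Q)` on `x`-coordinates. -/
lemma exists_sym2x_add_sub [W.IsElliptic] [DecidableEq K] (P Q : W.Point) :
    ∃ c : K, ∀ i, (P + Q).sym2x (P - Q) i = c * (W.addSubMap i).eval (P.sym2x Q) := by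
  rcases P with _ | ⟨x₁, y₁, h₁⟩
  · refine ⟨1, fun i ↦ ?_⟩
    rw [← zero_def, zero_add, zero_sub, sym2x_neg_right]
    rcases Q with _ | ⟨x, y, h⟩
    · rw [← zero_def, sym2x_zero_zero]
      fin_cases i <;> simp [addSubMap]
    · rw [sym2x_zero_some, sym2x_self]
      fin_cases i <;> simp [addSubMap]
  rcases Q with _ | ⟨x₂, y₂, h₂⟩
  · refine ⟨1, fun i ↦ ?_⟩
    rw [← zero_def, add_zero, sub_zero, sym2x_some_zero, sym2x_self]
    fin_cases i <;> simp [addSubMap]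
  by_cases hx : x₁ = x₂
  · subst hx
    rcases (X_eq_iff (h₁ := h₁) (h₂ := h₂)).mp rfl with h | h
    · rw [h, sub_self, sym2x_self]
      exact sym2x_add_self_zero _
    · rw [h, neg_add_cancel, sym2x_neg_left, sym2x_self, sym2x_comm, sub_eq_add_neg, ← neg_add,
        sym2x_neg_left]
      exact sym2x_add_self_zero _
  · have hne : x₁ - x₂ ≠ 0 := sub_ne_zero.mpr hx
    have e1 := (W.equation_iff x₁ y₁).mp h₁.1
    have e2 := (W.equation_iff x₂ y₂).mp h₂.1
    refine ⟨((x₁ - x₂) ^ 2)⁻¹, fun i ↦ ?_⟩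
    rw [sub_eq_add_neg, neg_some, add_of_X_ne hx, add_of_X_ne hx, sym2x_some_some, sym2x_some_some,
      eq_inv_mul_iff_mul_eq₀ (pow_ne_zero 2 hne), addX, addX, slope_of_X_ne hx, slope_of_X_ne hx]
    fin_cases i
    · simp only [Fin.zero_eta, eval_addSubMap_zero, Matrix.cons_val_zero, Matrix.cons_val_one,
        Matrix.cons_val]
      field_simp
      simp only [negY, b₄, b₆, b₈]
      -- Let λ, μ be the slopes for P + Q and P − Q. The two x-coordinates start with λ(λ + a₁) and
      -- μ(μ + a₁); `hA` and `hB` compute λμ and (λ + a₁)(μ + a₁), up to the factor (x₁ − x₂)².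
      have hA : (y₁ - y₂) * (y₁ - (-y₂ - W.a₁ * x₂ - W.a₃)) = (x₁ ^ 3 + W.a₂ * x₁ ^ 2 + W.a₄ * x₁) -
          (x₂ ^ 3 + W.a₂ * x₂ ^ 2 + W.a₄ * x₂) - W.a₁ * y₁ * (x₁ - x₂) := by
        linear_combination e1 - e2
      have hB : (y₁ - y₂ + W.a₁ * (x₁ - x₂)) *
          (y₁ - (-y₂ - W.a₁ * x₂ - W.a₃) + W.a₁ * (x₁ - x₂)) =
          (x₁ ^ 3 + W.a₂ * x₁ ^ 2 + W.a₄ * x₁) - (x₂ ^ 3 + W.a₂ * x₂ ^ 2 + W.a₄ * x₂) -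
            W.a₁ * (-y₁ - W.a₁ * x₁ - W.a₃) * (x₁ - x₂) := by
        linear_combination e1 - e2
      linear_combination (y₁ - y₂ + W.a₁ * (x₁ - x₂)) *
          (y₁ - (-y₂ - W.a₁ * x₂ - W.a₃) + W.a₁ * (x₁ - x₂)) * hA +
        ((x₁ ^ 3 + W.a₂ * x₁ ^ 2 + W.a₄ * x₁) - (x₂ ^ 3 + W.a₂ * x₂ ^ 2 + W.a₄ * x₂) -
          W.a₁ * y₁ * (x₁ - x₂)) * hB - W.a₁ ^ 2 * (x₁ - x₂) ^ 2 * e1 -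
        (W.a₂ + x₁ + x₂) * (x₁ - x₂) ^ 2 * (2 * e1 + 2 * e2)
    · simp only [Fin.mk_one, eval_addSubMap_one, Matrix.cons_val_zero, Matrix.cons_val_one,
        Matrix.cons_val]
      field_simp
      simp only [negY, b₂, b₄, b₆]
      linear_combination 2 * e1 + 2 * e2
    · simp only [Fin.reduceFinMk, eval_addSubMap_two, Matrix.cons_val_zero, Matrix.cons_val_one,
        Matrix.cons_val]
      ring

end Point

end WeierstrassCurve.Affine

/-! ### Multiplication by n on x-coordinates and the order of the n-torsion -/

namespace WeierstrassCurve.Affine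

open Polynomial

variable {K : Type*} [Field K] {W : Affine K}

lemma coeff_ne_zero_or_of_max_natDegree {u v : K[X]} (huv : IsCoprime u v) {n : ℕ}
    (hn : max u.natDegree v.natDegree = n) : u.coeff n ≠ 0 ∨ v.coeff n ≠ 0 := by
  by_contra! h
  have key (f : K[X]) (hf : f.natDegree = n) (h : f.coeff n = 0) : f = 0 := by
    rw [← hf] at h
    simpa using h
  have h0 : n = 0 → False := by
    rintro rfl
    have hu := key u (by omega) h.1
    have hv := key v (by omega) h.2
    rw [hu, hv] at huv
    simp [isCoprime_zero_left] at huv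
  rcases max_choice u.natDegree v.natDegree with h' | h'
  · exact h0 (by rw [← hn, h', key u (by omega) h.1, natDegree_zero])
  · exact h0 (by rw [← hn, h', key v (by omega) h.2, natDegree_zero])

/-- The coefficients of degree m + n are those of the product of two nonzero linear forms, with
coefficients (u_m, v_m) and (u'_n, v'_n); hence they do not all vanish. -/
lemma max_natDegree_mul_mul_add_mul {u v u' v' : K[X]} {m n : ℕ} (huv : IsCoprime u v)
    (huv' : IsCoprime u' v') (hm : max u.natDegree v.natDegree = m)
    (hn : max u'.natDegree v'.natDegree = n) :
    max (u * u').natDegree (max (u * v' + u' * v).natDegree (v * v').natDegree) = m + n := by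
  have hu : u.natDegree ≤ m := hm ▸ le_max_left _ _
  have hv : v.natDegree ≤ m := hm ▸ le_max_right _ _
  have hu' : u'.natDegree ≤ n := hn ▸ le_max_left _ _
  have hv' : v'.natDegree ≤ n := hn ▸ le_max_right _ _
  apply le_antisymm
  · refine max_le (natDegree_mul_le_of_le hu hu') (max_le ?_ (natDegree_mul_le_of_le hv hv'))
    refine natDegree_add_le_of_degree_le (natDegree_mul_le_of_le hu hv') ?_
    rw [add_comm]
    exact natDegree_mul_le_of_le hu' hv
  · by_contra! h
    simp only [max_lt_iff] at h
    have h1 := coeff_eq_zero_of_natDegree_lt h.1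
    have h2 := coeff_eq_zero_of_natDegree_lt h.2.1
    have h3 := coeff_eq_zero_of_natDegree_lt h.2.2
    rw [coeff_mul_add_eq_of_natDegree_le hu hu'] at h1
    rw [coeff_mul_add_eq_of_natDegree_le hv hv'] at h3
    rw [coeff_add, coeff_mul_add_eq_of_natDegree_le hu hv', add_comm m n,
      coeff_mul_add_eq_of_natDegree_le hu' hv] at h2
    have c1 := coeff_ne_zero_or_of_max_natDegree huv hm
    have c2 := coeff_ne_zero_or_of_max_natDegree huv' hn
    rcases mul_eq_zero.mp h1 with h1 | h1 <;> rcases mul_eq_zero.mp h3 with h3 | h3 <;> simp_all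

/-- The homogeneous coordinates of the pair `(P + Q, P - Q)`, where `x(P) = u / v` and `x(Q) = X`. -/
noncomputable def addSubPoly (W : Affine K) (u v : K[X]) (i : Fin 3) : K[X] :=
  ((W.map C).addSubMap i).eval ![u * X, u + v * X, v]

lemma eval_addSubPoly (u v : K[X]) (i : Fin 3) (x : K) : (addSubPoly W u v i).eval x =
    (W.addSubMap i).eval ![u.eval x * x, u.eval x + v.eval x * x, v.eval x] := by
  fin_cases i
  · simp [addSubPoly, eval_addSubMap_zero]
  · simp [addSubPoly, eval_addSubMap_one]
  · simp [addSubPoly, eval_addSubMap_two]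

/-- By `addSubMapCoeff_condition` the fourth powers of the input coordinates are combinations of the
components of `addSubMap`, so q divides the fourth powers of u + vX and of v, which are coprime. -/
lemma isUnit_of_dvd_addSubPoly [W.IsElliptic] {u v : K[X]} (huv : IsCoprime u v) {q : K[X]}
    (hq : ∀ i, q ∣ addSubPoly W u v i) : IsUnit q := by
  have key (i : Fin 3) : q ∣ ![u * X, u + v * X, v] i ^ 4 := by
    rw [← addSubMapCoeff_condition (W.map C)]
    exact Finset.dvd_sum fun j _ ↦ (hq j).mul_left _
  have hco : IsCoprime (u + v * X) v := huv.add_mul_left_left X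
  exact (hco.pow (m := 4) (n := 4)).isUnit_of_dvd' (key 1) (key 2)

/-- In degree 2n + 2 components 0 and 2 have coefficients u_n² and v_n², and one of these is
nonzero. -/
lemma max_natDegree_addSubPoly {u v : K[X]} (huv : IsCoprime u v) {n : ℕ}
    (hn : max u.natDegree v.natDegree = n) :
    max (addSubPoly W u v 0).natDegree
      (max (addSubPoly W u v 1).natDegree (addSubPoly W u v 2).natDegree) = 2 * n + 2 := by
  have hu : u.natDegree ≤ n := hn ▸ le_max_left _ _
  have hv : v.natDegree ≤ n := hn ▸ le_max_right _ _
  have hv' : v.natDegree ≤ n + 1 := by omega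
  have hs : (u * X).natDegree ≤ n + 1 := natDegree_mul_le_of_le hu natDegree_X_le
  have ht : (u + v * X).natDegree ≤ n + 1 :=
    natDegree_add_le_of_degree_le (hu.trans (by omega)) (natDegree_mul_le_of_le hv natDegree_X_le)
  have cs : (u * X).coeff (n + 1) = u.coeff n := coeff_mul_X ..
  have ct : (u + v * X).coeff (n + 1) = v.coeff n := by
    rw [coeff_add, coeff_mul_X, coeff_eq_zero_of_natDegree_lt (by omega), zero_add]
  have cw : v.coeff (n + 1) = 0 := coeff_eq_zero_of_natDegree_lt (by omega)
  have hd {f g : K[X]} (hf : f.natDegree ≤ n + 1) (hg : g.natDegree ≤ n + 1) :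
      (f * g).natDegree ≤ 2 * n + 2 := (natDegree_mul_le_of_le hf hg).trans (by omega)
  have hc {f g : K[X]} (hf : f.natDegree ≤ n + 1) (hg : g.natDegree ≤ n + 1) :
      (f * g).coeff (2 * n + 2) = f.coeff (n + 1) * g.coeff (n + 1) := by
    rw [← coeff_mul_add_eq_of_natDegree_le hf hg]
    congr 1
    omega
  have hC (a : K) {f : K[X]} (hf : f.natDegree ≤ 2 * n + 2) : (C a * f).natDegree ≤ 2 * n + 2 :=
    (natDegree_C_mul_le a f).trans hf
  have e0 : addSubPoly W u v 0 = (u * X) * (u * X) - C W.b₄ * ((u * X) * v) -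
      C W.b₆ * ((u + v * X) * v) - C W.b₈ * (v * v) := by
    rw [addSubPoly, eval_addSubMap_zero]
    simp
    ring
  have e1 : addSubPoly W u v 1 = C 2 * ((u + v * X) * (u * X)) + C W.b₂ * ((u * X) * v) +
      C W.b₄ * ((u + v * X) * v) + C W.b₆ * (v * v) := by
    rw [addSubPoly, eval_addSubMap_one]
    simp [← map_ofNat C]
    ring
  have e2 : addSubPoly W u v 2 = (u + v * X) * (u + v * X) - C 4 * ((u * X) * v) := by
    rw [addSubPoly, eval_addSubMap_two]
    simp [← map_ofNat C]
    ring
  apply le_antisymm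
  · refine max_le ?_ (max_le ?_ ?_)
    · rw [e0]
      exact natDegree_sub_le_of_le (natDegree_sub_le_of_le (natDegree_sub_le_of_le (hd hs hs)
        (hC _ (hd hs hv')) |>.trans (max_self _).le) (hC _ (hd ht hv')) |>.trans (max_self _).le)
        (hC _ (hd hv' hv')) |>.trans (max_self _).le
    · rw [e1]
      exact natDegree_add_le_of_degree_le (natDegree_add_le_of_degree_le
        (natDegree_add_le_of_degree_le (hC _ (hd ht hs)) (hC _ (hd hs hv'))) (hC _ (hd ht hv')))
        (hC _ (hd hv' hv'))
    · rw [e2]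
      exact natDegree_sub_le_of_le (hd ht ht) (hC _ (hd hs hv')) |>.trans (max_self _).le
  · by_contra! h
    simp only [max_lt_iff] at h
    have h1 := coeff_eq_zero_of_natDegree_lt h.1
    have h3 := coeff_eq_zero_of_natDegree_lt h.2.2
    rw [e0] at h1
    rw [e2] at h3
    simp only [coeff_sub, coeff_C_mul, hc hs hs, hc hs hv', hc ht hv', hc hv' hv', cs, cw,
      mul_zero, sub_zero, mul_self_eq_zero] at h1
    simp only [coeff_sub, coeff_C_mul, hc hs hv', hc ht ht, ct, cw,
      mul_zero, sub_zero, mul_self_eq_zero] at h3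
    have c1 := coeff_ne_zero_or_of_max_natDegree huv hn
    simp_all

namespace Point

lemma xRep_xCoord {P : W.Point} (h : P ≠ 0) : P.xRep = ![P.xCoord, 1] := by
  rcases P with _ | ⟨x, y, hP⟩
  · exact absurd rfl h
  · rfl

lemma eq_zero_of_forall_eval_xCoord [W.IsElliptic] [IsSepClosed K] {f : K[X]}
    (hf : ∀ P : W.Point, P ≠ 0 → f.eval P.xCoord = 0) : f = 0 := by
  by_contra h
  refine Set.infinite_univ (α := W.Point)
    (((finite_setOf_eval_eq_zero h).union (Set.finite_singleton 0)).subset fun P _ ↦ ?_)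
  by_cases hP : P = 0
  · exact Or.inr hP
  · exact Or.inl ⟨hP, hf P hP⟩

/-- On `x`-coordinates, multiplication by `n` is a rational function of degree `n ^ 2`. -/
theorem exists_xRep_nsmul [W.IsElliptic] [IsSepClosed K] [DecidableEq K] (n : ℕ) :
    ∃ u v : K[X], IsCoprime u v ∧ max u.natDegree v.natDegree = n ^ 2 ∧
      ∀ P : W.Point, P ≠ 0 →
        (n • P).xRep 0 * v.eval P.xCoord = (n • P).xRep 1 * u.eval P.xCoord := by
  induction n using Nat.twoStepInduction with
  | zero => exact ⟨1, 0, isCoprime_one_left, by simp, fun P _ ↦ by simp⟩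
  | one => exact ⟨X, 1, isCoprime_one_right, by simp, fun P hP ↦ by simp [xRep_xCoord hP]⟩
  | more n ih₀ ih₁ =>
    obtain ⟨u, v, huv, hdeg, h⟩ := ih₀
    obtain ⟨u₁, v₁, huv₁, hdeg₁, h₁⟩ := ih₁
    -- Since (n + 1)P ± P are (n + 2)P and nP, `T` describes this unordered pair. Splitting off the
    -- factor (u : v) of nP leaves (u' : v') for (n + 2)P, with the right degree because 2(n + 1)² +
    -- 2 = n² + (n + 2)².
    set T := addSubPoly W u₁ v₁ with hT
    have hprop (a b c d : K) (hab : a ≠ 0 ∨ b ≠ 0) (h : a * d = b * c) :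
        ∃ k, c = k * a ∧ d = k * b := by
      by_cases ha : a = 0
      · have hb : b ≠ 0 := by simp_all
        exact ⟨d / b, by rw [ha]; rw [ha] at h; simp_all, by field_simp⟩
      · exact ⟨c / a, by field_simp, by field_simp; linear_combination h⟩
    have hrep (P : W.Point) : P.xRep 0 ≠ 0 ∨ P.xRep 1 ≠ 0 := by
      by_contra! h
      refine P.xRep_ne_zero (funext fun i ↦ ?_)
      fin_cases i
      exacts [h.1, h.2]
    have hnz {u v : K[X]} (huv : IsCoprime u v) (x : K) : u.eval x ≠ 0 ∨ v.eval x ≠ 0 := by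
      by_contra! h
      obtain ⟨c, d, hcd⟩ := huv
      have := congrArg (eval x) hcd
      simp [h] at this
    have hTP (P : W.Point) (hP : P ≠ 0) : ∃ c : K, c ≠ 0 ∧ ∀ i, (T i).eval P.xCoord =
        c * ((n + 2) • P).sym2x (n • P) i := by
      obtain ⟨k, hk1, hk2⟩ := hprop _ _ _ _ (hnz huv₁ P.xCoord)
        (show u₁.eval P.xCoord * ((n + 1) • P).xRep 1 = v₁.eval P.xCoord * ((n + 1) • P).xRep 0 by
          linear_combination -h₁ P hP)
      obtain ⟨c, hc⟩ := exists_sym2x_add_sub ((n + 1) • P) P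
      rw [show (n + 1) • P + P = (n + 2) • P by rw [succ_nsmul _ (n + 1)],
        show (n + 1) • P - P = n • P by rw [succ_nsmul, add_sub_cancel_right]] at hc
      have hk : k ≠ 0 := by
        rintro rfl
        rcases hrep ((n + 1) • P) with h | h <;> simp_all
      have hc0 : c ≠ 0 := by
        rintro rfl
        exact sym2x_ne_zero ((n + 2) • P) (n • P) (funext fun i ↦ by simp [hc i])
      have hT' (i : Fin 3) : (W.addSubMap i).eval (((n + 1) • P).sym2x P) =
          k ^ 2 * (T i).eval P.xCoord := by
        have hs : ((n + 1) • P).sym2x P = ![k * (u₁.eval P.xCoord * P.xCoord),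
            k * (u₁.eval P.xCoord + v₁.eval P.xCoord * P.xCoord), k * v₁.eval P.xCoord] := by
          ext i
          fin_cases i <;> simp [sym2x, hk1, hk2, xRep_xCoord hP] <;> ring
        rw [hs, hT, eval_addSubPoly]
        fin_cases i
        · simp [eval_addSubMap_zero]
          ring
        · simp [eval_addSubMap_one]
          ring
        · simp [eval_addSubMap_two]
          ring
      refine ⟨(c * k ^ 2)⁻¹, by positivity, fun i ↦ ?_⟩
      rw [hc, hT']
      field_simp
    -- The pair (u : v) is a zero of the quadratic form with coefficients `T`; this holds at all
    -- affine points, hence identically.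
    have hroot : T 0 * v ^ 2 - T 1 * (u * v) + T 2 * u ^ 2 = 0 := by
      refine eq_zero_of_forall_eval_xCoord (W := W) fun P hP ↦ ?_
      obtain ⟨c, -, hc⟩ := hTP P hP
      obtain ⟨k, hk1, hk2⟩ := hprop _ _ _ _ (hrep (n • P)) (h P hP)
      simp only [eval_add, eval_sub, eval_mul, eval_pow, hc, hk1, hk2]
      simp [sym2x]
      ring
    obtain ⟨u', v', hu', hv'2, hv'⟩ :
        ∃ u' v', T 0 = u * u' ∧ T 1 = u * v' + u' * v ∧ T 2 = v * v' := by
      -- This does occur: for n = 0 the multiple is always the point at infinity.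
      by_cases hv0 : v = 0
      · subst hv0
        obtain ⟨w, hw⟩ := (isCoprime_zero_right.mp huv).exists_right_inv
        have hu0 : u ≠ 0 := by rintro rfl; simp at hw
        refine ⟨T 0 * w, T 1 * w, by linear_combination -T 0 * hw, by linear_combination -T 1 * hw,
          ?_⟩
        simpa [hu0] using hroot
      by_cases hu0 : u = 0
      · subst hu0
        obtain ⟨w, hw⟩ := (isCoprime_zero_left.mp huv).exists_right_inv
        refine ⟨T 1 * w, T 2 * w, ?_, by linear_combination -T 1 * hw, by linear_combination -T 2 * hw⟩
        simpa [hv0] using hroot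
      obtain ⟨u', hu'⟩ : u ∣ T 0 := (huv.pow_right (n := 2)).dvd_of_dvd_mul_right
        ⟨T 1 * v - T 2 * u, by linear_combination hroot⟩
      obtain ⟨v', hv'⟩ : v ∣ T 2 := (huv.symm.pow_right (n := 2)).dvd_of_dvd_mul_right
        ⟨T 1 * u - T 0 * v, by linear_combination hroot⟩
      refine ⟨u', v', hu', ?_, hv'⟩
      rw [hu', hv'] at hroot
      have h0 : (u * v) * (u * v' + u' * v - T 1) = 0 := by linear_combination hroot
      rw [mul_eq_zero, or_iff_right (mul_ne_zero hu0 hv0)] at h0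
      linear_combination -h0
    have hco : IsCoprime u' v' := by
      rw [← isRelPrime_iff_isCoprime]
      intro q hq1 hq2
      refine isUnit_of_dvd_addSubPoly (W := W) huv₁ fun i ↦ ?_
      fin_cases i
      · exact (hq1.mul_left u).trans hu'.symm.dvd
      · exact (dvd_add (hq2.mul_left u) (hq1.mul_right v)).trans hv'2.symm.dvd
      · exact (hq2.mul_left v).trans hv'.symm.dvd
    refine ⟨u', v', hco, ?_, fun P hP ↦ ?_⟩
    · have h1 := max_natDegree_mul_mul_add_mul huv hco hdeg rfl
      rw [← hu', ← hv'2, ← hv', hT, max_natDegree_addSubPoly huv₁ hdeg₁] at h1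
      zify at h1 ⊢
      linear_combination -h1
    · obtain ⟨c, hc0, hc⟩ := hTP P hP
      obtain ⟨k, hk1, hk2⟩ := hprop _ _ _ _ (hnz huv P.xCoord)
        (show u.eval P.xCoord * (n • P).xRep 1 = v.eval P.xCoord * (n • P).xRep 0 by
          linear_combination -h P hP)
      have hk : k ≠ 0 := by
        rintro rfl
        rcases hrep (n • P) with h | h <;> simp_all
      have t0 := hc 0
      have t1 := hc 1
      have t2 := hc 2
      rw [hu'] at t0
      rw [hv'2] at t1
      rw [hv'] at t2
      simp only [sym2x, hk1, hk2, eval_add, eval_mul, Matrix.cons_val_zero, Matrix.cons_val_one,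
        Matrix.cons_val] at t0 t1 t2
      rcases hnz huv P.xCoord with hz | hz
      · have e0 : u'.eval P.xCoord = c * k * ((n + 2) • P).xRep 0 :=
          mul_left_cancel₀ hz (by linear_combination t0)
        have e1 : v'.eval P.xCoord = c * k * ((n + 2) • P).xRep 1 :=
          mul_left_cancel₀ hz (by linear_combination t1 - v.eval P.xCoord * e0)
        rw [e0, e1]
        ring
      · have e1 : v'.eval P.xCoord = c * k * ((n + 2) • P).xRep 1 :=
          mul_left_cancel₀ hz (by linear_combination t2)
        have e0 : u'.eval P.xCoord = c * k * ((n + 2) • P).xRep 0 :=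
          mul_left_cancel₀ hz (by linear_combination t1 - u.eval P.xCoord * e1)
        rw [e0, e1]
        ring

theorem card_ker_nsmul [W.IsElliptic] [IsSepClosed K] [DecidableEq K] {n : ℕ} (hn : (n : K) ≠ 0) :
    Nat.card (nsmulAddMonoidHom (α := W.Point) n).ker = n ^ 2 := by
  obtain ⟨u, v, huv, hdeg, h⟩ := exists_xRep_nsmul (W := W) n
  refine (card_ker_and_surjective_of_xCoord _ huv hdeg (by simpa using hn) ?_).1
  have hv : v ≠ 0 := by
    rintro rfl
    have hu := natDegree_eq_zero_of_isUnit (isCoprime_zero_right.mp huv)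
    simp only [hu, natDegree_zero, max_self] at hdeg
    exact hn (by simp [pow_eq_zero_iff two_ne_zero |>.mp hdeg.symm])
  refine ((finite_setOf_eval_eq_zero hv).union (Set.finite_singleton 0)).subset fun P hP ↦ ?_
  by_contra hcon
  simp only [Set.mem_union, Set.mem_ofPred_eq, Set.mem_singleton_iff, not_or, not_and] at hcon
  have hv' := hcon.1 hcon.2
  have h' := h P hcon.2
  refine hP ⟨hv', ?_⟩
  rw [nsmulAddMonoidHom_apply]
  by_cases hz : n • P = 0
  · rw [hz] at h'
    simp [hv'] at h'
  · rw [xRep_xCoord hz] at h'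
    refine ⟨hz, ?_⟩
    rw [eq_div_iff hv']
    simpa using h'

end Point

end WeierstrassCurve.Affine

/-! ### Pole orders at infinity -/

namespace WeierstrassCurve.Affine

set_option linter.unusedSectionVars false

open Polynomial WithZero

variable {K : Type*} [Field K]

namespace CoordinateRing

variable {W : Affine K}

instance : Module.Finite K[X] W.CoordinateRing := .of_basis (CoordinateRing.basis W)

lemma two_nsmul_degree_add_le_iff (p : K[X]) (k n : ℕ) :
    2 • p.degree + (k : WithBot ℕ) ≤ n ↔ ∀ i, n < 2 * i + k → p.coeff i = 0 := by
  by_cases hp : p = 0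
  · simp [hp]
  have h : 2 • p.degree + (k : WithBot ℕ) = ((2 * p.natDegree + k : ℕ) : WithBot ℕ) := by
    rw [degree_eq_natDegree hp, nsmul_eq_mul]
    push_cast
    rfl
  rw [h, Nat.cast_le]
  constructor
  · intro h i hi
    exact coeff_eq_zero_of_natDegree_lt (by omega)
  · intro h
    by_contra! hlt
    exact hp (by simpa using h p.natDegree hlt)

/-- The pole order of p + qY at infinity is max(2 deg p, 2 deg q + 3). The coefficientwise form is
linear in p and q, from which the ultrametric inequality and the comparison of leading terms are
read off. -/
lemma degree_norm_le_iff (p q : K[X]) (n : ℕ) :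
    (Algebra.norm K[X] (p • (1 : W.CoordinateRing) + q • mk W Y)).degree ≤ n ↔
      (∀ i, n < 2 * i → p.coeff i = 0) ∧ ∀ i, n < 2 * i + 3 → q.coeff i = 0 := by
  rw [degree_norm_smul_basis, max_le_iff, ← two_nsmul_degree_add_le_iff q 3 n]
  refine and_congr ?_ Iff.rfl
  simpa using two_nsmul_degree_add_le_iff p 0 n

lemma degree_norm_lt_iff (p q : K[X]) (n : ℕ) :
    (Algebra.norm K[X] (p • (1 : W.CoordinateRing) + q • mk W Y)).degree < n ↔
      (∀ i, n ≤ 2 * i → p.coeff i = 0) ∧ ∀ i, n ≤ 2 * i + 3 → q.coeff i = 0 := by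
  rcases n with _ | n
  · rw [Nat.cast_zero, Nat.WithBot.lt_zero_iff, degree_eq_bot]
    constructor
    · intro h
      rw [Algebra.norm_eq_zero_iff] at h
      obtain ⟨rfl, rfl⟩ := smul_basis_eq_zero h
      simp
    · rintro ⟨h1, h2⟩
      have hp : p = 0 := by ext i; simpa using h1 i (by omega)
      have hq : q = 0 := by ext i; simpa using h2 i (by omega)
      simp [hp, hq]
  · have h1 (d : WithBot ℕ) : d < ((n + 1 : ℕ) : WithBot ℕ) ↔ d ≤ n := by
      induction d using WithBot.recBotCoe with
      | bot => simp
      | coe d =>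
        exact (WithBot.coe_lt_coe.trans Nat.lt_succ_iff).trans WithBot.coe_le_coe.symm
    rw [h1, degree_norm_le_iff]
    simp only [Nat.succ_le_iff]

lemma degree_norm_add_le (a b : W.CoordinateRing) : (Algebra.norm K[X] (a + b)).degree ≤
    max (Algebra.norm K[X] a).degree (Algebra.norm K[X] b).degree := by
  obtain ⟨p, q, rfl⟩ := exists_smul_basis_eq a
  obtain ⟨r, s, rfl⟩ := exists_smul_basis_eq b
  set N := max (Algebra.norm K[X] (p • (1 : W.CoordinateRing) + q • mk W Y)).degree
    (Algebra.norm K[X] (r • (1 : W.CoordinateRing) + s • mk W Y)).degree with hN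
  rw [show p • (1 : W.CoordinateRing) + q • mk W Y + (r • (1 : W.CoordinateRing) + s • mk W Y) =
    (p + r) • (1 : W.CoordinateRing) + (q + s) • mk W Y by module]
  have h1 := le_max_left _ _ |>.trans_eq hN.symm
  have h2 := le_max_right _ _ |>.trans_eq hN.symm
  clear_value N
  induction N using WithBot.recBotCoe with
  | bot =>
    rw [le_bot_iff, degree_eq_bot, Algebra.norm_eq_zero_iff] at h1 h2
    obtain ⟨rfl, rfl⟩ := smul_basis_eq_zero h1
    obtain ⟨rfl, rfl⟩ := smul_basis_eq_zero h2
    simp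
  | coe n =>
    have e1 := (degree_norm_le_iff p q n).mp h1
    have e2 := (degree_norm_le_iff r s n).mp h2
    refine (degree_norm_le_iff (W := W) (p + r) (q + s) n).mpr
      ⟨fun i hi ↦ ?_, fun i hi ↦ ?_⟩
    · simp [e1.1 i hi, e2.1 i hi]
    · simp [e1.2 i hi, e2.2 i hi]

open Classical in
variable (W) in
/-- The valuation at infinity on the coordinate ring. -/
noncomputable def infValuation : Valuation W.CoordinateRing ℤᵐ⁰ where
  toFun a := if a = 0 then 0 else exp ((Algebra.norm K[X] a).natDegree : ℤ)
  map_zero' := by simp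
  map_one' := by simp
  map_mul' a b := by
    by_cases ha : a = 0
    · simp [ha]
    by_cases hb : b = 0
    · simp [hb]
    rw [if_neg ha, if_neg hb, if_neg (mul_ne_zero ha hb), map_mul, natDegree_mul
      (Algebra.norm_ne_zero_iff.mpr ha) (Algebra.norm_ne_zero_iff.mpr hb), Nat.cast_add, exp_add]
  map_add_le_max' a b := by
    by_cases ha : a = 0
    · simp [ha]
    by_cases hb : b = 0
    · simp [hb]
    by_cases hab : a + b = 0
    · simp [hab]
    have h := degree_norm_add_le a b
    rw [degree_eq_natDegree (p := Algebra.norm K[X] a) (Algebra.norm_ne_zero_iff.mpr ha),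
      degree_eq_natDegree (p := Algebra.norm K[X] b) (Algebra.norm_ne_zero_iff.mpr hb),
      degree_eq_natDegree (p := Algebra.norm K[X] (a + b)) (Algebra.norm_ne_zero_iff.mpr hab)] at h
    rw [if_neg ha, if_neg hb, if_neg hab]
    rcases le_max_iff.mp h with h | h
    · exact le_max_of_le_left (by simpa using h)
    · exact le_max_of_le_right (by simpa using h)

lemma infValuation_apply {a : W.CoordinateRing} (ha : a ≠ 0) :
    infValuation W a = exp ((Algebra.norm K[X] a).natDegree : ℤ) := by
  classical
  exact if_neg ha

lemma infValuation_le_exp_iff (a : W.CoordinateRing) (n : ℕ) :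
    infValuation W a ≤ exp (n : ℤ) ↔ (Algebra.norm K[X] a).degree ≤ n := by
  by_cases ha : a = 0
  · simp [ha]
  · rw [infValuation_apply ha, degree_eq_natDegree (Algebra.norm_ne_zero_iff.mpr ha)]
    simp

lemma infValuation_lt_exp_iff (a : W.CoordinateRing) (n : ℕ) :
    infValuation W a < exp (n : ℤ) ↔ (Algebra.norm K[X] a).degree < n := by
  by_cases ha : a = 0
  · simp [ha]
  · rw [infValuation_apply ha, degree_eq_natDegree (Algebra.norm_ne_zero_iff.mpr ha)]
    simp

lemma infValuation_ne_zero {a : W.CoordinateRing} (ha : a ≠ 0) : infValuation W a ≠ 0 := by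
  rw [infValuation_apply ha]
  exact exp_ne_zero

/-- Two functions of the same pole order at infinity have proportional leading terms. -/
lemma exists_infValuation_sub_lt {a b : W.CoordinateRing} (hb : b ≠ 0)
    (h : infValuation W a ≤ infValuation W b) :
    ∃ c : K, infValuation W (a - algebraMap K _ c * b) < infValuation W b := by
  obtain ⟨n, hn⟩ : ∃ n : ℕ, infValuation W b = exp (n : ℤ) := ⟨_, infValuation_apply hb⟩
  obtain ⟨p, q, rfl⟩ := exists_smul_basis_eq a
  obtain ⟨r, s, rfl⟩ := exists_smul_basis_eq b
  rw [hn] at h ⊢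
  have hle := hn.le
  have hlt := hn.not_lt
  rw [infValuation_le_exp_iff, degree_norm_le_iff] at h hle
  rw [infValuation_lt_exp_iff, degree_norm_lt_iff] at hlt
  have hsub (c : K) : p • (1 : W.CoordinateRing) + q • mk W Y -
      algebraMap K _ c * (r • (1 : W.CoordinateRing) + s • mk W Y) =
      (p - C c * r) • (1 : W.CoordinateRing) + (q - C c * s) • mk W Y := by
    have : algebraMap K W.CoordinateRing c = algebraMap K[X] _ (C c) := rfl
    rw [this]
    simp only [Algebra.smul_def, map_sub, map_mul]
    ring
  -- The pole order n is even or odd according to whether p-type or q-type terms lead, so a single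
  -- coefficient is the leading one.
  have hcase : (∃ i, n = 2 * i ∧ r.coeff i ≠ 0) ∨ ∃ i, n = 2 * i + 3 ∧ s.coeff i ≠ 0 := by
    by_contra! hcon
    refine hlt ⟨fun i hi ↦ ?_, fun i hi ↦ ?_⟩
    · rcases hi.eq_or_lt with hi | hi
      exacts [hcon.1 i hi, hle.1 i hi]
    · rcases hi.eq_or_lt with hi | hi
      exacts [hcon.2 i hi, hle.2 i hi]
  rcases hcase with ⟨i, rfl, hi⟩ | ⟨i, rfl, hi⟩
  · refine ⟨p.coeff i / r.coeff i, ?_⟩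
    rw [infValuation_lt_exp_iff, hsub, degree_norm_lt_iff]
    refine ⟨fun j hj ↦ ?_, fun j hj ↦ ?_⟩
    · rcases hj.eq_or_lt with hj | hj
      · obtain rfl : i = j := by omega
        simp [hi]
      · simp [h.1 j hj, hle.1 j hj]
    · simp [h.2 j (by omega), hle.2 j (by omega)]
  · refine ⟨q.coeff i / s.coeff i, ?_⟩
    rw [infValuation_lt_exp_iff, hsub, degree_norm_lt_iff]
    refine ⟨fun j hj ↦ ?_, fun j hj ↦ ?_⟩
    · simp [h.1 j (by omega), hle.1 j (by omega)]
    · rcases hj.eq_or_lt with hj | hj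
      · obtain rfl : i = j := by omega
        simp [hi]
      · simp [h.2 j hj, hle.2 j hj]

/-- There is no function with exactly one simple pole at infinity. -/
lemma exists_eq_algebraMap_of_infValuation_le {a : W.CoordinateRing}
    (h : infValuation W a ≤ exp 1) : ∃ c : K, a = algebraMap K _ c := by
  obtain ⟨p, q, rfl⟩ := exists_smul_basis_eq a
  have h' := (infValuation_le_exp_iff _ 1).mp h
  rw [degree_norm_le_iff] at h'
  have hq : q = 0 := by ext i; simpa using h'.2 i (by omega)
  have hp : p = C (p.coeff 0) := by
    ext i
    rcases i with _ | i
    · simp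
    · simpa [coeff_C] using h'.1 (i + 1) (by omega)
  refine ⟨p.coeff 0, ?_⟩
  rw [hq, hp]
  simp [Algebra.smul_def]
  rfl

end CoordinateRing

namespace FunctionField

open CoordinateRing

variable (W : Affine K) (L : Type*) [Field L] [Algebra W.CoordinateRing L]
  [IsFractionRing W.CoordinateRing L]

/-- The valuation at infinity on the function field, with values `exp n` for a pole of order `n`. -/
noncomputable def infValuation : Valuation L ℤᵐ⁰ :=
  (CoordinateRing.infValuation W).extendToLocalization (S := nonZeroDivisors W.CoordinateRing)
    (fun a ha ↦ by
      intro h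
      exact CoordinateRing.infValuation_ne_zero (nonZeroDivisors.ne_zero ha)
        ((Valuation.mem_supp_iff _ _).mp h)) _

/-- The coordinate function `x`. -/
noncomputable def genX : L :=
  algebraMap W.CoordinateRing L (CoordinateRing.mk W (Polynomial.C Polynomial.X))

/-- The coordinate function `y`. -/
noncomputable def genY : L :=
  algebraMap W.CoordinateRing _ (CoordinateRing.mk W Polynomial.X)

variable {W L} [Algebra K L] [IsScalarTower K W.CoordinateRing L]

local notation "v" => infValuation W L
local notation "κ" => algebraMap K L

@[simp] lemma infValuation_algebraMap (a : W.CoordinateRing) :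
    v (algebraMap _ _ a) = CoordinateRing.infValuation W a :=
  Valuation.extendToLocalization_apply_map_apply ..

lemma infValuation_algebraMap_field {c : K} (hc : c ≠ 0) : v (κ c) = 1 := by
  rw [IsScalarTower.algebraMap_apply K W.CoordinateRing, infValuation_algebraMap,
    infValuation_apply (by simpa using hc)]
  have : algebraMap K W.CoordinateRing c = algebraMap K[X] _ (C c) := rfl
  rw [this, Algebra.norm_algebraMap]
  simp

lemma infValuation_algebraMap_field_le (c : K) : v (κ c) ≤ 1 := by
  by_cases hc : c = 0
  · simp [hc]
  · rw [infValuation_algebraMap_field hc]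

lemma infValuation_genX : v (genX W L) = exp 2 := by
  have h : (CoordinateRing.mk W (Polynomial.C Polynomial.X) : W.CoordinateRing) =
    (Polynomial.X : K[X]) • 1 + (0 : K[X]) • CoordinateRing.mk W Polynomial.X := by simp [CoordinateRing.smul]
  rw [genX, infValuation_algebraMap, h]
  apply le_antisymm
  · refine (infValuation_le_exp_iff _ 2).mpr ((degree_norm_le_iff _ _ _).mpr ⟨fun i hi ↦ ?_, by simp⟩)
    rw [coeff_X, if_neg (by omega)]
  · refine not_lt.mp fun h ↦ ?_
    have := ((degree_norm_lt_iff _ _ _).mp ((infValuation_lt_exp_iff _ 2).mp h)).1 1 le_rfl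
    simp at this

lemma infValuation_genY : v (genY W L) = exp 3 := by
  have h : (CoordinateRing.mk W Polynomial.X : W.CoordinateRing) =
    (0 : K[X]) • 1 + (1 : K[X]) • CoordinateRing.mk W Polynomial.X := by simp
  rw [genY, infValuation_algebraMap, h]
  apply le_antisymm
  · refine (infValuation_le_exp_iff _ 3).mpr ((degree_norm_le_iff _ _ _).mpr ⟨by simp, fun i hi ↦ ?_⟩)
    rw [coeff_one, if_neg (by omega)]
  · refine not_lt.mp fun h ↦ ?_
    have := ((degree_norm_lt_iff _ _ _).mp ((infValuation_lt_exp_iff _ 3).mp h)).2 0 le_rfl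
    simp at this

/-- The residue field at infinity is K. With a common denominator the claim becomes the one for
regular functions. -/
lemma exists_infValuation_sub_lt {f g : L} (hg : g ≠ 0) (h : v f ≤ v g) :
    ∃ c : K, v (f - κ c * g) < v g := by
  obtain ⟨a, b, s, hs, rfl, rfl⟩ : ∃ a b s : W.CoordinateRing, s ≠ 0 ∧
      f = algebraMap _ _ a / algebraMap _ _ s ∧ g = algebraMap _ _ b / algebraMap _ _ s := by
    obtain ⟨a, s, hs, rfl⟩ := IsFractionRing.div_surjective (A := W.CoordinateRing) f
    obtain ⟨b, t, ht, rfl⟩ := IsFractionRing.div_surjective (A := W.CoordinateRing) g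
    have hs := nonZeroDivisors.ne_zero hs
    have ht := nonZeroDivisors.ne_zero ht
    have hs' : algebraMap _ L s ≠ 0 := by simpa using hs
    have ht' : algebraMap _ L t ≠ 0 := by simpa using ht
    refine ⟨a * t, b * s, s * t, mul_ne_zero hs ht, ?_, ?_⟩
    · rw [map_mul, map_mul]
      field_simp
    · rw [map_mul, map_mul]
      field_simp
  have hs0 : 0 < v (algebraMap _ _ s) := by
    rw [infValuation_algebraMap]
    exact zero_lt_iff.mpr (infValuation_ne_zero hs)
  have hb : b ≠ 0 := by
    rintro rfl
    simp at hg
  rw [map_div₀, map_div₀, div_le_div_iff_of_pos_right hs0, infValuation_algebraMap,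
    infValuation_algebraMap] at h
  obtain ⟨c, hc⟩ := CoordinateRing.exists_infValuation_sub_lt hb h
  refine ⟨c, ?_⟩
  rw [show algebraMap _ L a / algebraMap _ _ s -
      κ c * (algebraMap _ _ b / algebraMap _ _ s) =
      algebraMap _ _ (a - algebraMap K _ c * b) / algebraMap _ _ s by
    rw [map_sub, map_mul, ← IsScalarTower.algebraMap_apply K W.CoordinateRing]
    ring, map_div₀, map_div₀, div_lt_div_iff_of_pos_right hs0, infValuation_algebraMap,
    infValuation_algebraMap]
  exact hc

end FunctionField

end WeierstrassCurve.Affine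

/-! ### The generic point and translations of the function field -/

namespace WeierstrassCurve.Affine

set_option linter.unusedSectionVars false

open Polynomial WithZero

variable {K : Type*} [Field K] {W : Affine K}

namespace Point

/-- The homomorphism on points induced by an embedding of fields. -/
noncomputable def mapField [DecidableEq K] {L : Type*} [Field L] [DecidableEq L] (f : K →+* L) :
    W.Point →+ (W.map f).Point where
  toFun
    | 0 => 0
    | some x y h => some (f x) (f y) ((W.map_nonsingular f.injective x y).mpr h)
  map_zero' := rfl
  map_add' := by
    rintro (_ | ⟨x₁, y₁, h₁⟩) (_ | ⟨x₂, y₂, h₂⟩)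
    any_goals rfl
    by_cases hxy : x₁ = x₂ ∧ y₁ = W.negY x₂ y₂
    · rw [add_of_Y_eq hxy.left hxy.right,
        add_of_Y_eq (congr_arg _ hxy.left) <| by rw [hxy.right, map_negY]]
    · simpa only [add_some hxy, ← map_addX, ← map_addY, ← map_slope] using!
        (add_some fun h ↦ hxy ⟨f.injective h.1, f.injective (W.map_negY f .. ▸ h).2⟩).symm

lemma mapField_injective [DecidableEq K] {L : Type*} [Field L] [DecidableEq L] (f : K →+* L) :
    Function.Injective (mapField (W := W) f) := by
  rintro (_ | _) (_ | _) h
  any_goals contradiction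
  · rfl
  · simpa only [some.injEq] using ⟨f.injective (some.inj h).left, f.injective (some.inj h).right⟩

end Point

namespace CoordinateRing

lemma algebraMap_eq_mk (c : K) : algebraMap K W.CoordinateRing c = mk W (C (C c)) := rfl

lemma mk_equation : mk W Y ^ 2 + algebraMap K _ W.a₁ * mk W (C X) * mk W Y +
    algebraMap K _ W.a₃ * mk W Y = mk W (C X) ^ 3 + algebraMap K _ W.a₂ * mk W (C X) ^ 2 +
      algebraMap K _ W.a₄ * mk W (C X) + algebraMap K _ W.a₆ := by
  have h : mk W W.polynomial = 0 := AdjoinRoot.mk_self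
  simp only [polynomial, map_add, map_sub, map_mul, map_pow] at h
  simp only [algebraMap_eq_mk]
  linear_combination h

/-- The coordinate ring is generated by the constants and the coordinate functions. -/
@[elab_as_elim]
lemma induction {p : W.CoordinateRing → Prop} (algebraMap : ∀ c : K, p (algebraMap K _ c))
    (hx : p (mk W (C X))) (hy : p (mk W Y)) (add : ∀ a b, p a → p b → p (a + b))
    (mul : ∀ a b, p a → p b → p (a * b)) (a : W.CoordinateRing) : p a := by
  have hpoly (q : K[X]) : p (mk W (C q)) := by
    induction q using Polynomial.induction_on' with
    | add q r hq hr => rw [C_add, map_add]; exact add _ _ hq hr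
    | monomial n c =>
      rw [← C_mul_X_pow_eq_monomial, C_mul, map_mul, C_pow, map_pow]
      refine mul _ _ (algebraMap c) ?_
      induction n with
      | zero => simpa using algebraMap 1
      | succ n ih => rw [pow_succ]; exact mul _ _ ih hx
  obtain ⟨q, r, rfl⟩ := exists_smul_basis_eq a
  rw [CoordinateRing.smul, CoordinateRing.smul, mul_one]
  exact add _ _ (hpoly q) (mul _ _ (hpoly r) hy)

lemma dvd_algebraMap_norm (a : W.CoordinateRing) :
    a ∣ algebraMap K[X] _ (Algebra.norm K[X] a) := by
  obtain ⟨p, q, rfl⟩ := exists_smul_basis_eq a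
  refine ⟨mk W (C p + C q * (-(Y : K[X][Y]) - C (C W.a₁ * X + C W.a₃))), ?_⟩
  have := coe_norm_smul_basis (W' := W) p q
  rw [map_mul] at this
  refine Eq.trans this ?_
  rw [CoordinateRing.smul, CoordinateRing.smul, mul_one, map_add, map_mul]

end CoordinateRing

namespace FunctionField

variable {L : Type*} [Field L] [Algebra W.CoordinateRing L] [IsFractionRing W.CoordinateRing L]
  [Algebra K L] [IsScalarTower K W.CoordinateRing L]

local notation "v" => infValuation W L
local notation "κ" => algebraMap K L

lemma equation_gen : (W.baseChange L).Equation (genX W L) (genY W L) := by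
  rw [equation_iff]
  have h := congrArg (algebraMap W.CoordinateRing L) (CoordinateRing.mk_equation (W := W))
  simp only [map_add, map_mul, map_pow, ← IsScalarTower.algebraMap_apply] at h
  exact h

lemma ringHom_ext {R : Type*} [Semiring R] {f g : L →+* R}
    (h : ∀ c, f (κ c) = g (κ c)) (hx : f (genX W L) = g (genX W L)) (hy : f (genY W L) = g (genY W L)) :
    f = g := by
  refine IsLocalization.ringHom_ext (nonZeroDivisors W.CoordinateRing) (RingHom.ext fun a ↦ ?_)
  induction a using CoordinateRing.induction with
  | algebraMap c => simpa [← IsScalarTower.algebraMap_apply] using h c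
  | hx => exact hx
  | hy => exact hy
  | add a b ha hb => rw [map_add, map_add, ha, hb]
  | mul a b ha hb => rw [map_mul, map_mul, ha, hb]

lemma algHom_ext {R : Type*} [Semiring R] [Algebra K R] {f g : L →ₐ[K] R}
    (hx : f (genX W L) = g (genX W L)) (hy : f (genY W L) = g (genY W L)) : f = g :=
  AlgHom.coe_ringHom_injective (ringHom_ext (fun c ↦ by simp) hx hy)

/-- A regular function divides its norm, a nonzero polynomial in x if the function is nonzero. So a
regular function mapped to 0 would give an algebraic equation for a; the map on the coordinate ring
is injective and extends to fractions. -/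
lemma exists_algHom {M : Type*} [Field M] [Algebra K M] {a b : M} (ha : Transcendental K a)
    (h : (W.baseChange M).Equation a b) :
    ∃ f : L →ₐ[K] M, f (genX W L) = a ∧ f (genY W L) = b := by
  have hroot : eval₂ (aeval a : K[X] →ₐ[K] M).toRingHom b W.polynomial = 0 := by
    rw [equation_iff] at h
    simp [polynomial, eval₂_add, eval₂_sub, eval₂_mul, eval₂_pow]
    simp at h
    linear_combination h
  let g₀ : W.CoordinateRing →+* M := AdjoinRoot.lift (aeval a : K[X] →ₐ[K] M).toRingHom b hroot
  let g : W.CoordinateRing →ₐ[K] M := { g₀ with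
    commutes' := fun c ↦ by
      change g₀ (CoordinateRing.mk W (C (C c))) = _
      simp [g₀] }
  have hg : Function.Injective g := by
    refine (injective_iff_map_eq_zero g).mpr fun c hc ↦ ?_
    by_contra hc0
    obtain ⟨d, hd⟩ := CoordinateRing.dvd_algebraMap_norm c
    have h1 := congrArg g hd
    rw [map_mul, hc, zero_mul] at h1
    refine hc0 (Algebra.norm_eq_zero_iff.mp (transcendental_iff.mp ha _ ?_))
    rw [← h1]
    exact (AdjoinRoot.lift_of hroot).symm
  refine ⟨IsFractionRing.liftAlgHom hg, ?_, ?_⟩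
  · rw [genX, IsFractionRing.liftAlgHom_apply, IsFractionRing.lift_algebraMap]
    exact (AdjoinRoot.lift_of hroot).trans (aeval_X a)
  · rw [genY, IsFractionRing.liftAlgHom_apply, IsFractionRing.lift_algebraMap]
    exact AdjoinRoot.lift_root hroot

lemma genX_ne_algebraMap (c : K) : genX W L ≠ κ c := by
  intro h
  have h1 := infValuation_genX (W := W) (L := L)
  have h2 := infValuation_algebraMap_field_le (W := W) (L := L) c
  rw [← h, h1, ← exp_zero, exp_le_exp] at h2
  omega

lemma exists_eq_algebraMap_of_not_transcendental [IsAlgClosed K] {M : Type*} [Field M] [Algebra K M]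
    {a : M} (ha : ¬ Transcendental K a) : ∃ c : K, algebraMap K M c = a := by
  rw [Transcendental, not_not] at ha
  have : Algebra.IsAlgebraic K (IntermediateField.adjoin K {a}) :=
    IntermediateField.isAlgebraic_adjoin_simple ha.isIntegral
  have := IntermediateField.eq_bot_of_isAlgClosed_of_isAlgebraic (IntermediateField.adjoin K {a})
  have h : a ∈ (IntermediateField.adjoin K {a}) := IntermediateField.mem_adjoin_simple_self K a
  rw [this] at h
  exact IntermediateField.mem_bot.mp h

section Translation

variable [W.IsElliptic]

instance : WeierstrassCurve.IsElliptic (W.baseChange L) :=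
  inferInstanceAs (WeierstrassCurve.IsElliptic (WeierstrassCurve.map W (algebraMap K _)))

variable (W L) in
/-- The generic point. -/
noncomputable def genPoint :
    (W.baseChange L).Point :=
  .some (genX W L) (genY W L) (equation_iff_nonsingular.mp equation_gen)

open Classical in
/-- A constant point. -/
noncomputable def constPoint : W.Point →+ (W.baseChange L).Point :=
  Point.mapField κ

lemma genPoint_ne_constPoint (Q : W.Point) : genPoint W L ≠ constPoint Q := by
  rcases Q with _ | ⟨x, y, h⟩
  · exact Point.some_ne_zero _
  · intro h'
    exact genX_ne_algebraMap x (Point.some.inj h').1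

open Classical in
lemma map_constPoint (f : L →ₐ[K] L) (Q : W.Point) :
    Point.map f (constPoint Q) = constPoint Q := by
  rcases Q with _ | ⟨x, y, h⟩
  · rfl
  · exact (Point.some.injEq ..).mpr ⟨f.commutes x, f.commutes y⟩

lemma exists_eq_constPoint [IsAlgClosed K] {a b : L}
    (h : (W.baseChange L).Nonsingular a b) (ha : ¬ Transcendental K a) :
    ∃ Q : W.Point, Point.some a b h = constPoint Q := by
  obtain ⟨x, rfl⟩ := exists_eq_algebraMap_of_not_transcendental ha
  set f : K[X] := Polynomial.X ^ 2 + (C (W.a₁ * x + W.a₃) * Polynomial.X -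
    C (x ^ 3 + W.a₂ * x ^ 2 + W.a₄ * x + W.a₆)) with hf
  have hb : aeval b f = 0 := by
    have := (equation_iff _ _).mp h.1
    simp [hf]
    simp at this
    linear_combination this
  have hf0 : f ≠ 0 := by
    intro h0
    have := congrArg (coeff · 2) h0
    simp only [hf, coeff_add, coeff_sub, coeff_X_pow, coeff_C_mul, coeff_X, coeff_C, coeff_zero] at this
    norm_num at this
  obtain ⟨y, rfl⟩ := exists_eq_algebraMap_of_not_transcendental (K := K) (a := b)
    (fun hb' ↦ hf0 (transcendental_iff.mp hb' f hb))
  exact ⟨.some x y ((W.map_nonsingular (algebraMap K L).injective x y).mp h), rfl⟩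

open Classical in
-- The generic point plus Q is not constant, since the generic point is not. Constants being
-- algebraically closed, its x-coordinate is transcendental, and its coordinates define the
-- endomorphism f ↦ f(· + Q).
lemma exists_translation [IsAlgClosed K] (Q : W.Point) :
    ∃ f : L →ₐ[K] L,
      Point.map f (genPoint W L) = genPoint W L + constPoint Q := by
  generalize hP : genPoint W L + constPoint Q = R
  rcases R with _ | ⟨a, b, h⟩
  · exact absurd (eq_neg_of_add_eq_zero_left hP) (by rw [← map_neg]; exact genPoint_ne_constPoint _)
  · by_cases ha : Transcendental K a
    · obtain ⟨f, rfl, rfl⟩ := exists_algHom (L := L) ha h.1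
      exact ⟨f, rfl⟩
    · obtain ⟨R, hR⟩ := exists_eq_constPoint h ha
      rw [hR, ← eq_sub_iff_add_eq, ← map_sub] at hP
      exact absurd hP (genPoint_ne_constPoint _)

/-- The translation by `Q`, as an endomorphism of the function field. -/
noncomputable def translation [IsAlgClosed K] (Q : W.Point) :
    L →ₐ[K] L :=
  (exists_translation Q).choose

open Classical in
lemma map_translation [IsAlgClosed K] (Q : W.Point) :
    Point.map (translation Q) (genPoint W L) = genPoint W L + constPoint Q :=
  (exists_translation Q).choose_spec

open Classical in
lemma translation_unique [IsAlgClosed K] {Q : W.Point} {f : L →ₐ[K] L}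
    (hf : Point.map f (genPoint W L) = genPoint W L + constPoint Q) : f = translation Q := by
  rw [← map_translation] at hf
  have := Point.some.inj hf
  exact algHom_ext this.1 this.2

lemma translation_zero [IsAlgClosed K] : translation (L := L) (0 : W.Point) = AlgHom.id K L := by
  classical
  refine (translation_unique ?_).symm
  rw [map_zero, add_zero]
  rfl

open Classical in
lemma translation_add [IsAlgClosed K] (P Q : W.Point) :
    translation (L := L) (P + Q) = (translation P).comp (translation Q) := by
  refine (translation_unique ?_).symm
  rw [← Point.map_map, map_translation, map_add, map_translation, map_constPoint, add_assoc,
    ← map_add]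

open Classical in
lemma translation_translation [IsAlgClosed K] (P Q : W.Point)
    (f : L) : translation P (translation Q f) = translation (P + Q) f := by
  rw [translation_add]
  rfl

end Translation

end FunctionField

end WeierstrassCurve.Affine

/-! ### Evaluation at points and explicit translation formulas -/

namespace WeierstrassCurve.Affine

set_option linter.unusedSectionVars false

open Polynomial WithZero

variable {K : Type*} [Field K] {W : Affine K}

namespace CoordinateRing

/-- Evaluation of a regular function at an affine point. -/
noncomputable def evalAt {x y : K} (h : W.Equation x y) : W.CoordinateRing →ₐ[K] K :=
  { AdjoinRoot.evalEval (p := W.polynomial) h with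
    commutes' := fun c ↦ by
      exact (AdjoinRoot.evalEval_mk (p := W.polynomial) h (C (C c))).trans (by simp) }

lemma evalAt_mk {x y : K} (h : W.Equation x y) (p : K[X][Y]) :
    evalAt h (CoordinateRing.mk W p) = p.evalEval x y :=
  AdjoinRoot.evalEval_mk (p := W.polynomial) h p

end CoordinateRing

namespace FunctionField

variable {L : Type*} [Field L] [Algebra W.CoordinateRing L] [IsFractionRing W.CoordinateRing L]
  [Algebra K L] [IsScalarTower K W.CoordinateRing L] [W.IsElliptic]

local notation "v" => infValuation W L
local notation "κ" => algebraMap K L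

section Formulas

lemma translation_gen [IsAlgClosed K] {a b : K} (h : W.Nonsingular a b) :
    let ℓ := (genY W L - κ b) / (genX W L - κ a)
    translation (.some a b h) (genX W L) =
        ℓ ^ 2 + κ W.a₁ * ℓ - κ W.a₂ - genX W L - κ a ∧
      translation (.some a b h) (genY W L) =
        -(ℓ * (translation (.some a b h) (genX W L) - κ a) + κ b) -
          κ W.a₁ * translation (.some a b h) (genX W L) - κ W.a₃ := by
  classical
  intro ℓ
  have hx : genX W L ≠ κ a := genX_ne_algebraMap a
  have h1 := map_translation (L := L) (Point.some a b h)
  have hc : (W.baseChange L).Nonsingular (κ a) (κ b) :=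
    (W.map_nonsingular (algebraMap K L).injective a b).mpr h
  have hg : (W.baseChange L).Nonsingular (genX W L) (genY W L) :=
    equation_iff_nonsingular.mp equation_gen
  have h2 : genPoint W L + constPoint (L := L) (Point.some a b h) = _ :=
    Point.add_some (h₁ := hg) (h₂ := hc) (fun h ↦ hx h.1)
  have h3 := Point.some.inj (h1.trans h2)
  rw [slope_of_X_ne hx] at h3
  have hX : translation (.some a b h) (genX W L) =
        ℓ ^ 2 + κ W.a₁ * ℓ - κ W.a₂ - genX W L - κ a := h3.1
  refine ⟨hX, ?_⟩
  have hY : translation (.some a b h) (genY W L) = _ := h3.2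
  simp only [addY, negAddY, negY] at hY
  have h4 : addX (W.baseChange L) (genX W L) (κ a) ℓ = translation (.some a b h) (genX W L) := h3.1.symm
  change _ = -(ℓ * (addX (W.baseChange L) (genX W L) (κ a) ℓ - _) + _) - κ W.a₁ *
    addX (W.baseChange L) (genX W L) (κ a) ℓ - κ W.a₃ at hY
  rw [h4] at hY
  rw [hY]
  have h5 : ℓ * (genX W L - κ a) = genY W L - κ b := div_mul_cancel₀ _ (sub_ne_zero.mpr hx)
  linear_combination h5

/-- The Taylor expansion of the curve equation at (a, b); r and s are the partial derivatives up to
sign. In this form the pole order of each term at infinity can be read off: d has order 2, n order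
3, and n² − d³ only order at most 5. -/
lemma translation_gen_sub [IsAlgClosed K] {a b : K} (h : W.Nonsingular a b) :
    let d := genX W L - κ a
    let n := genY W L - κ b
    let r := κ (3 * a ^ 2 + 2 * W.a₂ * a + W.a₄ - W.a₁ * b)
    let s := κ (2 * b + W.a₁ * a + W.a₃)
    n ^ 2 - d ^ 3 = κ (3 * a + W.a₂) * d ^ 2 + r * d - s * n - κ W.a₁ * d * n ∧
    translation (.some a b h) (genX W L) - κ a = (r * d - s * n) / d ^ 2 ∧
      translation (.some a b h) (genY W L) - κ b =
        -(r * n / d ^ 2) + s * ((n ^ 2 - d ^ 3) / d ^ 3) -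
          κ W.a₁ * (translation (.some a b h) (genX W L) - κ a) := by
  intro d n r s
  obtain ⟨hX, hY⟩ := translation_gen (L := L) h
  have hd : d ≠ 0 := sub_ne_zero.mpr (genX_ne_algebraMap a)
  have e1 := (equation_iff _ _).mp (equation_gen (W := W) (L := L))
  have e2 := congrArg κ ((equation_iff _ _).mp h.1)
  change genY W L ^ 2 + κ W.a₁ * genX W L * genY W L + κ W.a₃ * genY W L =
    genX W L ^ 3 + κ W.a₂ * genX W L ^ 2 + κ W.a₄ * genX W L + κ W.a₆ at e1
  simp only [map_add, map_mul, map_pow] at e2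
  have hxd : genX W L = κ a + d := by ring
  have hyn : genY W L = κ b + n := by ring
  have key : n ^ 2 - d ^ 3 = κ (3 * a + W.a₂) * d ^ 2 + r * d - s * n - κ W.a₁ * d * n := by
    simp only [r, s, map_add, map_sub, map_mul, map_pow, map_ofNat]
    rw [hxd, hyn] at e1
    linear_combination e1 - e2
  have hX' : translation (.some a b h) (genX W L) - κ a = (r * d - s * n) / d ^ 2 := by
    rw [hX, eq_div_iff (pow_ne_zero 2 hd)]
    change ((n / d) ^ 2 + _ * (n / d) - _ - _ - _ - _) * _ = _
    rw [hxd]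
    simp only [map_add, map_mul, map_ofNat] at key
    field_simp
    linear_combination key
  refine ⟨key, hX', ?_⟩
  rw [hY]
  have : n / d * (translation (.some a b h) (genX W L) - κ a) = r * n / d ^ 2 - s * (n ^ 2 / d ^ 3) := by
    rw [hX']
    field_simp
  have h2 : s * ((n ^ 2 - d ^ 3) / d ^ 3) = s * (n ^ 2 / d ^ 3) - s := by
    field_simp
  change -(n / d * _ + _) - _ - _ - _ = _
  rw [this, h2]
  simp only [s, map_add, map_mul, map_ofNat]
  ring

end Formulas

lemma infValuation_genX_sub (a : K) : v (genX W L - κ a) = exp 2 := by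
  rw [Valuation.map_sub_eq_of_lt_left, infValuation_genX]
  rw [infValuation_genX]
  exact (infValuation_algebraMap_field_le a).trans_lt (by rw [← exp_zero, exp_lt_exp]; norm_num)

lemma infValuation_genY_sub (a : K) : v (genY W L - κ a) = exp 3 := by
  rw [Valuation.map_sub_eq_of_lt_left, infValuation_genY]
  rw [infValuation_genY]
  exact (infValuation_algebraMap_field_le a).trans_lt (by rw [← exp_zero, exp_lt_exp]; norm_num)

lemma infValuation_algebraMap_mul_le {c : K} {f : L} {n : ℤᵐ⁰} (hf : v f ≤ n) : v (κ c * f) ≤ n := by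
  rw [map_mul]
  exact (mul_le_of_le_one_left' (infValuation_algebraMap_field_le c)).trans hf

end FunctionField

end WeierstrassCurve.Affine

/-! ### Valuations at points and values of functions -/

namespace WeierstrassCurve.Affine

set_option linter.unusedSectionVars false

open Polynomial WithZero

variable {K : Type*} [Field K] {W : Affine K}

namespace FunctionField

variable {L : Type*} [Field L] [Algebra W.CoordinateRing L] [IsFractionRing W.CoordinateRing L]
  [Algebra K L] [IsScalarTower K W.CoordinateRing L] [W.IsElliptic] [IsAlgClosed K]

local notation "v" => infValuation W L
local notation "κ" => algebraMap K L

variable (L) in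
/-- The valuation of the function field at a point, with values `exp n` for a pole of order `n`. -/
noncomputable def valAt (Q : W.Point) : Valuation L ℤᵐ⁰ :=
  (infValuation W L).comap (translation Q : L →ₐ[K] L).toRingHom

lemma valAt_apply (Q : W.Point) (f : L) : valAt L Q f = v (translation Q f) := rfl

lemma valAt_zero : valAt L (0 : W.Point) = v := by
  ext f
  rw [valAt_apply, translation_zero, AlgHom.id_apply]

open Classical in
lemma valAt_translation (Q R : W.Point) (f : L) :
    valAt L Q (translation R f) = valAt L (Q + R) f := by
  rw [valAt_apply, translation_translation, valAt_apply]

lemma valAt_algebraMap {c : K} (hc : c ≠ 0) (Q : W.Point) : valAt L Q (κ c) = 1 := by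
  rw [valAt_apply, AlgHom.commutes, infValuation_algebraMap_field hc]

lemma valAt_algebraMap_le (c : K) (Q : W.Point) : valAt L Q (κ c) ≤ 1 := by
  rw [valAt_apply, AlgHom.commutes]
  exact infValuation_algebraMap_field_le c

lemma valAt_algebraMap_mul_le {c : K} {Q : W.Point} {f : L} {n : ℤᵐ⁰} (hf : valAt L Q f ≤ n) :
    valAt L Q (κ c * f) ≤ n := by
  rw [map_mul]
  exact (mul_le_of_le_one_left' (valAt_algebraMap_le c Q)).trans hf

/-- The function `f` is regular at `Q` with value `c`. -/
def HasValueAt (Q : W.Point) (f : L) (c : K) : Prop :=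
  valAt L Q (f - κ c) < 1

namespace HasValueAt

variable {Q : W.Point} {f g : L} {a b : K}

lemma le_one (h : HasValueAt Q f a) : valAt L Q f ≤ 1 := by
  rw [← sub_add_cancel f (κ a)]
  exact (Valuation.map_add _ _ _).trans (max_le h.le (valAt_algebraMap_le a Q))

lemma unique (h : HasValueAt Q f a) (h' : HasValueAt Q f b) : a = b := by
  by_contra hab
  have h1 := valAt_algebraMap (L := L) (sub_ne_zero.mpr hab) Q
  have h2 : κ (a - b) = (f - κ b) - (f - κ a) := by rw [map_sub]; ring
  rw [h2] at h1
  exact (Valuation.map_sub_lt _ h' h).ne h1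

lemma const (Q : W.Point) (a : K) : HasValueAt (L := L) Q (κ a) a := by
  rw [HasValueAt, sub_self, map_zero]
  exact zero_lt_one

lemma add (h : HasValueAt Q f a) (h' : HasValueAt Q g b) : HasValueAt Q (f + g) (a + b) := by
  rw [HasValueAt, map_add, add_sub_add_comm]
  exact Valuation.map_add_lt _ h h'

lemma sub (h : HasValueAt Q f a) (h' : HasValueAt Q g b) : HasValueAt Q (f - g) (a - b) := by
  rw [HasValueAt, map_sub (algebraMap K L), sub_sub_sub_comm]
  exact Valuation.map_sub_lt _ h h'

lemma mul (h : HasValueAt Q f a) (h' : HasValueAt Q g b) : HasValueAt Q (f * g) (a * b) := by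
  have h1 : f * g - κ (a * b) = (f - κ a) * g + κ a * (g - κ b) := by
    rw [map_mul]
    ring
  rw [HasValueAt, h1]
  refine Valuation.map_add_lt _ ?_ ?_
  · rw [map_mul]
    exact (mul_le_of_le_one_right' h'.le_one).trans_lt h
  · rw [map_mul]
    exact (mul_le_of_le_one_left' (valAt_algebraMap_le a Q)).trans_lt h'

lemma neg (h : HasValueAt Q f a) : HasValueAt Q (-f) (-a) := by
  have := (const (L := L) Q (0 : K)).sub h
  simpa using this

lemma pow (h : HasValueAt Q f a) (n : ℕ) : HasValueAt Q (f ^ n) (a ^ n) := by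
  induction n with
  | zero => simpa using const (L := L) Q (1 : K)
  | succ n ih => rw [pow_succ, pow_succ]; exact ih.mul h

lemma valAt_eq_one (h : HasValueAt Q f a) (ha : a ≠ 0) : valAt L Q f = 1 := by
  have h1 := valAt_algebraMap (L := L) ha Q
  rw [← h1, ← add_sub_cancel (κ a) f]
  exact Valuation.map_add_eq_of_lt_left _ ((show valAt L Q (f - κ a) < 1 from h).trans_eq h1.symm)

lemma inv (h : HasValueAt Q f a) (ha : a ≠ 0) : HasValueAt Q f⁻¹ a⁻¹ := by
  have h0 : f ≠ 0 := by
    rintro rfl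
    have := h.valAt_eq_one ha
    simp at this
  have ha' : κ a ≠ 0 := by simpa using ha
  have h1 : f⁻¹ - κ a⁻¹ = -(f - κ a) * (f⁻¹ * (κ a)⁻¹) := by
    rw [map_inv₀]
    field_simp
    ring
  rw [HasValueAt, h1, map_mul, Valuation.map_neg, map_mul, map_inv₀, map_inv₀, h.valAt_eq_one ha,
    valAt_algebraMap ha]
  simpa [HasValueAt] using h

lemma div (h : HasValueAt Q f a) (h' : HasValueAt Q g b) (hb : b ≠ 0) :
    HasValueAt Q (f / g) (a / b) := by
  rw [div_eq_mul_inv, div_eq_mul_inv]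
  exact h.mul (h'.inv hb)

lemma sum {ι : Type*} (s : Finset ι) {f : ι → L} {a : ι → K}
    (h : ∀ i ∈ s, HasValueAt Q (f i) (a i)) :
    HasValueAt Q (∑ i ∈ s, f i) (∑ i ∈ s, a i) := by
  rw [HasValueAt, map_sum, ← Finset.sum_sub_distrib]
  exact Valuation.map_sum_lt' _ zero_lt_one h

lemma prod {ι : Type*} (s : Finset ι) {f : ι → L} {a : ι → K}
    (h : ∀ i ∈ s, HasValueAt Q (f i) (a i)) :
    HasValueAt Q (∏ i ∈ s, f i) (∏ i ∈ s, a i) := by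
  classical
  induction s using Finset.induction_on with
  | empty => simpa using const (L := L) Q (1 : K)
  | insert i s hi ih =>
    rw [Finset.prod_insert hi, Finset.prod_insert hi]
    exact (h i (Finset.mem_insert_self i s)).mul
      (ih fun j hj ↦ h j (Finset.mem_insert_of_mem hj))

open Classical in
lemma translation {Q R : W.Point} (h : HasValueAt (Q + R) f a) :
    HasValueAt Q (translation R f) a := by
  rw [HasValueAt, ← AlgHom.commutes (FunctionField.translation R) a, ← map_sub, valAt_translation]
  exact h

end HasValueAt

lemma hasValueAt_zero_iff {Q : W.Point} {f : L} : HasValueAt Q f 0 ↔ valAt L Q f < 1 := by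
  rw [HasValueAt, map_zero, sub_zero]

lemma valAt_genX_sub_le {a b : K} (h : W.Nonsingular a b) :
    valAt L (.some a b h) (genX W L - κ a) ≤ exp (-1) := by
  obtain ⟨-, hX, -⟩ := translation_gen_sub (L := L) h
  rw [valAt_apply, map_sub, AlgHom.commutes, hX, map_div₀, map_pow, infValuation_genX_sub,
    div_le_iff₀ (by simp [zero_lt_iff]), ← exp_nsmul, ← exp_add]
  refine Valuation.map_sub_le _ ?_ ?_
  · exact infValuation_algebraMap_mul_le (by rw [infValuation_genX_sub, exp_le_exp]; norm_num)
  · exact infValuation_algebraMap_mul_le (by rw [infValuation_genY_sub, exp_le_exp]; norm_num)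

/-- Off the 2-torsion the derivative s = 2b + a₁a + a₃ is nonzero, so in (rd − sn)/d² the term sn
dominates and the order is 3 − 4 = −1. -/
lemma valAt_genX_sub_eq {a b : K} (h : W.Nonsingular a b) (hb : b ≠ W.negY a b) :
    valAt L (.some a b h) (genX W L - κ a) = exp (-1) := by
  obtain ⟨-, hX, -⟩ := translation_gen_sub (L := L) h
  have hs : 2 * b + W.a₁ * a + W.a₃ ≠ 0 := by
    intro h0
    refine hb ?_
    rw [negY]
    linear_combination h0
  rw [valAt_apply, map_sub, AlgHom.commutes, hX, map_div₀, map_pow, infValuation_genX_sub,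
    Valuation.map_sub_eq_of_lt_right, map_mul, infValuation_algebraMap_field hs,
    infValuation_genY_sub, one_mul, ← exp_nsmul, ← exp_sub]
  · rfl
  · rw [map_mul _ (κ _) (genY W L - _), infValuation_algebraMap_field hs, infValuation_genY_sub,
      one_mul]
    exact (infValuation_algebraMap_mul_le le_rfl).trans_lt
      (by rw [infValuation_genX_sub, exp_lt_exp]; norm_num)

lemma hasValueAt_genX {a b : K} (h : W.Nonsingular a b) :
    HasValueAt (L := L) (.some a b h) (genX W L) a :=
  (valAt_genX_sub_le h).trans_lt (by rw [← exp_zero, exp_lt_exp]; norm_num)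

lemma hasValueAt_genY {a b : K} (h : W.Nonsingular a b) :
    HasValueAt (L := L) (.some a b h) (genY W L) b := by
  obtain ⟨hk, -, hY⟩ := translation_gen_sub (L := L) h
  have h1 : v (translation (.some a b h) (genX W L) - κ a) ≤ exp (-1) := by
    have := valAt_genX_sub_le (L := L) h
    rwa [valAt_apply, map_sub, AlgHom.commutes] at this
  rw [HasValueAt, valAt_apply, map_sub, AlgHom.commutes, hY]
  refine Valuation.map_sub_lt _ (Valuation.map_add_lt _ ?_ ?_) ?_
  · rw [Valuation.map_neg, map_div₀, div_lt_iff₀ (by simp [zero_lt_iff, sub_ne_zero, genX_ne_algebraMap]), one_mul,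
      map_pow, infValuation_genX_sub, ← exp_nsmul]
    exact (infValuation_algebraMap_mul_le le_rfl).trans_lt
      (by rw [infValuation_genY_sub, exp_lt_exp]; norm_num)
  -- Here n² and d³ both have pole order 6; the curve equation makes their leading terms cancel,
  -- leaving at most 5.
  · refine (infValuation_algebraMap_mul_le le_rfl).trans_lt ?_
    rw [map_div₀, div_lt_iff₀ (by simp [zero_lt_iff, sub_ne_zero, genX_ne_algebraMap]), one_mul, hk,
      map_pow, infValuation_genX_sub, ← exp_nsmul]
    refine lt_of_le_of_lt (b := exp 5) ?_ (by rw [exp_lt_exp]; norm_num)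
    refine Valuation.map_sub_le _ (Valuation.map_sub_le _ (Valuation.map_add_le _ ?_ ?_) ?_) ?_
    · refine infValuation_algebraMap_mul_le ?_
      rw [map_pow, infValuation_genX_sub, ← exp_nsmul, exp_le_exp]
      norm_num
    · refine infValuation_algebraMap_mul_le ?_
      rw [infValuation_genX_sub, exp_le_exp]
      norm_num
    · refine infValuation_algebraMap_mul_le ?_
      rw [infValuation_genY_sub, exp_le_exp]
      norm_num
    · rw [mul_assoc]
      refine infValuation_algebraMap_mul_le ?_
      rw [map_mul, infValuation_genX_sub, infValuation_genY_sub, ← exp_add, exp_le_exp]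
      norm_num
  · refine (infValuation_algebraMap_mul_le h1).trans_lt ?_
    rw [← exp_zero, exp_lt_exp]
    norm_num

lemma hasValueAt_algebraMap {a b : K} (h : W.Nonsingular a b) (f : W.CoordinateRing) :
    HasValueAt (L := L) (.some a b h) (algebraMap _ L f) (CoordinateRing.evalAt h.1 f) := by
  induction f using CoordinateRing.induction with
  | algebraMap c =>
    rw [AlgHom.commutes, ← IsScalarTower.algebraMap_apply]
    exact .const _ _
  | hx =>
    rw [CoordinateRing.evalAt_mk, show evalEval a b (C X) = a by rw [evalEval_C, eval_X]]
    exact hasValueAt_genX h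
  | hy =>
    rw [CoordinateRing.evalAt_mk, show evalEval a b Y = b by rw [evalEval_X]]
    exact hasValueAt_genY h
  | add f g hf hg => rw [map_add, map_add]; exact hf.add hg
  | mul f g hf hg => rw [map_mul, map_mul]; exact hf.mul hg

lemma valAt_algebraMap_le_one {Q : W.Point} (hQ : Q ≠ 0) (f : W.CoordinateRing) :
    valAt L Q (algebraMap _ L f) ≤ 1 := by
  rcases Q with _ | ⟨a, b, h⟩
  · exact absurd rfl hQ
  · exact (hasValueAt_algebraMap h f).le_one

lemma valAt_algebraMap_lt_one_iff {a b : K} (h : W.Nonsingular a b) {f : W.CoordinateRing} :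
    valAt L (.some a b h) (algebraMap _ L f) < 1 ↔ CoordinateRing.evalAt h.1 f = 0 := by
  rw [← hasValueAt_zero_iff]
  refine ⟨fun h' ↦ (hasValueAt_algebraMap h f).unique h', fun h' ↦ ?_⟩
  rw [← h']
  exact hasValueAt_algebraMap h f

end FunctionField

end WeierstrassCurve.Affine

/-! ### The coordinate ring is Dedekind; functions regular at all affine points -/

section Dedekind

open scoped nonZeroDivisors

/-- A Noetherian domain is a Dedekind domain if every nonzero maximal ideal divides a nonzero
principal ideal. -/
theorem isDedekindDomain_of_isMaximal {A : Type*} [CommRing A] [IsDomain A] [IsNoetherianRing A]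
    (h : ∀ m : Ideal A, m.IsMaximal → m ≠ ⊥ → ∃ (n : Ideal A) (c : A), c ≠ 0 ∧
      m * n = Ideal.span {c}) : IsDedekindDomain A := by
  have key (I : Ideal A) : I ≠ ⊥ → ∃ (J : Ideal A) (c : A), c ≠ 0 ∧ I * J = Ideal.span {c} := by
    induction I using IsNoetherian.induction with
    | hgt I ih =>
      intro hI
      by_cases hI1 : I = ⊤
      · exact ⟨⊤, 1, one_ne_zero, by simp [hI1]⟩
      obtain ⟨m, hm, hIm⟩ := Ideal.exists_le_maximal I hI1
      obtain ⟨n, c, hc, hmn⟩ := h m hm (fun h0 ↦ hI (eq_bot_iff.mpr (h0 ▸ hIm)))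
      have hle : I * n ≤ Ideal.span {c} := hmn ▸ Ideal.mul_mono_left hIm
      -- Noetherian induction: with I ⊂ m and mn = (c), one has In = cI' for an ideal I' ⊃ I, and an
      -- ideal inverting I' up to a principal factor also yields one for I.
      obtain ⟨I', hI'⟩ : Ideal.span {c} ∣ I * n := by
        refine ⟨Submodule.comap (LinearMap.mulLeft A c) (I * n), le_antisymm (fun x hx ↦ ?_) ?_⟩
        · obtain ⟨y, rfl⟩ := Ideal.mem_span_singleton.mp (hle hx)
          exact Ideal.mul_mem_mul (Ideal.mem_span_singleton_self c) hx
        · rw [Ideal.span_singleton_mul_le_iff]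
          exact fun z hz ↦ hz
      have hII' : I ≤ I' := by
        refine (Ideal.span_singleton_mul_right_mono hc).mp ?_
        rw [← hI', ← hmn, mul_comm m n, mul_comm, mul_comm n m]
        calc I * (m * n) = m * (I * n) := by ring
          _ ≤ I * n := Ideal.mul_le_right
      -- If I' = I then I = mI, which Nakayama excludes for I ≠ 0 in a domain.
      have hne : I ≠ I' := by
        rintro rfl
        have h1 : Ideal.span {c} * I = Ideal.span {c} * (m * I) := by
          conv_lhs => rw [← hmn, mul_assoc, mul_comm n, hI']
          ring
        have h2 : I = m * I := (Ideal.span_singleton_mul_right_inj hc).mp h1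
        obtain ⟨r, hr, hr'⟩ := Submodule.exists_sub_one_mem_and_smul_eq_zero_of_fg_of_le_smul m I
          (IsNoetherian.noetherian I) (by rw [smul_eq_mul]; exact h2.le)
        obtain ⟨x, hx, hx0⟩ := Submodule.exists_mem_ne_zero_of_ne_bot hI
        have hr0 : r = 0 := (mul_eq_zero.mp (hr' x hx)).resolve_right hx0
        rw [hr0, zero_sub, Ideal.neg_mem_iff] at hr
        exact hm.ne_top ((Ideal.eq_top_iff_one m).mpr hr)
      obtain ⟨J, d, hd, hJ⟩ := ih I' (lt_of_le_of_ne hII' hne)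
        (fun h0 ↦ hI (eq_bot_iff.mpr (h0 ▸ hII')))
      refine ⟨n * J, c * d, mul_ne_zero hc hd, ?_⟩
      rw [← mul_assoc, hI', mul_assoc, hJ, Ideal.span_singleton_mul_span_singleton]
  refine (isDedekindDomain_iff_mul_inv_cancel (K := FractionRing A)).mpr fun I hI ↦ ?_
  obtain ⟨a, J, ha, rfl⟩ := FractionalIdeal.exists_eq_spanSingleton_mul I
  have hJ : J ≠ ⊥ := by
    rintro rfl
    simp at hI
  obtain ⟨J', c, hc, hJ'⟩ := key J hJ
  have hc' : algebraMap A (FractionRing A) c ≠ 0 := by simpa using hc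
  have ha' : algebraMap A (FractionRing A) a ≠ 0 := by simpa using ha
  refine (FractionalIdeal.mul_inv_cancel_iff (K := FractionRing A)).mpr ⟨FractionalIdeal.spanSingleton A⁰
    (algebraMap A (FractionRing A) a * (algebraMap A (FractionRing A) c)⁻¹) * J', ?_⟩
  calc _ = FractionalIdeal.spanSingleton A⁰ (algebraMap A (FractionRing A) a)⁻¹ *
        FractionalIdeal.spanSingleton A⁰
          (algebraMap A (FractionRing A) a * (algebraMap A (FractionRing A) c)⁻¹) * (J * J') := by
        ring
    _ = 1 := by
      rw [← FractionalIdeal.coeIdeal_mul, hJ', FractionalIdeal.coeIdeal_span_singleton,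
        FractionalIdeal.spanSingleton_mul_spanSingleton,
        FractionalIdeal.spanSingleton_mul_spanSingleton, ← FractionalIdeal.spanSingleton_one]
      congr 1
      field_simp

end Dedekind

namespace WeierstrassCurve.Affine

set_option linter.unusedSectionVars false

open Polynomial WithZero

variable {K : Type*} [Field K] {W : Affine K}

namespace CoordinateRing

lemma mem_ker_evalAt_of_mem_XYIdeal {x y : K} (h : W.Equation x y) {f : W.CoordinateRing}
    (hf : f ∈ XYIdeal W x (C y)) : evalAt h f = 0 := by
  refine (Ideal.span_le (I := RingHom.ker (evalAt h))).mpr ?_ hf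
  rintro a (rfl | rfl)
  · exact (evalAt_mk h _).trans (by rw [evalEval_C, eval_sub, eval_X, eval_C, sub_self])
  · exact (evalAt_mk h _).trans
      (by rw [evalEval_sub, evalEval_X, evalEval_C, eval_C, sub_self])

lemma sub_evalAt_mem_XYIdeal {x y : K} (h : W.Equation x y) (f : W.CoordinateRing) :
    f - algebraMap K _ (evalAt h f) ∈ XYIdeal W x (C y) := by
  induction f using CoordinateRing.induction with
  | algebraMap c => simp
  | hx =>
    rw [evalAt_mk, evalEval_C, eval_X]
    refine Ideal.subset_span (Or.inl ?_)
    rw [XClass, C_sub, map_sub]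
    rfl
  | hy =>
    rw [evalAt_mk, evalEval_X]
    refine Ideal.subset_span (Or.inr ?_)
    rw [Set.mem_singleton_iff, YClass, map_sub]
    rfl
  | add f g hf hg =>
    rw [map_add, map_add, add_sub_add_comm]
    exact Ideal.add_mem _ hf hg
  | mul f g hf hg =>
    have h1 : f * g - algebraMap K W.CoordinateRing (evalAt h (f * g)) =
        g * (f - algebraMap K W.CoordinateRing (evalAt h f)) + algebraMap K W.CoordinateRing (evalAt h f) *
          (g - algebraMap K W.CoordinateRing (evalAt h g)) := by
      rw [map_mul, map_mul]
      ring
    rw [h1]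
    exact Ideal.add_mem _ (Ideal.mul_mem_left _ _ hf) (Ideal.mul_mem_left _ _ hg)

lemma mem_XYIdeal_iff {x y : K} (h : W.Equation x y) {f : W.CoordinateRing} :
    f ∈ XYIdeal W x (C y) ↔ evalAt h f = 0 := by
  refine ⟨mem_ker_evalAt_of_mem_XYIdeal h, fun h0 ↦ ?_⟩
  have := sub_evalAt_mem_XYIdeal h f
  rwa [h0, map_zero, sub_zero] at this

lemma evalAt_surjective {x y : K} (h : W.Equation x y) : Function.Surjective (evalAt h) :=
  fun c ↦ ⟨algebraMap K _ c, by simp⟩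

lemma XYIdeal_eq_ker {x y : K} (h : W.Equation x y) :
    XYIdeal W x (C y) = RingHom.ker (evalAt h) :=
  Ideal.ext fun _ ↦ mem_XYIdeal_iff h

lemma isMaximal_XYIdeal {x y : K} (h : W.Equation x y) : (XYIdeal W x (C y)).IsMaximal := by
  rw [XYIdeal_eq_ker h]
  exact RingHom.ker_isMaximal_of_surjective _ (evalAt_surjective h)

instance : Algebra.FiniteType K W.CoordinateRing :=
  .trans (S := K[X]) inferInstance inferInstance

instance : IsNoetherianRing W.CoordinateRing :=
  IsNoetherianRing.of_finite K[X] W.CoordinateRing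

/-- The weak Nullstellensatz. -/
lemma exists_eq_XYIdeal [IsAlgClosed K] (m : Ideal W.CoordinateRing) [hm : m.IsMaximal] :
    ∃ x y, W.Equation x y ∧ m = XYIdeal W x (C y) := by
  let _ : Field (W.CoordinateRing ⧸ m) := Ideal.Quotient.field m
  have hfin : Module.Finite K (W.CoordinateRing ⧸ m) := finite_of_finite_type_of_isJacobsonRing K _
  have hsurj : Function.Surjective (algebraMap K (W.CoordinateRing ⧸ m)) :=
    (IsAlgClosed.algebraMap_bijective_of_isIntegral (k := K)).2
  obtain ⟨x, hx⟩ := hsurj (Ideal.Quotient.mk m (mk W (C X)))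
  obtain ⟨y, hy⟩ := hsurj (Ideal.Quotient.mk m (mk W Y))
  have hxy : W.Equation x y := by
    rw [equation_iff]
    apply (algebraMap K (W.CoordinateRing ⧸ m)).injective
    have h1 := congrArg (Ideal.Quotient.mk m) (mk_equation (W := W))
    simp only [map_add, map_mul, map_pow, ← hx, ← hy] at h1 ⊢
    exact h1
  refine ⟨x, y, hxy, ((isMaximal_XYIdeal hxy).eq_of_le hm.ne_top (Ideal.span_le.mpr ?_)).symm⟩
  rintro a (rfl | rfl)
  · refine Ideal.Quotient.eq_zero_iff_mem.mp ?_
    rw [XClass, C_sub, map_sub, map_sub, ← hx]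
    exact sub_self _
  · refine Ideal.Quotient.eq_zero_iff_mem.mp ?_
    rw [YClass, map_sub, map_sub, ← hy]
    exact sub_self _

/-- Every maximal ideal is that of a point, and its product with the ideal of the opposite point is
generated by X − x. -/
instance [IsAlgClosed K] [W.IsElliptic] : IsDedekindDomain W.CoordinateRing := by
  refine isDedekindDomain_of_isMaximal fun m hm _ ↦ ?_
  obtain ⟨x, y, h, rfl⟩ := exists_eq_XYIdeal m
  refine ⟨XYIdeal W x (C (W.negY x y)), XClass W x, XClass_ne_zero x, ?_⟩
  rw [mul_comm, XYIdeal_neg_mul (equation_iff_nonsingular.mp h)]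
  rfl

/-- A function with no zeros is a unit. -/
lemma exists_evalAt_eq_zero [IsAlgClosed K] {f : W.CoordinateRing} (hf : ¬ IsUnit f) :
    ∃ (x y : K) (h : W.Equation x y), evalAt h f = 0 := by
  obtain ⟨m, hm, hfm⟩ := exists_max_ideal_of_mem_nonunits hf
  obtain ⟨x, y, h, rfl⟩ := exists_eq_XYIdeal m
  exact ⟨x, y, h, (mem_XYIdeal_iff h).mp hfm⟩

end CoordinateRing

namespace FunctionField

variable {L : Type*} [Field L] [Algebra W.CoordinateRing L] [IsFractionRing W.CoordinateRing L]
  [Algebra K L] [IsScalarTower K W.CoordinateRing L] [W.IsElliptic] [IsAlgClosed K]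

/-- A function which is regular at all affine points lies in the coordinate ring. -/
theorem exists_eq_algebraMap_of_valAt_le {f : L} (hf : ∀ Q : W.Point, Q ≠ 0 → valAt L Q f ≤ 1) :
    ∃ a, algebraMap W.CoordinateRing L a = f := by
  refine IsDedekindDomain.HeightOneSpectrum.mem_integers_of_valuation_le_one L f fun w ↦ ?_
  obtain ⟨x, y, h, hw⟩ := CoordinateRing.exists_eq_XYIdeal w.asIdeal (hm := w.isMaximal)
  have h' := equation_iff_nonsingular.mp h
  have hmem (a : W.CoordinateRing) : a ∈ w.asIdeal ↔ valAt L (.some x y h') (algebraMap _ L a) < 1 := by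
    rw [hw, valAt_algebraMap_lt_one_iff, CoordinateRing.mem_XYIdeal_iff h]
  have hd' (d : w.asIdeal.primeCompl) : valAt L (.some x y h') (algebraMap _ L (d : W.CoordinateRing)) = 1 :=
    le_antisymm (valAt_algebraMap_le_one (Point.some_ne_zero h') _)
      (not_lt.mp fun h0 ↦ d.2 ((hmem _).mpr h0))
  -- Either f or 1/f has a denominator prime to the maximal ideal. In the second case |f| ≤ 1 at the
  -- point forces n to be nonzero there, so f is a unit. Only membership in the maximal ideal is
  -- used, so the two valuations need not be compared further.
  obtain ⟨n, d, hnd | hnd⟩ := w.exists_primeCompl_mul_eq_or_mul_eq f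
  · have h1 : w.valuation L (algebraMap _ L (d : W.CoordinateRing)) = 1 :=
      w.valuation_eq_one_iff_notMem.mpr d.2
    have h2 := congrArg (w.valuation L) hnd
    rw [map_mul, h1, mul_one] at h2
    rw [h2]
    exact w.valuation_le_one n
  · have h1 : w.valuation L (algebraMap _ L (d : W.CoordinateRing)) = 1 :=
      w.valuation_eq_one_iff_notMem.mpr d.2
    have h2 := congrArg (valAt L (.some x y h')) hnd
    rw [map_mul, hd'] at h2
    have hn : n ∉ w.asIdeal := by
      rw [hmem]
      intro hlt
      have := (mul_le_of_le_one_left' (hf _ (Point.some_ne_zero h'))).trans_lt hlt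
      exact this.ne h2
    have h3 := congrArg (w.valuation L) hnd
    rw [map_mul, h1, w.valuation_eq_one_iff_notMem.mpr hn, mul_one] at h3
    exact h3.le

/-- A function with at most a simple pole at infinity and no other poles is constant. -/
theorem exists_eq_const {f : L} (hf : ∀ Q : W.Point, Q ≠ 0 → valAt L Q f ≤ 1)
    (h : infValuation W L f ≤ exp 1) : ∃ c, algebraMap K L c = f := by
  obtain ⟨a, rfl⟩ := exists_eq_algebraMap_of_valAt_le hf
  rw [infValuation_algebraMap] at h
  obtain ⟨c, rfl⟩ := CoordinateRing.exists_eq_algebraMap_of_infValuation_le h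
  exact ⟨c, IsScalarTower.algebraMap_apply K _ L c⟩

end FunctionField

end WeierstrassCurve.Affine

/-! ### Slope functions and invariants of a finite group of translations -/

namespace WeierstrassCurve.Affine

set_option linter.unusedSectionVars false

open Polynomial WithZero

variable {K : Type*} [Field K] {W : Affine K}

namespace FunctionField

variable {L : Type*} [Field L] [Algebra W.CoordinateRing L] [IsFractionRing W.CoordinateRing L]
  [Algebra K L] [IsScalarTower K W.CoordinateRing L]

local notation "v" => infValuation W L
local notation "κ" => algebraMap K L

variable [W.IsElliptic]

variable (L) in
/-- The slope of the line through the generic point and `-R`, a function with simple poles at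
`0` and `R`. -/
noncomputable def slopeAt (R : W.Point) : L :=
  match R with
  | 0 => 0
  | .some a b _ => (genY W L - κ (W.negY a b)) / (genX W L - κ a)

lemma genX_ne_zero : genX W L ≠ 0 := by
  have := genX_ne_algebraMap (W := W) (L := L) 0
  rwa [map_zero] at this

lemma genX_sub_ne_zero (a : K) : genX W L - κ a ≠ 0 := sub_ne_zero.mpr (genX_ne_algebraMap a)

variable (W L) in
/-- A function with a simple pole at infinity. -/
noncomputable def simplePole : L := genY W L / genX W L

lemma infValuation_simplePole : v (simplePole W L) = exp 1 := by
  rw [simplePole, map_div₀, infValuation_genX, infValuation_genY, ← exp_sub]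
  norm_num

lemma simplePole_ne_zero : simplePole W L ≠ 0 := by
  intro h
  have := infValuation_simplePole (W := W) (L := L)
  rw [h, map_zero] at this
  exact exp_ne_zero this.symm

/-- The polar part at infinity does not depend on a and c: it is always that of y/x. -/
lemma infValuation_slope_sub (a c : K) :
    v ((genY W L - κ c) / (genX W L - κ a) - simplePole W L) ≤ 1 := by
  have h1 : (genY W L - κ c) / (genX W L - κ a) - simplePole W L =
      (κ a * genY W L - κ c * genX W L) / ((genX W L - κ a) * genX W L) := by
    have := genX_ne_zero (W := W) (L := L)
    have := genX_sub_ne_zero (W := W) (L := L) a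
    rw [simplePole]
    field_simp
    ring
  rw [h1, map_div₀, map_mul, infValuation_genX_sub, infValuation_genX,
    div_le_iff₀ (by simp [zero_lt_iff]), one_mul, ← exp_add]
  refine Valuation.map_sub_le _ (infValuation_algebraMap_mul_le ?_)
    (infValuation_algebraMap_mul_le ?_)
  · rw [infValuation_genY, exp_le_exp]
    norm_num
  · rw [infValuation_genX, exp_le_exp]
    norm_num

lemma infValuation_slopeAt_sub {R : W.Point} (hR : R ≠ 0) :
    v (slopeAt L R - simplePole W L) ≤ 1 := by
  rcases R with _ | ⟨a, b, h⟩
  · exact absurd rfl hR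
  · exact infValuation_slope_sub _ _

variable [IsAlgClosed K]

/-- This yields the polar part of the slope function at R: opposite to the one at infinity. -/
lemma translation_slopeAt {a b : K} (h : W.Nonsingular a b) :
    translation (.some a b h) (slopeAt L (.some a b h)) =
      -((genY W L - κ b) / (genX W L - κ a)) - κ W.a₁ := by
  obtain ⟨-, hY⟩ := translation_gen (L := L) h
  have hx : translation (.some a b h) (genX W L) - κ a ≠ 0 := by
    rw [← AlgHom.commutes (translation (.some a b h)) a, ← map_sub]
    exact (_root_.map_ne_zero _).mpr (genX_sub_ne_zero a)
  rw [slopeAt, map_div₀, map_sub, map_sub, AlgHom.commutes, AlgHom.commutes, div_eq_iff hx, hY,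
    negY, map_sub, map_sub, map_neg, map_mul]
  ring

lemma infValuation_translation_slopeAt_add {R : W.Point} (hR : R ≠ 0) :
    v (translation R (slopeAt L R) + simplePole W L) ≤ 1 := by
  rcases R with _ | ⟨a, b, h⟩
  · exact absurd rfl hR
  · rw [translation_slopeAt, show -((genY W L - κ b) / (genX W L - κ a)) - κ W.a₁ + simplePole W L =
      -(((genY W L - κ b) / (genX W L - κ a)) - simplePole W L) - κ W.a₁ by ring]
    refine Valuation.map_sub_le _ ?_ (infValuation_algebraMap_field_le _)
    rw [Valuation.map_neg]
    exact infValuation_slope_sub _ _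

lemma hasValueAt_slopeAt {a b x y : K} (h : W.Nonsingular a b) (h' : W.Nonsingular x y)
    (hx : x ≠ a) : HasValueAt (.some x y h') (slopeAt L (.some a b h))
      ((y - W.negY a b) / (x - a)) :=
  ((hasValueAt_genY h').sub (.const _ _)).div ((hasValueAt_genX h').sub (.const _ _))
    (sub_ne_zero.mpr hx)

/-- The delicate case is Q = −R, where numerator and denominator both vanish. The curve equation
rewrites the slope with denominator y − b, which is nonzero at −R because R ≠ −R. -/
lemma valAt_slopeAt_le {Q R : W.Point} (hQ : Q ≠ 0) (hR : R ≠ -R) (hQR : Q ≠ R) :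
    valAt L Q (slopeAt L R) ≤ 1 := by
  rcases R with _ | ⟨a, b, h⟩
  · exact absurd rfl hR
  rcases Q with _ | ⟨x, y, h'⟩
  · exact absurd rfl hQ
  by_cases hx : x = a
  · subst hx
    have hb : b ≠ W.negY x b := by
      intro hb
      refine hR ?_
      rw [Point.neg_some, Point.some.injEq]
      exact ⟨rfl, hb⟩
    have hyb : y ≠ b := by
      rintro rfl
      exact hQR rfl
    have hy : y = W.negY x b := (Y_eq_of_X_eq h'.1 h.1 rfl).resolve_left hyb
    have e1 := (equation_iff _ _).mp (equation_gen (W := W) (L := L))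
    have e2 := congrArg κ ((equation_iff _ _).mp h.1)
    change genY W L ^ 2 + κ W.a₁ * genX W L * genY W L + κ W.a₃ * genY W L =
      genX W L ^ 3 + κ W.a₂ * genX W L ^ 2 + κ W.a₄ * genX W L + κ W.a₆ at e1
    simp only [map_add, map_mul, map_pow] at e2
    have hyb' : genY W L - κ b ≠ 0 := by
      intro h0
      have := infValuation_genY_sub (W := W) (L := L) b
      rw [h0, map_zero] at this
      exact exp_ne_zero this.symm
    have hs : slopeAt L (.some x b h) = (genX W L ^ 2 + κ x * genX W L + κ (x ^ 2) +
        κ W.a₂ * (genX W L + κ x) + κ W.a₄ - κ W.a₁ * genY W L) / (genY W L - κ b) := by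
      rw [slopeAt, div_eq_div_iff (genX_sub_ne_zero x) hyb', negY, map_sub, map_sub, map_neg,
        map_mul, map_pow]
      linear_combination e1 - e2
    rw [hs]
    have hX := hasValueAt_genX (L := L) h'
    have hY := hasValueAt_genY (L := L) h'
    exact ((((((hX.pow 2).add ((HasValueAt.const _ x).mul hX)).add (.const _ _)).add
      ((HasValueAt.const _ W.a₂).mul (hX.add (.const _ _)))).add (.const _ _)).sub
        ((HasValueAt.const _ W.a₁).mul hY)).div (hY.sub (.const _ b))
          (sub_ne_zero.mpr hyb) |>.le_one
  · exact (hasValueAt_slopeAt h h' hx).le_one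

open Classical in
/-- The functions which are invariant under the translations by the elements of `S` and regular
outside `S`. -/
structure IsInvariantRegular (S : AddSubgroup W.Point) (f : L) : Prop where
  translation_eq : ∀ R ∈ S, translation R f = f
  valAt_le : ∀ Q ∉ S, valAt L Q f ≤ 1

end FunctionField

namespace Point

lemma ne_neg_of_odd_card [DecidableEq K] {S : AddSubgroup W.Point} (hodd : Odd (Nat.card S))
    {R : W.Point} (hR : R ∈ S) (hR0 : R ≠ 0) : R ≠ -R := by
  intro h
  have h2 : 2 • R = 0 := by
    rw [two_nsmul]
    nth_rewrite 1 [h]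
    exact neg_add_cancel R
  have hl : Nat.card S • R = 0 := by
    have := card_nsmul_eq_zero' (G := S) (x := ⟨R, hR⟩)
    exact congrArg Subtype.val this
  obtain ⟨k, hk⟩ := hodd
  rw [hk, add_smul, mul_comm, mul_smul, h2, smul_zero, zero_add, one_smul] at hl
  exact hR0 hl

end Point

namespace FunctionField

variable {L : Type*} [Field L] [Algebra W.CoordinateRing L] [IsFractionRing W.CoordinateRing L]
  [Algebra K L] [IsScalarTower K W.CoordinateRing L] [W.IsElliptic] [IsAlgClosed K]

local notation "v" => infValuation W L
local notation "κ" => algebraMap K L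

lemma le_exp_of_lt_exp {x : ℤᵐ⁰} {n m : ℤ} (h : x < exp n) (hn : n = m + 1) : x ≤ exp m := by
  subst hn
  rw [exp_add] at h
  exact (lt_mul_exp_iff_le exp_ne_zero).mp h

open Classical in
/-- A function on the quotient by `S` with at most a simple pole is constant. -/
theorem IsInvariantRegular.exists_eq_const {S : AddSubgroup W.Point} [Finite S]
    (hodd : Odd (Nat.card S)) (hn : (Nat.card S : K) ≠ 0) {f : L} (hf : IsInvariantRegular S f)
    (h : v f ≤ exp 1) : ∃ c, κ c = f := by
  obtain ⟨r, hr⟩ := exists_infValuation_sub_lt (simplePole_ne_zero (W := W))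
    (h.trans_eq infValuation_simplePole.symm)
  rw [infValuation_simplePole] at hr
  replace hr := le_exp_of_lt_exp hr (m := 0) rfl
  rw [exp_zero] at hr
  have hfin : (S : Set W.Point).Finite := Set.toFinite _
  let T : Finset W.Point := hfin.toFinset.erase 0
  have hT {R : W.Point} : R ∈ T ↔ R ≠ 0 ∧ R ∈ S := by simp [T]
  have hcard : T.card + 1 = Nat.card S := by
    rw [Finset.card_erase_add_one (by simp), ← Nat.card_eq_card_finite_toFinset]
    rfl
  have hne {R : W.Point} (hR : R ∈ T) : R ≠ -R :=
    Point.ne_neg_of_odd_card hodd (hT.mp hR).2 (hT.mp hR).1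
  -- By invariance f has the same polar part r·y/x at every point of S. At R ≠ 0 the slope function
  -- of R cancels it, so `g` has at most a pole at 0, with polar part |S|·r·y/x. There is no
  -- function with a single simple pole, hence |S|·r = 0, and r = 0 as |S| is invertible.
  let g : L := f + κ r * ∑ R ∈ T, slopeAt L R
  have hreg (Q : W.Point) (hQ : Q ≠ 0) : valAt L Q g ≤ 1 := by
    by_cases hQS : Q ∈ S
    · have hQT : Q ∈ T := hT.mpr ⟨hQ, hQS⟩
      have h1 : translation Q g = (f - κ r * simplePole W L) +
          κ r * ((translation Q (slopeAt L Q) + simplePole W L) +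
            ∑ R ∈ T.erase Q, translation Q (slopeAt L R)) := by
        rw [map_add, hf.translation_eq Q hQS, map_mul, AlgHom.commutes, map_sum,
          ← Finset.add_sum_erase T _ hQT]
        ring
      rw [valAt_apply, h1]
      refine Valuation.map_add_le _ hr (infValuation_algebraMap_mul_le
        (Valuation.map_add_le _ (infValuation_translation_slopeAt_add hQ)
          (Valuation.map_sum_le _ fun R hR ↦ ?_)))
      rw [Finset.mem_erase] at hR
      exact valAt_slopeAt_le hQ (hne hR.2) hR.1.symm
    · refine Valuation.map_add_le _ (hf.valAt_le Q hQS) (valAt_algebraMap_mul_le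
        (Valuation.map_sum_le _ fun R hR ↦ valAt_slopeAt_le hQ (hne hR) ?_))
      rintro rfl
      exact hQS (hT.mp hR).2
  have hg : v (g - κ (Nat.card S * r) * simplePole W L) ≤ 1 := by
    have h1 : g - κ (Nat.card S * r) * simplePole W L = (f - κ r * simplePole W L) +
        κ r * ∑ R ∈ T, (slopeAt L R - simplePole W L) := by
      rw [Finset.sum_sub_distrib, Finset.sum_const, ← hcard, nsmul_eq_mul]
      simp only [g, map_mul, map_add, map_one, map_natCast, Nat.cast_add, Nat.cast_one]
      ring
    rw [h1]
    exact Valuation.map_add_le _ hr (infValuation_algebraMap_mul_le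
        (Valuation.map_sum_le _ fun R hR ↦ infValuation_slopeAt_sub (hT.mp hR).1))
  have h1exp : (1 : ℤᵐ⁰) ≤ exp 1 := by rw [← exp_zero, exp_le_exp]; norm_num
  obtain ⟨c, hc⟩ := FunctionField.exists_eq_const hreg (by
    rw [← sub_add_cancel g (κ (Nat.card S * r) * simplePole W L)]
    exact Valuation.map_add_le _ (hg.trans h1exp) (infValuation_algebraMap_mul_le
      infValuation_simplePole.le))
  have hr0 : r = 0 := by
    by_contra hr0
    have h2 := Valuation.map_sub_le _ (infValuation_algebraMap_field_le (W := W) (L := L) c) (hc ▸ hg)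
    rw [sub_sub_cancel, map_mul, infValuation_algebraMap_field (mul_ne_zero hn hr0), one_mul,
      infValuation_simplePole, ← exp_zero, exp_le_exp] at h2
    norm_num at h2
  refine ⟨c, ?_⟩
  rw [hc]
  simp [g, hr0]

end FunctionField

end WeierstrassCurve.Affine

/-! ### Zeros of regular functions -/

namespace WeierstrassCurve.Affine

set_option linter.unusedSectionVars false

open Polynomial WithZero

variable {K : Type*} [Field K] {W : Affine K}

namespace Point

/-- The ideal of functions vanishing at a point; the unit ideal at infinity. -/
noncomputable def ideal : W.Point → Ideal W.CoordinateRing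
  | 0 => ⊤
  | .some x y _ => CoordinateRing.XYIdeal W x (C y)

/-- The value of a regular function at a point, which is set to `0` at infinity. -/
noncomputable def eval : W.Point → W.CoordinateRing →ₗ[K] K
  | 0 => 0
  | .some _ _ h => (CoordinateRing.evalAt h.1).toLinearMap

lemma mem_ideal_iff {Q : W.Point} {a : W.CoordinateRing} : a ∈ Q.ideal ↔ Q.eval a = 0 := by
  rcases Q with _ | ⟨x, y, h⟩
  · exact ⟨fun _ ↦ rfl, fun _ ↦ Submodule.mem_top⟩
  · exact CoordinateRing.mem_XYIdeal_iff h.1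

lemma eval_algebraMap {Q : W.Point} (hQ : Q ≠ 0) (c : K) : Q.eval (algebraMap K _ c) = c := by
  rcases Q with _ | ⟨x, y, h⟩
  · exact absurd rfl hQ
  · exact AlgHom.commutes (CoordinateRing.evalAt h.1) c

lemma isMaximal_ideal {Q : W.Point} (hQ : Q ≠ 0) : Q.ideal.IsMaximal := by
  rcases Q with _ | ⟨x, y, h⟩
  · exact absurd rfl hQ
  · exact CoordinateRing.isMaximal_XYIdeal h.1

lemma ideal_injective : Function.Injective (ideal (W := W)) := by
  rintro (_ | ⟨x, y, h⟩) (_ | ⟨x', y', h'⟩) hPQ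
  · rfl
  · exact absurd hPQ.symm (CoordinateRing.isMaximal_XYIdeal h'.1).ne_top
  · exact absurd hPQ (CoordinateRing.isMaximal_XYIdeal h.1).ne_top
  · have hPQ' : CoordinateRing.XYIdeal W x (C y) = CoordinateRing.XYIdeal W x' (C y') := hPQ
    have hx : CoordinateRing.XClass W x ∈ CoordinateRing.XYIdeal W x' (C y') := by
      rw [← hPQ']
      exact Ideal.subset_span (Or.inl rfl)
    have hy : CoordinateRing.YClass W (C y) ∈ CoordinateRing.XYIdeal W x' (C y') := by
      rw [← hPQ']
      exact Ideal.subset_span (Or.inr rfl)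
    rw [CoordinateRing.mem_XYIdeal_iff h'.1] at hx hy
    have hx' := (CoordinateRing.evalAt_mk h'.1 _).symm.trans hx
    have hy' := (CoordinateRing.evalAt_mk h'.1 _).symm.trans hy
    rw [evalEval_C, eval_sub, eval_X, eval_C, sub_eq_zero] at hx'
    rw [evalEval_sub, evalEval_X, evalEval_C, eval_C, sub_eq_zero] at hy'
    subst hx' hy'
    rfl

lemma pairwise_isCoprime_ideal {s : Finset W.Point} (h0 : 0 ∉ s) :
    Pairwise (Function.onFun IsCoprime fun Q : s ↦ (Q : W.Point).ideal) := by
  intro P Q hPQ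
  have hP := isMaximal_ideal (fun h ↦ h0 (h ▸ P.2))
  have hQ := isMaximal_ideal (fun h ↦ h0 (h ▸ Q.2))
  exact Ideal.isCoprime_of_isMaximal (fun h ↦ hPQ (Subtype.ext (ideal_injective h)))

/-- The values of a regular function at finitely many affine points can be prescribed. -/
lemma exists_eval_eq {s : Finset W.Point} (h0 : 0 ∉ s) (c : s → K) :
    ∃ a : W.CoordinateRing, ∀ Q : s, (Q : W.Point).eval a = c Q := by
  obtain ⟨a, ha⟩ := Ideal.exists_forall_sub_mem_ideal (pairwise_isCoprime_ideal h0)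
    (fun Q ↦ algebraMap K W.CoordinateRing (c Q))
  refine ⟨a, fun Q ↦ ?_⟩
  have := mem_ideal_iff.mp (ha Q)
  rwa [map_sub, eval_algebraMap (fun h ↦ h0 (h ▸ Q.2)), sub_eq_zero] at this

/-- Evaluation at finitely many points. -/
noncomputable def evalPi (s : Finset W.Point) : W.CoordinateRing →ₗ[K] (s → K) :=
  LinearMap.pi fun Q ↦ (Q : W.Point).eval

section Zeros

variable {s : Finset W.Point} {a : W.CoordinateRing}

lemma span_le_ker_evalPi (hs : ∀ Q ∈ s, a ∈ ideal Q) :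
    (Ideal.span {a}).restrictScalars K ≤ LinearMap.ker (evalPi s) := by
  intro b hb
  obtain ⟨c, rfl⟩ := Ideal.mem_span_singleton.mp (show b ∈ Ideal.span {a} from hb)
  exact funext fun Q ↦ mem_ideal_iff.mp (Ideal.mul_mem_right c _ (hs Q Q.2))

/-- Evaluation of functions modulo `a` at finitely many zeros of `a`. -/
noncomputable def evalQuotient (hs : ∀ Q ∈ s, a ∈ ideal Q) :
    (W.CoordinateRing ⧸ Ideal.span {a}) →ₗ[K] (s → K) :=
  Submodule.liftQ ((Ideal.span {a}).restrictScalars K) (evalPi s) (span_le_ker_evalPi hs)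

lemma evalQuotient_surjective (h0 : 0 ∉ s) (hs : ∀ Q ∈ s, a ∈ ideal Q) :
    Function.Surjective (evalQuotient hs) := by
  intro c
  obtain ⟨b, hb⟩ := exists_eval_eq h0 c
  exact ⟨Ideal.Quotient.mk _ b, funext hb⟩

/-- The dimension equals the degree of the norm. It is positive, since a function of degree 0 is
constant and could not vanish at a point of s. -/
lemma finiteDimensional_quotient_span (h0 : 0 ∉ s) (ha : a ≠ 0) (hs : ∀ Q ∈ s, a ∈ ideal Q)
    (hne : s.Nonempty) : FiniteDimensional K (W.CoordinateRing ⧸ Ideal.span {a}) := by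
  refine Module.finite_of_finrank_pos ?_
  rw [finrank_quotient_span_eq_natDegree_norm (CoordinateRing.basis W) ha, pos_iff_ne_zero]
  intro hd
  obtain ⟨c, rfl⟩ := CoordinateRing.exists_eq_algebraMap_of_infValuation_le (a := a) (by
    rw [CoordinateRing.infValuation_apply ha, hd, exp_le_exp]
    norm_num)
  obtain ⟨Q, hQ⟩ := hne
  have := mem_ideal_iff.mp (hs Q hQ)
  rw [eval_algebraMap (fun h ↦ h0 (h ▸ hQ))] at this
  exact ha (by rw [this, _root_.map_zero])

/-- A function has at most as many zeros as its pole order at infinity. -/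
lemma card_le_natDegree_norm (h0 : 0 ∉ s) (ha : a ≠ 0) (hs : ∀ Q ∈ s, a ∈ ideal Q) :
    s.card ≤ (Algebra.norm K[X] a).natDegree := by
  rcases s.eq_empty_or_nonempty with rfl | hne
  · simp
  have := finiteDimensional_quotient_span h0 ha hs hne
  have h := LinearMap.finrank_le_finrank_of_surjective (evalQuotient_surjective h0 hs)
  rw [Module.finrank_fintype_fun_eq_card, Fintype.card_coe] at h
  rwa [finrank_quotient_span_eq_natDegree_norm (CoordinateRing.basis W) ha] at h

/-- A function with as many zeros as its pole order divides every function with these zeros. -/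
lemma dvd_of_card_eq_natDegree_norm (h0 : 0 ∉ s) (ha : a ≠ 0) (hs : ∀ Q ∈ s, a ∈ ideal Q)
    (hne : s.Nonempty) (hcard : (Algebra.norm K[X] a).natDegree = s.card) {b : W.CoordinateRing}
    (hb : ∀ Q ∈ s, b ∈ ideal Q) : a ∣ b := by
  have := finiteDimensional_quotient_span h0 ha hs hne
  have hinj : Function.Injective (evalQuotient hs) := by
    rw [LinearMap.injective_iff_surjective_of_finrank_eq_finrank]
    · exact evalQuotient_surjective h0 hs
    · rw [Module.finrank_fintype_fun_eq_card, Fintype.card_coe, ← hcard]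
      exact finrank_quotient_span_eq_natDegree_norm (CoordinateRing.basis W) ha
  have h1 : evalQuotient hs (Ideal.Quotient.mk _ b) = evalQuotient hs 0 := by
    rw [_root_.map_zero]
    exact funext fun Q ↦ mem_ideal_iff.mp (hb Q Q.2)
  exact Ideal.mem_span_singleton.mp (Ideal.Quotient.eq_zero_iff_mem.mp (hinj h1))

/-- The points of the divisor of a function sum up to zero. -/
lemma sum_eq_zero_of_span_eq_prod [DecidableEq K] (ha : a ≠ 0)
    (h : Ideal.span {a} = ∏ Q ∈ s, ideal Q) : ∑ Q ∈ s, Q = 0 := by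
  let u : W.Point → (FractionalIdeal (nonZeroDivisors W.CoordinateRing) W.FunctionField)ˣ
    | 0 => 1
    | .some _ _ h => CoordinateRing.XYIdeal' (W := W) h
  have hu (Q : W.Point) : (u Q : FractionalIdeal (nonZeroDivisors W.CoordinateRing) W.FunctionField) =
      Q.ideal := by
    rcases Q with _ | ⟨x, y, h⟩
    · exact (FractionalIdeal.coeIdeal_top (nonZeroDivisors W.CoordinateRing)).symm
    · rfl
  have hc (Q : W.Point) : (toClass Q).toMul = ClassGroup.mk W.FunctionField (u Q) := by
    rcases Q with _ | ⟨x, y, h⟩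
    · exact (map_one (ClassGroup.mk W.FunctionField)).symm
    · rfl
  -- The map from points to ideal classes is an injective homomorphism, so it suffices that the
  -- product of the ideals is principal.
  rw [← toClass_eq_zero, map_sum]
  refine Additive.toMul.injective ?_
  rw [toMul_sum, toMul_zero]
  simp_rw [hc]
  rw [← map_prod]
  refine (ClassGroup.mk_eq_one_of_coe_ideal (I' := Ideal.span {a}) ?_).mpr ⟨a, ha, rfl⟩
  rw [h, Units.coe_prod]
  exact (Finset.prod_congr rfl fun Q _ ↦ hu Q).trans
    (map_prod (FractionalIdeal.coeIdealHom (nonZeroDivisors W.CoordinateRing) W.FunctionField)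
      _ _).symm

lemma sum_eq_zero_of_card_eq_natDegree_norm [DecidableEq K] (h0 : 0 ∉ s) (ha : a ≠ 0)
    (hs : ∀ Q ∈ s, a ∈ ideal Q) (hne : s.Nonempty)
    (hcard : (Algebra.norm K[X] a).natDegree = s.card) : ∑ Q ∈ s, Q = 0 := by
  classical
  refine sum_eq_zero_of_span_eq_prod ha ?_
  -- The ideals are pairwise coprime, so their product consists of the functions vanishing at all
  -- points of s, and these are the multiples of a.
  have hprod : ∏ Q ∈ s, ideal Q = ⨅ Q ∈ s, ideal Q := by
    refine Ideal.prod_eq_iInf_of_pairwise_isCoprime ?_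
    intro P hP Q hQ hPQ
    exact pairwise_isCoprime_ideal h0 (i := ⟨P, hP⟩) (j := ⟨Q, hQ⟩) (fun h ↦ hPQ (congrArg Subtype.val h))
  rw [hprod]
  refine le_antisymm ?_ fun b hb ↦ ?_
  · rw [Ideal.span_singleton_le_iff_mem]
    simpa using hs
  · refine Ideal.mem_span_singleton.mpr (dvd_of_card_eq_natDegree_norm h0 ha hs hne hcard ?_)
    simpa using hb

end Zeros

end Point

namespace FunctionField

variable {L : Type*} [Field L] [Algebra W.CoordinateRing L] [IsFractionRing W.CoordinateRing L]
  [Algebra K L] [IsScalarTower K W.CoordinateRing L] [W.IsElliptic] [IsAlgClosed K]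

lemma mem_ideal_iff_valAt {Q : W.Point} (hQ : Q ≠ 0) {a : W.CoordinateRing} :
    a ∈ Q.ideal ↔ valAt L Q (algebraMap _ L a) < 1 := by
  rcases Q with _ | ⟨x, y, h⟩
  · exact absurd rfl hQ
  · rw [valAt_algebraMap_lt_one_iff]
    exact CoordinateRing.mem_XYIdeal_iff h.1

end FunctionField

end WeierstrassCurve.Affine

/-! ### Lagrange resolvents of the slope function -/

namespace WeierstrassCurve.Affine

set_option linter.unusedSectionVars false

open Polynomial WithZero

variable {K : Type*} [Field K] {W : Affine K}

namespace Point

/-- The `y`-coordinate of a point, which is set to `0` at infinity. -/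
noncomputable def yCoord : W.Point → K
  | 0 => 0
  | .some _ y _ => y

@[simp] lemma yCoord_some {x y : K} (h : W.Nonsingular x y) : (some x y h).yCoord = y := rfl

/-- The slope of the line through `T` and `-R`. -/
noncomputable def slopeValue (R T : W.Point) : K :=
  (T.yCoord - W.negY R.xCoord R.yCoord) / (T.xCoord - R.xCoord)

open Classical in
/-- The Lagrange resolvent of the values of the slope function along `Q + ⟨P⟩`. -/
noncomputable def resolvent (l : ℕ) (P : W.Point) (ξ : K) (Q : W.Point) : K :=
  ∑ i ∈ Finset.range l, ξ ^ i * slopeValue P (Q + i • P)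

lemma eq_or_eq_neg_of_xCoord_eq' {P Q : W.Point} (hP : P ≠ 0) (hQ : Q ≠ 0)
    (h : P.xCoord = Q.xCoord) : P = Q ∨ P = -Q := by
  rcases P with _ | ⟨x, y, hP'⟩
  · exact absurd rfl hP
  rcases Q with _ | ⟨x', y', hQ'⟩
  · exact absurd rfl hQ
  exact X_eq_iff.mp h

end Point

namespace FunctionField

variable {L : Type*} [Field L] [Algebra W.CoordinateRing L] [IsFractionRing W.CoordinateRing L]
  [Algebra K L] [IsScalarTower K W.CoordinateRing L] [W.IsElliptic] [IsAlgClosed K]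

local notation "v" => infValuation W L
local notation "κ" => algebraMap K L

lemma hasValueAt_genX_xCoord {Q : W.Point} (hQ : Q ≠ 0) : HasValueAt (L := L) Q (genX W L) Q.xCoord := by
  rcases Q with _ | ⟨x, y, h⟩
  · exact absurd rfl hQ
  · exact hasValueAt_genX h

lemma hasValueAt_genY_yCoord {Q : W.Point} (hQ : Q ≠ 0) : HasValueAt (L := L) Q (genY W L) Q.yCoord := by
  rcases Q with _ | ⟨x, y, h⟩
  · exact absurd rfl hQ
  · exact hasValueAt_genY h

lemma hasValueAt_slopeValue {R Q : W.Point} (hR : R ≠ 0) (hQ : Q ≠ 0) (h : Q ≠ R) (h' : Q ≠ -R) :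
    HasValueAt Q (slopeAt L R) (Point.slopeValue R Q) := by
  have hx : Q.xCoord ≠ R.xCoord := fun hx ↦
    (Point.eq_or_eq_neg_of_xCoord_eq' hQ hR hx).elim h h'
  rcases R with _ | ⟨a, b, hR'⟩
  · exact absurd rfl hR
  rcases Q with _ | ⟨x, y, hQ'⟩
  · exact absurd rfl hQ
  exact hasValueAt_slopeAt hR' hQ' hx

open Classical in
lemma translation_nsmul (P : W.Point) {f : L} {c : K} (h : translation P f = κ c * f) (j : ℕ) :
    translation (j • P) f = κ (c ^ j) * f := by
  induction j with
  | zero => rw [zero_smul, translation_zero, pow_zero, map_one, one_mul, AlgHom.id_apply]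
  | succ j ih =>
    rw [add_smul, one_smul, ← translation_translation, h, map_mul, AlgHom.commutes, ih, pow_succ,
      map_mul]
    ring

open Classical in
variable (L) in
/-- The Lagrange resolvent of the slope function with respect to translation by `P`. -/
noncomputable def resolvent (l : ℕ) (P : W.Point) (ξ : K) : L :=
  ∑ i ∈ Finset.range l, κ (ξ ^ i) * translation (i • P) (slopeAt L P)

section Resolvent

open Classical in
-- Because lP = 0 and ξ^l = 1, the summands depend on i modulo l only. Translating by P shifts the
-- index by one and costs a factor ξ⁻¹.
lemma translation_resolvent {l : ℕ} {P : W.Point} (hP : l • P = 0) {ξ : K} (hξ : ξ ^ l = 1)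
    (hl : l ≠ 0) : translation P (resolvent L l P ξ) = κ ξ⁻¹ * resolvent L l P ξ := by
  have hξ0 : ξ ≠ 0 := by
    rintro rfl
    rw [zero_pow hl] at hξ
    exact zero_ne_one hξ
  let F : ℕ → L := fun i ↦ κ (ξ ^ i) * translation (i • P) (slopeAt L P)
  have h1 (i : ℕ) : translation P (F i) = κ ξ⁻¹ * F (i + 1) := by
    have h2 : κ (ξ ^ i) = κ ξ⁻¹ * κ (ξ ^ (i + 1)) := by
      rw [← map_mul]
      congr 1
      field_simp
      ring
    simp only [F]
    rw [map_mul, AlgHom.commutes, translation_translation, add_smul, one_smul, add_comm P, h2]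
    ring
  have h3 : ∑ i ∈ Finset.range l, F (i + 1) = ∑ i ∈ Finset.range l, F i := by
    have h4 := Finset.sum_range_succ F l
    rw [Finset.sum_range_succ'] at h4
    have h5 : F l = F 0 := by simp only [F, hP, hξ, zero_smul, pow_zero]
    rw [h5] at h4
    exact add_right_cancel h4
  rw [resolvent, map_sum, Finset.sum_congr rfl fun i _ ↦ h1 i, ← Finset.mul_sum, h3]

open Classical in
lemma valAt_add_nsmul_resolvent {l : ℕ} {P : W.Point} (hP : l • P = 0) {ξ : K} (hξ : ξ ^ l = 1)
    (hl : l ≠ 0) (Q : W.Point) (j : ℕ) :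
    valAt L (Q + j • P) (resolvent L l P ξ) = valAt L Q (resolvent L l P ξ) := by
  have hξ0 : ξ ≠ 0 := by
    rintro rfl
    rw [zero_pow hl] at hξ
    exact zero_ne_one hξ
  rw [← valAt_translation, translation_nsmul P (translation_resolvent hP hξ hl), map_mul,
    valAt_algebraMap (pow_ne_zero j (inv_ne_zero hξ0)), one_mul]

open Classical in
lemma nsmul_ne_zero_of_addOrderOf {l : ℕ} {P : W.Point} (hP : addOrderOf P = l) {i : ℕ} (hi : i ≠ 0)
    (hil : i < l) : i • P ≠ 0 := by
  intro h
  have := Nat.le_of_dvd (Nat.pos_of_ne_zero hi) (addOrderOf_dvd_of_nsmul_eq_zero h)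
  omega

open Classical in
-- The i-th summand has a pole at infinity only if iP is a pole of the slope function, i.e. for i =
-- 0 and i = 1. The polar parts there are y/x and −ξ·y/x. Oddness of l ensures P ≠ −P.
lemma infValuation_resolvent_sub {l : ℕ} {P : W.Point} (hP : addOrderOf P = l) (hl : Odd l)
    (hl1 : l ≠ 1) (ξ : K) :
    v (resolvent L l P ξ - κ (1 - ξ) * simplePole W L) ≤ 1 := by
  obtain ⟨k, hk⟩ : ∃ k, l = k + 2 := by
    obtain ⟨m, rfl⟩ := hl
    exact ⟨2 * m - 1, by omega⟩
  have hP0 : P ≠ 0 := by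
    simpa using nsmul_ne_zero_of_addOrderOf hP one_ne_zero (by omega)
  have hPne : P ≠ -P := by
    intro h
    have h2 : 2 • P = 0 := by
      rw [two_nsmul]
      nth_rewrite 1 [h]
      exact neg_add_cancel P
    refine nsmul_ne_zero_of_addOrderOf hP two_ne_zero ?_ h2
    obtain ⟨m, rfl⟩ := hl
    omega
  have h1 : resolvent L l P ξ - κ (1 - ξ) * simplePole W L =
      (slopeAt L P - simplePole W L) + κ ξ * (translation P (slopeAt L P) + simplePole W L) +
      ∑ i ∈ Finset.range k, κ (ξ ^ (i + 2)) * translation ((i + 2) • P) (slopeAt L P) := by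
    rw [resolvent, hk, Finset.sum_range_succ', Finset.sum_range_succ']
    simp only [zero_smul, translation_zero, pow_zero, map_one, one_mul, AlgHom.id_apply, zero_add,
      one_smul, pow_one, map_sub]
    ring
  rw [h1]
  refine Valuation.map_add_le _ (Valuation.map_add_le _ (infValuation_slopeAt_sub hP0)
    (infValuation_algebraMap_mul_le (infValuation_translation_slopeAt_add hP0)))
      (Valuation.map_sum_le _ fun i hi ↦ infValuation_algebraMap_mul_le ?_)
  rw [Finset.mem_range] at hi
  refine valAt_slopeAt_le (nsmul_ne_zero_of_addOrderOf hP (by omega) (by omega)) hPne ?_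
  rw [add_smul, two_smul, ← add_assoc, Ne, add_eq_right, ← succ_nsmul]
  exact nsmul_ne_zero_of_addOrderOf hP (by omega) (by omega)

open Classical in
lemma infValuation_resolvent {l : ℕ} {P : W.Point} (hP : addOrderOf P = l) (hl : Odd l)
    (hl1 : l ≠ 1) {ξ : K} (hξ : ξ ≠ 1) : v (resolvent L l P ξ) = exp 1 := by
  have h1 : v (κ (1 - ξ) * simplePole W L) = exp 1 := by
    rw [map_mul, infValuation_algebraMap_field (sub_ne_zero.mpr hξ.symm), one_mul,
      infValuation_simplePole]
  rw [← h1]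
  refine Valuation.map_eq_of_sub_lt _ ((infValuation_resolvent_sub hP hl hl1 ξ).trans_lt ?_)
  rw [h1, ← exp_zero, exp_lt_exp]
  norm_num

open Classical in
lemma hasValueAt_resolvent (l : ℕ) {P : W.Point} (hP : P ≠ 0) (ξ : K) {Q : W.Point}
    (hQ : Q ∉ AddSubgroup.zmultiples P) :
    HasValueAt Q (resolvent L l P ξ) (Point.resolvent l P ξ Q) := by
  refine HasValueAt.sum _ fun i _ ↦ (HasValueAt.const _ _).mul (HasValueAt.translation ?_)
  have h (T : W.Point) (hT : T ∈ AddSubgroup.zmultiples P) : Q + i • P ≠ T := by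
    rintro rfl
    refine hQ ((AddSubgroup.add_mem_cancel_right _ ?_).mp hT)
    exact AddSubgroup.nsmul_mem _ (AddSubgroup.mem_zmultiples P) i
  exact hasValueAt_slopeValue hP (h _ (zero_mem _)) (h _ (AddSubgroup.mem_zmultiples P))
    (h _ (neg_mem (AddSubgroup.mem_zmultiples P)))

end Resolvent

section HalfProduct

open Classical in
variable (L) in
/-- The product of the functions `x - x(iP)` over `1 ≤ i ≤ m`. -/
noncomputable def halfProduct (m : ℕ) (P : W.Point) : L :=
  ∏ i ∈ Finset.Icc 1 m, (genX W L - κ (i • P).xCoord)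

open Classical in
lemma infValuation_halfProduct (m : ℕ) (P : W.Point) : v (halfProduct L m P) = exp (2 * m : ℤ) := by
  rw [halfProduct, map_prod, Finset.prod_congr rfl fun i _ ↦ infValuation_genX_sub _,
    Finset.prod_const, Nat.card_Icc, ← exp_nsmul]
  congr 1
  simp
  ring

open Classical in
lemma valAt_genX_sub_eq_one {Q R : W.Point} (hQ : Q ≠ 0) (hR : R ≠ 0) (h : Q ≠ R) (h' : Q ≠ -R) :
    valAt L Q (genX W L - κ R.xCoord) = 1 :=
  ((hasValueAt_genX_xCoord hQ).sub (.const _ _)).valAt_eq_one (sub_ne_zero.mpr fun hx ↦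
    (Point.eq_or_eq_neg_of_xCoord_eq' hQ hR hx).elim h h')

lemma valAt_genX_sub_self {Q R : W.Point} (hQ : Q ≠ 0) (hne : Q ≠ -Q) (h : Q = R ∨ Q = -R) :
    valAt L Q (genX W L - κ R.xCoord) = exp (-1) := by
  have hx : R.xCoord = Q.xCoord := by
    rcases h with rfl | rfl
    · rfl
    · rw [Point.xCoord_neg]
  rw [hx]
  rcases Q with _ | ⟨a, b, hQ'⟩
  · exact absurd rfl hQ
  · refine valAt_genX_sub_eq hQ' fun hb ↦ hne ?_
    rw [Point.neg_some, Point.some.injEq]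
    exact ⟨rfl, hb⟩

open Classical in
lemma valAt_halfProduct_of_notMem {m : ℕ} {P Q : W.Point} (hP : addOrderOf P = 2 * m + 1)
    (hQ : Q ∉ AddSubgroup.zmultiples P) : valAt L Q (halfProduct L m P) = 1 := by
  rw [halfProduct, map_prod]
  refine Finset.prod_eq_one fun i hi ↦ ?_
  rw [Finset.mem_Icc] at hi
  have hi' : i • P ∈ AddSubgroup.zmultiples P :=
    AddSubgroup.nsmul_mem _ (AddSubgroup.mem_zmultiples P) i
  refine valAt_genX_sub_eq_one ?_ (nsmul_ne_zero_of_addOrderOf hP (by omega) (by omega)) ?_ ?_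
  · rintro rfl
    exact hQ (zero_mem _)
  · rintro rfl
    exact hQ hi'
  · rintro rfl
    exact hQ (neg_mem hi')

open Classical in
-- Up to sign Q is jP for exactly one j between 1 and m, so only that factor vanishes at Q, and it
-- vanishes simply because Q ≠ −Q.
lemma valAt_halfProduct_of_mem {m : ℕ} {P Q : W.Point} (hP : addOrderOf P = 2 * m + 1)
    (hQ : Q ∈ AddSubgroup.zmultiples P) (hQ0 : Q ≠ 0) :
    valAt L Q (halfProduct L m P) = exp (-1) := by
  obtain ⟨j, hj, hjQ⟩ : ∃ j ∈ Finset.Icc 1 m, Q = j • P ∨ Q = -(j • P) := by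
    have hfin : IsOfFinAddOrder P := addOrderOf_pos_iff.mp (by omega)
    obtain ⟨j, hj, rfl⟩ := (hfin.mem_zmultiples_iff_mem_range_addOrderOf).mp hQ |> Finset.mem_image.mp
    rw [Finset.mem_range, hP] at hj
    have hj0 : j ≠ 0 := by
      rintro rfl
      exact hQ0 (zero_smul _ _)
    by_cases hjm : j ≤ m
    · exact ⟨j, Finset.mem_Icc.mpr ⟨by omega, hjm⟩, Or.inl rfl⟩
    · refine ⟨2 * m + 1 - j, Finset.mem_Icc.mpr ⟨by omega, by omega⟩, Or.inr ?_⟩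
      rw [eq_neg_iff_add_eq_zero]
      change j • P + _ = 0
      rw [← add_smul, show j + (2 * m + 1 - j) = 2 * m + 1 by omega, ← hP, addOrderOf_nsmul_eq_zero]
  rw [Finset.mem_Icc] at hj
  have hne : Q ≠ -Q := by
    intro h
    have h2 : 2 • Q = 0 := by
      rw [two_nsmul]
      nth_rewrite 1 [h]
      exact neg_add_cancel Q
    have h3 : (2 * j) • P = 0 := by
      rcases hjQ with rfl | rfl
      · rw [mul_smul]
        exact h2
      · rw [mul_smul, ← neg_eq_zero, ← smul_neg]
        exact h2
    exact nsmul_ne_zero_of_addOrderOf hP (by omega) (by omega) h3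
  rw [halfProduct, map_prod, ← Finset.mul_prod_erase _ _ (Finset.mem_Icc.mpr hj),
    valAt_genX_sub_self hQ0 hne hjQ, Finset.prod_eq_one, mul_one]
  intro i hi
  rw [Finset.mem_erase, Finset.mem_Icc] at hi
  have h1 : i • P ≠ j • P := fun h ↦ by
    have hmod := (nsmul_inj_mod.mp h)
    rw [hP, Nat.mod_eq_of_lt (by omega), Nat.mod_eq_of_lt (by omega)] at hmod
    exact hi.1 hmod
  have h2 : i • P ≠ -(j • P) := fun h ↦ by
    rw [eq_neg_iff_add_eq_zero, ← add_smul] at h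
    exact nsmul_ne_zero_of_addOrderOf hP (by omega) (by omega) h
  refine valAt_genX_sub_eq_one hQ0 (nsmul_ne_zero_of_addOrderOf hP (by omega) (by omega)) ?_ ?_
  · rcases hjQ with rfl | rfl
    · exact h1.symm
    · exact fun h ↦ h2 h.symm
  · rcases hjQ with rfl | rfl
    · intro h
      exact h2 (by rw [h, neg_neg])
    · intro h
      exact h1 (neg_injective h).symm

end HalfProduct

end FunctionField

end WeierstrassCurve.Affine

/-! ### The zeros of the resolvents -/

namespace WeierstrassCurve.Affine

set_option linter.unusedSectionVars false

open Polynomial WithZero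

variable {K : Type*} [Field K] {W : Affine K} [W.IsElliptic] [IsAlgClosed K]

namespace FunctionField

variable {L : Type*} [Field L] [Algebra W.CoordinateRing L] [IsFractionRing W.CoordinateRing L]
  [Algebra K L] [IsScalarTower K W.CoordinateRing L]

local notation "v" => infValuation W L
local notation "κ" => algebraMap K L

open Classical in
lemma valAt_resolvent_lt_one_iff (l : ℕ) {P : W.Point} (hP : P ≠ 0) (ξ : K) {Q : W.Point}
    (hQ : Q ∉ AddSubgroup.zmultiples P) :
    valAt L Q (resolvent L l P ξ) < 1 ↔ Point.resolvent l P ξ Q = 0 := by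
  rw [← hasValueAt_zero_iff]
  refine ⟨fun h ↦ (hasValueAt_resolvent l hP ξ hQ).unique h, fun h ↦ ?_⟩
  rw [← h]
  exact hasValueAt_resolvent l hP ξ hQ

open Classical in
variable (L) in
-- The resolvent has simple poles along ⟨P⟩. Multiplying by `halfProduct`, with simple zeros at the
-- nonzero multiples of P and a pole of order 2m at infinity, gives a regular function of pole order
-- 2m + 1 with the same zeros outside ⟨P⟩ and none on it.
lemma exists_eq_resolvent_mul_halfProduct {m : ℕ} (hm : m ≠ 0) {P : W.Point}
    (hP : addOrderOf P = 2 * m + 1) {ξ : K} (hξ : ξ ^ (2 * m + 1) = 1) (hξ1 : ξ ≠ 1) :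
    ∃ a : W.CoordinateRing, algebraMap _ L a = resolvent L (2 * m + 1) P ξ * halfProduct L m P ∧
      a ≠ 0 ∧ (Algebra.norm K[X] a).natDegree = 2 * m + 1 ∧
      (∀ Q ∉ AddSubgroup.zmultiples P, a ∈ Point.ideal Q ↔ Point.resolvent (2 * m + 1) P ξ Q = 0) ∧
      ∀ Q ∈ AddSubgroup.zmultiples P, Q ≠ 0 → a ∉ Point.ideal Q := by
  have hP0 : P ≠ 0 := by
    simpa using nsmul_ne_zero_of_addOrderOf hP one_ne_zero (by omega)
  have hPl : (2 * m + 1) • P = 0 := by rw [← hP, addOrderOf_nsmul_eq_zero]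
  have hg : v (resolvent L (2 * m + 1) P ξ) = exp 1 :=
    infValuation_resolvent hP (odd_two_mul_add_one m) (by omega) hξ1
  have hmem (Q : W.Point) (hQ : Q ∈ AddSubgroup.zmultiples P) (hQ0 : Q ≠ 0) :
      valAt L Q (resolvent L (2 * m + 1) P ξ * halfProduct L m P) = 1 := by
    have hfin : IsOfFinAddOrder P := addOrderOf_pos_iff.mp (by omega)
    obtain ⟨j, -, hj⟩ := (hfin.mem_zmultiples_iff_mem_range_addOrderOf).mp hQ |> Finset.mem_image.mp
    have h1 := valAt_add_nsmul_resolvent (L := L) hPl hξ (by omega) 0 j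
    rw [zero_add, valAt_zero, hg] at h1
    rw [map_mul, valAt_halfProduct_of_mem hP hQ hQ0, ← hj]
    change valAt L (j • P) _ * _ = 1
    rw [h1, ← exp_add]
    rfl
  have hnot (Q : W.Point) (hQ : Q ∉ AddSubgroup.zmultiples P) :
      valAt L Q (resolvent L (2 * m + 1) P ξ * halfProduct L m P) =
        valAt L Q (resolvent L (2 * m + 1) P ξ) := by
    rw [map_mul, valAt_halfProduct_of_notMem hP hQ, mul_one]
  obtain ⟨a, ha⟩ := exists_eq_algebraMap_of_valAt_le
    (f := resolvent L (2 * m + 1) P ξ * halfProduct L m P) fun Q hQ0 ↦ by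
      by_cases hQ : Q ∈ AddSubgroup.zmultiples P
      · exact (hmem Q hQ hQ0).le
      · rw [hnot Q hQ]
        exact (hasValueAt_resolvent _ hP0 ξ hQ).le_one
  have hva : CoordinateRing.infValuation W a = exp (2 * m + 1 : ℤ) := by
    rw [← infValuation_algebraMap (L := L), ha, map_mul, hg, infValuation_halfProduct, ← exp_add]
    congr 1
    ring
  have ha0 : a ≠ 0 := by
    rintro rfl
    rw [map_zero] at hva
    exact exp_ne_zero hva.symm
  refine ⟨a, ha, ha0, ?_, fun Q hQ ↦ ?_, fun Q hQ hQ0 ↦ ?_⟩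
  · rw [CoordinateRing.infValuation_apply ha0, exp_inj] at hva
    exact_mod_cast hva
  · rw [mem_ideal_iff_valAt (L := L) (by rintro rfl; exact hQ (zero_mem _)), ha, hnot Q hQ,
      valAt_resolvent_lt_one_iff _ hP0 _ hQ]
  · rw [mem_ideal_iff_valAt (L := L) hQ0, ha, hmem Q hQ hQ0]
    exact lt_irrefl _

end FunctionField

namespace Point

open WeierstrassCurve.Affine.FunctionField

open Classical in
lemma resolvent_add_nsmul {m : ℕ} {P : W.Point} (hP : addOrderOf P = 2 * m + 1) (hm : m ≠ 0)
    {ξ : K} (hξ : ξ ^ (2 * m + 1) = 1) {Q : W.Point}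
    (hQ : Q ∉ AddSubgroup.zmultiples P) (h : resolvent (2 * m + 1) P ξ Q = 0) (j : ℕ) :
    resolvent (2 * m + 1) P ξ (Q + j • P) = 0 := by
  have hP0 : P ≠ 0 := by
    simpa using nsmul_ne_zero_of_addOrderOf hP one_ne_zero (by omega)
  have hPl : (2 * m + 1) • P = 0 := by rw [← hP, addOrderOf_nsmul_eq_zero]
  rw [← valAt_resolvent_lt_one_iff (L := W.FunctionField) _ hP0 _ hQ] at h
  rw [← valAt_resolvent_lt_one_iff (L := W.FunctionField) _ hP0,
    valAt_add_nsmul_resolvent hPl hξ (by omega)]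
  · exact h
  · rwa [AddSubgroup.add_mem_cancel_right]
    exact AddSubgroup.nsmul_mem _ (AddSubgroup.mem_zmultiples P) j

section Coset

open Classical in
/-- The points `Q + iP` for `i < l`. -/
noncomputable def coset (l : ℕ) (P Q : W.Point) : Finset W.Point :=
  (Finset.range l).image fun i ↦ Q + i • P

open Classical in
lemma add_nsmul_injOn {l : ℕ} {P : W.Point} (hP : addOrderOf P = l) (Q : W.Point) :
    Set.InjOn (fun i : ℕ ↦ Q + i • P) (Finset.range l) := by
  intro i hi j hj hij
  rw [Finset.coe_range, Set.mem_Iio] at hi hj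
  have := nsmul_inj_mod.mp (add_left_cancel hij)
  rwa [hP, Nat.mod_eq_of_lt hi, Nat.mod_eq_of_lt hj] at this

open Classical in
lemma card_coset {l : ℕ} {P : W.Point} (hP : addOrderOf P = l) (Q : W.Point) :
    (coset l P Q).card = l := by
  rw [coset, Finset.card_image_of_injOn (add_nsmul_injOn hP Q), Finset.card_range]

open Classical in
-- For odd l = 2m + 1 the coefficient l(l − 1)/2 of P is divisible by l.
lemma sum_coset {m : ℕ} {P : W.Point} (hP : addOrderOf P = 2 * m + 1) (Q : W.Point) :
    ∑ T ∈ coset (2 * m + 1) P Q, T = (2 * m + 1) • Q := by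
  rw [coset, Finset.sum_image (add_nsmul_injOn hP Q), Finset.sum_add_distrib, Finset.sum_const,
    Finset.card_range, ← Finset.sum_smul, Finset.sum_range_id, Nat.add_sub_cancel,
    show (2 * m + 1) * (2 * m) / 2 = m * (2 * m + 1) by
      rw [show (2 * m + 1) * (2 * m) = 2 * (m * (2 * m + 1)) by ring,
        Nat.mul_div_cancel_left _ two_pos], mul_smul, ← hP,
    addOrderOf_nsmul_eq_zero, smul_zero, add_zero]

open Classical in
lemma notMem_of_mem_coset {l : ℕ} {P Q T : W.Point} (hQ : Q ∉ AddSubgroup.zmultiples P)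
    (hT : T ∈ coset l P Q) : T ∉ AddSubgroup.zmultiples P := by
  obtain ⟨j, -, rfl⟩ := Finset.mem_image.mp hT
  rwa [AddSubgroup.add_mem_cancel_right]
  exact AddSubgroup.nsmul_mem _ (AddSubgroup.mem_zmultiples P) j

end Coset

section

open Classical

variable {m : ℕ} (hm : m ≠ 0) {P : W.Point} (hP : addOrderOf P = 2 * m + 1) {ξ : K}
  (hξ : ξ ^ (2 * m + 1) = 1) (hξ1 : ξ ≠ 1)

include hm hP hξ hξ1

/-- The resolvent has a zero, which is a torsion point. -/
theorem exists_resolvent_eq_zero : ∃ Q ∉ AddSubgroup.zmultiples P,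
    resolvent (2 * m + 1) P ξ Q = 0 ∧ (2 * m + 1) • Q = 0 := by
  obtain ⟨a, -, ha0, hdeg, hnot, hmem⟩ :=
    exists_eq_resolvent_mul_halfProduct W.FunctionField hm hP hξ hξ1
  have hunit : ¬ IsUnit a := by
    intro hu
    have h1 := finrank_quotient_span_eq_natDegree_norm (CoordinateRing.basis W) ha0
    rw [Ideal.span_singleton_eq_top.mpr hu, hdeg] at h1
    have : Subsingleton (W.CoordinateRing ⧸ (⊤ : Ideal W.CoordinateRing)) :=
      Ideal.Quotient.subsingleton_iff.mpr rfl
    rw [Module.finrank_zero_of_subsingleton] at h1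
    omega
  obtain ⟨x, y, h, h0⟩ := CoordinateRing.exists_evalAt_eq_zero hunit
  have h' := equation_iff_nonsingular.mp h
  have hQa : a ∈ ideal (.some x y h') := (CoordinateRing.mem_XYIdeal_iff h).mpr h0
  have hQ : Point.some x y h' ∉ AddSubgroup.zmultiples P :=
    fun hQ ↦ hmem _ hQ (some_ne_zero h') hQa
  have hQ0 := (hnot _ hQ).mp hQa
  refine ⟨_, hQ, hQ0, ?_⟩
  -- The coset of Q consists of 2m + 1 zeros of `a`, as many as its pole order; so it is the whole
  -- divisor of zeros, and its sum is 0.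
  rw [← sum_coset hP]
  refine sum_eq_zero_of_card_eq_natDegree_norm (a := a) ?_ ha0 ?_ ?_ ?_
  · exact fun h0 ↦ notMem_of_mem_coset hQ h0 (zero_mem _)
  · intro T hT
    refine (hnot T (notMem_of_mem_coset hQ hT)).mpr ?_
    obtain ⟨j, -, rfl⟩ := Finset.mem_image.mp hT
    exact resolvent_add_nsmul hP hm hξ hQ hQ0 j
  · rw [← Finset.card_pos, card_coset hP]
    omega
  · rw [hdeg, card_coset hP]

/-- The zeros of the resolvent form one coset of `⟨P⟩`. -/
theorem sub_mem_of_resolvent_eq_zero {Q Q' : W.Point} (hQ : Q ∉ AddSubgroup.zmultiples P)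
    (hQ' : Q' ∉ AddSubgroup.zmultiples P) (h : resolvent (2 * m + 1) P ξ Q = 0)
    (h' : resolvent (2 * m + 1) P ξ Q' = 0) : Q' - Q ∈ AddSubgroup.zmultiples P := by
  obtain ⟨a, -, ha0, hdeg, hnot, hmem⟩ :=
    exists_eq_resolvent_mul_halfProduct W.FunctionField hm hP hξ hξ1
  by_contra hsub
  have hQ'c : Q' ∉ coset (2 * m + 1) P Q := by
    intro hc
    obtain ⟨j, -, hj⟩ := Finset.mem_image.mp hc
    refine hsub ?_
    rw [← hj]
    rw [add_sub_cancel_left]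
    exact AddSubgroup.nsmul_mem _ (AddSubgroup.mem_zmultiples P) j
  have hs (T : W.Point) (hT : T ∈ insert Q' (coset (2 * m + 1) P Q)) :
      T ∉ AddSubgroup.zmultiples P ∧ resolvent (2 * m + 1) P ξ T = 0 := by
    rcases Finset.mem_insert.mp hT with rfl | hT
    · exact ⟨hQ', h'⟩
    · refine ⟨notMem_of_mem_coset hQ hT, ?_⟩
      obtain ⟨j, -, rfl⟩ := Finset.mem_image.mp hT
      exact resolvent_add_nsmul hP hm hξ hQ h j
  -- A zero outside the coset of Q would be the (2m + 2)-nd zero of a function of degree 2m + 1.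
  have := card_le_natDegree_norm (s := insert Q' (coset (2 * m + 1) P Q)) (a := a)
    (fun h0 ↦ (hs 0 h0).1 (zero_mem _)) ha0 fun T hT ↦ (hnot T (hs T hT).1).mpr (hs T hT).2
  rw [Finset.card_insert_of_notMem hQ'c, card_coset hP, hdeg] at this
  omega

/-- The resolvents for different roots of unity have no common zeros. -/
theorem eq_of_resolvent_eq_zero {ξ' : K} (hξ' : ξ' ^ (2 * m + 1) = 1) (hξ1' : ξ' ≠ 1) {Q : W.Point}
    (hQ : Q ∉ AddSubgroup.zmultiples P) (h : resolvent (2 * m + 1) P ξ Q = 0)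
    (h' : resolvent (2 * m + 1) P ξ' Q = 0) : ξ = ξ' := by
  obtain ⟨a, ha, ha0, hdeg, hnot, -⟩ :=
    exists_eq_resolvent_mul_halfProduct W.FunctionField hm hP hξ hξ1
  obtain ⟨a', ha', ha0', hdeg', hnot', -⟩ :=
    exists_eq_resolvent_mul_halfProduct W.FunctionField hm hP hξ' hξ1'
  have hs (T : W.Point) (hT : T ∈ coset (2 * m + 1) P Q) : a ∈ ideal T := by
    refine (hnot T (notMem_of_mem_coset hQ hT)).mpr ?_
    obtain ⟨j, -, rfl⟩ := Finset.mem_image.mp hT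
    exact resolvent_add_nsmul hP hm hξ hQ h j
  have hs' (T : W.Point) (hT : T ∈ coset (2 * m + 1) P Q) : a' ∈ ideal T := by
    refine (hnot' T (notMem_of_mem_coset hQ hT)).mpr ?_
    obtain ⟨j, -, rfl⟩ := Finset.mem_image.mp hT
    exact resolvent_add_nsmul hP hm hξ' hQ h' j
  -- Both functions have the coset of Q as their zeros, so they differ by a constant factor. Then
  -- the two resolvents are proportional, and comparing their eigenvalues ξ⁻¹ and ξ'⁻¹ under
  -- translation by P gives ξ = ξ'.
  obtain ⟨b, hb⟩ := dvd_of_card_eq_natDegree_norm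
    (fun h0 ↦ notMem_of_mem_coset hQ h0 (zero_mem _)) ha0 hs
    (by rw [← Finset.card_pos, card_coset hP]; omega) (by rw [hdeg, card_coset hP]) hs'
  have hvb : CoordinateRing.infValuation W b ≤ exp 1 := by
    have h1 := congrArg (CoordinateRing.infValuation W) hb
    rw [map_mul, CoordinateRing.infValuation_apply ha0, CoordinateRing.infValuation_apply ha0', hdeg,
      hdeg', left_eq_mul₀ exp_ne_zero] at h1
    rw [h1, ← exp_zero, exp_le_exp]
    norm_num
  obtain ⟨c, rfl⟩ := CoordinateRing.exists_eq_algebraMap_of_infValuation_le hvb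
  have hPl : (2 * m + 1) • P = 0 := by rw [← hP, addOrderOf_nsmul_eq_zero]
  have hd : halfProduct W.FunctionField m P ≠ 0 := by
    intro h0
    have := infValuation_halfProduct (L := W.FunctionField) m P
    rw [h0, _root_.map_zero] at this
    exact exp_ne_zero this.symm
  have hg : FunctionField.resolvent W.FunctionField (2 * m + 1) P ξ' =
      algebraMap K _ c * FunctionField.resolvent W.FunctionField (2 * m + 1) P ξ := by
    have h1 := congrArg (algebraMap W.CoordinateRing W.FunctionField) hb
    rw [map_mul, ha, ha', ← IsScalarTower.algebraMap_apply] at h1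
    refine mul_right_cancel₀ hd ?_
    rw [h1]
    ring
  have hg0 : FunctionField.resolvent W.FunctionField (2 * m + 1) P ξ' ≠ 0 := by
    intro h0
    rw [h0, zero_mul] at ha'
    exact ha0' ((FaithfulSMul.algebraMap_injective W.CoordinateRing W.FunctionField) (by rw [ha', _root_.map_zero]))
  have h1 := translation_resolvent (L := W.FunctionField) hPl hξ' (by omega)
  rw [hg, map_mul, AlgHom.commutes, translation_resolvent hPl hξ (by omega), mul_left_comm, ← hg] at h1
  have h2 := (algebraMap K W.FunctionField).injective (mul_right_cancel₀ hg0 h1)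
  exact inv_injective h2

end

end Point

end WeierstrassCurve.Affine

/-! ### Transfer of the resolvents to separably closed fields -/

namespace WeierstrassCurve.Affine.Point

set_option linter.unusedSectionVars false

variable {K : Type*} [Field K] {W : Affine K}

section Map

variable {K' : Type*} [Field K'] {W' : Affine K'}

open Classical in
/-- Compatibility of a homomorphism on points with an embedding of fields. -/
structure IsCoordMap (f : K →+* K') (φ : W.Point →+ W'.Point) : Prop where
  map_a₁ : f W.a₁ = W'.a₁
  map_a₃ : f W.a₃ = W'.a₃
  xCoord : ∀ P, (φ P).xCoord = f P.xCoord
  yCoord : ∀ P, (φ P).yCoord = f P.yCoord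

open Classical in
lemma IsCoordMap.resolvent {f : K →+* K'} {φ : W.Point →+ W'.Point} (h : IsCoordMap f φ) (l : ℕ)
    (P : W.Point) (ξ : K) (Q : W.Point) :
    resolvent l (φ P) (f ξ) (φ Q) = f (resolvent l P ξ Q) := by
  simp only [Point.resolvent, slopeValue, negY, map_sum, map_mul, map_pow, map_div₀, map_sub,
    map_neg, ← map_nsmul, ← map_add, h.xCoord, h.yCoord, h.map_a₁, h.map_a₃]

open Classical in
lemma isCoordMap_mapField (f : K →+* K') : IsCoordMap f (mapField (W := W) f) where
  map_a₁ := rfl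
  map_a₃ := rfl
  xCoord P := by
    rcases P with _ | ⟨x, y, h⟩
    · exact (_root_.map_zero f).symm
    · rfl
  yCoord P := by
    rcases P with _ | ⟨x, y, h⟩
    · exact (_root_.map_zero f).symm
    · rfl

end Map

open Classical in
lemma map_mem_zmultiples_iff {G H : Type*} [AddGroup G] [AddGroup H] {φ : G →+ H}
    (hφ : Function.Injective φ) {P Q : G} :
    φ Q ∈ AddSubgroup.zmultiples (φ P) ↔ Q ∈ AddSubgroup.zmultiples P := by
  rw [← AddMonoidHom.map_zmultiples, AddSubgroup.mem_map_iff_mem hφ]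

section SepClosed

variable [IsSepClosed K] [W.IsElliptic]

open Classical in
-- Both fields have exactly n² points killed by n, so the injection between these sets is bijective:
-- torsion prime to the characteristic appears over any separably closed field.
lemma exists_mapField_eq {L : Type*} [Field L] [IsSepClosed L] (f : K →+* L) {n : ℕ}
    (hn : (n : K) ≠ 0) {Q : (W.map f).Point} (hQ : n • Q = 0) : ∃ P, n • P = 0 ∧ mapField f P = Q := by
  have hn' : (n : L) ≠ 0 := by
    rw [← map_natCast f]
    exact (_root_.map_ne_zero f).mpr hn
  have h1 := card_ker_nsmul (W := W) hn
  have h2 := card_ker_nsmul (W := W.map f) hn'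
  have hn0 : n ≠ 0 := by
    rintro rfl
    simp at hn
  have hfin : Finite (nsmulAddMonoidHom (α := (W.map f).Point) n).ker :=
    Nat.finite_of_card_ne_zero (by rw [h2]; positivity)
  let g : (nsmulAddMonoidHom (α := W.Point) n).ker → (nsmulAddMonoidHom (α := (W.map f).Point) n).ker :=
    fun P ↦ ⟨mapField f P, by
      have : n • (P : W.Point) = 0 := P.2
      change n • mapField f (P : W.Point) = 0
      rw [← map_nsmul, this, _root_.map_zero]⟩
  have hg : Function.Bijective g := by
    refine (Nat.bijective_iff_injective_and_card g).mpr ⟨fun P P' h ↦ ?_, h1.trans h2.symm⟩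
    exact Subtype.ext (mapField_injective f (congrArg Subtype.val h))
  obtain ⟨P, hP⟩ := hg.2 ⟨Q, hQ⟩
  exact ⟨P, P.2, congrArg Subtype.val hP⟩

open Classical in
-- The zero found over the algebraic closure is a torsion point of order prime to the
-- characteristic, hence already defined over K.
theorem exists_resolvent_eq_zero_of_isSepClosed {m : ℕ} (hm : m ≠ 0)
    (hmK : ((2 * m + 1 : ℕ) : K) ≠ 0) {P : W.Point} (hP : addOrderOf P = 2 * m + 1) {ξ : K}
    (hξ : ξ ^ (2 * m + 1) = 1) (hξ1 : ξ ≠ 1) : ∃ Q ∉ AddSubgroup.zmultiples P,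
    resolvent (2 * m + 1) P ξ Q = 0 ∧ (2 * m + 1) • Q = 0 := by
  let f := algebraMap K (AlgebraicClosure K)
  have hinj := mapField_injective (W := W) f
  obtain ⟨Q, hQ, hQ0, hQl⟩ := exists_resolvent_eq_zero (W := W.map f) hm (P := mapField f P) (ξ := f ξ)
    (by rw [addOrderOf_injective _ hinj, hP]) (by rw [← map_pow, hξ, map_one])
    (fun h ↦ hξ1 (f.injective (by rw [h, map_one])))
  obtain ⟨Q, hQl', rfl⟩ := exists_mapField_eq f hmK hQl
  refine ⟨Q, fun h ↦ hQ ((map_mem_zmultiples_iff hinj).mpr h), ?_, hQl'⟩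
  rw [(isCoordMap_mapField f).resolvent] at hQ0
  exact f.injective (by rw [hQ0, _root_.map_zero])

open Classical in
lemma resolvent_add_nsmul_of_isSepClosed {m : ℕ} {P : W.Point} (hP : addOrderOf P = 2 * m + 1)
    (hm : m ≠ 0) {ξ : K} (hξ : ξ ^ (2 * m + 1) = 1) {Q : W.Point}
    (hQ : Q ∉ AddSubgroup.zmultiples P) (h : resolvent (2 * m + 1) P ξ Q = 0) (j : ℕ) :
    resolvent (2 * m + 1) P ξ (Q + j • P) = 0 := by
  let f := algebraMap K (AlgebraicClosure K)
  have hinj := mapField_injective (W := W) f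
  rw [← map_mem_zmultiples_iff hinj] at hQ
  refine f.injective ?_
  rw [← (isCoordMap_mapField f).resolvent, _root_.map_zero, map_add, map_nsmul]
  refine resolvent_add_nsmul (W := W.map f) (by rw [addOrderOf_injective _ hinj, hP]) hm
    (by rw [← map_pow, hξ, map_one]) hQ ?_ j
  rw [(isCoordMap_mapField f).resolvent, h, _root_.map_zero]

open Classical in
theorem sub_mem_of_resolvent_eq_zero_of_isSepClosed {m : ℕ} (hm : m ≠ 0)
    {P : W.Point} (hP : addOrderOf P = 2 * m + 1) {ξ : K}
    (hξ : ξ ^ (2 * m + 1) = 1) (hξ1 : ξ ≠ 1) {Q Q' : W.Point} (hQ : Q ∉ AddSubgroup.zmultiples P)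
    (hQ' : Q' ∉ AddSubgroup.zmultiples P) (h : resolvent (2 * m + 1) P ξ Q = 0)
    (h' : resolvent (2 * m + 1) P ξ Q' = 0) : Q' - Q ∈ AddSubgroup.zmultiples P := by
  let f := algebraMap K (AlgebraicClosure K)
  have hinj := mapField_injective (W := W) f
  rw [← map_mem_zmultiples_iff hinj] at hQ hQ' ⊢
  rw [map_sub]
  refine sub_mem_of_resolvent_eq_zero (W := W.map f) hm (ξ := f ξ)
    (by rw [addOrderOf_injective _ hinj, hP]) (by rw [← map_pow, hξ, map_one])
    (fun h ↦ hξ1 (f.injective (by rw [h, map_one]))) hQ hQ' ?_ ?_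
  · rw [(isCoordMap_mapField f).resolvent, h, _root_.map_zero]
  · rw [(isCoordMap_mapField f).resolvent, h', _root_.map_zero]

open Classical in
theorem eq_of_resolvent_eq_zero_of_isSepClosed {m : ℕ} (hm : m ≠ 0)
    {P : W.Point} (hP : addOrderOf P = 2 * m + 1) {ξ ξ' : K}
    (hξ : ξ ^ (2 * m + 1) = 1) (hξ1 : ξ ≠ 1) (hξ' : ξ' ^ (2 * m + 1) = 1) (hξ1' : ξ' ≠ 1)
    {Q : W.Point} (hQ : Q ∉ AddSubgroup.zmultiples P) (h : resolvent (2 * m + 1) P ξ Q = 0)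
    (h' : resolvent (2 * m + 1) P ξ' Q = 0) : ξ = ξ' := by
  let f := algebraMap K (AlgebraicClosure K)
  have hinj := mapField_injective (W := W) f
  rw [← map_mem_zmultiples_iff hinj] at hQ
  refine f.injective (eq_of_resolvent_eq_zero (W := W.map f) hm (ξ := f ξ)
    (by rw [addOrderOf_injective _ hinj, hP]) (by rw [← map_pow, hξ, map_one])
    (fun h ↦ hξ1 (f.injective (by rw [h, map_one]))) (by rw [← map_pow, hξ', map_one])
    (fun h ↦ hξ1' (f.injective (by rw [h, map_one]))) hQ ?_ ?_)
  · rw [(isCoordMap_mapField f).resolvent, h, _root_.map_zero]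
  · rw [(isCoordMap_mapField f).resolvent, h', _root_.map_zero]

end SepClosed

end WeierstrassCurve.Affine.Point

/-! ### Weierstrass equations of discriminant zero -/

namespace WeierstrassCurve.Affine

open Polynomial

variable {K : Type*} [Field K]

/-- A Weierstrass curve with vanishing discriminant has a singular point. -/
lemma exists_singular_of_Δ_eq_zero [IsAlgClosed K] (W : Affine K)
    (hΔ : WeierstrassCurve.Δ W = 0) : ∃ a b : K, W.Equation a b ∧
      W.a₁ * b = 3 * a ^ 2 + 2 * W.a₂ * a + W.a₄ ∧ 2 * b + W.a₁ * a + W.a₃ = 0 := by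
  by_cases h2 : (2 : K) = 0
  · have : CharP K 2 := CharTwo.of_one_ne_zero_of_two_eq_zero one_ne_zero h2
    have hΔ' := WeierstrassCurve.Δ_of_char_two W
    rw [hΔ, WeierstrassCurve.b₈] at hΔ'
    by_cases h1 : W.a₁ = 0
    · have h3 : W.a₃ = 0 := by
        rw [h1] at hΔ'
        simpa using hΔ'.symm
      obtain ⟨a, ha⟩ := IsAlgClosed.exists_pow_nat_eq W.a₄ two_pos
      obtain ⟨b, hb⟩ := IsAlgClosed.exists_pow_nat_eq
        (a ^ 3 + W.a₂ * a ^ 2 + W.a₄ * a + W.a₆) two_pos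
      refine ⟨a, b, ?_, ?_, ?_⟩
      · rw [equation_iff, h1, h3, hb]
        ring
      · rw [h1, ← ha]
        linear_combination (-W.a₂ * a - 2 * a ^ 2) * h2
      · rw [h1, h3, h2]
        ring
    -- For a₁ ≠ 0 in characteristic 2 the vanishing of the two partial derivatives determines (a,
    -- b). The error `e` in the curve equation satisfies Δ = a₁⁶e modulo 2, so it vanishes.
    · obtain ⟨a, ha⟩ : ∃ a, W.a₃ = W.a₁ * a := ⟨W.a₃ / W.a₁, by field_simp⟩
      obtain ⟨b, hb⟩ : ∃ b, W.a₄ = W.a₁ * b - 3 * a ^ 2 - 2 * W.a₂ * a :=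
        ⟨(W.a₄ + 3 * a ^ 2 + 2 * W.a₂ * a) / W.a₁, by field_simp; ring⟩
      obtain ⟨e, he⟩ : ∃ e, W.a₆ = b ^ 2 + W.a₁ * a * b + W.a₃ * b - a ^ 3 - W.a₂ * a ^ 2 -
        W.a₄ * a - e := ⟨_, (sub_sub_cancel _ _).symm⟩
      have he0 : W.a₁ ^ 6 * e = 0 := by
        rw [he, hb, ha] at hΔ'
        linear_combination -hΔ' + (W.a₁ ^ 6 * e - (-2 * W.a₁ ^ 4 * e * W.a₂ +
          2 * W.a₁ ^ 4 * b ^ 2 * W.a₂ - 2 * W.a₁ ^ 4 * a ^ 3 * W.a₂ - 4 * W.a₁ ^ 4 * a ^ 4 +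
          4 * W.a₁ ^ 5 * b * a * W.a₂ + 3 * W.a₁ ^ 5 * b * a ^ 2 + 2 * W.a₁ ^ 6 * a ^ 2 * W.a₂ +
          3 * W.a₁ ^ 6 * a ^ 3)) * h2
      have he0 : e = 0 := (mul_eq_zero.mp he0).resolve_left (pow_ne_zero 6 h1)
      refine ⟨a, b, ?_, ?_, ?_⟩
      · rw [equation_iff, he, he0]
        ring
      · rw [hb]
        ring
      · rw [ha]
        linear_combination (b + W.a₁ * a) * h2
  · have h4 : (4 : K) ≠ 0 := by
      rw [show (4 : K) = 2 * 2 by norm_num]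
      exact mul_ne_zero h2 h2
    obtain ⟨x, y, z, hxyz⟩ := (Cubic.splits_iff_roots_eq_three (P := W.twoTorsionPolynomial)
      (φ := RingHom.id K) h4).mp (IsAlgClosed.splits _)
    have hb := Cubic.b_eq_three_roots h4 hxyz
    have hc := Cubic.c_eq_three_roots h4 hxyz
    have hd := Cubic.d_eq_three_roots h4 hxyz
    have hdisc := Cubic.discr_eq_prod_three_roots h4 hxyz
    rw [twoTorsionPolynomial_discr, hΔ] at hdisc
    simp only [RingHom.id_apply, twoTorsionPolynomial] at hb hc hd hdisc
    -- A double root a of the 2-torsion cubic gives the singular point, with b the fixed point −(a₁a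
    -- + a₃)/2 of negation.
    have key (a c : K) (hb' : W.b₂ = 4 * -(a + a + c)) (hc' : 2 * W.b₄ = 4 * (a * a + a * c + a * c))
        (hd' : W.b₆ = 4 * -(a * a * c)) : ∃ a b : K, W.Equation a b ∧
        W.a₁ * b = 3 * a ^ 2 + 2 * W.a₂ * a + W.a₄ ∧ 2 * b + W.a₁ * a + W.a₃ = 0 := by
      obtain ⟨b, hb₀⟩ : ∃ b, 2 * b = -(W.a₁ * a + W.a₃) := ⟨-(W.a₁ * a + W.a₃) / 2, by field_simp⟩
      rw [WeierstrassCurve.b₂] at hb'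
      rw [WeierstrassCurve.b₄] at hc'
      rw [WeierstrassCurve.b₆] at hd'
      refine ⟨a, b, ?_, ?_, by linear_combination hb₀⟩
      · rw [equation_iff]
        refine mul_left_cancel₀ h4 ?_
        linear_combination (2 * b + W.a₁ * a + W.a₃) * hb₀ - a ^ 2 * hb' - a * hc' - hd'
      · refine mul_left_cancel₀ h4 ?_
        linear_combination 2 * W.a₁ * hb₀ - 2 * a * hb' - hc'
    rcases pow_eq_zero_iff two_ne_zero |>.mp (hdisc.symm.trans (mul_zero _)) |> mul_eq_zero.mp with h | h
    · rcases mul_eq_zero.mp h with h | h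
      · rcases mul_eq_zero.mp h with h | h
        · exact absurd h (mul_ne_zero h4 h4)
        · obtain rfl := sub_eq_zero.mp h
          exact key x z (by linear_combination hb) (by linear_combination hc)
            (by linear_combination hd)
      · obtain rfl := sub_eq_zero.mp h
        exact key x y (by linear_combination hb) (by linear_combination hc)
          (by linear_combination hd)
    · obtain rfl := sub_eq_zero.mp h
      exact key y x (by linear_combination hb) (by linear_combination hc)
        (by linear_combination hd)

end WeierstrassCurve.Affine

/-! ### The Weierstrass equation of the quotient by a finite subgroup -/

namespace WeierstrassCurve.Affine

set_option linter.unusedSectionVars false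

open Polynomial WithZero

variable {K : Type*} [Field K] {W : Affine K}

namespace FunctionField

variable {L : Type*} [Field L] [Algebra W.CoordinateRing L] [IsFractionRing W.CoordinateRing L]
  [Algebra K L] [IsScalarTower K W.CoordinateRing L] [W.IsElliptic] [IsAlgClosed K]

local notation "v" => infValuation W L
local notation "κ" => algebraMap K L

open Classical

variable {S : AddSubgroup W.Point}

namespace IsInvariantRegular

variable {f g : L}

lemma const (S : AddSubgroup W.Point) (c : K) : IsInvariantRegular S (κ c) :=
  ⟨fun _ _ ↦ AlgHom.commutes _ c, fun Q _ ↦ valAt_algebraMap_le c Q⟩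

lemma sub (hf : IsInvariantRegular S f) (hg : IsInvariantRegular S g) :
    IsInvariantRegular S (f - g) :=
  ⟨fun R hR ↦ by rw [map_sub, hf.translation_eq R hR, hg.translation_eq R hR],
    fun Q hQ ↦ Valuation.map_sub_le _ (hf.valAt_le Q hQ) (hg.valAt_le Q hQ)⟩

lemma mul (hf : IsInvariantRegular S f) (hg : IsInvariantRegular S g) :
    IsInvariantRegular S (f * g) :=
  ⟨fun R hR ↦ by rw [map_mul, hf.translation_eq R hR, hg.translation_eq R hR],
    fun Q hQ ↦ by rw [map_mul]; exact mul_le_one' (hf.valAt_le Q hQ) (hg.valAt_le Q hQ)⟩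

lemma pow (hf : IsInvariantRegular S f) (n : ℕ) : IsInvariantRegular S (f ^ n) := by
  induction n with
  | zero => simpa using const (L := L) S (1 : K)
  | succ n ih => rw [pow_succ]; exact ih.mul hf

variable [Fintype S]

lemma sum_translation {a : L} (ha : ∀ Q : W.Point, Q ≠ 0 → valAt L Q a ≤ 1) :
    IsInvariantRegular S (∑ R : S, translation (R : W.Point) a) where
  translation_eq T hT := by
    rw [map_sum]
    refine Fintype.sum_equiv (Equiv.addLeft (⟨T, hT⟩ : S)) _ _ fun R ↦ ?_
    rw [translation_translation]
    rfl
  valAt_le Q hQ := by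
    refine Valuation.map_sum_le _ fun R _ ↦ ?_
    rw [valAt_translation]
    exact ha _ fun h ↦ hQ (by rw [eq_neg_of_add_eq_zero_left h]; exact neg_mem R.2)

lemma prod_translation {a : L} (ha : ∀ Q : W.Point, Q ≠ 0 → valAt L Q a ≤ 1) :
    IsInvariantRegular S (∏ R : S, translation (R : W.Point) a) where
  translation_eq T hT := by
    rw [map_prod]
    refine Fintype.prod_equiv (Equiv.addLeft (⟨T, hT⟩ : S)) _ _ fun R ↦ ?_
    rw [translation_translation]
    rfl
  valAt_le Q hQ := by
    rw [map_prod]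
    refine Finset.prod_le_one' fun R _ ↦ ?_
    rw [valAt_translation]
    exact ha _ fun h ↦ hQ (by rw [eq_neg_of_add_eq_zero_left h]; exact neg_mem R.2)

end IsInvariantRegular

lemma valAt_genX_le {Q : W.Point} (hQ : Q ≠ 0) : valAt L Q (genX W L) ≤ 1 :=
  valAt_algebraMap_le_one hQ _

lemma valAt_genY_le {Q : W.Point} (hQ : Q ≠ 0) : valAt L Q (genY W L) ≤ 1 :=
  valAt_algebraMap_le_one hQ _

section Quotient

variable [Fintype S]

lemma infValuation_sum_translation_sub {a : L} (ha : ∀ Q : W.Point, Q ≠ 0 → valAt L Q a ≤ 1) :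
    v (∑ R : S, translation (R : W.Point) a - a) ≤ 1 := by
  rw [← Finset.add_sum_erase _ _ (Finset.mem_univ (0 : S)), ZeroMemClass.coe_zero, translation_zero,
    AlgHom.id_apply, add_sub_cancel_left]
  refine Valuation.map_sum_le _ fun R hR ↦ ha R fun h ↦ ?_
  exact Finset.ne_of_mem_erase hR (Subtype.ext h)

variable (L S)

/-- The `x`-coordinate on the quotient by `S`. -/
noncomputable def quotX : L := ∑ R : S, translation (R : W.Point) (genX W L)

/-- The `y`-coordinate on the quotient by `S`. -/
noncomputable def quotY : L := ∑ R : S, translation (R : W.Point) (genY W L)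

lemma isInvariantRegular_quotX : IsInvariantRegular S (quotX L S) :=
  .sum_translation fun _ ↦ valAt_genX_le

lemma isInvariantRegular_quotY : IsInvariantRegular S (quotY L S) :=
  .sum_translation fun _ ↦ valAt_genY_le

lemma infValuation_quotX_sub : v (quotX L S - genX W L) ≤ 1 :=
  infValuation_sum_translation_sub fun _ ↦ valAt_genX_le

lemma infValuation_quotY_sub : v (quotY L S - genY W L) ≤ 1 :=
  infValuation_sum_translation_sub fun _ ↦ valAt_genY_le

lemma infValuation_quotX : v (quotX L S) = exp 2 := by
  rw [← infValuation_genX (W := W) (L := L)]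
  refine Valuation.map_eq_of_sub_lt _ ((infValuation_quotX_sub L S).trans_lt ?_)
  rw [infValuation_genX, ← exp_zero, exp_lt_exp]
  norm_num

lemma infValuation_quotY : v (quotY L S) = exp 3 := by
  rw [← infValuation_genY (W := W) (L := L)]
  refine Valuation.map_eq_of_sub_lt _ ((infValuation_quotY_sub L S).trans_lt ?_)
  rw [infValuation_genY, ← exp_zero, exp_lt_exp]
  norm_num

variable {L S}

lemma exists_sub_le {n : ℤ} {f g : L} (hg : v g = exp n) (hf : v f ≤ exp n) :
    ∃ c : K, v (f - κ c * g) ≤ exp (n - 1) := by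
  have hg0 : g ≠ 0 := by
    rintro rfl
    rw [map_zero] at hg
    exact exp_ne_zero hg.symm
  obtain ⟨c, hc⟩ := exists_infValuation_sub_lt hg0 (hf.trans_eq hg.symm)
  exact ⟨c, le_exp_of_lt_exp (hc.trans_eq hg) (by ring)⟩

variable (hodd : Odd (Nat.card S)) (hn : (Nat.card S : K) ≠ 0)

include hodd hn

/-- Riemann–Roch in low degree on the quotient: subtracting a multiple of `quotX` leaves a pole of
order at most one, hence a constant. -/
lemma IsInvariantRegular.exists_eq_of_le_two {f : L} (hf : IsInvariantRegular S f)
    (h : v f ≤ exp 2) : ∃ b c : K, f = κ b * quotX L S + κ c := by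
  obtain ⟨b, hb⟩ := exists_sub_le (infValuation_quotX L S) h
  obtain ⟨c, hc⟩ := (hf.sub ((IsInvariantRegular.const S b).mul
    (isInvariantRegular_quotX L S))).exists_eq_const hodd hn hb
  exact ⟨b, c, by rw [hc]; ring⟩

lemma IsInvariantRegular.exists_eq_of_le_three {f : L} (hf : IsInvariantRegular S f)
    (h : v f ≤ exp 3) : ∃ a b c : K, f = κ a * quotY L S + κ b * quotX L S + κ c := by
  obtain ⟨a, ha⟩ := exists_sub_le (infValuation_quotY L S) h
  obtain ⟨b, c, hbc⟩ := (hf.sub ((IsInvariantRegular.const S a).mul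
    (isInvariantRegular_quotY L S))).exists_eq_of_le_two hodd hn ha
  exact ⟨a, b, c, by rw [add_assoc, ← hbc]; ring⟩

variable (L) in
/-- The coordinates on the quotient satisfy a Weierstrass equation. -/
lemma exists_equation_quot : ∃ W' : Affine K, (W'.baseChange L).Equation (quotX L S) (quotY L S) := by
  set X := quotX L S with hX
  set Z := quotY L S with hY
  have hMX := isInvariantRegular_quotX L S
  have hMY := isInvariantRegular_quotY L S
  have vX : v X = exp 2 := infValuation_quotX L S
  have vY : v Z = exp 3 := infValuation_quotY L S
  have dX : v (X - genX W L) ≤ 1 := infValuation_quotX_sub L S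
  have dY : v (Z - genY W L) ≤ 1 := infValuation_quotY_sub L S
  have vx : v (genX W L) = exp 2 := infValuation_genX
  have vy : v (genY W L) = exp 3 := infValuation_genY
  have e1 : genY W L ^ 2 + κ W.a₁ * genX W L * genY W L + κ W.a₃ * genY W L =
    genX W L ^ 3 + κ W.a₂ * genX W L ^ 2 + κ W.a₄ * genX W L + κ W.a₆ :=
    (equation_iff _ _).mp (equation_gen (W := W) (L := L))
  have hXX : v (X ^ 2) = exp 4 := by rw [map_pow, vX, ← exp_nsmul]; rfl
  have hXY : v (X * Z) = exp 5 := by rw [map_mul, vX, vY, ← exp_add]; rfl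
  -- `X` and `Z` differ from x and y by functions regular at infinity, so the cancellation of
  -- leading terms in y² − x³ persists. The remaining poles of order 5 and 4 are then removed by
  -- multiples of XZ and X².
  have h0 : v (Z ^ 2 - X ^ 3) ≤ exp 5 := by
    have h1 : Z ^ 2 - X ^ 3 = (Z - genY W L) * (Z + genY W L) -
        (X - genX W L) * (X ^ 2 + X * genX W L + genX W L ^ 2) +
        (κ W.a₂ * genX W L ^ 2 + κ W.a₄ * genX W L + κ W.a₆ - κ W.a₃ * genY W L -
          κ W.a₁ * (genX W L * genY W L)) := by
      linear_combination e1
    have le (m n : ℤ) (h : m ≤ n) : exp m ≤ exp n := exp_le_exp.mpr h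
    rw [h1]
    refine Valuation.map_add_le _ (Valuation.map_sub_le _ ?_ ?_) (Valuation.map_sub_le _
      (Valuation.map_sub_le _ (Valuation.map_add_le _ (Valuation.map_add_le _ ?_ ?_) ?_) ?_) ?_)
    · rw [map_mul]
      refine (mul_le_of_le_one_left' dY).trans (Valuation.map_add_le _ ?_ ?_)
      · rw [vY]; exact le _ _ (by norm_num)
      · rw [vy]; exact le _ _ (by norm_num)
    · rw [map_mul]
      refine (mul_le_of_le_one_left' dX).trans (Valuation.map_add_le _ (Valuation.map_add_le _ ?_ ?_) ?_)
      · rw [hXX]; exact le _ _ (by norm_num)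
      · rw [map_mul, vX, vx, ← exp_add]; exact le _ _ (by norm_num)
      · rw [map_pow, vx, ← exp_nsmul]; exact le _ _ (by norm_num)
    · refine infValuation_algebraMap_mul_le ?_
      rw [map_pow, vx, ← exp_nsmul]; exact le _ _ (by norm_num)
    · refine infValuation_algebraMap_mul_le ?_
      rw [vx]; exact le _ _ (by norm_num)
    · refine (infValuation_algebraMap_field_le _).trans ?_
      rw [← exp_zero]; exact le _ _ (by norm_num)
    · refine infValuation_algebraMap_mul_le ?_
      rw [vy]; exact le _ _ (by norm_num)
    · refine infValuation_algebraMap_mul_le ?_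
      rw [map_mul, vx, vy, ← exp_add]; exact le _ _ (by norm_num)
  obtain ⟨c₁, h1⟩ := exists_sub_le hXY h0
  obtain ⟨c₂, h2⟩ := exists_sub_le hXX h1
  obtain ⟨c₃, c₄, c₆, h3⟩ := IsInvariantRegular.exists_eq_of_le_three hodd hn
    ((((hMY.pow 2).sub (hMX.pow 3)).sub ((IsInvariantRegular.const S c₁).mul (hMX.mul hMY))).sub
      ((IsInvariantRegular.const S c₂).mul (hMX.pow 2))) h2
  refine ⟨⟨-c₁, c₂, -c₃, c₄, c₆⟩, (equation_iff _ _).mpr ?_⟩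
  change Z ^ 2 + κ (-c₁) * X * Z + κ (-c₃) * Z = X ^ 3 + κ c₂ * X ^ 2 + κ c₄ * X + κ c₆
  rw [map_neg, map_neg]
  linear_combination h3

/-- The Weierstrass equation of the quotient is nonsingular. -/
lemma isElliptic_of_equation_quot {W' : Affine K}
    (h : (W'.baseChange L).Equation (quotX L S) (quotY L S)) : W'.IsElliptic := by
  refine ⟨isUnit_iff_ne_zero.mpr fun hΔ ↦ ?_⟩
  obtain ⟨a, b, hab, h1, h2⟩ := exists_singular_of_Δ_eq_zero W' hΔ
  set X := quotX L S with hX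
  set Z := quotY L S with hY
  have hMX := isInvariantRegular_quotX L S
  have hMY := isInvariantRegular_quotY L S
  have e1 : Z ^ 2 + κ W'.a₁ * X * Z + κ W'.a₃ * Z =
    X ^ 3 + κ W'.a₂ * X ^ 2 + κ W'.a₄ * X + κ W'.a₆ := (equation_iff _ _).mp h
  have e2 := congrArg κ ((equation_iff _ _).mp hab)
  have e3 := congrArg κ h1
  have e4 := congrArg κ h2
  simp only [map_add, map_mul, map_pow, map_ofNat, map_zero] at e2 e3 e4
  have vX : v (X - κ a) = exp 2 := by
    rw [Valuation.map_sub_eq_of_lt_left, infValuation_quotX]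
    rw [infValuation_quotX]
    exact (infValuation_algebraMap_field_le a).trans_lt (by rw [← exp_zero, exp_lt_exp]; norm_num)
  have vY : v (Z - κ b) = exp 3 := by
    rw [Valuation.map_sub_eq_of_lt_left, infValuation_quotY]
    rw [infValuation_quotY]
    exact (infValuation_algebraMap_field_le b).trans_lt (by rw [← exp_zero, exp_lt_exp]; norm_num)
  have hX0 : X - κ a ≠ 0 := by
    intro h0
    rw [h0, map_zero] at vX
    exact exp_ne_zero vX.symm
  -- The slope from a singular point satisfies a monic quadratic equation over K[X], so it is
  -- regular wherever `X` is. It would be an invariant function with simple poles along S, but such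
  -- a function is constant.
  set t : L := (Z - κ b) / (X - κ a) with ht
  have hvt : v t = exp 1 := by
    rw [ht, map_div₀, vX, vY, ← exp_sub]
    norm_num
  have hteq : t * (t + κ W'.a₁) = X - κ a + κ (3 * a + W'.a₂) := by
    rw [ht, map_add, map_mul, map_ofNat]
    field_simp
    linear_combination e1 - e2 - (X - κ a) * e3 - (Z - κ b) * e4
  have hMt : IsInvariantRegular S t := by
    refine ⟨fun R hR ↦ ?_, fun Q hQ ↦ ?_⟩
    · rw [ht, map_div₀, map_sub, map_sub, AlgHom.commutes, AlgHom.commutes,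
        hMX.translation_eq R hR, hMY.translation_eq R hR]
    · by_contra! hlt
      have h5 : valAt L Q (t + κ W'.a₁) = valAt L Q t :=
        Valuation.map_add_eq_of_lt_left _ ((valAt_algebraMap_le _ Q).trans_lt hlt)
      have h6 := congrArg (valAt L Q) hteq
      rw [map_mul, h5] at h6
      have h7 : valAt L Q (X - κ a + κ (3 * a + W'.a₂)) ≤ 1 :=
        Valuation.map_add_le _ (Valuation.map_sub_le _ (hMX.valAt_le Q hQ) (valAt_algebraMap_le _ Q))
          (valAt_algebraMap_le _ Q)
      rw [← h6] at h7
      exact absurd (hlt.trans_le (le_mul_of_one_le_right' hlt.le)) h7.not_gt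
  obtain ⟨c, hc⟩ := hMt.exists_eq_const hodd hn hvt.le
  have := infValuation_algebraMap_field_le (W := W) (L := L) c
  rw [hc, hvt, ← exp_zero, exp_le_exp] at this
  norm_num at this

end Quotient

end FunctionField

end WeierstrassCurve.Affine

/-! ### The quotient map is a homomorphism -/

namespace WeierstrassCurve.Affine

set_option linter.unusedSectionVars false

open Polynomial WithZero

variable {K : Type*} [Field K] {W : Affine K}

namespace Point

/-- The line through two points with distinct `x`-coordinates, and the points on it. -/
lemma exists_line [DecidableEq K] {P Q : W.Point} (hP : P ≠ 0) (hQ : Q ≠ 0)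
    (hPQ : P.xCoord ≠ Q.xCoord) : ∃ m c : K,
      (∀ R : W.Point, R ≠ 0 → R.yCoord = m * R.xCoord + c → R = P ∨ R = Q ∨ R = -(P + Q)) ∧
      P.yCoord = m * P.xCoord + c ∧ Q.yCoord = m * Q.xCoord + c ∧
      (-(P + Q)).yCoord = m * (-(P + Q)).xCoord + c := by
  rcases P with _ | ⟨x₁, y₁, h₁⟩
  · exact absurd rfl hP
  rcases Q with _ | ⟨x₂, y₂, h₂⟩
  · exact absurd rfl hQ
  replace hPQ : x₁ ≠ x₂ := hPQ
  have hxy : ¬(x₁ = x₂ ∧ y₁ = W.negY x₂ y₂) := fun h ↦ hPQ h.1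
  rw [add_of_X_ne' hPQ, neg_neg]
  have hs := slope_of_X_ne (W := W) (y₁ := y₁) (y₂ := y₂) hPQ
  have hadd := addPolynomial_slope h₁.1 h₂.1 hxy
  set m := W.slope x₁ x₂ y₁ y₂
  have hs' : m * (x₁ - x₂) = y₁ - y₂ := by
    rw [hs, div_mul_cancel₀ _ (sub_ne_zero.mpr hPQ)]
  refine ⟨m, y₁ - m * x₁, ?_, ?_, ?_, ?_⟩
  · rintro (_ | ⟨x, y, h⟩) hR hy
    · exact absurd rfl hR
    simp only [yCoord_some, xCoord_some] at hy
    have hy' : y = m * (x - x₁) + y₁ := by rw [hy]; ring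
    have h0 : Polynomial.eval x (W.addPolynomial x₁ y₁ m) = 0 := by
      have h3 := (equation_iff x y).mp h.1
      rw [addPolynomial_eq]
      simp only [Cubic.toPoly, Polynomial.eval_neg, Polynomial.eval_add,
        Polynomial.eval_mul, eval_C, Polynomial.eval_pow, eval_X]
      rw [hy'] at h3
      linear_combination h3
    rw [hadd] at h0
    simp only [Polynomial.eval_neg, Polynomial.eval_mul, Polynomial.eval_sub, eval_X, eval_C, neg_eq_zero, mul_eq_zero, sub_eq_zero,
      or_assoc] at h0
    rcases h0 with h0 | h0 | h0
    · left
      simp only [some.injEq]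
      exact ⟨h0, by rw [hy', h0]; ring⟩
    · right; left
      simp only [some.injEq]
      exact ⟨h0, by rw [hy', h0]; linear_combination -hs'⟩
    · right; right
      simp only [some.injEq]
      exact ⟨h0, by rw [hy', h0, negAddY]⟩
  · simp only [yCoord_some, xCoord_some]; ring
  · simp only [yCoord_some, xCoord_some]; linear_combination hs'
  · simp only [yCoord_some, xCoord_some, negAddY]; ring

lemma add_eq_neg_of_collinear [DecidableEq K] {P Q R : W.Point} (hP : P ≠ 0) (hQ : Q ≠ 0)
    (hR : R ≠ 0) (hPQ : P.xCoord ≠ Q.xCoord) (hPR : R.xCoord ≠ P.xCoord)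
    (hQR : R.xCoord ≠ Q.xCoord) {a b c : K} (ha : a ≠ 0)
    (h₁ : a * P.yCoord + b * P.xCoord + c = 0) (h₂ : a * Q.yCoord + b * Q.xCoord + c = 0)
    (h₃ : a * R.yCoord + b * R.xCoord + c = 0) : P + Q = -R := by
  obtain ⟨m, d, hm, hmP, hmQ, -⟩ := exists_line hP hQ hPQ
  have hb : b = -(a * m) := by
    refine mul_right_cancel₀ (sub_ne_zero.mpr hPQ) ?_
    linear_combination h₁ - h₂ - a * hmP + a * hmQ
  have hc : c = -(a * d) := by
    linear_combination h₁ - P.xCoord * hb - a * hmP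
  rcases hm R hR (mul_left_cancel₀ ha (by linear_combination h₃ - R.xCoord * hb - hc)) with h | h | h
  · exact absurd (congrArg xCoord h) hPR
  · exact absurd (congrArg xCoord h) hQR
  · rw [h, neg_neg]

lemma yCoord_neg {P : W.Point} (hP : P ≠ 0) :
    (-P).yCoord = -P.yCoord - W.a₁ * P.xCoord - W.a₃ := by
  rcases P with _ | ⟨x, y, h⟩
  · exact absurd rfl hP
  · rfl

section Quotient

open Classical

variable (S : AddSubgroup W.Point) [Fintype S]

/-- The sum of the `x`-coordinates on a coset. -/
noncomputable def sumX (Q : W.Point) : K := ∑ R : S, (Q + R).xCoord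

/-- The sum of the `y`-coordinates on a coset. -/
noncomputable def sumY (Q : W.Point) : K := ∑ R : S, (Q + R).yCoord

lemma sumX_neg (Q : W.Point) : sumX S (-Q) = sumX S Q := by
  refine Fintype.sum_equiv (Equiv.neg S) _ _ fun R ↦ ?_
  rw [← xCoord_neg]
  congr 1
  simp [add_comm]

lemma sumY_neg {Q : W.Point} (hQ : Q ∉ S) :
    sumY S (-Q) = -sumY S Q - W.a₁ * sumX S Q - Nat.card S * W.a₃ := by
  have h : sumY S (-Q) = ∑ R : S, (-(Q + R)).yCoord := by
    refine Fintype.sum_equiv (Equiv.neg S) _ _ fun R ↦ ?_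
    congr 1
    simp [add_comm]
  rw [h, sumX, sumY, Finset.mul_sum, Finset.sum_congr rfl fun (R : S) _ ↦ yCoord_neg
    (fun h ↦ hQ (by rw [eq_neg_of_add_eq_zero_left h]; exact neg_mem R.2)),
    Finset.sum_sub_distrib, Finset.sum_sub_distrib, Finset.sum_neg_distrib, Finset.sum_const,
    nsmul_eq_mul, Nat.card_eq_fintype_card, Finset.card_univ]

variable {S}

lemma sumX_add {Q T : W.Point} (hT : T ∈ S) : sumX S (Q + T) = sumX S Q := by
  refine Fintype.sum_equiv (Equiv.addLeft (⟨T, hT⟩ : S)) _ _ fun R ↦ ?_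
  rw [add_assoc]
  rfl

lemma sumY_add {Q T : W.Point} (hT : T ∈ S) : sumY S (Q + T) = sumY S Q := by
  refine Fintype.sum_equiv (Equiv.addLeft (⟨T, hT⟩ : S)) _ _ fun R ↦ ?_
  rw [add_assoc]
  rfl

end Quotient

end Point

lemma CoordinateRing.finite_setOf_eval_eq_zero
    {a : W.CoordinateRing} (ha : a ≠ 0) : {Q : W.Point | Q ≠ 0 ∧ Q.eval a = 0}.Finite := by
  have hN : Algebra.norm K[X] a ≠ 0 := Algebra.norm_ne_zero_iff.mpr ha
  refine (Point.finite_setOf_xCoord_mem (W := W) (rootSet_finite (Algebra.norm K[X] a) K)).subset ?_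
  rintro (_ | ⟨x, y, h⟩) ⟨hQ, h0⟩
  · exact absurd rfl hQ
  refine ⟨hQ, ?_⟩
  rw [mem_rootSet]
  refine ⟨hN, ?_⟩
  obtain ⟨b, hb⟩ := CoordinateRing.dvd_algebraMap_norm a
  have h1 := congrArg (CoordinateRing.evalAt h.1) hb
  have h2 : CoordinateRing.evalAt h.1 a = 0 := h0
  rw [map_mul, h2, zero_mul] at h1
  have h3 : algebraMap K[X] W.CoordinateRing (Algebra.norm K[X] a) =
    CoordinateRing.mk W (C (Algebra.norm K[X] a)) := rfl
  rw [h3, CoordinateRing.evalAt_mk, evalEval_C] at h1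
  simpa using h1

namespace FunctionField

variable {L : Type*} [Field L] [Algebra W.CoordinateRing L] [IsFractionRing W.CoordinateRing L]
  [Algebra K L] [IsScalarTower K W.CoordinateRing L] [W.IsElliptic] [IsAlgClosed K]

local notation "v" => infValuation W L
local notation "κ" => algebraMap K L

lemma finite_setOf_valAt_lt_one {f : L} (hf : f ≠ 0) : {Q : W.Point | valAt L Q f < 1}.Finite := by
  obtain ⟨a, b, hb, rfl⟩ := IsFractionRing.div_surjective (A := W.CoordinateRing) f
  have hb0 := nonZeroDivisors.ne_zero hb
  have ha0 : a ≠ 0 := by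
    rintro rfl
    simp at hf
  refine ((CoordinateRing.finite_setOf_eval_eq_zero ha0).insert 0).subset fun Q hQ ↦ ?_
  by_cases hQ0 : Q = 0
  · exact .inl hQ0
  refine .inr ⟨hQ0, ?_⟩
  rw [← Point.mem_ideal_iff, mem_ideal_iff_valAt (L := L) hQ0]
  rw [Set.mem_ofPred_eq, map_div₀, div_lt_one₀ (by
    rw [zero_lt_iff, Valuation.ne_zero_iff]
    simpa using hb0)] at hQ
  exact hQ.trans_le (valAt_algebraMap_le_one hQ0 b)

lemma finite_setOf_hasValueAt_zero {f : L} (hf : f ≠ 0) : {Q : W.Point | HasValueAt Q f 0}.Finite := by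
  simp_rw [hasValueAt_zero_iff]
  exact finite_setOf_valAt_lt_one hf

lemma eq_zero_of_hasValueAt_zero {f : L} {s : Set W.Point} (hs : s.Finite)
    (h : ∀ Q ∉ s, HasValueAt Q f 0) : f = 0 := by
  by_contra hf
  exact (hs.infinite_compl.mono h) (finite_setOf_hasValueAt_zero hf)

section Quotient

open Classical

variable {S : AddSubgroup W.Point} [Fintype S]

open Point

omit [Fintype S] [W.IsElliptic] [IsAlgClosed K] in
lemma add_ne_zero_of_notMem {Q : W.Point} (hQ : Q ∉ S) (R : S) : Q + R ≠ 0 :=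
  fun h ↦ hQ (by rw [eq_neg_of_add_eq_zero_left h]; exact neg_mem R.2)

lemma hasValueAt_quotX {Q : W.Point} (hQ : Q ∉ S) : HasValueAt Q (quotX L S) (sumX S Q) :=
  .sum _ fun R _ ↦ (hasValueAt_genX_xCoord (add_ne_zero_of_notMem hQ R)).translation

lemma hasValueAt_quotY {Q : W.Point} (hQ : Q ∉ S) : HasValueAt Q (quotY L S) (sumY S Q) :=
  .sum _ fun R _ ↦ (hasValueAt_genY_yCoord (add_ne_zero_of_notMem hQ R)).translation

variable {W' : Affine K} (hW' : (W'.baseChange L).Equation (quotX L S) (quotY L S))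

include hW'

lemma equation_sum {Q : W.Point} (hQ : Q ∉ S) : W'.Equation (sumX S Q) (sumY S Q) := by
  have hX := hasValueAt_quotX (L := L) hQ
  have hY := hasValueAt_quotY (L := L) hQ
  have e : quotY L S ^ 2 + κ W'.a₁ * quotX L S * quotY L S + κ W'.a₃ * quotY L S =
    quotX L S ^ 3 + κ W'.a₂ * quotX L S ^ 2 + κ W'.a₄ * quotX L S + κ W'.a₆ :=
    (equation_iff _ _).mp hW'
  refine (equation_iff _ _).mpr (HasValueAt.unique (L := L) (Q := Q)
    (f := quotY L S ^ 2 + κ W'.a₁ * quotX L S * quotY L S + κ W'.a₃ * quotY L S) ?_ ?_)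
  · exact ((hY.pow 2).add (((HasValueAt.const Q _).mul hX).mul hY)).add
      ((HasValueAt.const Q _).mul hY)
  · rw [e]
    exact (((hX.pow 3).add ((HasValueAt.const Q _).mul (hX.pow 2))).add
      ((HasValueAt.const Q _).mul hX)).add (HasValueAt.const Q _)

/-- Needed for the quotient map to commute with negation. Evaluating at −Q shows that Z' = −Z − a₁X
− |S|a₃ is also a root of the quadratic equation for Z; if it is the other root, the coefficients
agree. -/
lemma quot_neg_eq (hn : (Nat.card S : K) ≠ 0) : W'.a₁ = W.a₁ ∧ W'.a₃ = Nat.card S * W.a₃ := by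
  set X' := quotX L S with hX'
  set Z := quotY L S with hZ
  set Z' := -Z - κ W.a₁ * X' - κ (Nat.card S * W.a₃) with hZ'
  have e : Z ^ 2 + κ W'.a₁ * X' * Z + κ W'.a₃ * Z =
    X' ^ 3 + κ W'.a₂ * X' ^ 2 + κ W'.a₄ * X' + κ W'.a₆ := (equation_iff _ _).mp hW'
  have hfin : (S : Set W.Point).Finite := Set.toFinite _
  have e' : Z' ^ 2 + κ W'.a₁ * X' * Z' + κ W'.a₃ * Z' -
      (X' ^ 3 + κ W'.a₂ * X' ^ 2 + κ W'.a₄ * X' + κ W'.a₆) = 0 := by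
    refine eq_zero_of_hasValueAt_zero hfin fun Q hQ ↦ ?_
    have hQ : Q ∉ S := hQ
    have hQ' : -Q ∉ S := fun h ↦ hQ (neg_mem_iff.mp h)
    have hX := hasValueAt_quotX (L := L) hQ
    have hY : HasValueAt Q Z' (sumY S (-Q)) := by
      rw [sumY_neg S hQ]
      exact ((hasValueAt_quotY hQ).neg.sub ((HasValueAt.const Q _).mul hX)).sub
        (HasValueAt.const Q _)
    have h0 := (equation_iff _ _).mp (equation_sum hW' hQ')
    rw [sumX_neg] at h0
    rw [← sub_eq_zero.mpr h0]
    exact (((hY.pow 2).add (((HasValueAt.const Q _).mul hX).mul hY)).add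
      ((HasValueAt.const Q _).mul hY)).sub ((((hX.pow 3).add ((HasValueAt.const Q _).mul (hX.pow 2))).add
      ((HasValueAt.const Q _).mul hX)).add (HasValueAt.const Q _))
  have vX : v X' = exp 2 := infValuation_quotX L S
  have vZ : v Z = exp 3 := infValuation_quotY L S
  have lin (a b : K) (h : κ a * X' + κ b = 0) : a = 0 ∧ b = 0 := by
    have ha : a = 0 := by
      by_contra ha
      have h1 := congrArg v (eq_neg_of_add_eq_zero_left h)
      rw [map_mul, Valuation.map_neg, vX, infValuation_algebraMap_field ha, one_mul] at h1
      have := h1.trans_le (infValuation_algebraMap_field_le b)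
      rw [← exp_zero, exp_le_exp] at this
      norm_num at this
    rw [ha, _root_.map_zero, zero_mul, zero_add] at h
    exact ⟨ha, by simpa using h⟩
  have hmul : (Z' - Z) * (Z' + Z + κ W'.a₁ * X' + κ W'.a₃) = 0 := by
    linear_combination e' - e
  rcases mul_eq_zero.mp hmul with h | h
  -- If Z' = Z, the pole order of 2Z forces characteristic 2, then a₁ = a₃ = 0, and the curve would
  -- be singular.
  · exfalso
    have h2 : (2 : K) = 0 := by
      by_contra h2
      have h1 : κ 2 * Z = -(κ W.a₁ * X' + κ (Nat.card S * W.a₃)) := by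
        rw [map_ofNat]
        linear_combination -h
      have h3 := congrArg v h1
      rw [map_mul, infValuation_algebraMap_field h2, one_mul, vZ, Valuation.map_neg] at h3
      have h4 : v (κ W.a₁ * X' + κ (Nat.card S * W.a₃)) ≤ exp 2 := by
        refine Valuation.map_add_le _ (infValuation_algebraMap_mul_le vX.le) ?_
        refine (infValuation_algebraMap_field_le _).trans ?_
        rw [← exp_zero, exp_le_exp]
        norm_num
      rw [← h3, exp_le_exp] at h4
      norm_num at h4
    have h2' : (2 : L) = 0 := by rw [← map_ofNat κ, h2, _root_.map_zero]
    obtain ⟨h1, h3⟩ := lin W.a₁ (Nat.card S * W.a₃) (by linear_combination -h - Z * h2')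
    have h4 := (mul_eq_zero.mp h3).resolve_left hn
    refine W.isUnit_Δ.ne_zero ?_
    rw [Δ, b₂, b₄, b₆, h1, h4]
    linear_combination (-8 * W.a₂ ^ 2 * W.b₈ - 32 * W.a₄ ^ 3 - 216 * W.a₆ ^ 2 + 144 * W.a₂ * W.a₄ * W.a₆) * h2
  · obtain ⟨h1, h3⟩ := lin (W'.a₁ - W.a₁) (W'.a₃ - Nat.card S * W.a₃) (by
      rw [map_sub, map_sub]
      linear_combination h)
    exact ⟨sub_eq_zero.mp h1, sub_eq_zero.mp h3⟩

omit hW' in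
lemma finite_setOf_sumX_eq (c : K) : {Q : W.Point | Q ∉ S ∧ sumX S Q = c}.Finite := by
  refine (finite_setOf_hasValueAt_zero (L := W.FunctionField)
    (f := quotX W.FunctionField S - algebraMap K _ c) ?_).subset ?_
  · intro h
    have := congrArg (infValuation W W.FunctionField) (sub_eq_zero.mp h)
    rw [infValuation_quotX] at this
    have h1 := this.trans_le (infValuation_algebraMap_field_le c)
    rw [← exp_zero, exp_le_exp] at h1
    norm_num at h1
  · rintro Q ⟨hQ, rfl⟩
    rw [Set.mem_ofPred_eq, ← sub_self (sumX S Q)]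
    exact (hasValueAt_quotX hQ).sub (.const _ _)

omit hW' in
-- The translate of `quotX` by P ∉ S is regular at 0, while `quotX` has a pole there, so their
-- difference is not the zero function.
lemma finite_setOf_sumX_add_eq {P : W.Point} (hP : P ∉ S) :
    {Q : W.Point | Q ∉ S ∧ P + Q ∉ S ∧ sumX S (P + Q) = sumX S Q}.Finite := by
  refine (finite_setOf_hasValueAt_zero (L := W.FunctionField)
    (f := translation P (quotX W.FunctionField S) - quotX W.FunctionField S) ?_).subset ?_
  · intro h
    have := congrArg (infValuation W W.FunctionField) (sub_eq_zero.mp h)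
    rw [infValuation_quotX, ← valAt_zero, valAt_translation, zero_add] at this
    have h1 := this.symm.trans_le ((isInvariantRegular_quotX W.FunctionField S).valAt_le P hP)
    rw [← exp_zero, exp_le_exp] at h1
    norm_num at h1
  · rintro Q ⟨hQ, hPQ, h⟩
    rw [Set.mem_ofPred_eq, ← sub_self (sumX S Q)]
    nth_rw 1 [← h]
    rw [add_comm] at hPQ ⊢
    exact ((hasValueAt_quotX hPQ).translation).sub (hasValueAt_quotX hQ)

omit hW' in
/-- Points on a line have images on a line. -/
lemma exists_collinear_sum (hodd : Odd (Nat.card S)) (hn : (Nat.card S : K) ≠ 0) {P Q : W.Point}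
    (hP : P ∉ S) (hQ : Q ∉ S) (hPQ : P + Q ∉ S) (hx : P.xCoord ≠ Q.xCoord) :
    ∃ a b c : K, a ≠ 0 ∧ a * sumY S P + b * sumX S P + c = 0 ∧
      a * sumY S Q + b * sumX S Q + c = 0 ∧
      a * sumY S (-(P + Q)) + b * sumX S (-(P + Q)) + c = 0 := by
  have hP0 : P ≠ 0 := fun h ↦ hP (h ▸ S.zero_mem)
  have hQ0 : Q ≠ 0 := fun h ↦ hQ (h ▸ S.zero_mem)
  obtain ⟨m, d, hline, hmP, hmQ, hmR⟩ := exists_line hP0 hQ0 hx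
  have hR : -(P + Q) ∉ S := fun h ↦ hPQ (neg_mem_iff.mp h)
  let k := algebraMap K W.FunctionField
  set f : W.FunctionField := genY W W.FunctionField - k m * genX W W.FunctionField - k d with hf
  have hval {T : W.Point} (hT : T ≠ 0) : HasValueAt T f (T.yCoord - m * T.xCoord - d) :=
    ((hasValueAt_genY_yCoord hT).sub ((HasValueAt.const T m).mul (hasValueAt_genX_xCoord hT))).sub
      (.const T d)
  -- The product of the translates of the line function is the norm of the line to the quotient. Its
  -- pole at 0 has order 3, as the line meets S nowhere in the affine part; hence it is aY + bX + c
  -- with a ≠ 0, and it vanishes at the images of the three points.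
  have hreg : IsInvariantRegular S (∏ R : S, translation (R : W.Point) f) :=
    .prod_translation fun T hT ↦ (hval hT).le_one
  have hv0 : infValuation W W.FunctionField f = exp 3 := by
    rw [hf, sub_sub, Valuation.map_sub_eq_of_lt_left, infValuation_genY]
    rw [infValuation_genY]
    refine Valuation.map_add_lt _ ?_ ?_
    · exact (infValuation_algebraMap_mul_le infValuation_genX.le).trans_lt
        (by rw [exp_lt_exp]; norm_num)
    · exact (infValuation_algebraMap_field_le d).trans_lt (by rw [← exp_zero, exp_lt_exp]; norm_num)
  have hv : infValuation W W.FunctionField (∏ R : S, translation (R : W.Point) f) = exp 3 := by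
    rw [map_prod, ← Finset.mul_prod_erase _ _ (Finset.mem_univ (0 : S)), ZeroMemClass.coe_zero,
      translation_zero, AlgHom.id_apply, hv0, Finset.prod_eq_one, mul_one]
    intro R hR
    have hR0 : (R : W.Point) ≠ 0 := fun h ↦ Finset.ne_of_mem_erase hR (Subtype.ext h)
    rw [← valAt_zero, valAt_translation, zero_add]
    refine (hval hR0).valAt_eq_one fun h0 ↦ ?_
    rcases hline R hR0 (by linear_combination h0) with h | h | h
    · exact hP (h ▸ R.2)
    · exact hQ (h ▸ R.2)
    · exact hPQ (neg_mem_iff.mp (h ▸ R.2))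
  obtain ⟨a, b, c, habc⟩ := hreg.exists_eq_of_le_three hodd hn hv.le
  have hzero {T : W.Point} (hT : T ∉ S) (hm : T.yCoord = m * T.xCoord + d) :
      a * sumY S T + b * sumX S T + c = 0 := by
    have h1 : HasValueAt T (∏ R : S, translation (R : W.Point) f)
        (∏ R : S, ((T + R).yCoord - m * (T + R).xCoord - d)) :=
      .prod _ fun R _ ↦ (hval (add_ne_zero_of_notMem hT R)).translation
    have h2 : ∏ R : S, ((T + R).yCoord - m * (T + R).xCoord - d) = 0 :=
      Finset.prod_eq_zero (Finset.mem_univ (0 : S)) (by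
        rw [ZeroMemClass.coe_zero, add_zero, hm]; ring)
    rw [h2, habc] at h1
    refine HasValueAt.unique ?_ h1
    exact (((HasValueAt.const T a).mul (hasValueAt_quotY hT)).add
      ((HasValueAt.const T b).mul (hasValueAt_quotX hT))).add (.const T c)
  refine ⟨a, b, c, ?_, hzero hP hmP, hzero hQ hmQ, hzero hR hmR⟩
  rintro rfl
  rw [habc, _root_.map_zero, zero_mul, zero_add] at hv
  have h1 : infValuation W W.FunctionField (k b * quotX W.FunctionField S + k c) ≤ exp 2 := by
    refine Valuation.map_add_le _ (infValuation_algebraMap_mul_le (infValuation_quotX _ S).le) ?_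
    exact (infValuation_algebraMap_field_le c).trans (by rw [← exp_zero, exp_le_exp]; norm_num)
  have h2 := hv.symm.trans_le h1
  rw [exp_le_exp] at h2
  norm_num at h2

omit hW' in
-- Additivity outside finite sets is enough: for generic c, expand f(a + b + c) in two ways and
-- cancel f(c).
lemma _root_.AddMonoidHom.exists_of_finite_setOf_map_add_ne {G H : Type*} [AddCommGroup G]
    [Infinite G] [AddCommGroup H] (f : G → H) (hf : ∀ a, {b | f (a + b) ≠ f a + f b}.Finite) :
    ∃ φ : G →+ H, ⇑φ = f := by
  refine ⟨AddMonoidHom.mk' f fun a b ↦ ?_, rfl⟩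
  have h3 : {c | f (a + (b + c)) ≠ f a + f (b + c)}.Finite :=
    (hf a).preimage (add_right_injective b).injOn
  obtain ⟨c, hc⟩ := (((hf (a + b)).union (hf b)).union h3).infinite_compl.nonempty
  simp only [Set.mem_compl_iff, Set.mem_union, Set.mem_ofPred_eq, not_or, not_not] at hc
  obtain ⟨⟨h1, h2⟩, h4⟩ := hc
  rw [h2, ← add_assoc, h1, ← add_assoc] at h4
  exact add_right_cancel h4

/-- The quotient map by a finite subgroup of odd order is a homomorphism. -/
theorem exists_quotientHom [W'.IsElliptic] (hodd : Odd (Nat.card S)) (hn : (Nat.card S : K) ≠ 0) :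
    ∃ φ : W.Point →+ W'.Point, φ.ker = S ∧
      ∀ Q ∉ S, (φ Q).xCoord = sumX S Q ∧ (φ Q).yCoord = sumY S Q := by
  let f (Q : W.Point) : W'.Point :=
    if hQ : Q ∈ S then 0 else .some _ _ (equation_iff_nonsingular.mp (equation_sum hW' hQ))
  have hf0 {Q : W.Point} (hQ : Q ∈ S) : f Q = 0 := dif_pos hQ
  have hf1 {Q : W.Point} (hQ : Q ∉ S) : f Q ≠ 0 := by
    simp only [f, dif_neg hQ]
    exact some_ne_zero _
  have hfx {Q : W.Point} (hQ : Q ∉ S) : (f Q).xCoord = sumX S Q := by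
    simp only [f, dif_neg hQ, xCoord_some]
  have hfy {Q : W.Point} (hQ : Q ∉ S) : (f Q).yCoord = sumY S Q := by
    simp only [f, dif_neg hQ, yCoord_some]
  obtain ⟨hn1, hn3⟩ := quot_neg_eq hW' hn
  have ext' {A B : W'.Point} (hA : A ≠ 0) (hB : B ≠ 0) (hx : A.xCoord = B.xCoord)
      (hy : A.yCoord = B.yCoord) : A = B := by
    rcases A with _ | ⟨x, y, h⟩
    · exact absurd rfl hA
    rcases B with _ | ⟨x', y', h'⟩
    · exact absurd rfl hB
    simp only [xCoord_some, yCoord_some] at hx hy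
    simp only [some.injEq]
    exact ⟨hx, hy⟩
  have hneg {Q : W.Point} (hQ : Q ∉ S) : f (-Q) = -f Q := by
    have hQ' : -Q ∉ S := fun h ↦ hQ (neg_mem_iff.mp h)
    refine ext' (hf1 hQ') (neg_ne_zero.mpr (hf1 hQ)) ?_ ?_
    · rw [xCoord_neg, hfx hQ, hfx hQ', sumX_neg]
    · rw [yCoord_neg (hf1 hQ), hfx hQ, hfy hQ', hfy hQ, sumY_neg S hQ, hn1, hn3]
  have hadd (P : W.Point) : {Q | f (P + Q) ≠ f P + f Q}.Finite := by
    by_cases hP : P ∈ S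
    · refine (Set.toFinite (S : Set W.Point)).subset fun Q hQ ↦ ?_
      by_contra hQS
      have hQS : Q ∉ S := hQS
      have hPQ : P + Q ∉ S := fun h ↦ hQS ((add_mem_cancel_left hP).mp h)
      refine hQ ?_
      rw [hf0 hP, zero_add]
      refine ext' (hf1 hPQ) (hf1 hQS) ?_ ?_
      · rw [hfx hPQ, hfx hQS, add_comm, sumX_add (S := S) hP]
      · rw [hfy hPQ, hfy hQS, add_comm, sumY_add (S := S) hP]
    -- Outside these finitely many Q the images of P, Q and P + Q are affine with distinct
    -- x-coordinates, so collinearity determines their sum.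
    · have hfin : (S : Set W.Point).Finite := Set.toFinite _
      refine ((((((hfin.union (hfin.preimage (add_right_injective P).injOn)).union
        (finite_setOf_xCoord_eq P.xCoord)).union (finite_setOf_sumX_eq (S := S) (sumX S P))).union
        ((finite_setOf_sumX_eq (S := S) (sumX S P)).preimage (add_right_injective P).injOn)).union
        (finite_setOf_sumX_add_eq hP))).subset fun Q hQ ↦ ?_
      by_contra hbad
      simp only [Set.mem_union, Set.mem_preimage, Set.mem_ofPred_eq, not_or, SetLike.mem_coe,
        not_and] at hbad
      obtain ⟨⟨⟨⟨⟨hQS, hPQ⟩, hx⟩, h1⟩, h2⟩, h3⟩ := hbad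
      have hR : -(P + Q) ∉ S := fun h ↦ hPQ (neg_mem_iff.mp h)
      obtain ⟨a, b, c, ha, e1, e2, e3⟩ := exists_collinear_sum hodd hn hP hQS hPQ
        (fun h ↦ hx (fun h0 ↦ hQS (h0 ▸ S.zero_mem)) h.symm)
      have := add_eq_neg_of_collinear (hf1 hP) (hf1 hQS) (hf1 hR) (a := a) (b := b) (c := c)
        (by rw [hfx hP, hfx hQS]; exact fun h ↦ h1 hQS h.symm)
        (by rw [hfx hP, hfx hR, sumX_neg]; exact h2 hPQ)
        (by rw [hfx hR, hfx hQS, sumX_neg]; exact h3 hQS hPQ) ha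
        (by rw [hfx hP, hfy hP, e1]) (by rw [hfx hQS, hfy hQS, e2]) (by rw [hfx hR, hfy hR, e3])
      refine hQ ?_
      rw [this, hneg hPQ, neg_neg]
  obtain ⟨φ, hφ⟩ := AddMonoidHom.exists_of_finite_setOf_map_add_ne f hadd
  refine ⟨φ, ?_, fun Q hQ ↦ ?_⟩
  · ext Q
    rw [AddMonoidHom.mem_ker, hφ]
    exact ⟨fun h ↦ by_contra fun hQ ↦ hf1 hQ h, hf0⟩
  · rw [hφ]
    exact ⟨hfx hQ, hfy hQ⟩

end Quotient

end FunctionField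

end WeierstrassCurve.Affine

/-! ### Values of functions defined over a subfield -/

namespace WeierstrassCurve.Affine

set_option linter.unusedSectionVars false

open Polynomial

section Eval

variable {K : Type*} [Field K] {W : Affine K}

lemma Point.eval_some {x y : K} (h : W.Nonsingular x y) (a : W.CoordinateRing) :
    (Point.some x y h).eval a = CoordinateRing.evalAt h.1 a := rfl

lemma Point.eval_smul_basis {Q : W.Point} (hQ : Q ≠ 0) (p q : K[X]) :
    Q.eval (p • (1 : W.CoordinateRing) + q • CoordinateRing.mk W Y) =
      p.eval Q.xCoord + q.eval Q.xCoord * Q.yCoord := by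
  rcases Q with _ | ⟨x, y, h⟩
  · exact absurd rfl hQ
  rw [Point.eval_some, CoordinateRing.smul, CoordinateRing.smul, mul_one, map_add, map_mul, CoordinateRing.evalAt_mk,
    CoordinateRing.evalAt_mk, CoordinateRing.evalAt_mk, evalEval_C, evalEval_C, evalEval_X]
  rfl

lemma Point.sub_yCoord_neg_sq {Q : W.Point} (hQ : Q ≠ 0) :
    (Q.yCoord - (-Q).yCoord) ^ 2 = W.Ψ₂Sq.eval Q.xCoord := by
  rcases Q with _ | ⟨x, y, h⟩
  · exact absurd rfl hQ
  · exact h.1.sub_negY_sq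

/-- A regular function which is invariant under negation is a polynomial in `x`. -/
lemma CoordinateRing.exists_eq_algebraMap_of_eval_neg [W.IsElliptic] [IsSepClosed K]
    {a : W.CoordinateRing} (h : {Q : W.Point | Q.eval a ≠ (-Q).eval a}.Finite) :
    ∃ p : K[X], a = algebraMap K[X] _ p := by
  obtain ⟨p, q, rfl⟩ := exists_smul_basis_eq a
  suffices hq : q = 0 by
    refine ⟨p, ?_⟩
    rw [hq, zero_smul, add_zero, Algebra.algebraMap_eq_smul_one]
  by_contra hq
  have h1 := Point.finite_setOf_eval_eq_zero (W := W) hq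
  have h2 := Point.finite_setOf_eval_eq_zero (W := W) W.Ψ₂Sq_ne_zero_of_isElliptic
  obtain ⟨Q, hQ⟩ := (((Set.finite_singleton 0).union h).union (h1.union h2)).infinite_compl.nonempty
  simp only [Set.mem_compl_iff, Set.mem_union, Set.mem_singleton_iff, Set.mem_ofPred_eq, not_or,
    not_and, not_not] at hQ
  obtain ⟨⟨hQ0, e⟩, hq0, hΨ⟩ := hQ
  have hQ0' : -Q ≠ 0 := fun h ↦ hQ0 ((neg_neg Q).symm.trans (congrArg _ h))
  rw [Point.eval_smul_basis hQ0, Point.eval_smul_basis hQ0', Point.xCoord_neg] at e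
  have e' : q.eval Q.xCoord * (Q.yCoord - (-Q).yCoord) = 0 := by linear_combination e
  have := (mul_eq_zero.mp e').resolve_left (hq0 hQ0)
  exact hΨ hQ0 (by rw [← Point.sub_yCoord_neg_sq hQ0, this, zero_pow two_ne_zero])

end Eval

section Value

variable {F : Type*} [Field F] {V : Affine F} {K : Type*} [Field K] [Algebra F K]

variable (V K) in
/-- Extension of scalars for regular functions. -/
noncomputable def CoordinateRing.baseChange :
    V.CoordinateRing →+* (V.baseChange K).CoordinateRing :=
  CoordinateRing.map V (algebraMap F K)

lemma CoordinateRing.baseChange_injective : Function.Injective (CoordinateRing.baseChange V K) :=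
  CoordinateRing.map_injective (algebraMap F K).injective

lemma CoordinateRing.baseChange_mk (f : F[X][Y]) : CoordinateRing.baseChange V K (mk V f) =
    mk (V.baseChange K) (f.map (mapRingHom (algebraMap F K))) :=
  CoordinateRing.map_mk _ _

lemma CoordinateRing.baseChange_smul_basis (p q : F[X]) :
    CoordinateRing.baseChange V K (p • (1 : V.CoordinateRing) + q • CoordinateRing.mk V Y) =
      p.map (algebraMap F K) • (1 : (V.baseChange K).CoordinateRing) +
        q.map (algebraMap F K) • CoordinateRing.mk (V.baseChange K) Y := by
  rw [map_add]
  refine congr_arg₂ _ ((CoordinateRing.map_smul _ _ _).trans ?_)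
    ((CoordinateRing.map_smul _ _ _).trans ?_)
  · exact congrArg _ (map_one (CoordinateRing.map V (algebraMap F K)))
  · exact congrArg _ ((CoordinateRing.baseChange_mk _).trans (by rw [map_X]))

namespace Point

/-- The value of a regular function at a point over an extension field. -/
noncomputable def value (Q : (V.baseChange K).Point) (a : V.CoordinateRing) : K :=
  Q.eval (CoordinateRing.baseChange V K a)

lemma exists_ringHom_value {Q : (V.baseChange K).Point} (hQ : Q ≠ 0) :
    ∃ g : V.CoordinateRing →+* K, ∀ a, Q.value a = g a := by
  rcases Q with _ | ⟨x, y, h⟩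
  · exact absurd rfl hQ
  · exact ⟨(CoordinateRing.evalAt h.1).toRingHom.comp (CoordinateRing.baseChange V K),
      fun _ ↦ rfl⟩

lemma value_mk_some {x y : K} (h : (V.baseChange K).Nonsingular x y) (f : F[X][Y]) :
    (some x y h).value (CoordinateRing.mk V f) = aevalAeval x y f := by
  rw [value, eval_some, CoordinateRing.baseChange_mk, CoordinateRing.evalAt_mk, ← coe_evalEvalRingHom, ← coe_mapRingHom,
    ← RingHom.comp_apply]
  refine RingHom.congr_fun (g := (aevalAeval x y : F[X][Y] →ₐ[F] K).toRingHom) ?_ f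
  ext <;> simp

lemma value_smul_basis {Q : (V.baseChange K).Point} (hQ : Q ≠ 0) (p q : F[X]) :
    Q.value (p • (1 : V.CoordinateRing) + q • CoordinateRing.mk V Y) =
      aeval Q.xCoord p + aeval Q.xCoord q * Q.yCoord := by
  rw [value, CoordinateRing.baseChange_smul_basis, eval_smul_basis hQ, eval_map_algebraMap, eval_map_algebraMap]

lemma value_algebraMap {Q : (V.baseChange K).Point} (hQ : Q ≠ 0) (p : F[X]) :
    Q.value (algebraMap F[X] V.CoordinateRing p) = aeval Q.xCoord p := by
  rw [Algebra.algebraMap_eq_smul_one]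
  simpa using value_smul_basis hQ p 0

end Point

variable [IsSepClosed K] [V.IsElliptic]

lemma CoordinateRing.finite_setOf_value_eq_zero {a : V.CoordinateRing} (ha : a ≠ 0) :
    {Q : (V.baseChange K).Point | Q ≠ 0 ∧ Q.value a = 0}.Finite :=
  finite_setOf_eval_eq_zero fun h ↦ ha
    (CoordinateRing.baseChange_injective (h.trans (map_zero _).symm))

lemma CoordinateRing.eq_of_value_eq {a b : V.CoordinateRing} {s : Set (V.baseChange K).Point}
    (hs : s.Finite) (h : ∀ Q ∉ s, Q ≠ 0 → Q.value a = Q.value b) : a = b := by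
  by_contra hab
  have h1 := finite_setOf_value_eq_zero (K := K) (sub_ne_zero.mpr hab)
  obtain ⟨Q, hQ⟩ := (((Set.finite_singleton 0).union hs).union h1).infinite_compl.nonempty
  simp only [Set.mem_compl_iff, Set.mem_union, Set.mem_singleton_iff, Set.mem_ofPred_eq, not_or,
    not_and] at hQ
  refine hQ.2 hQ.1.1 ?_
  obtain ⟨g, hg⟩ := Point.exists_ringHom_value hQ.1.1
  have := h Q hQ.1.2 hQ.1.1
  rw [hg, hg] at this
  rw [hg, map_sub, this, sub_self]

lemma CoordinateRing.exists_eq_algebraMap_of_value_neg {a : V.CoordinateRing}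
    (h : {Q : (V.baseChange K).Point | Q.value a ≠ (-Q).value a}.Finite) :
    ∃ p : F[X], a = algebraMap F[X] _ p := by
  obtain ⟨P, hP⟩ := exists_eq_algebraMap_of_eval_neg h
  obtain ⟨p, q, rfl⟩ := exists_smul_basis_eq a
  refine ⟨p, ?_⟩
  rw [baseChange_smul_basis] at hP
  have h0 : (p.map (algebraMap F K) - P) • (1 : (V.baseChange K).CoordinateRing) +
      q.map (algebraMap F K) • CoordinateRing.mk (V.baseChange K) Y = 0 := by
    rw [sub_smul, sub_add_eq_add_sub, hP, Algebra.algebraMap_eq_smul_one, sub_self]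
  have hq := (smul_basis_eq_zero h0).2
  rw [Polynomial.map_eq_zero_iff (algebraMap F K).injective] at hq
  rw [hq, zero_smul, add_zero, Algebra.algebraMap_eq_smul_one]

end Value

end WeierstrassCurve.Affine

/-! ### Degrees of subfields of the function field -/

section FieldTheory

open Polynomial IntermediateField

lemma Polynomial.natDegree_eq_of_isCoprime_of_mul_eq {F : Type*} [Field F] {a b c d : F[X]}
    (hab : IsCoprime a b) (hcd : IsCoprime c d) (h : a * d = c * b) :
    a.natDegree = c.natDegree ∧ b.natDegree = d.natDegree := by
  have aux {p q : F[X]} (h1 : p ∣ q) (h2 : q ∣ p) : p.natDegree = q.natDegree :=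
    natDegree_eq_of_degree_eq (degree_eq_degree_of_associated (associated_of_dvd_dvd h1 h2))
  exact ⟨aux (hab.dvd_of_dvd_mul_right ⟨d, h.symm⟩) (hcd.dvd_of_dvd_mul_right ⟨b, h⟩),
    aux (hab.symm.dvd_of_dvd_mul_left ⟨c, by rw [h, mul_comm]⟩)
      (hcd.symm.dvd_of_dvd_mul_left ⟨a, by rw [← h, mul_comm]⟩)⟩

variable {F : Type*} [Field F] {M : Type*} [Field M] [Algebra F M]

lemma IntermediateField.relfinrank_adjoin_pair {x y : M} (hy : y ∉ F⟮x⟯) {b c : M} (hb : b ∈ F⟮x⟯)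
    (hc : c ∈ F⟮x⟯) (h : y ^ 2 + b * y + c = 0) : relfinrank F⟮x⟯ (adjoin F {x, y}) = 2 := by
  have h1 : adjoin F {x, y} = (adjoin F⟮x⟯ {y}).restrictScalars F := by
    rw [adjoin_adjoin_left]
    rfl
  have hle : F⟮x⟯ ≤ adjoin F {x, y} := adjoin.mono _ _ _ (by simp)
  have h2 : extendScalars hle = F⟮x⟯⟮y⟯ := by
    apply restrictScalars_injective F
    rw [extendScalars_restrictScalars, h1]
  rw [relfinrank_eq_finrank_of_le hle, h2]
  set p : F⟮x⟯[X] := X ^ 2 + C ⟨b, hb⟩ * X + C ⟨c, hc⟩ with hp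
  have hdeg : p.natDegree = 2 := by
    have := natDegree_quadratic (R := F⟮x⟯) (a := 1) (b := ⟨b, hb⟩) (c := ⟨c, hc⟩) one_ne_zero
    rwa [C_1, one_mul] at this
  have hmon : p.Monic := by
    rw [Monic, leadingCoeff, hdeg, hp]
    simp
  have hroot : aeval y p = 0 := by
    rw [hp]
    simpa using h
  have hint : IsIntegral F⟮x⟯ y := ⟨p, hmon, by rwa [← aeval_def]⟩
  rw [adjoin.finrank hint]
  refine le_antisymm ?_ ?_
  · rw [← hdeg]
    exact natDegree_le_natDegree (minpoly.min _ _ hmon hroot)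
  · have h3 := minpoly.natDegree_pos hint
    have h4 : (minpoly F⟮x⟯ y).natDegree ≠ 1 := by
      rw [Ne, minpoly.natDegree_eq_one_iff]
      rintro ⟨z, rfl⟩
      exact hy z.2
    omega

/-- The degree of F(x) over F(f(x)), transported along an embedding of F(x); only the degrees of
numerator and denominator in lowest terms matter. -/
lemma RatFunc.relfinrank_adjoin_map (j : F⟮X⟯ →ₐ[F] M) (f : F⟮X⟯) :
    relfinrank F⟮j f⟯ F⟮j RatFunc.X⟯ = max f.num.natDegree f.denom.natDegree := by
  have h (g : F⟮X⟯) : F⟮j g⟯ = (F⟮g⟯).map j := by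
    rw [adjoin_map, Set.image_singleton]
  rw [h, h, relfinrank_map_map, RatFunc.adjoin_X, relfinrank_top_right,
    RatFunc.finrank_eq_max_natDegree]

end FieldTheory

namespace WeierstrassCurve.Affine.FunctionField

set_option linter.unusedSectionVars false

open Polynomial IntermediateField

variable {F : Type*} [Field F] {V : Affine F} {L : Type*} [Field L] [Algebra V.CoordinateRing L]
  [IsFractionRing V.CoordinateRing L] [Algebra F L] [IsScalarTower F V.CoordinateRing L]

lemma aeval_genX (p : F[X]) : aeval (genX V L) p =
    algebraMap V.CoordinateRing L (algebraMap F[X] V.CoordinateRing p) := by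
  have h : (algebraMap F[X] V.CoordinateRing p) = aeval (CoordinateRing.mk V (C X)) p := by
    have := aeval_algebraMap_apply V.CoordinateRing (X : F[X]) p
    rw [aeval_X_left_apply] at this
    exact this.symm
  rw [h, ← aeval_algebraMap_apply]
  rfl

lemma aeval_genX_injective : Function.Injective (aeval (R := F) (genX V L)) := by
  rw [injective_iff_map_eq_zero]
  intro p h
  rw [aeval_genX, map_eq_zero_iff _ (IsFractionRing.injective V.CoordinateRing L),
    Algebra.algebraMap_eq_smul_one] at h
  exact (CoordinateRing.smul_basis_eq_zero (p := p) (q := 0) (by rw [h, zero_smul, add_zero])).1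

lemma algebraMap_smul_basis (p q : F[X]) : algebraMap V.CoordinateRing L
    (p • (1 : V.CoordinateRing) + q • CoordinateRing.mk V Y) =
      aeval (genX V L) p + aeval (genX V L) q * genY V L := by
  rw [map_add, ← Algebra.algebraMap_eq_smul_one, ← aeval_genX, Algebra.smul_def, map_mul,
    ← aeval_genX]
  rfl

variable (V L) in
lemma adjoin_gen : adjoin F {genX V L, genY V L} = ⊤ := by
  rw [eq_top_iff]
  intro f _
  have hx : F⟮genX V L⟯ ≤ adjoin F {genX V L, genY V L} := adjoin.mono _ _ _ (by simp)
  have hy : genY V L ∈ adjoin F {genX V L, genY V L} := subset_adjoin _ _ (by simp)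
  have hp (p : F[X]) : aeval (genX V L) p ∈ adjoin F {genX V L, genY V L} :=
    hx ((mem_adjoin_simple_iff _ _).mpr ⟨p, 1, by simp⟩)
  have ha (a : V.CoordinateRing) : algebraMap V.CoordinateRing L a ∈ adjoin F {genX V L, genY V L} := by
    obtain ⟨p, q, rfl⟩ := CoordinateRing.exists_smul_basis_eq a
    rw [algebraMap_smul_basis]
    exact add_mem (hp p) (mul_mem (hp q) hy)
  obtain ⟨a, b, -, rfl⟩ := IsFractionRing.div_surjective (A := V.CoordinateRing) f
  exact div_mem (ha a) (ha b)

lemma genY_notMem : genY V L ∉ F⟮genX V L⟯ := by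
  rw [mem_adjoin_simple_iff]
  rintro ⟨r, s, h⟩
  by_cases hs : s = 0
  · rw [hs, map_zero, div_zero] at h
    have h1 := algebraMap_smul_basis (L := L) (V := V) 0 1
    rw [h, mul_zero, map_zero, zero_add,
      map_eq_zero_iff _ (IsFractionRing.injective V.CoordinateRing L)] at h1
    exact one_ne_zero (CoordinateRing.smul_basis_eq_zero h1).2
  · have hs' : aeval (genX V L) s ≠ 0 := by
      rw [Ne, map_eq_zero_iff _ aeval_genX_injective]
      exact hs
    rw [eq_div_iff hs'] at h
    have h1 := algebraMap_smul_basis (L := L) (V := V) (-r) s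
    rw [map_neg, neg_add_eq_sub, mul_comm, h, sub_self,
      map_eq_zero_iff _ (IsFractionRing.injective V.CoordinateRing L)] at h1
    exact hs (CoordinateRing.smul_basis_eq_zero h1).2

variable (V L) in
lemma finrank_adjoin_genX : Module.finrank F⟮genX V L⟯ L = 2 := by
  have h := relfinrank_adjoin_pair (F := F) (genY_notMem (V := V) (L := L))
    (b := algebraMap F L V.a₁ * genX V L + algebraMap F L V.a₃)
    (c := -(genX V L ^ 3 + algebraMap F L V.a₂ * genX V L ^ 2 + algebraMap F L V.a₄ * genX V L +
      algebraMap F L V.a₆)) ?_ ?_ ?_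
  · rwa [adjoin_gen, relfinrank_top_right] at h
  · have hx := mem_adjoin_simple_self F (genX V L)
    exact add_mem (mul_mem (_root_.algebraMap_mem _ _) hx) (_root_.algebraMap_mem _ _)
  · have hx := mem_adjoin_simple_self F (genX V L)
    exact neg_mem (add_mem (add_mem (add_mem (pow_mem hx 3) (mul_mem (_root_.algebraMap_mem _ _)
      (pow_mem hx 2))) (mul_mem (_root_.algebraMap_mem _ _) hx)) (_root_.algebraMap_mem _ _))
  · have e : genY V L ^ 2 + algebraMap F L V.a₁ * genX V L * genY V L + algebraMap F L V.a₃ * genY V L =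
      genX V L ^ 3 + algebraMap F L V.a₂ * genX V L ^ 2 + algebraMap F L V.a₄ * genX V L +
        algebraMap F L V.a₆ := (equation_iff _ _).mp equation_gen
    linear_combination e

/-- The degree of the extension generated by functions `x'`, `y'` with `x'` a rational function of
`x` and `y'` quadratic over `x'` but not a rational function of `x`. -/
lemma finrank_adjoin_pair {u w : F[X]} (huw : IsCoprime u w) (hw : w ≠ 0) {x' y' b c : L}
    (hx : x' = aeval (genX V L) u / aeval (genX V L) w) (hy : y' ∉ F⟮genX V L⟯)
    (hb : b ∈ F⟮x'⟯) (hc : c ∈ F⟮x'⟯) (h : y' ^ 2 + b * y' + c = 0) :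
    Module.finrank (adjoin F {x', y'}) L = max u.natDegree w.natDegree := by
  let j : F⟮X⟯ →ₐ[F] L := RatFunc.liftAlgHom (aeval (genX V L))
    (nonZeroDivisors_le_comap_nonZeroDivisors_of_injective _ aeval_genX_injective)
  have hjX : j RatFunc.X = genX V L := by
    have := RatFunc.liftAlgHom_apply_div (aeval (genX V L))
      (nonZeroDivisors_le_comap_nonZeroDivisors_of_injective _ aeval_genX_injective) (X : F[X]) 1
    simpa using this
  have hjf : j (algebraMap _ _ u / algebraMap _ _ w) = x' := by
    rw [hx]
    exact RatFunc.liftAlgHom_apply_div (aeval (genX V L))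
      (nonZeroDivisors_le_comap_nonZeroDivisors_of_injective _ aeval_genX_injective) u w
  have hmem : F⟮x'⟯ ≤ F⟮genX V L⟯ := by
    rw [adjoin_simple_le_iff, mem_adjoin_simple_iff]
    exact ⟨u, w, hx⟩
  -- [L : F(x')] is computed through F(x), with [L : F(x)] = 2, and through F(x', y'), with [F(x',
  -- y') : F(x')] = 2. The factors 2 cancel.
  have h1 := RatFunc.relfinrank_adjoin_map j (algebraMap _ _ u / algebraMap _ _ w)
  rw [hjX, hjf] at h1
  have h2 := relfinrank_mul_finrank_top hmem
  rw [finrank_adjoin_genX] at h2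
  have h3 := relfinrank_mul_finrank_top (adjoin.mono F {x'} {x', y'} (by simp))
  rw [relfinrank_adjoin_pair (fun h' ↦ hy (hmem h')) hb hc h, ← h2, h1] at h3
  set f : F⟮X⟯ := algebraMap _ _ u / algebraMap _ _ w with hf
  have h4 : u * f.denom = f.num * w := by
    apply RatFunc.algebraMap_injective F
    have hw' : algebraMap F[X] F⟮X⟯ w ≠ 0 := by simpa using hw
    have hd' : algebraMap F[X] F⟮X⟯ f.denom ≠ 0 := by simpa using f.denom_ne_zero
    have := f.num_div_denom
    nth_rw 3 [hf] at this
    rw [div_eq_div_iff hd' hw'] at this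
    rw [map_mul, map_mul, this]
  obtain ⟨h5, h6⟩ := natDegree_eq_of_isCoprime_of_mul_eq huw f.isCoprime_num_denom h4
  rw [h5, h6]
  omega

end WeierstrassCurve.Affine.FunctionField

/-! ### The degree of an isogeny, its kernel and its surjectivity -/

namespace WeierstrassCurve.Isogeny

set_option linter.unusedSectionVars false

open Polynomial WeierstrassCurve.Affine WeierstrassCurve.Affine.FunctionField IntermediateField

variable {F : Type*} [Field F] {E₁ E₂ : WeierstrassCurve F} [E₁.IsElliptic] (φ : Isogeny E₁ E₂)

local notation "mk" => CoordinateRing.mk E₁.toAffine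

lemma finite_setOf_value_den_eq_zero :
    {Q : E₁.SepPoints | Q ≠ 0 ∧ Q.value (mk φ.den) = 0}.Finite :=
  CoordinateRing.finite_setOf_value_eq_zero φ.den_ne_zero

variable {φ} in
lemma toHom_of_value_ne_zero {Q : E₁.SepPoints} (hQ : Q ≠ 0) (hd : Q.value (mk φ.den) ≠ 0) :
    φ.toHom Q ≠ 0 ∧ (φ.toHom Q).xCoord = Q.value (mk φ.numX) / Q.value (mk φ.den) ∧
      (φ.toHom Q).yCoord = Q.value (mk φ.numY) / Q.value (mk φ.den) := by
  rcases Q with _ | ⟨x, y, h⟩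
  · exact absurd rfl hQ
  rw [Point.value_mk_some] at hd
  obtain ⟨h', e⟩ := φ.toHom_some x y h hd
  rw [e]
  exact ⟨Point.some_ne_zero _, by rw [Point.value_mk_some, Point.value_mk_some]; rfl,
    by rw [Point.value_mk_some, Point.value_mk_some]; rfl⟩

lemma finite_ker : (φ.toHom.ker : Set E₁.SepPoints).Finite := by
  refine (φ.finite_setOf_value_den_eq_zero.insert 0).subset fun Q hQ ↦ ?_
  by_cases hQ0 : Q = 0
  · exact .inl hQ0
  · exact .inr ⟨hQ0, by_contra fun hd ↦ (toHom_of_value_ne_zero hQ0 hd).1 hQ⟩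

instance : Infinite E₁.SepPoints :=
  inferInstanceAs (Infinite (E₁.toAffine.baseChange (SeparableClosure F)).Point)

/-- Fibres are cosets of the finite kernel. -/
lemma infinite_range : (Set.range φ.toHom).Infinite := by
  intro h
  have := h.to_subtype
  obtain ⟨⟨_, P, rfl⟩, hP⟩ := Finite.exists_infinite_fiber (Set.rangeFactorization φ.toHom)
  have h1 : (Set.rangeFactorization φ.toHom ⁻¹' {⟨φ.toHom P, P, rfl⟩}).Infinite :=
    Set.infinite_coe_iff.mp hP
  refine h1 ((φ.finite_ker.image (· + P)).subset fun Q hQ ↦ ⟨Q - P, ?_, sub_add_cancel Q P⟩)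
  have : φ.toHom Q = φ.toHom P := congrArg Subtype.val (show _ = _ from hQ)
  rw [SetLike.mem_coe, AddMonoidHom.mem_ker, map_sub, this, sub_self]

/-- The `x`-coordinate of an isogeny takes infinitely many values. -/
lemma not_finite_of_xCoord_mem {s : Set (SeparableClosure F)} (hs : s.Finite)
    {t : Set E₁.SepPoints} (ht : t.Finite) : ∃ Q ∉ t, Q ≠ 0 ∧ φ.toHom Q ≠ 0 ∧
      (φ.toHom Q).xCoord ∉ s := by
  by_contra! h
  refine φ.infinite_range (((ht.image φ.toHom).union
    ((Set.finite_singleton 0).union (Point.finite_setOf_xCoord_mem hs))).subset ?_)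
  rintro _ ⟨Q, rfl⟩
  by_cases hQ : Q ∈ t
  · exact .inl ⟨Q, hQ, rfl⟩
  refine .inr ?_
  by_cases h0 : φ.toHom Q = 0
  · exact .inl h0
  · exact .inr ⟨h0, h Q hQ (fun h1 ↦ h0 (by rw [h1, map_zero])) h0⟩

/-- The coordinate functions of an isogeny as elements of the function field. -/
lemma exists_isCoprime : ∃ u w : F[X], IsCoprime u w ∧ w ≠ 0 ∧
    E₁.polynomialFunction φ.numX / E₁.polynomialFunction φ.den =
      aeval (genX E₁.toAffine E₁.toAffine.FunctionField) u /
        aeval (genX E₁.toAffine E₁.toAffine.FunctionField) w := by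
  obtain ⟨d, hd⟩ := CoordinateRing.dvd_algebraMap_norm (mk φ.den)
  set n : F[X] := Algebra.norm F[X] (mk φ.den)
  have hn : n ≠ 0 := Algebra.norm_ne_zero_iff.mpr φ.den_ne_zero
  -- Multiplying by d turns the denominator into its norm n, a polynomial in x. Then numX·d takes
  -- the value x(φ(Q))·n(x(Q)), which is even in Q, so it is a polynomial in x as well.
  have hval {Q : E₁.SepPoints} (hQ : Q ≠ 0) (hv : Q.value (mk φ.den) ≠ 0) :
      Q.value (mk φ.numX * d) = (φ.toHom Q).xCoord * aeval Q.xCoord n := by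
    rw [← Point.value_algebraMap hQ, hd, (toHom_of_value_ne_zero hQ hv).2.1]
    obtain ⟨g, hg⟩ := Point.exists_ringHom_value hQ
    rw [hg] at hv
    simp only [hg, map_mul]
    field_simp
  obtain ⟨p, hp⟩ : ∃ p : F[X], mk φ.numX * d = algebraMap F[X] _ p := by
    refine CoordinateRing.exists_eq_algebraMap_of_value_neg (K := SeparableClosure F) ?_
    have h1 := φ.finite_setOf_value_den_eq_zero
    refine (((Set.finite_singleton (0 : E₁.SepPoints)).union h1).union
      (h1.preimage (neg_injective (G := E₁.SepPoints)).injOn)).subset fun Q hQ ↦ ?_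
    by_contra hbad
    simp only [Set.mem_union, Set.mem_singleton_iff, Set.mem_ofPred_eq, Set.mem_preimage, not_or,
      not_and] at hbad
    obtain ⟨⟨hQ0, h2⟩, h3⟩ := hbad
    have hQ0' : (-Q : E₁.SepPoints) ≠ 0 := neg_ne_zero.mpr hQ0
    refine hQ ?_
    rw [hval hQ0 (h2 hQ0), hval hQ0' (h3 hQ0'), Point.xCoord_neg]
    rw [show φ.toHom (-Q) = -φ.toHom Q from map_neg _ _, Point.xCoord_neg]
  let f : F⟮X⟯ := algebraMap _ _ p / algebraMap _ _ n
  have hf : p * f.denom = f.num * n := by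
    apply RatFunc.algebraMap_injective F
    have hw' : algebraMap F[X] F⟮X⟯ n ≠ 0 := by simpa using hn
    have hd' : algebraMap F[X] F⟮X⟯ f.denom ≠ 0 := by simpa using f.denom_ne_zero
    have : algebraMap F[X] F⟮X⟯ f.num / algebraMap F[X] F⟮X⟯ f.denom =
      algebraMap _ _ p / algebraMap _ _ n := f.num_div_denom
    rw [div_eq_div_iff hd' hw'] at this
    rw [map_mul, map_mul, this]
  refine ⟨f.num, f.denom, f.isCoprime_num_denom, f.denom_ne_zero, ?_⟩
  have hinj := IsFractionRing.injective E₁.toAffine.CoordinateRing E₁.toAffine.FunctionField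
  have h1 : E₁.polynomialFunction φ.den ≠ 0 := by
    rw [polynomialFunction, Ne, map_eq_zero_iff _ hinj]
    exact φ.den_ne_zero
  have h2 : aeval (genX E₁.toAffine E₁.toAffine.FunctionField) f.denom ≠ 0 := by
    rw [Ne, map_eq_zero_iff _ aeval_genX_injective]
    exact f.denom_ne_zero
  have h3 : aeval (genX E₁.toAffine E₁.toAffine.FunctionField) n ≠ 0 := by
    rw [Ne, map_eq_zero_iff _ aeval_genX_injective]
    exact hn
  have e1 := congrArg (algebraMap E₁.toAffine.CoordinateRing E₁.toAffine.FunctionField) hp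
  have e2 := congrArg (algebraMap E₁.toAffine.CoordinateRing E₁.toAffine.FunctionField) hd
  have e3 := congrArg (aeval (genX E₁.toAffine E₁.toAffine.FunctionField)) hf
  rw [← aeval_genX, map_mul] at e1 e2
  rw [map_mul, map_mul] at e3
  rw [div_eq_div_iff h1 h2]
  refine mul_right_cancel₀ h3 ?_
  change E₁.polynomialFunction φ.numX * algebraMap _ _ d = _ at e1
  change _ = E₁.polynomialFunction φ.den * algebraMap _ _ d at e2
  linear_combination E₁.polynomialFunction φ.numX *
    aeval (genX E₁.toAffine E₁.toAffine.FunctionField) f.denom * e2 +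
    aeval (genX E₁.toAffine E₁.toAffine.FunctionField) f.denom * E₁.polynomialFunction φ.den * e1 +
    E₁.polynomialFunction φ.den * e3

local notation "𝕏" => E₁.polynomialFunction φ.numX / E₁.polynomialFunction φ.den
local notation "𝕐" => E₁.polynomialFunction φ.numY / E₁.polynomialFunction φ.den

lemma polynomialFunction_den_ne_zero : E₁.polynomialFunction φ.den ≠ 0 := by
  rw [polynomialFunction, Ne, map_eq_zero_iff _
    (IsFractionRing.injective E₁.toAffine.CoordinateRing E₁.toAffine.FunctionField)]
  exact φ.den_ne_zero

/-- The values of a function of the form `f / den` which is a rational function of `x`. -/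
lemma value_div_den_eq {f : F[X][Y]} {u w : F[X]} (hw : w ≠ 0)
    (h : E₁.polynomialFunction f / E₁.polynomialFunction φ.den =
      aeval (genX E₁.toAffine E₁.toAffine.FunctionField) u /
        aeval (genX E₁.toAffine E₁.toAffine.FunctionField) w) {Q : E₁.SepPoints} (hQ : Q ≠ 0)
    (hd : Q.value (mk φ.den) ≠ 0) (hQw : aeval Q.xCoord w ≠ 0) :
    Q.value (mk f) / Q.value (mk φ.den) = aeval Q.xCoord u / aeval Q.xCoord w := by
  have h2 : aeval (genX E₁.toAffine E₁.toAffine.FunctionField) w ≠ 0 := by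
    rw [Ne, map_eq_zero_iff _ aeval_genX_injective]
    exact hw
  rw [div_eq_div_iff φ.polynomialFunction_den_ne_zero h2, aeval_genX, aeval_genX,
    polynomialFunction, polynomialFunction, ← map_mul, ← map_mul] at h
  replace h := IsFractionRing.injective _ _ h
  rw [div_eq_div_iff hd hQw, ← Point.value_algebraMap hQ, ← Point.value_algebraMap hQ]
  obtain ⟨g, hg⟩ := Point.exists_ringHom_value hQ
  simp only [hg, ← map_mul, h]

lemma finite_setOf_aeval_eq_zero {w : F[X]} (hw : w ≠ 0) :
    {Q : E₁.SepPoints | Q ≠ 0 ∧ aeval Q.xCoord w = 0}.Finite := by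
  have h := Point.finite_setOf_eval_eq_zero (W := E₁.toAffine.baseChange (SeparableClosure F))
    (f := w.map (algebraMap F (SeparableClosure F))) (Polynomial.map_ne_zero hw)
  simpa only [eval_map_algebraMap] using h

/-- Otherwise φ(Q) and φ(−Q) = −φ(Q) would have the same y-coordinate for almost all Q, putting the
infinite image of φ into the 2-torsion up to finitely many points. -/
lemma numY_div_den_notMem [E₂.IsElliptic] : 𝕐 ∉ F⟮genX E₁.toAffine E₁.toAffine.FunctionField⟯ := by
  rw [mem_adjoin_simple_iff]
  rintro ⟨r, s, h⟩
  wlog hs : s ≠ 0 generalizing r s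
  · rw [not_not] at hs
    refine this 0 1 ?_ one_ne_zero
    rw [h, hs, _root_.map_zero, div_zero, zero_div]
  have h1 := φ.finite_setOf_value_den_eq_zero
  have h2 := finite_setOf_aeval_eq_zero (E₁ := E₁) hs
  obtain ⟨Q, hQ, hQ0, hφ, hx⟩ := φ.not_finite_of_xCoord_mem
    (((E₂.toAffine.baseChange (SeparableClosure F)).Ψ₂Sq).rootSet_finite (SeparableClosure F))
    ((h1.union h2).union (h1.preimage (neg_injective (G := E₁.SepPoints)).injOn))
  simp only [Set.mem_union, Set.mem_ofPred_eq, Set.mem_preimage, not_or, not_and] at hQ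
  obtain ⟨⟨hd, hsQ⟩, hd'⟩ := hQ
  have hQ0' : (-Q : E₁.SepPoints) ≠ 0 := neg_ne_zero.mpr hQ0
  have e1 := (toHom_of_value_ne_zero hQ0 (hd hQ0)).2.2
  have e2 := (toHom_of_value_ne_zero hQ0' (hd' hQ0')).2.2
  have hsQ' : aeval (-Q : E₁.SepPoints).xCoord s ≠ 0 := by
    rw [show (-Q : E₁.SepPoints).xCoord = Q.xCoord from Point.xCoord_neg Q]
    exact hsQ hQ0
  rw [φ.value_div_den_eq hs h hQ0 (hd hQ0) (hsQ hQ0)] at e1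
  rw [φ.value_div_den_eq hs h hQ0' (hd' hQ0') hsQ',
    show (-Q : E₁.SepPoints).xCoord = Q.xCoord from Point.xCoord_neg Q, ← e1,
    show φ.toHom (-Q) = -φ.toHom Q from map_neg _ _] at e2
  have e3 := Point.sub_yCoord_neg_sq hφ
  rw [show (-φ.toHom Q).yCoord = (φ.toHom Q).yCoord from e2, sub_self, zero_pow two_ne_zero] at e3
  refine hx ((mem_rootSet).mpr ⟨?_, ?_⟩)
  · have : (E₂.toAffine.baseChange (SeparableClosure F)).IsElliptic :=
      inferInstanceAs (WeierstrassCurve.IsElliptic (WeierstrassCurve.map E₂ (algebraMap F _)))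
    exact Ψ₂Sq_ne_zero_of_isElliptic _
  · simpa using e3.symm

lemma equation_numX_numY : 𝕐 ^ 2 +
    (algebraMap F _ E₂.a₁ * 𝕏 + algebraMap F _ E₂.a₃) * 𝕐 +
    -(𝕏 ^ 3 + algebraMap F _ E₂.a₂ * 𝕏 ^ 2 + algebraMap F _ E₂.a₄ * 𝕏 + algebraMap F _ E₂.a₆) = 0 := by
  let c := algebraMap F E₁.toAffine.CoordinateRing
  have key : mk φ.numY ^ 2 * mk φ.den + c E₂.a₁ * mk φ.numX * mk φ.numY * mk φ.den +
      c E₂.a₃ * mk φ.numY * mk φ.den ^ 2 = mk φ.numX ^ 3 + c E₂.a₂ * mk φ.numX ^ 2 * mk φ.den +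
      c E₂.a₄ * mk φ.numX * mk φ.den ^ 2 + c E₂.a₆ * mk φ.den ^ 3 := by
    refine CoordinateRing.eq_of_value_eq (K := SeparableClosure F) φ.finite_setOf_value_den_eq_zero
      fun Q hQ hQ0 ↦ ?_
    have hd : Q.value (mk φ.den) ≠ 0 := fun h ↦ hQ ⟨hQ0, h⟩
    obtain ⟨h1, hx, hy⟩ := toHom_of_value_ne_zero hQ0 hd
    have hc (a : F) : Q.value (c a) = algebraMap F _ a := by
      have := Point.value_algebraMap (V := E₁.toAffine) hQ0 (C a)
      rwa [aeval_C] at this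
    have heq : (E₂.toAffine.baseChange (SeparableClosure F)).Equation (φ.toHom Q).xCoord
        (φ.toHom Q).yCoord := by
      generalize φ.toHom Q = P at h1
      rcases P with _ | ⟨x, y, h⟩
      · exact absurd rfl h1
      · exact h.1
    rw [hx, hy] at heq
    have e := (equation_iff _ _).mp heq
    obtain ⟨g, hg⟩ := Point.exists_ringHom_value hQ0
    simp only [hg] at hc hd e
    change _ + algebraMap F _ E₂.a₁ * _ * _ + algebraMap F _ E₂.a₃ * _ = _ + algebraMap F _ E₂.a₂ * _ +
      algebraMap F _ E₂.a₄ * _ + algebraMap F _ E₂.a₆ at e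
    simp only [hg, map_add, map_mul, map_pow, hc]
    field_simp at e
    linear_combination e
  have h0 := φ.polynomialFunction_den_ne_zero
  have hpf (f : F[X][Y]) : algebraMap E₁.toAffine.CoordinateRing E₁.toAffine.FunctionField (mk f) =
    E₁.polynomialFunction f := rfl
  have e := congrArg (algebraMap E₁.toAffine.CoordinateRing E₁.toAffine.FunctionField) key
  simp only [map_add, map_mul, map_pow, c, ← IsScalarTower.algebraMap_apply] at e
  simp only [hpf] at e
  field_simp
  linear_combination e

/-- The `x`-coordinate of an isogeny is a rational function of `x` whose degree is the degree of the
isogeny. -/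
theorem exists_isCoprime_degree [E₂.IsElliptic] : ∃ u w : F[X], IsCoprime u w ∧ w ≠ 0 ∧
    max u.natDegree w.natDegree = φ.degree ∧
    {Q : E₁.SepPoints | ¬(Q ≠ 0 ∧ aeval Q.xCoord w ≠ 0 ∧ φ.toHom Q ≠ 0 ∧
      (φ.toHom Q).xCoord = aeval Q.xCoord u / aeval Q.xCoord w)}.Finite := by
  obtain ⟨u, w, huw, hw, hX⟩ := φ.exists_isCoprime
  refine ⟨u, w, huw, hw, ?_, ?_⟩
  · have hx := mem_adjoin_simple_self F (𝕏)
    exact (finrank_adjoin_pair huw hw hX φ.numY_div_den_notMem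
      (add_mem (mul_mem (_root_.algebraMap_mem _ _) hx) (_root_.algebraMap_mem _ _))
      (neg_mem (add_mem (add_mem (add_mem (pow_mem hx 3) (mul_mem (_root_.algebraMap_mem _ _)
      (pow_mem hx 2))) (mul_mem (_root_.algebraMap_mem _ _) hx)) (_root_.algebraMap_mem _ _)))
      φ.equation_numX_numY).symm
  · refine ((φ.finite_setOf_value_den_eq_zero.union (finite_setOf_aeval_eq_zero hw)).insert 0).subset
      fun Q hQ ↦ ?_
    by_contra hbad
    simp only [Set.mem_insert_iff, Set.mem_union, Set.mem_ofPred_eq, not_or, not_and] at hbad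
    obtain ⟨hQ0, hd, hwQ⟩ := hbad
    obtain ⟨h1, hx, -⟩ := toHom_of_value_ne_zero hQ0 (hd hQ0)
    exact hQ ⟨hQ0, hwQ hQ0, h1, hx.trans (φ.value_div_den_eq hw hX hQ0 (hd hQ0) (hwQ hQ0))⟩

/-- The kernel of an isogeny of degree prime to the characteristic, and its surjectivity. -/
theorem card_ker_and_surjective [E₂.IsElliptic] (h : (φ.degree : F) ≠ 0) :
    Nat.card φ.toHom.ker = φ.degree ∧ Function.Surjective φ.toHom := by
  obtain ⟨u, w, huw, hw, hdeg, hfin⟩ := φ.exists_isCoprime_degree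
  let _ : DecidableEq (SeparableClosure F) := fun a b ↦ Classical.propDecidable (a = b)
  have : (E₂.toAffine.baseChange (SeparableClosure F)).IsElliptic :=
    inferInstanceAs (WeierstrassCurve.IsElliptic (WeierstrassCurve.map E₂ (algebraMap F _)))
  have huw' : IsCoprime (u.map (algebraMap F (SeparableClosure F))) (w.map (algebraMap F (SeparableClosure F))) :=
    (isCoprime_map _).mpr huw
  have hd : max (u.map (algebraMap F (SeparableClosure F))).natDegree (w.map (algebraMap F (SeparableClosure F))).natDegree = φ.degree := by
    rwa [natDegree_map, natDegree_map]
  have h' : (φ.degree : SeparableClosure F) ≠ 0 := by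
    rw [← map_natCast (algebraMap F (SeparableClosure F))]
    exact (_root_.map_ne_zero _).mpr h
  let ψ : (E₁.toAffine.baseChange (SeparableClosure F)).Point →+
    (E₂.toAffine.baseChange (SeparableClosure F)).Point := φ.toHom
  refine Point.card_ker_and_surjective_of_xCoord ψ huw' hd h' (hfin.subset fun Q hQ hbad ↦ hQ ?_)
  rw [eval_map_algebraMap, eval_map_algebraMap]
  exact hbad.2

end WeierstrassCurve.Isogeny

/-! ### The quotient coordinates as fractions with denominator in x -/

namespace WeierstrassCurve.Affine

set_option linter.unusedSectionVars false

open Polynomial WithZero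

variable {K : Type*} [Field K] {W : Affine K}

namespace Point

open Classical

variable (S : AddSubgroup W.Point) [Fintype S]

/-- The polynomial whose roots are the `x`-coordinates of the nonzero points of `S`. -/
noncomputable def denomPoly : K[X] := ∏ R ∈ Finset.univ.erase (0 : S), (X - C (R : W.Point).xCoord)

lemma denomPoly_ne_zero : denomPoly S ≠ 0 :=
  Finset.prod_ne_zero_iff.mpr fun _ _ ↦ X_sub_C_ne_zero _

lemma natDegree_denomPoly : (denomPoly S).natDegree = Nat.card S - 1 := by
  rw [denomPoly, natDegree_prod_of_monic _ _ fun _ _ ↦ monic_X_sub_C _]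
  simp

variable {S}

lemma eval_denomPoly_eq_zero_iff {Q : W.Point} (hQ : Q ≠ 0) :
    (denomPoly S).eval Q.xCoord = 0 ↔ Q ∈ S := by
  rw [denomPoly, eval_prod, Finset.prod_eq_zero_iff]
  constructor
  · rintro ⟨R, hR, h⟩
    rw [Polynomial.eval_sub, eval_X, eval_C, sub_eq_zero] at h
    have hR0 : (R : W.Point) ≠ 0 := fun h ↦ Finset.ne_of_mem_erase hR (Subtype.ext h)
    rcases eq_or_eq_neg_of_xCoord_eq hQ hR0 h with h | h
    · exact h ▸ R.2
    · rw [h]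
      exact neg_mem R.2
  · intro h
    refine ⟨⟨Q, h⟩, Finset.mem_erase.mpr ⟨fun h' ↦ hQ (congrArg Subtype.val h'), Finset.mem_univ _⟩, ?_⟩
    simp

end Point

namespace FunctionField

variable {L : Type*} [Field L] [Algebra W.CoordinateRing L] [IsFractionRing W.CoordinateRing L]
  [Algebra K L] [IsScalarTower K W.CoordinateRing L] [W.IsElliptic] [IsAlgClosed K]

local notation "v" => infValuation W L
local notation "κ" => algebraMap K L

lemma infValuation_aeval_genX {p : K[X]} (hp : p ≠ 0) :
    v (aeval (genX W L) p) = exp (2 * (p.natDegree : ℤ)) := by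
  have h : algebraMap K[X] W.CoordinateRing p ≠ 0 := by
    intro h
    refine hp (aeval_genX_injective (V := W) (L := L) ?_)
    rw [aeval_genX, h, map_zero, map_zero]
  rw [aeval_genX, infValuation_algebraMap, CoordinateRing.infValuation_apply h,
    Algebra.norm_algebraMap]
  simp [natDegree_pow, Module.finrank_eq_card_basis (CoordinateRing.basis W)]

open Classical Point

variable {S : AddSubgroup W.Point} [Fintype S]

/-- The product runs over all nonzero points of S, so each abscissa occurs twice, for Q and for −Q ≠
Q. -/
lemma valAt_denomPoly (hodd : Odd (Nat.card S)) {Q : W.Point} (hQ : Q ∈ S) (hQ0 : Q ≠ 0) :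
    valAt L Q (aeval (genX W L) (denomPoly S)) = exp (-2) := by
  have hne := ne_neg_of_odd_card hodd hQ hQ0
  have h1 : (⟨Q, hQ⟩ : S) ∈ Finset.univ.erase (0 : S) :=
    Finset.mem_erase.mpr ⟨fun h' ↦ hQ0 (congrArg Subtype.val h'), Finset.mem_univ _⟩
  have h2 : (⟨-Q, neg_mem hQ⟩ : S) ∈ (Finset.univ.erase (0 : S)).erase ⟨Q, hQ⟩ := by
    refine Finset.mem_erase.mpr ⟨fun h' ↦ hne (congrArg Subtype.val h').symm,
      Finset.mem_erase.mpr ⟨fun h' ↦ hQ0 ?_, Finset.mem_univ _⟩⟩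
    exact neg_eq_zero.mp (congrArg Subtype.val h')
  rw [denomPoly, map_prod, map_prod, ← Finset.mul_prod_erase _ _ h1, ← Finset.mul_prod_erase _ _ h2,
    Finset.prod_eq_one, mul_one]
  · simp only [map_sub, aeval_X, aeval_C]
    rw [valAt_genX_sub_self hQ0 hne (.inl rfl), valAt_genX_sub_self hQ0 hne (.inr (neg_neg Q).symm),
      ← exp_add]
    rfl
  · intro R hR
    rw [Finset.mem_erase, Finset.mem_erase, Finset.mem_erase] at hR
    simp only [map_sub, aeval_X, aeval_C]
    refine valAt_genX_sub_eq_one hQ0 (fun h ↦ hR.2.2.1 (Subtype.ext h)) (fun h ↦ hR.2.1 ?_)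
      (fun h ↦ hR.1 ?_)
    · exact Subtype.ext h.symm
    · exact Subtype.ext (neg_eq_iff_eq_neg.mpr h).symm

lemma valAt_quotX {Q : W.Point} (hQ : Q ∈ S) : valAt L Q (quotX L S) = exp 2 := by
  have h := valAt_translation (L := L) 0 Q (quotX L S)
  rwa [(isInvariantRegular_quotX L S).translation_eq Q hQ, zero_add, valAt_zero,
    infValuation_quotX, eq_comm] at h

lemma valAt_quotY {Q : W.Point} (hQ : Q ∈ S) : valAt L Q (quotY L S) = exp 3 := by
  have h := valAt_translation (L := L) 0 Q (quotY L S)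
  rwa [(isInvariantRegular_quotY L S).translation_eq Q hQ, zero_add, valAt_zero,
    infValuation_quotY, eq_comm] at h

lemma hasValueAt_aeval_genX {Q : W.Point} (hQ : Q ≠ 0) (p : K[X]) :
    HasValueAt (L := L) Q (aeval (genX W L) p) (p.eval Q.xCoord) := by
  rcases Q with _ | ⟨x, y, h⟩
  · exact absurd rfl hQ
  rw [aeval_genX]
  convert hasValueAt_algebraMap (L := L) h (algebraMap K[X] _ p)
  rw [← Point.eval_some h, Algebra.algebraMap_eq_smul_one]
  simpa using (Point.eval_smul_basis hQ p 0).symm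

lemma hasValueAt_algebraMap_eval {Q : W.Point} (hQ : Q ≠ 0) (a : W.CoordinateRing) :
    HasValueAt (L := L) Q (algebraMap _ L a) (Q.eval a) := by
  rcases Q with _ | ⟨x, y, h⟩
  · exact absurd rfl hQ
  exact hasValueAt_algebraMap h a

/-- The pole of order 3 of `quotY` at a nonzero point of S is cancelled by the zero of order 4 of
the squared denominator. -/
lemma exists_eval_eq_sumY (hodd : Odd (Nat.card S)) : ∃ a : W.CoordinateRing,
    ∀ Q ∉ S, Q.eval a = sumY S Q * (denomPoly S).eval Q.xCoord ^ 2 := by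
  obtain ⟨a, ha⟩ := exists_eq_algebraMap_of_valAt_le (W := W)
    (f := quotY W.FunctionField S * aeval (genX W W.FunctionField) (denomPoly S) ^ 2) (fun Q hQ0 ↦ by
      rw [map_mul, map_pow]
      by_cases hQ : Q ∈ S
      · rw [valAt_quotY hQ, valAt_denomPoly hodd hQ hQ0, ← exp_nsmul, ← exp_add, ← exp_zero,
          exp_le_exp]
        norm_num
      · exact mul_le_one' ((isInvariantRegular_quotY _ S).valAt_le Q hQ)
          (pow_le_one' (hasValueAt_aeval_genX hQ0 _).le_one 2))
  refine ⟨a, fun Q hQ ↦ ?_⟩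
  have hQ0 : Q ≠ 0 := fun h ↦ hQ (h ▸ S.zero_mem)
  refine (hasValueAt_algebraMap_eval (L := W.FunctionField) hQ0 a).unique ?_
  rw [ha]
  exact (hasValueAt_quotY hQ).mul ((hasValueAt_aeval_genX hQ0 _).pow 2)

/-- The `x`-coordinate on the quotient as a rational function of `x`. -/
lemma exists_eval_eq_sumX (hodd : Odd (Nat.card S)) : ∃ u : K[X],
    IsCoprime u (denomPoly S) ∧ u.natDegree = Nat.card S ∧
      ∀ Q ∉ S, u.eval Q.xCoord = sumX S Q * (denomPoly S).eval Q.xCoord := by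
  obtain ⟨a, ha⟩ := exists_eq_algebraMap_of_valAt_le (W := W)
    (f := quotX W.FunctionField S * aeval (genX W W.FunctionField) (denomPoly S)) (fun Q hQ0 ↦ by
      rw [map_mul]
      by_cases hQ : Q ∈ S
      · rw [valAt_quotX hQ, valAt_denomPoly hodd hQ hQ0, ← exp_add, ← exp_zero, exp_le_exp]
        norm_num
      · exact mul_le_one' ((isInvariantRegular_quotX _ S).valAt_le Q hQ)
          (hasValueAt_aeval_genX hQ0 _).le_one)
  have hval {Q : W.Point} (hQ : Q ∉ S) : Q.eval a = sumX S Q * (denomPoly S).eval Q.xCoord := by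
    have hQ0 : Q ≠ 0 := fun h ↦ hQ (h ▸ S.zero_mem)
    refine (hasValueAt_algebraMap_eval (L := W.FunctionField) hQ0 a).unique ?_
    rw [ha]
    exact (hasValueAt_quotX hQ).mul (hasValueAt_aeval_genX hQ0 _)
  obtain ⟨u, rfl⟩ := CoordinateRing.exists_eq_algebraMap_of_eval_neg (a := a)
    ((Set.toFinite (S : Set W.Point)).subset fun Q hQ ↦ by
      by_contra hQS
      have hQS : Q ∉ S := hQS
      refine hQ ?_
      rw [hval hQS, hval (fun h ↦ hQS (neg_mem_iff.mp h)), sumX_neg, xCoord_neg])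
  rw [← aeval_genX] at ha
  have heval {Q : W.Point} (hQ : Q ≠ 0) : Q.eval (algebraMap K[X] _ u) = u.eval Q.xCoord := by
    rw [Algebra.algebraMap_eq_smul_one]
    simpa using (Point.eval_smul_basis hQ u 0)
  refine ⟨u, ?_, ?_, fun Q hQ ↦ ?_⟩
  · refine IsCoprime.prod_right fun R hR ↦ ?_
    have hR0 : (R : W.Point) ≠ 0 := fun h ↦ Finset.ne_of_mem_erase hR (Subtype.ext h)
    rw [isCoprime_comm, (irreducible_X_sub_C _).coprime_iff_not_dvd, dvd_iff_isRoot, IsRoot.def]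
    -- At R the double pole of `quotX` exactly cancels the double zero of the denominator, so u
    -- cannot vanish there.
    intro h0
    have h1 := hasValueAt_aeval_genX (L := W.FunctionField) hR0 u
    rw [h0, hasValueAt_zero_iff, ha, map_mul, valAt_quotX R.2, valAt_denomPoly hodd R.2 hR0,
      ← exp_add, ← exp_zero, exp_lt_exp] at h1
    norm_num at h1
  · have hv := congrArg (infValuation W W.FunctionField) ha
    have hD := denomPoly_ne_zero S
    have hu : u ≠ 0 := by
      rintro rfl
      rw [_root_.map_zero, _root_.map_zero, map_mul, infValuation_quotX, infValuation_aeval_genX hD] at hv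
      exact mul_ne_zero exp_ne_zero exp_ne_zero hv.symm
    rw [map_mul, infValuation_quotX, infValuation_aeval_genX hD, infValuation_aeval_genX hu,
      ← exp_add, exp_inj, natDegree_denomPoly] at hv
    have := Nat.card_pos (α := S)
    omega
  · rw [← heval (fun h ↦ hQ (by rw [h]; exact S.zero_mem)), hval hQ]

end FunctionField

end WeierstrassCurve.Affine

/-! ### Independence of the quotient coordinates and descent of functions -/

namespace WeierstrassCurve.Affine

set_option linter.unusedSectionVars false

open Polynomial WithZero

section CoordMap

open Classical Point

variable {K : Type*} [Field K] {W : Affine K} {K' : Type*} [Field K'] {W' : Affine K'}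
  {f : K →+* K'} {φ : W.Point →+ W'.Point} {S : AddSubgroup W.Point} [Fintype S]
  {S' : AddSubgroup W'.Point} [Fintype S']

lemma Point.IsCoordMap.sumX (h : IsCoordMap f φ) (hφ : Function.Injective φ) (hS : S.map φ = S')
    (Q : W.Point) : Point.sumX S' (φ Q) = f (Point.sumX S Q) := by
  subst hS
  rw [Point.sumX, Point.sumX, map_sum]
  refine (Fintype.sum_equiv (S.equivMapOfInjective φ hφ).toEquiv _ _ fun R ↦ ?_).symm
  rw [← h.xCoord, map_add]
  rfl

lemma Point.IsCoordMap.sumY (h : IsCoordMap f φ) (hφ : Function.Injective φ) (hS : S.map φ = S')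
    (Q : W.Point) : Point.sumY S' (φ Q) = f (Point.sumY S Q) := by
  subst hS
  rw [Point.sumY, Point.sumY, map_sum]
  refine (Fintype.sum_equiv (S.equivMapOfInjective φ hφ).toEquiv _ _ fun R ↦ ?_).symm
  rw [← h.yCoord, map_add]
  rfl

lemma Point.IsCoordMap.denomPoly (h : IsCoordMap f φ) (hφ : Function.Injective φ)
    (hS : S.map φ = S') : Point.denomPoly S' = (Point.denomPoly S).map f := by
  subst hS
  rw [Point.denomPoly, Point.denomPoly, Polynomial.map_prod]
  refine (Finset.prod_equiv (S.equivMapOfInjective φ hφ).toEquiv (fun R ↦ ?_) fun R _ ↦ ?_).symm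
  · simp
  · rw [Polynomial.map_sub, map_X, map_C, ← h.xCoord]
    rfl

end CoordMap

section Independence

variable {K : Type*} [Field K] {W : Affine K} [W.IsElliptic] [IsAlgClosed K]

open Classical Point WeierstrassCurve.Affine.FunctionField

variable {S : AddSubgroup W.Point} [Fintype S]

/-- Linear independence of `1`, `x`, `y`, `x²`, `xy` on the quotient by `S`. -/
lemma eq_zero_of_sum_eq_zero {d₁ d₂ d₃ d₄ d₆ : K} {T : Set W.Point} (hT : T.Infinite)
    (hTS : ∀ Q ∈ T, Q ∉ S) (h : ∀ Q ∈ T, d₁ * sumX S Q * sumY S Q + d₂ * sumX S Q ^ 2 +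
      d₃ * sumY S Q + d₄ * sumX S Q + d₆ = 0) :
    d₁ = 0 ∧ d₂ = 0 ∧ d₃ = 0 ∧ d₄ = 0 ∧ d₆ = 0 := by
  let k := algebraMap K W.FunctionField
  let val := infValuation W W.FunctionField
  set A := quotX W.FunctionField S
  set B := quotY W.FunctionField S
  have hA : val A = exp 2 := infValuation_quotX _ S
  have hB : val B = exp 3 := infValuation_quotY _ S
  have hk (c : K) : val (k c) ≤ exp 0 := infValuation_algebraMap_field_le c
  have hkm {c : K} {g : W.FunctionField} {n m : ℤ} (hg : val g = exp n) (hm : n ≤ m) :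
      val (k c * g) ≤ exp m := infValuation_algebraMap_mul_le (hg.le.trans (exp_le_exp.mpr hm))
  have h0 : k d₁ * (A * B) + (k d₂ * A ^ 2 + (k d₃ * B + (k d₄ * A + k d₆))) = 0 := by
    by_contra hf
    refine hT ((finite_setOf_hasValueAt_zero hf).subset fun Q hQ ↦ ?_)
    have hX := hasValueAt_quotX (L := W.FunctionField) (hTS Q hQ)
    have hY := hasValueAt_quotY (L := W.FunctionField) (hTS Q hQ)
    rw [Set.mem_ofPred_eq, show (0 : K) = d₁ * (sumX S Q * sumY S Q) + (d₂ * sumX S Q ^ 2 +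
      (d₃ * sumY S Q + (d₄ * sumX S Q + d₆))) by rw [← h Q hQ]; ring]
    exact ((HasValueAt.const Q _).mul (hX.mul hY)).add (((HasValueAt.const Q _).mul (hX.pow 2)).add
      (((HasValueAt.const Q _).mul hY).add (((HasValueAt.const Q _).mul hX).add
        (HasValueAt.const Q _))))
  -- The functions xy, x², y, x, 1 on the quotient have distinct pole orders 5, 4, 3, 2, 0, so the
  -- coefficients vanish one after the other.
  have step {d : K} {g r : W.FunctionField} {n m : ℤ} (hg : val g = exp n) (hr : val r ≤ exp m)
      (hm : m < n) (e : k d * g + r = 0) : d = 0 ∧ r = 0 := by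
    have hd : d = 0 := by
      by_contra hd
      have h1 := congrArg val (eq_neg_of_add_eq_zero_left e)
      rw [map_mul, Valuation.map_neg, hg, infValuation_algebraMap_field hd, one_mul] at h1
      rw [← h1, exp_le_exp] at hr
      exact hm.not_ge hr
    refine ⟨hd, ?_⟩
    rwa [hd, _root_.map_zero, zero_mul, zero_add] at e
  have hAB : val (A * B) = exp 5 := by rw [map_mul, hA, hB, ← exp_add]; rfl
  have hAA : val (A ^ 2) = exp 4 := by rw [map_pow, hA, ← exp_nsmul]; rfl
  have r4 (m : ℤ) (hm : 0 ≤ m) : val (k d₆) ≤ exp m := (hk d₆).trans (exp_le_exp.mpr hm)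
  have r3 (m : ℤ) (hm : 2 ≤ m) : val (k d₄ * A + k d₆) ≤ exp m :=
    Valuation.map_add_le _ (hkm hA hm) (r4 m (by omega))
  have r2 (m : ℤ) (hm : 3 ≤ m) : val (k d₃ * B + (k d₄ * A + k d₆)) ≤ exp m :=
    Valuation.map_add_le _ (hkm hB hm) (r3 m (by omega))
  have r1 (m : ℤ) (hm : 4 ≤ m) : val (k d₂ * A ^ 2 + (k d₃ * B + (k d₄ * A + k d₆))) ≤ exp m :=
    Valuation.map_add_le _ (hkm hAA hm) (r2 m (by omega))
  obtain ⟨h1, e1⟩ := step hAB (r1 4 le_rfl) (by norm_num) h0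
  obtain ⟨h2, e2⟩ := step hAA (r2 3 le_rfl) (by norm_num) e1
  obtain ⟨h3, e3⟩ := step hB (r3 2 le_rfl) (by norm_num) e2
  obtain ⟨h4, e4⟩ := step hA (r4 0 le_rfl) (by norm_num) e3
  exact ⟨h1, h2, h3, h4, by simpa [k] using e4⟩

end Independence

section Descent

open Classical Point

variable {K : Type*} [Field K] {M : Type*} [Field M] [Algebra K M]

lemma _root_.Polynomial.exists_eval_eq_linearMap (r : M →ₗ[K] K) (P : M[X]) : ∃ P' : K[X], ∀ x y : K,
    r (P.eval (algebraMap K M x) * algebraMap K M y) = P'.eval x * y := by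
  induction P using Polynomial.induction_on' with
  | add p q hp hq =>
    obtain ⟨p', hp'⟩ := hp
    obtain ⟨q', hq'⟩ := hq
    refine ⟨p' + q', fun x y ↦ ?_⟩
    rw [Polynomial.eval_add, add_mul, map_add, hp', hq', Polynomial.eval_add, add_mul]
  | monomial n a =>
    refine ⟨monomial n (r a), fun x y ↦ ?_⟩
    rw [eval_monomial, eval_monomial, ← map_pow, mul_assoc, ← map_mul, mul_comm, ← Algebra.smul_def,
      map_smul, smul_eq_mul]
    ring

variable (K M) in
-- Serves to bring coefficients from M down to K. M will be the algebraic closure of a separably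
-- closed field, possibly purely inseparable over it, so Galois descent is not available for this
-- step.
lemma _root_.exists_linearMap_retraction : ∃ r : M →ₗ[K] K, ∀ x, r (algebraMap K M x) = x := by
  obtain ⟨r, hr⟩ := LinearMap.exists_leftInverse_of_injective (Algebra.linearMap K M)
    (LinearMap.ker_eq_bot.mpr (algebraMap K M).injective)
  exact ⟨r, fun x ↦ LinearMap.congr_fun hr x⟩

variable {W : Affine K}

/-- A regular function with values in a subfield at points over the subfield. -/
lemma exists_eval_eq_of_mapField (a : (W.map (algebraMap K M)).CoordinateRing) {T : Set W.Point}
    {g : W.Point → K} (h : ∀ Q ∉ T, Q ≠ 0 → (mapField (algebraMap K M) Q).eval a =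
      algebraMap K M (g Q)) :
    ∃ b : W.CoordinateRing, ∀ Q ∉ T, Q ≠ 0 → Q.eval b = g Q := by
  obtain ⟨P, Q, rfl⟩ := CoordinateRing.exists_smul_basis_eq a
  obtain ⟨r, hr⟩ := exists_linearMap_retraction K M
  obtain ⟨p, hp⟩ := Polynomial.exists_eval_eq_linearMap r P
  obtain ⟨q, hq⟩ := Polynomial.exists_eval_eq_linearMap r Q
  refine ⟨p • (1 : W.CoordinateRing) + q • CoordinateRing.mk W Y, fun R hR hR0 ↦ ?_⟩
  have hR0' : mapField (algebraMap K M) R ≠ 0 := by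
    rw [Ne, map_eq_zero_iff _ (mapField_injective _)]
    exact hR0
  have hc := isCoordMap_mapField (W := W) (algebraMap K M)
  have e := congrArg r (h R hR hR0)
  rw [hr, Point.eval_smul_basis hR0', hc.xCoord, hc.yCoord, map_add, hq,
    ← mul_one (Polynomial.eval _ P), ← map_one (algebraMap K M), hp, mul_one] at e
  rw [Point.eval_smul_basis hR0, e]

end Descent

section GaloisDescent

open Classical Point

variable {F : Type*} [Field F] {K : Type*} [Field K] [Algebra F K] {E : WeierstrassCurve F}

lemma isCoordMap_pointsMap (σ : K →ₐ[F] K) : IsCoordMap (σ : K →+* K) (E.pointsMap σ) where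
  map_a₁ := σ.commutes E.a₁
  map_a₃ := σ.commutes E.a₃
  xCoord P := by
    rcases P with _ | ⟨x, y, h⟩
    · exact (_root_.map_zero σ).symm
    · rfl
  yCoord P := by
    rcases P with _ | ⟨x, y, h⟩
    · exact (_root_.map_zero σ).symm
    · rfl

lemma pointsMap_injective {L : Type*} [Field L] [Algebra F L] (σ : K →ₐ[F] L) :
    Function.Injective (E.pointsMap σ) :=
  Point.map_injective σ

variable [IsSepClosed K] [IsGalois F K] [E.IsElliptic]

/-- If the values are Galois-equivariant, then b = p + qY and its conjugate agree at infinitely many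
points, hence are equal. So p and q have Galois-fixed coefficients, which lie in F. -/
lemma exists_value_eq_of_eval (b : (E.toAffine.baseChange K).CoordinateRing)
    {T : Set (E.PointsOver K)} (hT : T.Finite) {g : E.PointsOver K → K}
    (hb : ∀ Q ∉ T, Q ≠ 0 → Q.eval b = g Q)
    (hg : ∀ σ : K ≃ₐ[F] K, ∀ Q ∉ T, g (E.pointsMap σ Q) = σ (g Q)) :
    ∃ a : E.toAffine.CoordinateRing, ∀ Q ∉ T, Q ≠ 0 → Q.value a = g Q := by
  obtain ⟨p, q, rfl⟩ := CoordinateRing.exists_smul_basis_eq b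
  have key (σ : K ≃ₐ[F] K) : p.map (σ : K →+* K) = p ∧ q.map (σ : K →+* K) = q := by
    have hc := isCoordMap_pointsMap (E := E) (σ : K →ₐ[F] K)
    have h0 : (p.map (σ : K →+* K) - p) • (1 : (E.toAffine.baseChange K).CoordinateRing) +
        (q.map (σ : K →+* K) - q) • CoordinateRing.mk (E.toAffine.baseChange K) Y = 0 := by
      by_contra hne
      have hfin := CoordinateRing.finite_setOf_eval_eq_zero hne
      have hinf : Infinite (E.PointsOver K) :=
        inferInstanceAs (Infinite (E.toAffine.baseChange K).Point)
      have hinj := pointsMap_injective (E := E) (σ : K →ₐ[F] K)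
      obtain ⟨Q, hQ⟩ := (((Set.finite_singleton 0).union hT).union
        ((hT.union hfin).preimage hinj.injOn)).infinite_compl.nonempty
      simp only [Set.mem_compl_iff, Set.mem_union, Set.mem_singleton_iff, Set.mem_preimage,
        Set.mem_ofPred_eq, not_or, not_and] at hQ
      obtain ⟨⟨hQ0, hQT⟩, hσT, h1⟩ := hQ
      have hσ0 : E.pointsMap (σ : K →ₐ[F] K) Q ≠ 0 := by
        rw [Ne, map_eq_zero_iff _ hinj]
        exact hQ0
      refine h1 hσ0 ?_
      have e1 := hb _ hσT hσ0
      rw [hg σ Q hQT, ← hb Q hQT hQ0, Point.eval_smul_basis hQ0, Point.eval_smul_basis hσ0,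
        hc.xCoord, hc.yCoord] at e1
      rw [Point.eval_smul_basis hσ0, hc.xCoord, hc.yCoord, Polynomial.eval_sub, Polynomial.eval_sub]
      have hev (s : K[X]) (x : K) : (s.map (σ : K →+* K)).eval ((σ : K →ₐ[F] K) x) = σ (s.eval x) := by
        rw [eval_map]
        exact (hom_eval₂ s (RingHom.id K) (σ : K →+* K) x).symm
      have e2 (s : K[X]) := hev s Q.xCoord
      simp only [RingHom.coe_coe] at e1 e2 ⊢
      rw [e2, e2]
      simp only [map_add, map_mul] at e1
      have hs : (σ : K →ₐ[F] K) Q.yCoord = σ Q.yCoord := rfl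
      linear_combination -e1 + σ (q.eval Q.xCoord) * hs
    obtain ⟨h1, h2⟩ := CoordinateRing.smul_basis_eq_zero h0
    exact ⟨sub_eq_zero.mp h1, sub_eq_zero.mp h2⟩
  have lift (s : K[X]) (hs : ∀ σ : K ≃ₐ[F] K, s.map (σ : K →+* K) = s) :
      ∃ s' : F[X], s'.map (algebraMap F K) = s := by
    rw [← Polynomial.mem_lifts, lifts_iff_coeff_lifts]
    intro n
    rw [InfiniteGalois.mem_range_algebraMap_iff_fixed]
    intro σ
    conv_rhs => rw [← hs σ]
    rw [coeff_map]
    rfl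
  obtain ⟨p', hp'⟩ := lift p fun σ ↦ (key σ).1
  obtain ⟨q', hq'⟩ := lift q fun σ ↦ (key σ).2
  refine ⟨p' • (1 : E.toAffine.CoordinateRing) + q' • CoordinateRing.mk E.toAffine Y,
    fun Q hQ hQ0 ↦ ?_⟩
  rw [value, CoordinateRing.baseChange_smul_basis, hp', hq', hb Q hQ hQ0]

end GaloisDescent

end WeierstrassCurve.Affine

/-! ### The quotient by a Galois-stable subgroup over the base field -/

namespace WeierstrassCurve.Affine

set_option linter.unusedSectionVars false

open Polynomial

open Classical Point

section

variable {K : Type*} [Field K] {M : Type*} [Field M] {V : Affine K}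

lemma Point.exists_mapField_eq_of_coord (f : K →+* M) {A : (V.map f).Point} (hA : A ≠ 0) {x y : K}
    (hx : A.xCoord = f x) (hy : A.yCoord = f y) : ∃ P : V.Point, mapField f P = A := by
  rcases A with _ | ⟨x', y', h⟩
  · exact absurd rfl hA
  obtain rfl : x' = f x := hx
  obtain rfl : y' = f y := hy
  exact ⟨.some x y ((V.map_nonsingular f.injective x y).mp h), rfl⟩

lemma _root_.AddMonoidHom.exists_lift_of_injective {A B C : Type*} [AddGroup A] [AddGroup B]
    [AddGroup C] {g : B →+ C} (hg : Function.Injective g) (f : A →+ C) (h : ∀ a, ∃ b, g b = f a) :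
    ∃ k : A →+ B, ∀ a, g (k a) = f a := by
  choose k hk using h
  exact ⟨AddMonoidHom.mk' k fun a b ↦ hg (by rw [map_add, hk, hk, hk, map_add]), hk⟩

end

variable {F : Type*} [Field F] {K : Type*} [Field K] [Algebra F K] [IsSepClosed K] [IsGalois F K]
  {E : WeierstrassCurve F} [E.IsElliptic]

instance : (E.toAffine.baseChange K).IsElliptic :=
  inferInstanceAs (WeierstrassCurve.IsElliptic (WeierstrassCurve.map E (algebraMap F K)))

instance : Infinite (E.PointsOver K) :=
  inferInstanceAs (Infinite (E.toAffine.baseChange K).Point)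

lemma pointsMap_surjective (σ : K ≃ₐ[F] K) :
    Function.Surjective (E.pointsMap (σ : K →ₐ[F] K)) := by
  refine fun Q ↦ ⟨E.pointsMap (σ.symm : K →ₐ[F] K) Q, ?_⟩
  rcases Q with _ | ⟨x, y, h⟩
  · rfl
  · change Point.some _ _ _ = Point.some _ _ _
    simp only [Point.some.injEq]
    exact ⟨σ.apply_symm_apply x, σ.apply_symm_apply y⟩

lemma sumX_pointsMap {S : AddSubgroup (E.PointsOver K)} [Fintype S] {σ : K ≃ₐ[F] K}
    (hS : S.map (E.pointsMap (σ : K →ₐ[F] K)) = S) (Q : E.PointsOver K) :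
    sumX S (E.pointsMap (σ : K →ₐ[F] K) Q) = σ (sumX S Q) :=
  (isCoordMap_pointsMap (σ : K →ₐ[F] K)).sumX (pointsMap_injective _) hS Q

lemma sumY_pointsMap {S : AddSubgroup (E.PointsOver K)} [Fintype S] {σ : K ≃ₐ[F] K}
    (hS : S.map (E.pointsMap (σ : K →ₐ[F] K)) = S) (Q : E.PointsOver K) :
    sumY S (E.pointsMap (σ : K →ₐ[F] K) Q) = σ (sumY S Q) :=
  (isCoordMap_pointsMap (σ : K →ₐ[F] K)).sumY (pointsMap_injective _) hS Q

lemma eval_denomPoly_pointsMap {S : AddSubgroup (E.PointsOver K)} [Fintype S] {σ : K ≃ₐ[F] K}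
    (hS : S.map (E.pointsMap (σ : K →ₐ[F] K)) = S) (Q : E.PointsOver K) :
    (denomPoly S).eval (E.pointsMap (σ : K →ₐ[F] K) Q).xCoord = σ ((denomPoly S).eval Q.xCoord) := by
  have hc := isCoordMap_pointsMap (E := E) (σ : K →ₐ[F] K)
  have h := hc.denomPoly (pointsMap_injective _) hS
  nth_rw 1 [h]
  rw [hc.xCoord, eval_map]
  exact (hom_eval₂ (denomPoly S) (RingHom.id K) (σ : K →+* K) Q.xCoord).symm

/-- The Weierstrass equation of the quotient by a Galois-stable subgroup is defined over `F`. -/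
lemma exists_baseChange_eq {S : AddSubgroup (E.PointsOver K)} [Fintype S] {M : Type*} [Field M]
    [Algebra K M] [IsAlgClosed M]
    (hS : ∀ σ : K ≃ₐ[F] K, S.map (E.pointsMap (σ : K →ₐ[F] K)) = S)
    {SM : AddSubgroup ((E.toAffine.baseChange K).map (algebraMap K M)).Point} [Fintype SM]
    (hSM : AddSubgroup.map (mapField (algebraMap K M)) S = SM) {W' : Affine M}
    (hW' : ∀ Q ∉ SM, W'.Equation (sumX SM Q) (sumY SM Q)) :
    ∃ E' : WeierstrassCurve F, W' = (E'.toAffine.baseChange K).map (algebraMap K M) := by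
  let ι := algebraMap K M
  have hinj := mapField_injective (W := E.toAffine.baseChange K) ι
  have hc := isCoordMap_mapField (W := E.toAffine.baseChange K) ι
  have hmem {Q : E.PointsOver K} : mapField ι Q ∈ SM ↔ Q ∈ S := by
    rw [← hSM, AddSubgroup.mem_map_iff_mem hinj]
  have hX (Q : E.PointsOver K) : sumX SM (mapField ι Q) = ι (sumX S Q) := hc.sumX hinj hSM Q
  have hY (Q : E.PointsOver K) : sumY SM (mapField ι Q) = ι (sumY S Q) := hc.sumY hinj hSM Q
  have hindep {d₁ d₂ d₃ d₄ d₆ : M} (h : ∀ Q ∉ S, d₁ * ι (sumX S Q) * ι (sumY S Q) +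
      d₂ * ι (sumX S Q) ^ 2 + d₃ * ι (sumY S Q) + d₄ * ι (sumX S Q) + d₆ = 0) :
      d₁ = 0 ∧ d₂ = 0 ∧ d₃ = 0 ∧ d₄ = 0 ∧ d₆ = 0 := by
    have hfin : (S : Set (E.PointsOver K)).Finite := Set.toFinite _
    refine eq_zero_of_sum_eq_zero (S := SM) (T := mapField ι '' (S : Set (E.PointsOver K))ᶜ)
      (hfin.infinite_compl.image hinj.injOn) ?_ ?_
    · rintro _ ⟨Q, hQ, rfl⟩
      exact fun h ↦ hQ (hmem.mp h)
    · rintro _ ⟨Q, hQ, rfl⟩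
      rw [hX, hY]
      exact h Q hQ
  obtain ⟨r, hr⟩ := exists_linearMap_retraction K M
  have e1 (Q : E.PointsOver K) (hQ : Q ∉ S) : ι (sumY S Q) ^ 2 + W'.a₁ * ι (sumX S Q) * ι (sumY S Q) +
      W'.a₃ * ι (sumY S Q) = ι (sumX S Q) ^ 3 + W'.a₂ * ι (sumX S Q) ^ 2 + W'.a₄ * ι (sumX S Q) +
        W'.a₆ := by
    rw [← hX, ← hY]
    exact (equation_iff _ _).mp (hW' _ fun h ↦ hQ (hmem.mp h))
  -- Applying the retraction gives a relation of the same shape with coefficients in K. By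
  -- independence of 1, x, y, x², xy it coincides with the given one.
  have e2 (Q : E.PointsOver K) (hQ : Q ∉ S) : sumY S Q ^ 2 + r W'.a₁ * sumX S Q * sumY S Q +
      r W'.a₃ * sumY S Q = sumX S Q ^ 3 + r W'.a₂ * sumX S Q ^ 2 + r W'.a₄ * sumX S Q + r W'.a₆ := by
    have hm (a : M) (b : K) : r (a * ι b) = r a * b := by
      rw [mul_comm, ← Algebra.smul_def, map_smul, smul_eq_mul, mul_comm]
    have := congrArg r (e1 Q hQ)
    rw [mul_assoc W'.a₁, ← map_mul, ← map_pow, ← map_pow, ← map_pow] at this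
    simp only [map_add] at this
    rw [hr, hr, hm, hm, hm, hm] at this
    linear_combination this
  have hιr : ∀ Q ∉ S, _ := fun Q hQ ↦ congrArg ι (e2 Q hQ)
  simp only [map_add, map_mul, map_pow] at hιr
  obtain ⟨h1, h2, h3, h4, h6⟩ := hindep (d₁ := ι (r W'.a₁) - W'.a₁) (d₂ := W'.a₂ - ι (r W'.a₂))
    (d₃ := ι (r W'.a₃) - W'.a₃) (d₄ := W'.a₄ - ι (r W'.a₄)) (d₆ := W'.a₆ - ι (r W'.a₆))
    (fun Q hQ ↦ by linear_combination hιr Q hQ - e1 Q hQ)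
  -- Since σ permutes the points outside S and the sums are equivariant, the conjugate coefficients
  -- satisfy the same relation; uniqueness makes them fixed.
  have hfix (σ : K ≃ₐ[F] K) : σ (r W'.a₁) = r W'.a₁ ∧ σ (r W'.a₂) = r W'.a₂ ∧
      σ (r W'.a₃) = r W'.a₃ ∧ σ (r W'.a₄) = r W'.a₄ ∧ σ (r W'.a₆) = r W'.a₆ := by
    have e3 (Q : E.PointsOver K) (hQ : Q ∉ S) : sumY S Q ^ 2 + σ (r W'.a₁) * sumX S Q * sumY S Q +
        σ (r W'.a₃) * sumY S Q = sumX S Q ^ 3 + σ (r W'.a₂) * sumX S Q ^ 2 +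
          σ (r W'.a₄) * sumX S Q + σ (r W'.a₆) := by
      obtain ⟨R, rfl⟩ := pointsMap_surjective (E := E) σ Q
      have hR : R ∉ S := fun h ↦ hQ (by rw [← hS σ]; exact AddSubgroup.mem_map_of_mem _ h)
      have := congrArg σ (e2 R hR)
      simp only [map_add, map_mul, map_pow] at this
      rw [sumX_pointsMap (hS σ), sumY_pointsMap (hS σ), this]
    have hισ : ∀ Q ∉ S, _ := fun Q hQ ↦ congrArg ι (e3 Q hQ)
    simp only [map_add, map_mul, map_pow] at hισ
    obtain ⟨h1, h2, h3, h4, h6⟩ := hindep (d₁ := ι (σ (r W'.a₁)) - ι (r W'.a₁))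
      (d₂ := ι (r W'.a₂) - ι (σ (r W'.a₂))) (d₃ := ι (σ (r W'.a₃)) - ι (r W'.a₃))
      (d₄ := ι (r W'.a₄) - ι (σ (r W'.a₄))) (d₆ := ι (r W'.a₆) - ι (σ (r W'.a₆)))
      (fun Q hQ ↦ by linear_combination hισ Q hQ - hιr Q hQ)
    exact ⟨ι.injective (sub_eq_zero.mp h1), (ι.injective (sub_eq_zero.mp h2)).symm,
      ι.injective (sub_eq_zero.mp h3), (ι.injective (sub_eq_zero.mp h4)).symm,
      (ι.injective (sub_eq_zero.mp h6)).symm⟩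
  have hF (x : K) (hx : ∀ σ : K ≃ₐ[F] K, σ x = x) : ∃ y : F, algebraMap F K y = x :=
    (InfiniteGalois.mem_range_algebraMap_iff_fixed x).mpr hx
  obtain ⟨b₁, hb1⟩ := hF _ fun σ ↦ (hfix σ).1
  obtain ⟨b₂, hb2⟩ := hF _ fun σ ↦ (hfix σ).2.1
  obtain ⟨b₃, hb3⟩ := hF _ fun σ ↦ (hfix σ).2.2.1
  obtain ⟨b₄, hb4⟩ := hF _ fun σ ↦ (hfix σ).2.2.2.1
  obtain ⟨b₆, hb6⟩ := hF _ fun σ ↦ (hfix σ).2.2.2.2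
  refine ⟨⟨b₁, b₂, b₃, b₄, b₆⟩, WeierstrassCurve.ext ?_ ?_ ?_ ?_ ?_⟩
  · exact ((congrArg ι hb1).trans (sub_eq_zero.mp h1)).symm
  · exact ((congrArg ι hb2).trans (sub_eq_zero.mp h2).symm).symm
  · exact ((congrArg ι hb3).trans (sub_eq_zero.mp h3)).symm
  · exact ((congrArg ι hb4).trans (sub_eq_zero.mp h4).symm).symm
  · exact ((congrArg ι hb6).trans (sub_eq_zero.mp h6).symm).symm

/-- The quotient by a finite Galois-stable subgroup of odd order prime to the characteristic. -/
theorem exists_quotient {S : AddSubgroup (E.PointsOver K)} [Fintype S] (hodd : Odd (Nat.card S))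
    (hn : (Nat.card S : F) ≠ 0) (hS : ∀ σ : K ≃ₐ[F] K, S.map (E.pointsMap (σ : K →ₐ[F] K)) = S)
    (M : Type*) [Field M] [Algebra K M] [IsAlgClosed M] :
    ∃ E' : WeierstrassCurve F, E'.IsElliptic ∧ ∃ φ : E.PointsOver K →+ E'.PointsOver K, φ.ker = S ∧
      (∀ Q ∉ S, (φ Q).xCoord = sumX S Q ∧ (φ Q).yCoord = sumY S Q) ∧
      (∃ numX numY den : E.toAffine.CoordinateRing,
        (∀ Q : E.PointsOver K, Q ≠ 0 → Q.value den = (denomPoly S).eval Q.xCoord ^ 2) ∧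
        (∀ Q ∉ S, Q.value numX = sumX S Q * (denomPoly S).eval Q.xCoord ^ 2) ∧
        (∀ Q ∉ S, Q.value numY = sumY S Q * (denomPoly S).eval Q.xCoord ^ 2)) ∧
      ∃ u : M[X], IsCoprime u ((denomPoly S).map (algebraMap K M)) ∧ u.natDegree = Nat.card S ∧
        ∀ Q ∉ S, u.eval (algebraMap K M Q.xCoord) =
          algebraMap K M (sumX S Q * (denomPoly S).eval Q.xCoord) := by
  let ι := algebraMap K M
  have hinj := mapField_injective (W := E.toAffine.baseChange K) ι
  have hc := isCoordMap_mapField (W := E.toAffine.baseChange K) ι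
  let SM : AddSubgroup ((E.toAffine.baseChange K).map ι).Point := AddSubgroup.map (mapField ι) S
  have hSM : AddSubgroup.map (mapField ι) S = SM := rfl
  let equiv : S ≃ SM := (AddSubgroup.equivMapOfInjective S (mapField ι) hinj).toEquiv
  let _ : Fintype SM := Fintype.ofEquiv S equiv
  have hcard : Nat.card SM = Nat.card S := (Nat.card_congr equiv).symm
  have hmem {Q : E.PointsOver K} : mapField ι Q ∈ SM ↔ Q ∈ S := by
    rw [← hSM, AddSubgroup.mem_map_iff_mem hinj]
  have hX (Q : E.PointsOver K) : sumX SM (mapField ι Q) = ι (sumX S Q) := hc.sumX hinj hSM Q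
  have hY (Q : E.PointsOver K) : sumY SM (mapField ι Q) = ι (sumY S Q) := hc.sumY hinj hSM Q
  have hD : denomPoly SM = (denomPoly S).map ι := hc.denomPoly hinj hSM
  have hDev (Q : E.PointsOver K) : (denomPoly SM).eval (mapField ι Q).xCoord =
      ι ((denomPoly S).eval Q.xCoord) := by
    rw [hD, hc.xCoord, eval_map]
    exact (hom_eval₂ (denomPoly S) (RingHom.id K) ι Q.xCoord).symm
  have hodd' : Odd (Nat.card SM) := by rwa [hcard]
  have hnM : (Nat.card SM : M) ≠ 0 := by
    rw [hcard, ← map_natCast ι, ← map_natCast (algebraMap F K)]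
    exact (_root_.map_ne_zero _).mpr ((_root_.map_ne_zero _).mpr hn)
  -- The quotient is formed over the algebraically closed field M; its equation and the homomorphism
  -- are then descended.
  obtain ⟨W', hW'⟩ := FunctionField.exists_equation_quot
    ((E.toAffine.baseChange K).map ι).FunctionField hodd' hnM
  have hell := FunctionField.isElliptic_of_equation_quot hodd' hnM hW'
  obtain ⟨E', rfl⟩ := exists_baseChange_eq hS hSM fun Q hQ ↦ FunctionField.equation_sum hW' hQ
  obtain ⟨φM, hker, hφM⟩ := FunctionField.exists_quotientHom hW' hodd' hnM
  have hE' : E'.IsElliptic := by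
    refine ⟨isUnit_iff_ne_zero.mpr fun h ↦ hell.1.ne_zero ?_⟩
    have e1 := WeierstrassCurve.map_Δ (W := E'.toAffine.baseChange K) ι
    have e2 := WeierstrassCurve.map_Δ (W := E') (algebraMap F K)
    rw [h, _root_.map_zero] at e2
    exact e1.trans ((congrArg ι e2).trans (_root_.map_zero ι))
  -- Images of K-points have coordinates `sumX` and `sumY`, which lie in K.
  obtain ⟨φ, hφ⟩ := AddMonoidHom.exists_lift_of_injective
    (mapField_injective (W := E'.toAffine.baseChange K) ι) (φM.comp (mapField ι)) fun Q ↦ by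
      by_cases hQ : Q ∈ S
      · refine ⟨0, ?_⟩
        have : mapField ι Q ∈ φM.ker := by rw [hker, hmem]; exact hQ
        rw [_root_.map_zero, AddMonoidHom.comp_apply, (AddMonoidHom.mem_ker).mp this]
      · have hQ' : mapField ι Q ∉ SM := fun h ↦ hQ (hmem.mp h)
        refine exists_mapField_eq_of_coord ι (x := sumX S Q) (y := sumY S Q) ?_ ?_ ?_
        · rw [AddMonoidHom.comp_apply, Ne, ← AddMonoidHom.mem_ker, hker]
          exact hQ'
        · rw [AddMonoidHom.comp_apply, (hφM _ hQ').1, hX]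
        · rw [AddMonoidHom.comp_apply, (hφM _ hQ').2, hY]
  have hc' := isCoordMap_mapField (W := E'.toAffine.baseChange K) ι
  refine ⟨E', hE', φ, ?_, fun Q hQ ↦ ?_, ?_, ?_⟩
  · ext Q
    rw [AddMonoidHom.mem_ker, ← map_eq_zero_iff _ (mapField_injective (W := E'.toAffine.baseChange K) ι),
      hφ, AddMonoidHom.comp_apply, ← AddMonoidHom.mem_ker, hker, hmem]
  · have hQ' : mapField ι Q ∉ SM := fun h ↦ hQ (hmem.mp h)
    obtain ⟨h1, h2⟩ := hφM _ hQ'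
    rw [hX, ← AddMonoidHom.comp_apply, ← hφ, hc'.xCoord] at h1
    rw [hY, ← AddMonoidHom.comp_apply, ← hφ, hc'.yCoord] at h2
    exact ⟨ι.injective h1, ι.injective h2⟩
  · have hne {Q : E.PointsOver K} (hQ : Q ∉ S) : Q ≠ 0 := fun h ↦ hQ (h ▸ S.zero_mem)
    have hne' {Q : E.PointsOver K} (hQ : Q ∉ S) : mapField ι Q ≠ 0 := by
      rw [Ne, map_eq_zero_iff _ hinj]
      exact hne hQ
    have hST (σ : K ≃ₐ[F] K) {Q : E.PointsOver K} (hQ : Q ∉ S) :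
        E.pointsMap (σ : K →ₐ[F] K) Q ∉ S := fun h ↦ hQ (by
      rw [← hS σ] at h
      exact (AddSubgroup.mem_map_iff_mem (pointsMap_injective _)).mp h)
    have hfin : (S : Set (E.PointsOver K)).Finite := Set.toFinite _
    obtain ⟨den, hden⟩ := exists_value_eq_of_eval (E := E)
      (((denomPoly S) ^ 2) • (1 : (E.toAffine.baseChange K).CoordinateRing) +
        (0 : K[X]) • CoordinateRing.mk (E.toAffine.baseChange K) Y) Set.finite_empty
      (g := fun Q ↦ (denomPoly S).eval Q.xCoord ^ 2)
      (fun Q _ hQ ↦ by rw [Point.eval_smul_basis hQ]; simp)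
      (fun σ Q _ ↦ by rw [eval_denomPoly_pointsMap (hS σ), map_pow])
    obtain ⟨u, hu, hdeg, hval⟩ := FunctionField.exists_eval_eq_sumX hodd'
    obtain ⟨bX, hbX⟩ := exists_eval_eq_of_mapField (W := E.toAffine.baseChange K) (M := M)
      ((u * denomPoly SM) • (1 : ((E.toAffine.baseChange K).map ι).CoordinateRing) +
        (0 : M[X]) • CoordinateRing.mk ((E.toAffine.baseChange K).map ι) Y)
      (T := (S : Set (E.PointsOver K))) (g := fun Q ↦ sumX S Q * (denomPoly S).eval Q.xCoord ^ 2)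
      (fun Q hQ hQ0 ↦ by
        rw [Point.eval_smul_basis (hne' hQ), Polynomial.eval_mul, hval _ fun h ↦ hQ (hmem.mp h), hX,
          hDev]
        simp only [Polynomial.eval_zero, zero_mul, add_zero, map_mul, map_pow]
        ring)
    obtain ⟨numX, hnumX⟩ := exists_value_eq_of_eval bX hfin hbX fun σ Q hQ ↦ by
      rw [eval_denomPoly_pointsMap (hS σ), sumX_pointsMap (hS σ), map_mul, map_pow]
    obtain ⟨v', hv'⟩ := FunctionField.exists_eval_eq_sumY hodd'
    obtain ⟨bY, hbY⟩ := exists_eval_eq_of_mapField (W := E.toAffine.baseChange K) (M := M) v'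
      (T := (S : Set (E.PointsOver K))) (g := fun Q ↦ sumY S Q * (denomPoly S).eval Q.xCoord ^ 2)
      (fun Q hQ hQ0 ↦ by
        have := hv' (mapField ι Q) fun h ↦ hQ (hmem.mp h)
        rw [hY, hDev] at this
        rw [this, map_mul, map_pow])
    obtain ⟨numY, hnumY⟩ := exists_value_eq_of_eval bY hfin hbY fun σ Q hQ ↦ by
      rw [eval_denomPoly_pointsMap (hS σ), sumY_pointsMap (hS σ), map_mul, map_pow]
    exact ⟨numX, numY, den, fun Q hQ ↦ hden Q (Set.notMem_empty _) hQ,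
      fun Q hQ ↦ hnumX Q hQ (hne hQ), fun Q hQ ↦ hnumY Q hQ (hne hQ)⟩
  · obtain ⟨u, hu, hdeg, hval⟩ := FunctionField.exists_eval_eq_sumX hodd'
    refine ⟨u, ?_, hdeg.trans hcard, fun Q hQ ↦ ?_⟩
    · rwa [hD] at hu
    · have := hval (mapField ι Q) (fun h ↦ hQ (hmem.mp h))
      rwa [hX, hDev, hc.xCoord, ← map_mul] at this

end WeierstrassCurve.Affine

/-! ### Stable subgroups of odd order are kernels of isogenies -/

namespace WeierstrassCurve

set_option linter.unusedSectionVars false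

open Polynomial WeierstrassCurve.Affine

open Classical WeierstrassCurve.Affine.Point

variable {F : Type*} [Field F] {E : WeierstrassCurve F} [E.IsElliptic]

/-- A finite Galois-stable subgroup of odd order prime to the characteristic is the kernel of an
isogeny whose degree is its order. -/
theorem mem_isogenyKernels {S : AddSubgroup E.SepPoints} [Fintype S] (hodd : Odd (Nat.card S))
    (hn : (Nat.card S : F) ≠ 0) (hS : ∀ σ : Gal(SeparableClosure F/F),
      S.map (E.pointsMap (σ : SeparableClosure F →ₐ[F] SeparableClosure F)) = S) :
    S ∈ E.isogenyKernels (Nat.card S) := by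
  let K := SeparableClosure F
  let M := AlgebraicClosure K
  obtain ⟨E', hE', φ, hker, hφ, ⟨nX, nY, d, hd, hnX, hnY⟩, u, hu, hudeg, hval⟩ :=
    exists_quotient hodd hn hS M
  obtain ⟨numX, rfl⟩ := AdjoinRoot.mk_surjective nX
  obtain ⟨numY, rfl⟩ := AdjoinRoot.mk_surjective nY
  obtain ⟨den, rfl⟩ := AdjoinRoot.mk_surjective d
  have hfin : (S : Set E.SepPoints).Finite := Set.toFinite _
  have hDne {Q : E.SepPoints} (hQ : Q ∉ S) : (denomPoly S).eval Q.xCoord ≠ 0 := by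
    have hQ0 : Q ≠ 0 := fun h ↦ hQ (h ▸ S.zero_mem)
    rw [Ne, eval_denomPoly_eq_zero_iff hQ0]
    exact hQ
  have hden0 : CoordinateRing.mk E.toAffine den ≠ 0 := by
    intro h0
    obtain ⟨Q, hQ⟩ := hfin.infinite_compl.nonempty
    have hQ0 : Q ≠ 0 := fun h ↦ hQ (h ▸ S.zero_mem)
    have := hd Q hQ0
    obtain ⟨g, hg⟩ := exists_ringHom_value hQ0
    change Q.value (CoordinateRing.mk E.toAffine den) = _ at this
    rw [h0, hg, _root_.map_zero] at this
    exact hDne hQ (pow_eq_zero_iff two_ne_zero |>.mp this.symm)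
  let ψ : Isogeny E E' :=
    { toHom := φ
      numX := numX
      numY := numY
      den := den
      den_ne_zero := hden0
      toHom_some := fun x y h hne ↦ by
        have hd' := hd (.some x y h) (Point.some_ne_zero h)
        have e1 := value_mk_some h den
        have e2 := value_mk_some h numX
        have e3 := value_mk_some h numY
        have hne' : (denomPoly S).eval (Point.some x y h).xCoord ^ 2 ≠ 0 := by
          rw [← hd']
          exact e1 ▸ hne
        have hQ : Point.some x y h ∉ S := by
          rw [← eval_denomPoly_eq_zero_iff (Point.some_ne_zero h)]
          exact fun h ↦ hne' (by rw [h, zero_pow two_ne_zero])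
        have eX := hnX _ hQ
        have eY := hnY _ hQ
        obtain ⟨h1, h2⟩ := hφ _ hQ
        have hφ0 : φ (.some x y h) ≠ 0 := by
          refine fun h0 ↦ hQ ?_
          rw [← hker]
          exact h0
        have hx : (φ (.some x y h)).xCoord = aevalAeval x y numX / aevalAeval x y den := by
          rw [h1, ← e1, ← e2]
          exact eq_div_of_mul_eq (by rw [e1]; exact hne) ((congrArg _ hd').trans eX.symm)
        have hy : (φ (.some x y h)).yCoord = aevalAeval x y numY / aevalAeval x y den := by
          rw [h2, ← e1, ← e3]
          exact eq_div_of_mul_eq (by rw [e1]; exact hne) ((congrArg _ hd').trans eY.symm)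
        rw [← hx, ← hy]
        generalize φ (.some x y h) = R at hφ0
        rcases R with _ | ⟨x', y', h'⟩
        · exact absurd rfl hφ0
        · exact ⟨h', rfl⟩ }
  refine ⟨E', hE', ψ, ?_, hker⟩
  obtain ⟨u', w', hcop, hw', hdeg, hfin'⟩ := ψ.exists_isCoprime_degree
  let ι := algebraMap F M
  have hcop' : IsCoprime (u'.map ι) (w'.map ι) := (isCoprime_map _).mpr hcop
  -- The x-coordinate of the isogeny has two expressions in lowest terms: u'/w', whose degree is
  -- that of the isogeny, and u over `denomPoly`. They agree at infinitely many points, so their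
  -- degrees are equal, and the second one has degree |S|.
  have hmul : u * w'.map ι = u'.map ι * (denomPoly S).map (algebraMap K M) := by
    rw [← sub_eq_zero]
    by_contra hp
    have hroots := ((Polynomial.rootSet_finite _ M).preimage
      ((algebraMap K M).injective.injOn)).subset fun x (hx : _) ↦
        show algebraMap K M x ∈ _ from mem_rootSet.mpr ⟨hp, hx⟩
    obtain ⟨Q, hQ⟩ := ((hfin.union hfin').union
      (finite_setOf_xCoord_mem (W := E.toAffine.baseChange K) hroots)).infinite_compl.nonempty
    simp only [Set.mem_compl_iff, Set.mem_union, Set.mem_ofPred_eq, not_or,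
      not_not] at hQ
    obtain ⟨⟨hQS, hQ0, hwQ, -, hxQ⟩, hne⟩ := hQ
    refine hne ⟨hQ0, ?_⟩
    change aeval (algebraMap K M Q.xCoord) _ = 0
    have hev (s : F[X]) : (s.map ι).eval (algebraMap K M Q.xCoord) =
        algebraMap K M (aeval Q.xCoord s) := by
      rw [eval_map_algebraMap, aeval_algebraMap_apply]
    have hD : ((denomPoly S).map (algebraMap K M)).eval (algebraMap K M Q.xCoord) =
        algebraMap K M ((denomPoly S).eval Q.xCoord) := by
      rw [eval_map_algebraMap, aeval_algebraMap_apply, coe_aeval_eq_eval]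
    have e1 : sumX S Q * aeval Q.xCoord w' = aeval Q.xCoord u' := by
      rw [← (hφ Q hQS).1]
      exact (eq_div_iff hwQ).mp hxQ
    rw [coe_aeval_eq_eval, Polynomial.eval_sub, Polynomial.eval_mul, Polynomial.eval_mul, hev, hev,
      hval Q hQS, hD, ← e1]
    simp only [map_mul]
    ring
  obtain ⟨h1, h2⟩ := Polynomial.natDegree_eq_of_isCoprime_of_mul_eq hu hcop' hmul
  rw [natDegree_map] at h1
  rw [natDegree_map, natDegree_map] at h2
  rw [← hdeg, ← h1, ← h2, hudeg, natDegree_denomPoly]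
  exact max_eq_left (Nat.sub_le _ _)

end WeierstrassCurve

/-! ### Galois action on points, isogenies and rational torsion -/

namespace WeierstrassCurve

set_option linter.unusedSectionVars false

open Polynomial WeierstrassCurve.Affine

open WeierstrassCurve.Affine.Point

variable {F : Type*} [Field F]

section Rational

variable (E : WeierstrassCurve F)

lemma pointsMap_pointsMap_ofId (σ : Gal(SeparableClosure F/F)) (P : E.PointsOver F) :
    E.pointsMap (σ : SeparableClosure F →ₐ[F] SeparableClosure F)
      (E.pointsMap (Algebra.ofId F (SeparableClosure F)) P) =
        E.pointsMap (Algebra.ofId F (SeparableClosure F)) P := by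
  rcases P with _ | ⟨x, y, h⟩
  · rfl
  · change Point.some _ _ _ = Point.some _ _ _
    simp only [Point.some.injEq]
    exact ⟨σ.commutes x, σ.commutes y⟩

variable {E}

lemma exists_pointsMap_ofId_eq {Q : E.SepPoints} (hQ : ∀ σ : Gal(SeparableClosure F/F),
    E.pointsMap (σ : SeparableClosure F →ₐ[F] SeparableClosure F) Q = Q) :
    ∃ P, E.pointsMap (Algebra.ofId F (SeparableClosure F)) P = Q := by
  rcases Q with _ | ⟨x, y, h⟩
  · exact ⟨0, rfl⟩
  have hF (z : SeparableClosure F) (hz : ∀ σ : Gal(SeparableClosure F/F), σ z = z) :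
      ∃ w : F, algebraMap F (SeparableClosure F) w = z :=
    (InfiniteGalois.mem_range_algebraMap_iff_fixed z).mpr hz
  have hxy (σ : Gal(SeparableClosure F/F)) : σ x = x ∧ σ y = y := by
    have : Point.some _ _ _ = Point.some _ _ _ := hQ σ
    rw [Point.some.injEq] at this
    exact this
  obtain ⟨a, rfl⟩ := hF x fun σ ↦ (hxy σ).1
  obtain ⟨b, rfl⟩ := hF y fun σ ↦ (hxy σ).2
  exact ⟨.some a b ((E.toAffine.baseChange_nonsingular
    (Algebra.ofId F (SeparableClosure F)).injective a b).mp h), rfl⟩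

end Rational

section Isogeny

variable {E₁ E₂ : WeierstrassCurve F} [E₁.IsElliptic]

lemma aevalAeval_algEquiv (σ : Gal(SeparableClosure F/F)) (x y : SeparableClosure F) (f : F[X][Y]) :
    aevalAeval (σ x) (σ y) f = σ (aevalAeval x y f) := by
  change _ = ((σ : SeparableClosure F →ₐ[F] SeparableClosure F).comp (aevalAeval x y)) f
  congr 1
  ext <;> simp

/-- Isogenies over `F` commute with the Galois action. -/
lemma Isogeny.toHom_pointsMap (φ : Isogeny E₁ E₂) (σ : Gal(SeparableClosure F/F))
    (Q : E₁.SepPoints) :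
    φ.toHom (E₁.pointsMap (σ : SeparableClosure F →ₐ[F] SeparableClosure F) Q) =
      E₂.pointsMap (σ : SeparableClosure F →ₐ[F] SeparableClosure F) (φ.toHom Q) := by
  have key {R : E₁.SepPoints} (hR : R ≠ 0) (hd : R.value (CoordinateRing.mk E₁.toAffine φ.den) ≠ 0) :
      φ.toHom (E₁.pointsMap (σ : SeparableClosure F →ₐ[F] SeparableClosure F) R) =
        E₂.pointsMap (σ : SeparableClosure F →ₐ[F] SeparableClosure F) (φ.toHom R) := by
    rcases R with _ | ⟨x, y, h⟩
    · exact absurd rfl hR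
    rw [Point.value_mk_some] at hd
    obtain ⟨h₁, e₁⟩ := φ.toHom_some x y h hd
    obtain ⟨h₂, e₂⟩ := φ.toHom_some (σ x) (σ y)
      ((E₁.toAffine.baseChange_nonsingular (f := (σ : SeparableClosure F →ₐ[F] SeparableClosure F))
        σ.injective x y).mpr h) (by rw [aevalAeval_algEquiv]; exact (_root_.map_ne_zero σ).mpr hd)
    rw [e₁]
    refine e₂.trans ?_
    change Point.some _ _ _ = Point.some _ _ _
    simp only [Point.some.injEq, aevalAeval_algEquiv, ← map_div₀]
    exact ⟨rfl, rfl⟩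
  -- The defining formula gives equivariance only off the zeros of the denominator; a general Q is
  -- the difference of two such points R + Q and R.
  have hfin := φ.finite_setOf_value_den_eq_zero.insert 0
  obtain ⟨R, hR⟩ := (hfin.union (hfin.preimage (add_left_injective Q).injOn)).infinite_compl.nonempty
  simp only [Set.mem_compl_iff, Set.mem_union, Set.mem_preimage, Set.mem_insert_iff,
    Set.mem_ofPred_eq, not_or, not_and] at hR
  obtain ⟨⟨h1, h2⟩, h3, h4⟩ := hR
  have e1 := key h1 (h2 h1)
  have e2 := key h3 (h4 h3)
  rw [_root_.map_add, _root_.map_add, _root_.map_add, _root_.map_add, e1] at e2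
  exact add_left_cancel e2

end Isogeny

section Torsion

variable (E : WeierstrassCurve F) (l : ℕ)

lemma mem_torsionOver_iff {L : Type*} [Field L] [Algebra F L] {P : E.PointsOver L} :
    P ∈ E.torsionOver L l ↔ l • P = 0 :=
  AddSubgroup.torsionBy.nsmul_iff

variable {l}

lemma card_geomTorsion [E.IsElliptic] (hl : (l : F) ≠ 0) : Nat.card (E.geomTorsion l) = l ^ 2 := by
  have hl' : (l : SeparableClosure F) ≠ 0 := by
    rw [← map_natCast (algebraMap F (SeparableClosure F))]
    exact (_root_.map_ne_zero _).mpr hl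
  let _ : DecidableEq (SeparableClosure F) := fun a b ↦ Classical.propDecidable (a = b)
  rw [← Point.card_ker_nsmul (W := E.toAffine.baseChange (SeparableClosure F)) hl']
  exact Nat.card_congr (Equiv.subtypeEquivRight fun P ↦ E.mem_torsionOver_iff l)

variable {E} [Fact l.Prime]

lemma exists_fixed_of_torsionOver_ne_bot (h : E.torsionOver F l ≠ ⊥) :
    ∃ P : E.SepPoints, l • P = 0 ∧ P ≠ 0 ∧ ∀ σ : Gal(SeparableClosure F/F),
      E.pointsMap (σ : SeparableClosure F →ₐ[F] SeparableClosure F) P = P := by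
  obtain ⟨⟨P, hP⟩, hP'⟩ := AddSubgroup.ne_bot_iff_exists_ne_zero.mp h
  have hP0 : P ≠ 0 := fun h ↦ hP' (Subtype.ext h)
  refine ⟨E.pointsMap (Algebra.ofId F (SeparableClosure F)) P, ?_, ?_,
    fun σ ↦ pointsMap_pointsMap_ofId E σ P⟩
  · rw [← map_nsmul, (E.mem_torsionOver_iff l).mp hP, _root_.map_zero]
  · rw [Ne, map_eq_zero_iff _ (pointsMap_injective _)]
    exact hP0

lemma torsionOver_ne_bot_of_fixed {P : E.SepPoints} (hl : l • P = 0) (hP : P ≠ 0)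
    (h : ∀ σ : Gal(SeparableClosure F/F),
      E.pointsMap (σ : SeparableClosure F →ₐ[F] SeparableClosure F) P = P) :
    E.torsionOver F l ≠ ⊥ := by
  obtain ⟨P, rfl⟩ := exists_pointsMap_ofId_eq h
  rw [← map_nsmul, map_eq_zero_iff _ (pointsMap_injective _)] at hl
  refine fun hbot ↦ hP ?_
  have : P ∈ E.torsionOver F l := (E.mem_torsionOver_iff l).mpr hl
  rw [hbot, AddSubgroup.mem_bot] at this
  rw [this, _root_.map_zero]

lemma torsionOver_ne_bot_of_rank_eq_one (h : Module.rank (ZMod l) (E.torsionOver F l) = 1) :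
    E.torsionOver F l ≠ ⊥ := by
  intro hbot
  have : Subsingleton (E.torsionOver F l) := by
    rw [hbot]
    infer_instance
  rw [rank_subsingleton'] at h
  exact zero_ne_one h

/-- If `E(F)[l]` is one-dimensional, some `l`-torsion point is not rational. -/
lemma exists_not_fixed_of_rank_eq_one [E.IsElliptic] (hl : (l : F) ≠ 0)
    (h : Module.rank (ZMod l) (E.torsionOver F l) = 1) :
    ∃ (σ : Gal(SeparableClosure F/F)) (P : E.SepPoints), l • P = 0 ∧
      E.pointsMap (σ : SeparableClosure F →ₐ[F] SeparableClosure F) P ≠ P := by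
  by_contra! hfix
  have hfin : Module.Finite (ZMod l) (E.torsionOver F l) :=
    Module.finite_of_rank_eq_one h
  have hcard : Nat.card (E.torsionOver F l) = l := by
    rw [Module.natCard_eq_pow_finrank (K := ZMod l), Module.rank_eq_one_iff_finrank_eq_one.mp h,
      Nat.card_zmod, pow_one]
  have hl1 : 1 < l := (Fact.out : l.Prime).one_lt
  have : Finite (E.torsionOver F l) := Nat.finite_of_card_ne_zero (by omega)
  have hex (P : E.geomTorsion l) : ∃ Q : E.torsionOver F l,
      E.pointsMap (Algebra.ofId F (SeparableClosure F)) Q = P := by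
    have hP : l • (P : E.SepPoints) = 0 := (E.mem_torsionOver_iff l).mp P.2
    obtain ⟨Q, hQ⟩ := exists_pointsMap_ofId_eq fun σ ↦ hfix σ P hP
    refine ⟨⟨Q, (E.mem_torsionOver_iff l).mpr ?_⟩, hQ⟩
    rwa [← hQ, ← map_nsmul, map_eq_zero_iff _ (pointsMap_injective _)] at hP
  choose g hg using hex
  have hinj : Function.Injective g := fun P Q h ↦ Subtype.ext (by rw [← hg, ← hg, h])
  have := Nat.card_le_card_of_injective g hinj
  rw [E.card_geomTorsion hl, hcard] at this
  nlinarith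

end Torsion

end WeierstrassCurve

/-! ### Galois action on the zeros of the resolvents -/

namespace WeierstrassCurve

set_option linter.unusedSectionVars false

open Polynomial WeierstrassCurve.Affine

section Resolvent

open Classical WeierstrassCurve.Affine.Point

variable {F : Type*} [Field F] {K : Type*} [Field K] [Algebra F K] [IsSepClosed K]
  {E : WeierstrassCurve F} [E.IsElliptic] {m : ℕ} {P : E.PointsOver K}

lemma pointsMap_mem_zmultiples_iff {σ : K ≃ₐ[F] K}
    (hfix : E.pointsMap (σ : K →ₐ[F] K) P = P) {Q : E.PointsOver K} :
    E.pointsMap (σ : K →ₐ[F] K) Q ∈ AddSubgroup.zmultiples P ↔ Q ∈ AddSubgroup.zmultiples P := by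
  conv_lhs => rw [← hfix]
  exact map_mem_zmultiples_iff (pointsMap_injective _)

lemma resolvent_pointsMap {σ : K ≃ₐ[F] K} (hfix : E.pointsMap (σ : K →ₐ[F] K) P = P) (l : ℕ)
    (ξ : K) (Q : E.PointsOver K) :
    resolvent l P (σ ξ) (E.pointsMap (σ : K →ₐ[F] K) Q) = σ (resolvent l P ξ Q) := by
  conv_lhs => rw [← hfix]
  exact (isCoordMap_pointsMap (σ : K →ₐ[F] K)).resolvent l P ξ Q

/-- If `F` contains the `l`-th roots of unity, the Galois action on some torsion point outside a
rational subgroup is unipotent. -/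
lemma exists_sub_mem_zmultiples_of_rootOfUnity (hm : m ≠ 0) (hmK : ((2 * m + 1 : ℕ) : K) ≠ 0)
    (hP : addOrderOf P = 2 * m + 1) (hfix : ∀ σ : K ≃ₐ[F] K, E.pointsMap (σ : K →ₐ[F] K) P = P)
    {ζ : F} (hζ : ζ ^ (2 * m + 1) = 1) (hζ1 : ζ ≠ 1) :
    ∃ Q ∉ AddSubgroup.zmultiples P, (2 * m + 1) • Q = 0 ∧ ∀ σ : K ≃ₐ[F] K,
      E.pointsMap (σ : K →ₐ[F] K) Q - Q ∈ AddSubgroup.zmultiples P := by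
  have hξ : algebraMap F K ζ ^ (2 * m + 1) = 1 := by rw [← map_pow, hζ, map_one]
  have hξ1 : algebraMap F K ζ ≠ 1 := fun h ↦
    hζ1 ((algebraMap F K).injective (by rw [h, map_one]))
  obtain ⟨Q, hQ, h0, hQl⟩ := exists_resolvent_eq_zero_of_isSepClosed hm hmK hP hξ hξ1
  -- As σ fixes P and the root of unity, σQ is a zero of the same resolvent, hence lies in the same
  -- coset.
  refine ⟨Q, hQ, hQl, fun σ ↦ sub_mem_of_resolvent_eq_zero_of_isSepClosed hm hP hξ hξ1 hQ ?_ h0 ?_⟩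
  · rw [pointsMap_mem_zmultiples_iff (hfix σ)]
    exact hQ
  · have := resolvent_pointsMap (hfix σ) (2 * m + 1) (algebraMap F K ζ) Q
    rwa [h0, _root_.map_zero, σ.commutes] at this

/-- If the Galois action on the torsion points is unipotent with respect to a rational subgroup,
the roots of unity are fixed. -/
lemma fixed_rootOfUnity_of_sub_mem_zmultiples (hm : m ≠ 0) (hmK : ((2 * m + 1 : ℕ) : K) ≠ 0)
    (hP : addOrderOf P = 2 * m + 1) {σ : K ≃ₐ[F] K} (hfix : E.pointsMap (σ : K →ₐ[F] K) P = P)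
    (h : ∀ Q : E.PointsOver K, (2 * m + 1) • Q = 0 →
      E.pointsMap (σ : K →ₐ[F] K) Q - Q ∈ AddSubgroup.zmultiples P)
    {ξ : K} (hξ : ξ ^ (2 * m + 1) = 1) (hξ1 : ξ ≠ 1) : σ ξ = ξ := by
  obtain ⟨Q, hQ, h0, hQl⟩ := exists_resolvent_eq_zero_of_isSepClosed hm hmK hP hξ hξ1
  have hfin : IsOfFinAddOrder P := addOrderOf_pos_iff.mp (by rw [hP]; omega)
  obtain ⟨n, hn⟩ := hfin.mem_multiples_iff_mem_zmultiples.mpr (h Q hQl)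
  -- This point is a zero of the resolvent for σξ, being the conjugate of Q, and of the one for ξ,
  -- being in the coset of Q. Hence σξ = ξ.
  have hσQ : E.pointsMap (σ : K →ₐ[F] K) Q = Q + n • P := by
    exact eq_add_of_sub_eq' hn.symm
  refine eq_of_resolvent_eq_zero_of_isSepClosed hm hP (ξ := σ ξ) (ξ' := ξ) (Q := Q + n • P) ?_ ?_ hξ hξ1 ?_ ?_ ?_
  · rw [← map_pow, hξ, map_one]
  · exact fun h ↦ hξ1 (σ.injective (by rw [h, map_one]))
  · rw [← hσQ, pointsMap_mem_zmultiples_iff hfix]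
    exact hQ
  · rw [← hσQ, resolvent_pointsMap hfix, h0, _root_.map_zero]
  · exact resolvent_add_nsmul_of_isSepClosed hP hm hξ hQ h0 n

end Resolvent

end WeierstrassCurve

/-! ### Coinvariants of the torsion under (SC) and (B) -/

namespace WeierstrassCurve

set_option linter.unusedSectionVars false

open Polynomial WeierstrassCurve.Affine WeierstrassCurve.Affine.Point Representation

variable {F : Type*} [Field F]

/-- The action of a Galois automorphism on `E(Fˢᵉᵖ)`. -/
noncomputable abbrev galMap (E : WeierstrassCurve F) (σ : Gal(SeparableClosure F/F)) :
    E.SepPoints →+ E.SepPoints :=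
  E.pointsMap (σ : SeparableClosure F →ₐ[F] SeparableClosure F)

variable {E : WeierstrassCurve F} {l : ℕ} [Fact l.Prime]

section Stable

variable {C : AddSubgroup E.SepPoints}

lemma nsmul_eq_zero_of_card_eq (hC : Nat.card C = l) {Q : E.SepPoints} (hQ : Q ∈ C) : l • Q = 0 := by
  have : Nat.card C • (⟨Q, hQ⟩ : C) = 0 := card_nsmul_eq_zero'
  rw [hC] at this
  exact congrArg Subtype.val this

lemma map_galMap_eq (hC : Nat.card C = l) {σ : Gal(SeparableClosure F/F)}
    (h : ∀ Q ∈ C, E.galMap σ Q ∈ C) : C.map (E.galMap σ) = C := by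
  have : Finite C := Nat.finite_of_card_ne_zero (by rw [hC]; exact (Fact.out : l.Prime).ne_zero)
  refine AddSubgroup.eq_of_le_of_card_ge (AddSubgroup.map_le_iff_le_comap.mpr h) ?_
  rw [AddSubgroup.card_map_of_injective (pointsMap_injective _)]

variable [E.IsElliptic]

lemma card_of_mem_isogenyKernels (hl : (l : F) ≠ 0) (h : C ∈ E.isogenyKernels l) :
    Nat.card C = l ∧ ∀ σ, ∀ Q ∈ C, E.galMap σ Q ∈ C := by
  obtain ⟨E', hE', φ, hφ, rfl⟩ := h
  refine ⟨?_, fun σ Q hQ ↦ ?_⟩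
  · rw [(φ.card_ker_and_surjective (by rwa [hφ])).1, hφ]
  · rw [AddMonoidHom.mem_ker] at hQ ⊢
    rw [φ.toHom_pointsMap, hQ, _root_.map_zero]

lemma mem_isogenyKernels_of_card (hl : (l : F) ≠ 0) (hodd : Odd l) (hC : Nat.card C = l)
    (h : ∀ σ, ∀ Q ∈ C, E.galMap σ Q ∈ C) : C ∈ E.isogenyKernels l := by
  have : Finite C := Nat.finite_of_card_ne_zero (by rw [hC]; exact (Fact.out : l.Prime).ne_zero)
  let _ := Fintype.ofFinite C
  have := mem_isogenyKernels (S := C) (by rwa [hC]) (by rwa [hC]) fun σ ↦ map_galMap_eq hC (h σ)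
  rwa [hC] at this

/-- If the action on `E[l]` modulo a stable line fixes a point off the line, it is trivial. -/
lemma galMap_sub_mem (hl : (l : F) ≠ 0) (hC : Nat.card C = l) {σ : Gal(SeparableClosure F/F)}
    (hst : ∀ Q ∈ C, E.galMap σ Q ∈ C) {R : E.SepPoints} (hR : l • R = 0) (hRC : R ∉ C)
    (h : E.galMap σ R - R ∈ C) {Q : E.SepPoints} (hQ : l • Q = 0) : E.galMap σ Q - Q ∈ C := by
  have hlp : l.Prime := Fact.out
  have hV := E.card_geomTorsion hl
  have : Finite (E.geomTorsion l) :=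
    Nat.finite_of_card_ne_zero (by rw [hV]; exact pow_ne_zero _ hlp.ne_zero)
  -- The l-torsion points moved by σ only within C form a subgroup of order dividing l² that
  -- contains C and the further point R, so it is everything.
  let T := C.comap (E.galMap σ - AddMonoidHom.id _) ⊓ E.geomTorsion l
  have hT : T ≤ E.geomTorsion l := inf_le_right
  have hCT : C ≤ T := fun c hc ↦
    ⟨C.sub_mem (hst c hc) hc, (E.mem_torsionOver_iff l).mpr (nsmul_eq_zero_of_card_eq hC hc)⟩
  have hRT : R ∈ T := ⟨h, (E.mem_torsionOver_iff l).mpr hR⟩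
  have : Finite T := Finite.of_injective _ (AddSubgroup.inclusion_injective hT)
  obtain ⟨k, hk, hcard⟩ := (Nat.dvd_prime_pow hlp).mp (hV ▸ AddSubgroup.card_dvd_of_le hT)
  have hk2 : k = 2 := by
    by_contra hne
    refine hRC ?_
    rw [AddSubgroup.eq_of_le_of_card_ge hCT]
    · exact hRT
    · rw [hcard, hC]
      exact (Nat.pow_le_pow_right hlp.pos (by omega : k ≤ 1)).trans (pow_one l).le
  have hTV : T = E.geomTorsion l :=
    AddSubgroup.eq_of_le_of_card_ge hT (by rw [hV, hcard, hk2])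
  have hQT : Q ∈ T := by
    rw [hTV]
    exact (E.mem_torsionOver_iff l).mpr hQ
  exact hQT.1

end Stable

section Coinvariants

variable (E l) in
lemma ker_eq_bot_iff : Coinvariants.ker (E.modGaloisRep l) = ⊥ ↔
    ∀ σ, ∀ Q : E.SepPoints, l • Q = 0 → E.galMap σ Q = Q := by
  refine ⟨fun h σ Q hQ ↦ ?_, fun h ↦ ?_⟩
  · have hm := Coinvariants.sub_mem_ker (ρ := E.modGaloisRep l) σ
      ⟨Q, (E.mem_torsionOver_iff l).mpr hQ⟩
    rw [h, Submodule.mem_bot, sub_eq_zero] at hm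
    exact congrArg Subtype.val hm
  · rw [eq_bot_iff, Coinvariants.ker, Submodule.span_le]
    rintro _ ⟨⟨σ, Q⟩, rfl⟩
    rw [SetLike.mem_coe, Submodule.mem_bot, sub_eq_zero]
    exact Subtype.ext (h σ Q ((E.mem_torsionOver_iff l).mp Q.2))

lemma mem_of_mem_ker {H : AddSubgroup E.SepPoints}
    (h : ∀ σ, ∀ Q : E.SepPoints, l • Q = 0 → E.galMap σ Q - Q ∈ H) {v : E.geomTorsion l}
    (hv : v ∈ Coinvariants.ker (E.modGaloisRep l)) : (v : E.SepPoints) ∈ H := by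
  have hle : Coinvariants.ker (E.modGaloisRep l) ≤
      AddSubgroup.toZModSubmodule l (H.addSubgroupOf (E.geomTorsion l)) := by
    rw [Coinvariants.ker, Submodule.span_le]
    rintro _ ⟨⟨σ, Q⟩, rfl⟩
    exact h σ Q ((E.mem_torsionOver_iff l).mp Q.2)
  exact hle hv

lemma ker_ne_top {H : AddSubgroup E.SepPoints}
    (h : ∀ σ, ∀ Q : E.SepPoints, l • Q = 0 → E.galMap σ Q - Q ∈ H) {R : E.SepPoints}
    (hR : l • R = 0) (hRH : R ∉ H) : Coinvariants.ker (E.modGaloisRep l) ≠ ⊤ := fun htop ↦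
  hRH (mem_of_mem_ker h (v := ⟨R, (E.mem_torsionOver_iff l).mpr hR⟩) (by rw [htop]; trivial))

variable [E.IsElliptic]

lemma finite_geomTorsion (hl : (l : F) ≠ 0) : Finite (E.geomTorsion l) :=
  Nat.finite_of_card_ne_zero (by
    rw [E.card_geomTorsion hl]
    exact pow_ne_zero _ (Fact.out : l.Prime).ne_zero)

lemma finrank_geomTorsion (hl : (l : F) ≠ 0) : Module.finrank (ZMod l) (E.geomTorsion l) = 2 := by
  have := finite_geomTorsion (E := E) hl
  have h := Module.natCard_eq_pow_finrank (K := ZMod l) (V := E.geomTorsion l)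
  rw [E.card_geomTorsion hl, Nat.card_zmod] at h
  exact (Nat.pow_right_injective (Fact.out : l.Prime).two_le h).symm

lemma rank_torsionCoinvariants (hl : (l : F) ≠ 0) {n : ℕ}
    (hn : n + Module.finrank (ZMod l) (Coinvariants.ker (E.modGaloisRep l)) = 2) :
    Module.rank (ZMod l) (E.torsionCoinvariants l) = n := by
  have := finite_geomTorsion (E := E) hl
  have h := Submodule.finrank_quotient_add_finrank (Coinvariants.ker (E.modGaloisRep l))
  rw [finrank_geomTorsion hl, ← hn] at h
  have h' : Module.finrank (ZMod l) (E.torsionCoinvariants l) = n := Nat.add_right_cancel h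
  rw [← h', Module.finrank_eq_rank]

lemma finrank_ker_eq_one (hl : (l : F) ≠ 0) (h0 : Coinvariants.ker (E.modGaloisRep l) ≠ ⊥)
    (h1 : Coinvariants.ker (E.modGaloisRep l) ≠ ⊤) :
    Module.finrank (ZMod l) (Coinvariants.ker (E.modGaloisRep l)) = 1 := by
  have := finite_geomTorsion (E := E) hl
  have h2 := Submodule.finrank_lt h1
  have h3 := mt Submodule.finrank_eq_zero.mp h0
  rw [finrank_geomTorsion hl] at h2
  omega

lemma rank_torsionCoinvariants_eq_one (hl : (l : F) ≠ 0)
    (h0 : Coinvariants.ker (E.modGaloisRep l) ≠ ⊥)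
    (h1 : Coinvariants.ker (E.modGaloisRep l) ≠ ⊤) :
    Module.rank (ZMod l) (E.torsionCoinvariants l) = 1 := by
  exact_mod_cast rank_torsionCoinvariants hl (n := 1) (by rw [finrank_ker_eq_one hl h0 h1])

lemma rank_torsionCoinvariants_eq_zero (hl : (l : F) ≠ 0)
    (h : Coinvariants.ker (E.modGaloisRep l) = ⊤) :
    Module.rank (ZMod l) (E.torsionCoinvariants l) = 0 := by
  exact_mod_cast rank_torsionCoinvariants hl (n := 0) (by
    rw [h, finrank_top, finrank_geomTorsion hl])

theorem rank_of_hasRationalTorsion (hl : (l : F) ≠ 0) (h : E.HasRationalTorsion l) :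
    Module.rank (ZMod l) (E.torsionCoinvariants l) = 2 := by
  have hbot : Coinvariants.ker (E.modGaloisRep l) = ⊥ := by
    refine (ker_eq_bot_iff E l).mpr fun σ Q hQ ↦ ?_
    obtain ⟨P, rfl⟩ := h ((E.mem_torsionOver_iff l).mpr hQ)
    exact pointsMap_pointsMap_ofId E σ P
  exact_mod_cast rank_torsionCoinvariants hl (n := 2) (by rw [hbot, finrank_bot])

lemma ker_ne_bot_of_rank_eq_one (hl : (l : F) ≠ 0)
    (h : Module.rank (ZMod l) (E.torsionOver F l) = 1) :
    Coinvariants.ker (E.modGaloisRep l) ≠ ⊥ := by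
  obtain ⟨σ, P, hP, hne⟩ := exists_not_fixed_of_rank_eq_one hl h
  exact fun hbot ↦ hne ((ker_eq_bot_iff E l).mp hbot σ P hP)

lemma card_zmultiples {P : E.SepPoints} (hP : l • P = 0) (hP0 : P ≠ 0) :
    Nat.card (AddSubgroup.zmultiples P) = l := by
  rw [Nat.card_zmultiples, addOrderOf_eq_prime hP hP0]

lemma galMap_mem_zmultiples {P : E.SepPoints} {σ : Gal(SeparableClosure F/F)}
    (h : E.galMap σ P = P) {Q : E.SepPoints} (hQ : Q ∈ AddSubgroup.zmultiples P) :
    E.galMap σ Q ∈ AddSubgroup.zmultiples P := by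
  obtain ⟨n, rfl⟩ := hQ
  exact ⟨n, by simp only [map_zsmul, h]⟩

/-- One of the two kernels, C, is not the line of the rational point P. The action modulo C fixes P
∉ C, hence is trivial, so all σQ − Q lie in C; they do not all vanish because E[l] is not rational.
-/
theorem rank_of_condSC (hl : (l : F) ≠ 0) (h : E.CondSC l) :
    Module.rank (ZMod l) (E.torsionCoinvariants l) = 1 := by
  obtain ⟨h1, C₁, hC₁, C₂, hC₂, hne⟩ := h
  refine rank_torsionCoinvariants_eq_one hl (ker_ne_bot_of_rank_eq_one hl h1) ?_
  obtain ⟨P, hP, hP0, hfix⟩ :=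
    exists_fixed_of_torsionOver_ne_bot (torsionOver_ne_bot_of_rank_eq_one h1)
  have key {C : AddSubgroup E.SepPoints} (hC : C ∈ E.isogenyKernels l)
      (hne : AddSubgroup.zmultiples P ≠ C) : Coinvariants.ker (E.modGaloisRep l) ≠ ⊤ := by
    obtain ⟨hcard, hst⟩ := card_of_mem_isogenyKernels hl hC
    have hPC : P ∉ C := fun hPC ↦ hne (by
      have : Finite C :=
        Nat.finite_of_card_ne_zero (by rw [hcard]; exact (Fact.out : l.Prime).ne_zero)
      refine AddSubgroup.eq_of_le_of_card_ge (AddSubgroup.zmultiples_le_of_mem hPC) ?_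
      rw [hcard, card_zmultiples hP hP0])
    refine ker_ne_top (fun σ Q hQ ↦ galMap_sub_mem hl hcard (hst σ) hP hPC ?_ hQ) hP hPC
    rw [galMap, hfix σ, sub_self]
    exact C.zero_mem
  by_cases hC : AddSubgroup.zmultiples P = C₁
  · exact key hC₂ (hC ▸ hne)
  · exact key hC₁ hC

/-- All σQ − Q lie in the image of E'[l] under φ, which is a proper subgroup of E[l] because φ kills
a rational point of order l. -/
theorem rank_of_condB (hl : (l : F) ≠ 0) (h : E.CondB l) :
    Module.rank (ZMod l) (E.torsionCoinvariants l) = 1 := by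
  have hlp : l.Prime := Fact.out
  obtain ⟨hbot, E', hE', φ, hdeg, hne⟩ := h
  have hfin := finite_geomTorsion (E := E) hl
  have hfin' := finite_geomTorsion (E := E') hl
  refine rank_torsionCoinvariants_eq_one hl ?_ ?_
  · intro h0
    have : Nontrivial (E.geomTorsion l) := by
      rw [← Finite.one_lt_card_iff_nontrivial, E.card_geomTorsion hl]
      exact Nat.one_lt_pow two_ne_zero hlp.one_lt
    obtain ⟨⟨Q, hQ⟩, hQ0⟩ := exists_ne (0 : E.geomTorsion l)
    have hQl := (E.mem_torsionOver_iff l).mp hQ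
    exact torsionOver_ne_bot_of_fixed hQl (fun h ↦ hQ0 (Subtype.ext h))
      (fun σ ↦ (ker_eq_bot_iff E l).mp h0 σ Q hQl) hbot
  obtain ⟨P, hP, hP0, hfix⟩ := exists_fixed_of_torsionOver_ne_bot hne
  obtain ⟨hcard, hsurj⟩ := φ.card_ker_and_surjective (by rwa [hdeg])
  rw [hdeg] at hcard
  -- Otherwise φ(P) would be a nonzero rational l-torsion point of E.
  have hPφ : φ.toHom P = 0 := by
    by_contra hP1
    refine torsionOver_ne_bot_of_fixed (l := l) (P := φ.toHom P) ?_ hP1 (fun σ ↦ ?_) hbot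
    · rw [← map_nsmul, hP, _root_.map_zero]
    · rw [← φ.toHom_pointsMap, hfix σ]
  have hker : AddSubgroup.zmultiples P = φ.toHom.ker := by
    have : Finite φ.toHom.ker := Nat.finite_of_card_ne_zero (by rw [hcard]; exact hlp.ne_zero)
    refine AddSubgroup.eq_of_le_of_card_ge (AddSubgroup.zmultiples_le_of_mem hPφ) ?_
    rw [hcard, card_zmultiples hP hP0]
  let H := (E'.geomTorsion l).map φ.toHom
  have hH : ¬ E.geomTorsion l ≤ H := by
    intro hle
    let g : E'.geomTorsion l → H := fun Q ↦ ⟨φ.toHom Q, AddSubgroup.mem_map_of_mem _ Q.2⟩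
    have hg : Function.Surjective g := by
      rintro ⟨_, Q, hQ, rfl⟩
      exact ⟨⟨Q, hQ⟩, rfl⟩
    have : Finite H := Finite.of_surjective g hg
    have hcardH : Nat.card (E'.geomTorsion l) ≤ Nat.card H := by
      rw [E'.card_geomTorsion hl, ← E.card_geomTorsion hl]
      exact Nat.card_le_card_of_injective _ (AddSubgroup.inclusion_injective hle)
    have hinj : Function.Injective g := (Nat.bijective_iff_surjective_and_card g).mpr
      ⟨hg, le_antisymm hcardH (Nat.card_le_card_of_surjective g hg)⟩ |>.1
    refine hP0 (congrArg Subtype.val (@hinj ⟨P, (E'.mem_torsionOver_iff l).mpr hP⟩ 0 ?_))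
    exact Subtype.ext (hPφ.trans (_root_.map_zero φ.toHom).symm)
  obtain ⟨R, hR, hRH⟩ := SetLike.not_le_iff_exists.mp hH
  refine ker_ne_top (H := H) (fun σ Q hQ ↦ ?_) ((E.mem_torsionOver_iff l).mp hR) hRH
  obtain ⟨Q, rfl⟩ := hsurj Q
  -- The preimage Q need not be l-torsion, but lQ is a multiple of the fixed point P, so σQ − Q is
  -- killed by l.
  have hlQ : l • Q ∈ AddSubgroup.zmultiples P := by
    rw [hker, AddMonoidHom.mem_ker, map_nsmul, hQ]
  refine ⟨E'.galMap σ Q - Q, ?_, ?_⟩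
  · refine (E'.mem_torsionOver_iff l).mpr ?_
    obtain ⟨n, hn⟩ := hlQ
    change n • P = l • Q at hn
    rw [smul_sub, ← map_nsmul, ← hn, map_zsmul, galMap, hfix σ, sub_self]
  · rw [map_sub, galMap, φ.toHom_pointsMap]

end Coinvariants

end WeierstrassCurve

/-! ### Roots of unity, condition (B') and the theorem -/

namespace WeierstrassCurve

set_option linter.unusedSectionVars false

open Polynomial WeierstrassCurve.Affine WeierstrassCurve.Affine.Point Representation

variable {F : Type*} [Field F] {E : WeierstrassCurve F} {l : ℕ} [Fact l.Prime] [E.IsElliptic]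

lemma natCast_separableClosure_ne_zero (hl : (l : F) ≠ 0) : (l : SeparableClosure F) ≠ 0 := by
  rw [← map_natCast (algebraMap F (SeparableClosure F))]
  exact (_root_.map_ne_zero _).mpr hl

lemma galMap_injective (σ : Gal(SeparableClosure F/F)) : Function.Injective (E.galMap σ) :=
  pointsMap_injective _

/-- For l = 2 the resolvents, which need odd order, are not used: E[2]/⟨P⟩ has order two and so has
no nontrivial automorphism. -/
lemma galMap_sub_mem_zmultiples_of_two (hl : ((2 : ℕ) : F) ≠ 0) {P : E.SepPoints}
    (hP : 2 • P = 0) (hP0 : P ≠ 0) {σ : Gal(SeparableClosure F/F)} (hfix : E.galMap σ P = P)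
    {Q : E.SepPoints} (hQ : 2 • Q = 0) : E.galMap σ Q - Q ∈ AddSubgroup.zmultiples P := by
  have hcard := card_zmultiples (l := 2) hP hP0
  have hV := E.card_geomTorsion hl
  have hle : AddSubgroup.zmultiples P ≤ E.geomTorsion 2 :=
    AddSubgroup.zmultiples_le_of_mem ((E.mem_torsionOver_iff 2).mpr hP)
  let H := (AddSubgroup.zmultiples P).addSubgroupOf (E.geomTorsion 2)
  have hH : Nat.card H = 2 :=
    (Nat.card_congr (AddSubgroup.addSubgroupOfEquivOfLe hle).toEquiv).trans hcard
  have hidx : H.index = 2 := by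
    have := H.card_mul_index
    rw [hH, hV] at this
    omega
  have hσQ : 2 • E.galMap σ Q = 0 := by rw [← map_nsmul, hQ, _root_.map_zero]
  have hmem : E.galMap σ Q ∈ AddSubgroup.zmultiples P ↔ -Q ∈ AddSubgroup.zmultiples P := by
    rw [neg_mem_iff]
    refine ⟨fun h ↦ ?_, galMap_mem_zmultiples hfix⟩
    have : Finite (AddSubgroup.zmultiples P) := Nat.finite_of_card_ne_zero (by omega)
    rw [← map_galMap_eq hcard (fun R ↦ galMap_mem_zmultiples hfix)] at h
    exact (AddSubgroup.mem_map_iff_mem (galMap_injective σ)).mp h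
  rw [sub_eq_add_neg]
  exact (AddSubgroup.add_mem_iff_of_index_two hidx
    (a := ⟨E.galMap σ Q, (E.mem_torsionOver_iff 2).mpr hσQ⟩)
    (b := ⟨-Q, neg_mem ((E.mem_torsionOver_iff 2).mpr hQ)⟩)).mpr hmem

/-- If `F` contains the `l`-th roots of unity, a rational `l`-torsion point gives a nonzero
coinvariant. -/
lemma ker_ne_top_of_rootOfUnity (hl : (l : F) ≠ 0) {P : E.SepPoints} (hP : l • P = 0) (hP0 : P ≠ 0)
    (hfix : ∀ σ, E.galMap σ P = P) {ζ : F} (hζ : ζ ^ l = 1) (hζ1 : ζ ≠ 1) :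
    Coinvariants.ker (E.modGaloisRep l) ≠ ⊤ := by
  have hcard := card_zmultiples hP hP0
  obtain rfl | hodd := (Fact.out : l.Prime).eq_two_or_odd'
  · have hV := E.card_geomTorsion hl
    have hnle : ¬ E.geomTorsion 2 ≤ AddSubgroup.zmultiples P := fun hle ↦ by
      have := AddSubgroup.card_dvd_of_le hle
      rw [hV, hcard] at this
      exact absurd (Nat.le_of_dvd two_pos this) (by norm_num)
    obtain ⟨R, hR, hRP⟩ := SetLike.not_le_iff_exists.mp hnle
    exact ker_ne_top (fun σ Q hQ ↦ galMap_sub_mem_zmultiples_of_two hl hP hP0 (hfix σ) hQ)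
      ((E.mem_torsionOver_iff 2).mp hR) hRP
  · obtain ⟨m, rfl⟩ := hodd
    have hm : m ≠ 0 := by
      rintro rfl
      exact (Fact.out : (2 * 0 + 1).Prime).ne_one rfl
    obtain ⟨R, hRP, hR, h⟩ := exists_sub_mem_zmultiples_of_rootOfUnity hm
      (natCast_separableClosure_ne_zero hl) (addOrderOf_eq_prime hP hP0) hfix hζ hζ1
    exact ker_ne_top (fun σ Q hQ ↦ galMap_sub_mem hl hcard
      (fun Q hQ ↦ galMap_mem_zmultiples (hfix σ) hQ) hR hRP (h σ) hQ) hR hRP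

/-- If `E` has a rational `l`-torsion point and only one isogeny of degree `l`, a nonzero coinvariant
forces the `l`-th roots of unity into `F`. -/
lemma exists_rootOfUnity_of_ker_ne_top (hl : (l : F) ≠ 0) (hodd : Odd l) (h : E.CondB' l)
    (htop : Coinvariants.ker (E.modGaloisRep l) ≠ ⊤) : ∃ ζ : F, ζ ^ l = 1 ∧ ζ ≠ 1 := by
  have hlp : l.Prime := Fact.out
  obtain ⟨h1, hunique⟩ := h
  obtain ⟨P, hP, hP0, hfix⟩ :=
    exists_fixed_of_torsionOver_ne_bot (torsionOver_ne_bot_of_rank_eq_one h1)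
  have hfin := finite_geomTorsion (E := E) hl
  -- Neither zero nor everything, the subgroup generated by the σQ − Q is a line, stable because it
  -- contains σQ − Q for each of its own points Q.
  let I := (Coinvariants.ker (E.modGaloisRep l)).toAddSubgroup.map (E.geomTorsion l).subtype
  have hmemI {σ : Gal(SeparableClosure F/F)} {Q : E.SepPoints} (hQ : l • Q = 0) :
      E.galMap σ Q - Q ∈ I :=
    ⟨_, Coinvariants.sub_mem_ker (ρ := E.modGaloisRep l) σ
      ⟨Q, (E.mem_torsionOver_iff l).mpr hQ⟩, rfl⟩
  have hIcard : Nat.card I = l := by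
    rw [AddSubgroup.card_map_of_injective (AddSubgroup.subtype_injective _)]
    change Nat.card (Coinvariants.ker (E.modGaloisRep l)) = l
    rw [Module.natCard_eq_pow_finrank (K := ZMod l), Nat.card_zmod,
      finrank_ker_eq_one hl (ker_ne_bot_of_rank_eq_one hl h1) htop, pow_one]
  have hIst (σ : Gal(SeparableClosure F/F)) (Q : E.SepPoints) (hQ : Q ∈ I) : E.galMap σ Q ∈ I := by
    rw [← sub_add_cancel (E.galMap σ Q) Q]
    exact I.add_mem (hmemI (nsmul_eq_zero_of_card_eq hIcard hQ)) hQ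
  -- Both lines are stable of odd order l, hence kernels of isogenies of degree l, and there is only
  -- one such kernel. So every σ acts trivially on E[l]/⟨P⟩.
  have hI : I = AddSubgroup.zmultiples P := hunique.unique
    (mem_isogenyKernels_of_card hl hodd hIcard hIst)
    (mem_isogenyKernels_of_card hl hodd (card_zmultiples hP hP0)
      fun σ Q hQ ↦ galMap_mem_zmultiples (hfix σ) hQ)
  obtain ⟨m, rfl⟩ := hodd
  have hm : m ≠ 0 := by
    rintro rfl
    exact hlp.ne_one rfl
  have hl' := natCast_separableClosure_ne_zero hl
  have : NeZero ((2 * m + 1 : ℕ) : SeparableClosure F) := ⟨hl'⟩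
  obtain ⟨ξ, hξ⟩ := HasEnoughRootsOfUnity.exists_primitiveRoot (SeparableClosure F) (2 * m + 1)
  have hξ1 : ξ ≠ 1 := hξ.ne_one hlp.one_lt
  obtain ⟨ζ, rfl⟩ : ∃ ζ, algebraMap F (SeparableClosure F) ζ = ξ :=
    (InfiniteGalois.mem_range_algebraMap_iff_fixed ξ).mpr fun σ ↦
      fixed_rootOfUnity_of_sub_mem_zmultiples hm hl' (addOrderOf_eq_prime hP hP0) (hfix σ)
        (fun Q hQ ↦ hI ▸ hmemI hQ) hξ.pow_eq_one hξ1
  refine ⟨ζ, (algebraMap F (SeparableClosure F)).injective ?_, ?_⟩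
  · rw [map_pow, hξ.pow_eq_one, map_one]
  · rintro rfl
    exact hξ1 (map_one _)

end WeierstrassCurve

/-- The roots of unity in a field extension in which a finite field is algebraically closed. -/
lemma exists_rootOfUnity_iff_dvd_card {k F : Type*} [Field k] [Finite k] [Field F] [Algebra k F]
    (hconst : algebraicClosure k F = ⊥) (l : ℕ) [Fact l.Prime] :
    (∃ ζ : F, ζ ^ l = 1 ∧ ζ ≠ 1) ↔ l ∣ Nat.card k - 1 := by
  rw [← Nat.card_units]
  constructor
  · rintro ⟨ζ, hζ, hζ1⟩
    -- A root of unity is algebraic over k, hence lies in k.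
    have hζ' : ζ ∈ algebraicClosure k F := mem_algebraicClosure_iff.mpr
      (IsIntegral.of_pow (Fact.out : l.Prime).pos (hζ ▸ isIntegral_one)).isAlgebraic
    rw [hconst, IntermediateField.mem_bot] at hζ'
    obtain ⟨z, rfl⟩ := hζ'
    have hz : z ^ l = 1 := (algebraMap k F).injective (by rw [map_pow, hζ, map_one])
    have hz1 : z ≠ 1 := fun h ↦ hζ1 (by rw [h, map_one])
    let u := Units.ofPowEqOne z l hz (Fact.out : l.Prime).ne_zero
    have hu : orderOf u = l := orderOf_eq_prime (Units.pow_ofPowEqOne hz _)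
      fun h ↦ hz1 (congrArg Units.val h)
    exact hu ▸ orderOf_dvd_natCard u
  · intro h
    obtain ⟨u, hu⟩ := exists_prime_orderOf_dvd_card' l h
    refine ⟨algebraMap k F u, ?_, fun h1 ↦ ?_⟩
    · rw [← map_pow, ← Units.val_pow_eq_pow_val, ← hu, pow_orderOf_eq_one, Units.val_one, map_one]
    · have : u = 1 := Units.ext ((algebraMap k F).injective (by rw [h1, Units.val_one, map_one]))
      rw [this, orderOf_one] at hu
      exact (Fact.out : l.Prime).ne_one hu.symm

open WeierstrassCurve Representation

/-- `F` is the function field of a smooth projective geometrically irreducible curve over the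
finite field `k`: it is a finite extension of `k(X)` in which `k` is algebraically closed. -/
theorem mainTheorem7 {k F : Type*} [Field k] [Finite k] [Field F] [Algebra k F] [Algebra k⟮X⟯ F]
    [IsScalarTower k k⟮X⟯ F] [FunctionField k F] (hconst : algebraicClosure k F = ⊥)
    (p : ℕ) [CharP F p] (E : WeierstrassCurve F) [E.IsElliptic]
    (l : ℕ) [Fact l.Prime] (hl : l ≠ p) :
    (¬ l ∣ Nat.card k - 1 →
      (E.CondB' l → Module.rank (ZMod l) (E.torsionCoinvariants l) = 0) ∧
      (E.CondSC l ∨ E.CondB l → Module.rank (ZMod l) (E.torsionCoinvariants l) = 1) ∧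
      (E.HasRationalTorsion l → Module.rank (ZMod l) (E.torsionCoinvariants l) = 2)) ∧
    (l ∣ Nat.card k - 1 →
      (E.CondB' l ∨ E.CondSC l ∨ E.CondB l →
        Module.rank (ZMod l) (E.torsionCoinvariants l) = 1) ∧
      (E.HasRationalTorsion l → Module.rank (ZMod l) (E.torsionCoinvariants l) = 2)) := by
  have hlp : l.Prime := Fact.out
  have hlF : (l : F) ≠ 0 := by
    rw [Ne, CharP.cast_eq_zero_iff F p]
    intro hdvd
    rcases (Nat.dvd_prime hlp).mp hdvd with h | h
    · exact CharP.ringChar_ne_one (R := F) ((ringChar.eq F p).trans h)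
    · exact hl h.symm
  refine ⟨fun hk ↦ ⟨fun h ↦ ?_, ?_, rank_of_hasRationalTorsion hlF⟩,
    fun hk ↦ ⟨?_, rank_of_hasRationalTorsion hlF⟩⟩
  -- For l = 2 the root of unity −1 ≠ 1 is always in F, which contradicts the assumption on #k − 1.
  · have hodd : Odd l := hlp.eq_two_or_odd'.resolve_left fun h2 ↦ by
      subst h2
      refine hk ((exists_rootOfUnity_iff_dvd_card hconst 2).mp ⟨-1, neg_one_sq, fun h1 ↦ hlF ?_⟩)
      rw [Nat.cast_two]
      linear_combination -h1
    refine rank_torsionCoinvariants_eq_zero hlF (by_contra fun htop ↦ hk ?_)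
    exact (exists_rootOfUnity_iff_dvd_card hconst l).mp
      (exists_rootOfUnity_of_ker_ne_top hlF hodd h htop)
  · rintro (h | h)
    exacts [rank_of_condSC hlF h, rank_of_condB hlF h]
  · rintro (h | h | h)
    · obtain ⟨P, hP, hP0, hfix⟩ :=
        exists_fixed_of_torsionOver_ne_bot (torsionOver_ne_bot_of_rank_eq_one h.1)
      obtain ⟨ζ, hζ, hζ1⟩ := (exists_rootOfUnity_iff_dvd_card hconst l).mpr hk
      exact rank_torsionCoinvariants_eq_one hlF (ker_ne_bot_of_rank_eq_one hlF h.1)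
        (ker_ne_top_of_rootOfUnity hlF hP hP0 hfix hζ hζ1)
    · exact rank_of_condSC hlF h
    · exact rank_of_condB hlF h
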